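/- **Setting.** Let $G=(V,E,w)$ be a simple undirected graph with $V=\{0,\dots,n-1\}$, $m=|E|$ and edge weights $w\in\mathbb{Z}_{\ge 0}^E$. For $X\subseteq V$ let $\delta(X)$ be the set of edges with exactly one endpoint in $X$, $w(\delta(X))=\sum_{e\in\delta(X)}w(e)$ the cut value of $X$, and $\mathrm{vol}(X)$ the number of edges with at least one endpoint in $X$. A set $X$ is *extreme* if $w(\delta(Y))>w(\delta(X))$ for every nonempty strict subset $Y\subsetneq X$. For $x\in V$ and $\nu,\sigma,k\in\mathbb{Z}_{\ge0}$, $X$ is an $(x,\nu,\sigma,k)$-*set* if $x\in X$, $\mathrm{vol}(X)<\nu$, $|X|<\sigma$ and $w(\delta(X))<k$; it is an $(x,\nu,\sigma,k)$-*extreme set* if it is moreover extreme. **Problem (LocalKCut).** Given $G,x,\nu,\sigma,k$, either return an $(x,\nu,\sigma,k)$-set, or return $\bot$; returning $\bot$ is correct only if no $(x,\nu,\sigma,k)$-extreme set exists. **Model.** Algorithms are fixed (uniform) programs on a word RAM with memory initially zero, in which every operation $+,-,\cdot,\div,\bmod,<,=$ on words, every memory or input access, every test and every flip of a fair coin takes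 one step. All words stored are smaller than $N^{K}$, where $K$ is a constant and $N$ is the sum of $2$, $n$, the given parameters (those among $\nu,\sigma,k$ that are known in the phase considered) and the largest edge weight. Adjacency lists give access to the degree of a vertex, its $i$-th neighbour, and the weight of the corresponding edge. **Theorem.** For every constant $c\in\mathbb{Z}_{\ge 0}$, with constants in the $O(\cdot)$ depending only on $c$ (bounds that are zero or less than one being read as $O(1)$): 1. There is a randomized algorithm that, given access to adjacency lists of $G$ (in any order) and $n,x,\nu,\sigma,k$, always halts within $O(\nu\sigma^2\log^2 n)$ steps and solves LocalKCut correctly with probability at least $1-n^{-c}$. 2. There are a randomized preprocessing algorithm and a randomized query algorithm such that the following holds. Given the list of edges of $G$ with their weights (in any order), $n$, $m$ and $\sigma$, the preprocessing always halts within $O(m\sigma^2\log^2 n)$ steps. Thereafter, for any $x,\nu,k$ that are given only after preprocessing, the query algorithm, started on the memory left by the preprocessing, always halts within $O(\sigma^4\log n)$ steps and solves LocalKCut for $(G,x,\nu,\sigma,k)$ correctly with probability at least $1-n^{-c}$ over the random choices of both phases. In particular none of these running times depends on $k$ or on the edge weights. -/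

import Mathlib

namespace LocalKCut

/-! ### Weighted graphs, cuts, volume, extreme sets -/

/-- An undirected graph `G = (V, E, w)` on the vertex set `V = {0, …, n-1}` with nonnegative integer
edge weights.  Only the values of `weight` on edges of `graph` are ever used. -/
structure WeightedGraph (n : ℕ) where
  graph : SimpleGraph (Fin n)
  weight : Sym2 (Fin n) → ℕ

namespace WeightedGraph

variable {n : ℕ} (G : WeightedGraph n)

open Classical in
/-- The edge set `E`. -/
noncomputable def edges : Finset (Sym2 (Fin n)) :=
  Finset.univ.filter (fun e => e ∈ G.graph.edgeSet)

/-- The number `m` of edges. -/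
noncomputable def numEdges : ℕ := G.edges.card

/-- The largest edge weight (`0` if there are no edges). -/
noncomputable def maxWeight : ℕ := G.edges.sup G.weight

open Classical in
/-- The cut set `δ(X) = E(X, V \ X)`. -/
noncomputable def cutSet (X : Finset (Fin n)) : Finset (Sym2 (Fin n)) :=
  G.edges.filter (fun e => ∃ u ∈ X, ∃ v, v ∉ X ∧ e = s(u, v))

/-- The cut value `w(δ(X))`. -/
noncomputable def cutValue (X : Finset (Fin n)) : ℕ := ∑ e ∈ G.cutSet X, G.weight e

open Classical in
/-- The (unweighted) volume `vol(X) = |E(X, V)|`: the number of edges incident to `X`. -/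
noncomputable def vol (X : Finset (Fin n)) : ℕ :=
  (G.edges.filter (fun e => ∃ u ∈ X, u ∈ e)).card

/-- `X` is extreme: every nonempty strict subset has a strictly larger cut value. -/
def IsExtreme (X : Finset (Fin n)) : Prop :=
  ∀ Y : Finset (Fin n), Y.Nonempty → Y ⊂ X → G.cutValue X < G.cutValue Y

/-- `X` is an `(x, ν, σ, k)`-set. -/
def IsLocalSet (x : Fin n) (ν σ k : ℕ) (X : Finset (Fin n)) : Prop :=
  x ∈ X ∧ G.vol X < ν ∧ X.card < σ ∧ G.cutValue X < k

/-- `X` is an `(x, ν, σ, k)`-extreme set. -/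
def IsLocalExtremeSet (x : Fin n) (ν σ k : ℕ) (X : Finset (Fin n)) : Prop :=
  G.IsLocalSet x ν σ k X ∧ G.IsExtreme X

end WeightedGraph

/-! ### A randomized word RAM -/

/-- Unit-cost operations on words. -/
inductive Op
  | add | sub | mul | div | mod | lt | eq

/-- Subtraction is truncated, division rounds down; comparisons give `1` (true) or `0` (false). -/
def Op.eval : Op → ℕ → ℕ → ℕ
  | .add, a, b => a + b
  | .sub, a, b => a - b
  | .mul, a, b => a * b
  | .div, a, b => a / b
  | .mod, a, b => a % b
  | .lt, a, b => if a < b then 1 else 0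
  | .eq, a, b => if a = b then 1 else 0

/-- Programs.  The natural numbers `d a b` name registers; `v` and `q` are literal constants.
A program is a finite object, so it can mention only finitely many registers. -/
inductive Prog
  /-- do nothing -/
  | skip
  /-- `reg d := v` -/
  | const (d v : ℕ)
  /-- `reg d := reg a ∘ reg b` -/
  | op (o : Op) (d a b : ℕ)
  /-- `reg d := mem[reg a]` -/
  | load (d a : ℕ)
  /-- `mem[reg a] := reg b` -/
  | store (a b : ℕ)
  /-- `reg d := ` the word with index `(q, reg a, reg b)` of the read-only input -/
  | read (q d a b : ℕ)
  /-- `reg d := ` a fresh fair random bit -/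
  | flip (d : ℕ)
  /-- sequential composition -/
  | seq (c₁ c₂ : Prog)
  /-- `if reg a ≠ 0 then c₁ else c₂` -/
  | cond (a : ℕ) (c₁ c₂ : Prog)
  /-- `while reg a ≠ 0 do c` -/
  | loop (a : ℕ) (c : Prog)

/-- The registers and the random access memory. -/
structure Store where
  reg : ℕ → ℕ
  mem : ℕ → ℕ

/-- A read-only random access input. -/
abbrev Input := ℕ → ℕ → ℕ → ℕ

/-- A configuration: the stack of programs that remain to be executed, and the store.
The machine has halted when the stack is empty. -/
abbrev Config := List Prog × Store

/-- Write the value `v` to register `d` and continue with `K`.  The machine crashes (`none`) if `v`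
is not a word, i.e. not smaller than `M`. -/
def writeReg (M : ℕ) (K : List Prog) (s : Store) (d v : ℕ) : Option Config :=
  if v < M then some (K, { s with reg := Function.update s.reg d v }) else none

/-- One step of the machine whose words are the numbers smaller than `M`.  Each step does one
operation, one memory or input access, one coin flip, or one test (unfolding `seq` and `skip` also
count as steps). Halted configurations do not change. -/
noncomputable def step (M : ℕ) (inp : Input) : Config → PMF (Option Config)
  | ([], s) => PMF.pure (some ([], s))
  | (.skip :: K, s) => PMF.pure (some (K, s))
  | (.const d v :: K, s) => PMF.pure (writeReg M K s d v)
  | (.op o d a b :: K, s) => PMF.pure (writeReg M K s d (o.eval (s.reg a) (s.reg b)))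
  | (.load d a :: K, s) => PMF.pure (writeReg M K s d (s.mem (s.reg a)))
  | (.store a b :: K, s) =>
      PMF.pure (some (K, { s with mem := Function.update s.mem (s.reg a) (s.reg b) }))
  | (.read q d a b :: K, s) => PMF.pure (writeReg M K s d (inp q (s.reg a) (s.reg b)))
  | (.flip d :: K, s) =>
      (PMF.uniformOfFintype Bool).map (fun t => writeReg M K s d (if t then 1 else 0))
  | (.seq c₁ c₂ :: K, s) => PMF.pure (some (c₁ :: c₂ :: K, s))
  | (.cond a c₁ c₂ :: K, s) => PMF.pure (some ((if s.reg a ≠ 0 then c₁ else c₂) :: K, s))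
  | (.loop a c :: K, s) => PMF.pure (some (if s.reg a ≠ 0 then c :: .loop a c :: K else K, s))

/-- The distribution of the configuration after `T` steps (`none` after a crash). -/
noncomputable def runFor (M : ℕ) (inp : Input) : ℕ → Config → PMF (Option Config)
  | 0, c => PMF.pure (some c)
  | T + 1, c => (step M inp c).bind (fun o =>
      match o with
      | none => PMF.pure none
      | some c' => runFor M inp T c')

/-- The final store of a halted configuration; `none` if the machine crashed or is still running. -/
def finalStore : Option Config → Option Store
  | some ([], s) => some s
  | _ => none

/-- The distribution of the final store when the program `P` is started in `s` and given `T` steps.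
The outcome `none` means that `P` crashed or did not halt within `T` steps. -/
noncomputable def exec (M : ℕ) (inp : Input) (P : Prog) (T : ℕ) (s : Store) :
    PMF (Option Store) :=
  (runFor M inp T ([P], s)).map finalStore

/-- Registers `0, 1, 2, …` hold the given list of parameters; all others are `0`. -/
def paramRegs (l : List ℕ) : ℕ → ℕ := fun i => l.getD i 0

/-! ### Representations of the input graph and of the answer -/

/-- Adjacency lists of `G`: an enumeration, in an arbitrary order, of the neighbours of each
vertex. -/
structure AdjLists {n : ℕ} (G : WeightedGraph n) where
  nbrs : Fin n → List (Fin n)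
  nodup : ∀ v, (nbrs v).Nodup
  mem_iff : ∀ v u, u ∈ nbrs v ↔ G.graph.Adj v u

/-- Access to adjacency lists: index `(0, v, _)` is the degree of `v`, and `(1, v, i)`, `(2, v, i)`
are the `i`-th neighbour of `v` and the weight of the edge to it.  All other indices give `0`. -/
def AdjLists.input {n : ℕ} {G : WeightedGraph n} (A : AdjLists G) : Input := fun q v i =>
  if hv : v < n then
    match q with
    | 0 => (A.nbrs ⟨v, hv⟩).length
    | 1 => if hi : i < (A.nbrs ⟨v, hv⟩).length then ((A.nbrs ⟨v, hv⟩)[i] : ℕ) else 0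
    | 2 => if hi : i < (A.nbrs ⟨v, hv⟩).length then
        G.weight s(⟨v, hv⟩, (A.nbrs ⟨v, hv⟩)[i]) else 0
    | _ => 0
  else 0

/-- A list of the edges of `G`, each once, in an arbitrary order and with arbitrary
orientations. -/
structure EdgeList {n : ℕ} (G : WeightedGraph n) where
  list : List (Fin n × Fin n)
  nodup : (list.map (fun p => s(p.1, p.2))).Nodup
  mem_iff : ∀ e, e ∈ list.map (fun p => s(p.1, p.2)) ↔ e ∈ G.edges

/-- Access to an edge list: indices `(0, i, _)`, `(1, i, _)`, `(2, i, _)` are the two endpoints and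
the weight of the `i`-th edge.  All other indices give `0`. -/
def EdgeList.input {n : ℕ} {G : WeightedGraph n} (L : EdgeList G) : Input := fun q i _ =>
  if hi : i < L.list.length then
    match q with
    | 0 => (L.list[i].1 : ℕ)
    | 1 => (L.list[i].2 : ℕ)
    | 2 => G.weight s(L.list[i].1, L.list[i].2)
    | _ => 0
  else 0

/-- The machine returns the set `X`: register `0` is `1`, register `1` is `|X|`, and the memory
cells from the address in register `2` on list the elements of `X`. -/
def ReturnsSet {n : ℕ} (s : Store) (X : Finset (Fin n)) : Prop :=
  s.reg 0 = 1 ∧ s.reg 1 = X.card ∧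
    (Finset.range X.card).image (fun i => s.mem (s.reg 2 + i)) = X.image Fin.val

/-- The machine returns `⊥`. -/
def ReturnsBot (s : Store) : Prop := s.reg 0 = 0

/-- The final store is a correct answer to the instance `(G, x, ν, σ, k)` of LocalKCut. -/
def Solves {n : ℕ} (G : WeightedGraph n) (x : Fin n) (ν σ k : ℕ) (s : Store) : Prop :=
  (∃ X, ReturnsSet s X ∧ G.IsLocalSet x ν σ k X) ∨
    (ReturnsBot s ∧ ¬ ∃ X, G.IsLocalExtremeSet x ν σ k X)

/-- The outcome `o` of an execution is not a correct answer to the instance. -/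
def Fails {n : ℕ} (G : WeightedGraph n) (x : Fin n) (ν σ k : ℕ) (o : Option Store) : Prop :=
  ¬ ∃ s, o = some s ∧ Solves G x ν σ k s

/-- The distribution of the outcome when `pre` is run on `s`, and then `query` is run on the memory
that `pre` has left, with the parameters `l` in its registers. -/
noncomputable def execTwo (inp : Input) (Mpre : ℕ) (pre : Prog) (Tpre : ℕ) (s : Store)
    (M : ℕ) (query : Prog) (T : ℕ) (l : List ℕ) : PMF (Option Store) :=
  (exec Mpre inp pre Tpre s).bind (fun o =>
    match o with
    | none => PMF.pure none
    | some s' => exec M inp query T ⟨paramRegs l, s'.mem⟩)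

end LocalKCut

/-! Give every edge `e` an independent random priority `p e`, approximately exponentially
distributed, and order the edges by `p e / w e`; this is an exponential clock of rate `w e`. An
extreme set `X` is good for these priorities if at some time the edges inside `X` whose clocks have
rung connect `X`, while no edge leaving `X` has rung (`Separates`).

Let `λ` be the cut value of `X`. In a partition of `X` into `b ≥ 2` blocks every block is a nonempty
strict subset, so its cut value is at least `λ + 1`. Summing over the blocks shows that twice the
weight between blocks is at least `(b - 1) * (λ + 1)` (`IsExtreme.le_sum_blocks`). Every ringing
edge between two blocks merges them, so the expectation of `b - 1` decays at rate `(λ + 1) / 2`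
(`IsExtreme.excess_le`, `expJoin_decay`), whereas the boundary is still silent at time `θ` with
probability `exp (-θ λ)`. At `θ = 2 log (2 |X|) / (λ + 1)` the expected surplus of blocks is at most
`1 / 2`, and the boundary is silent with probability at least `1 / (2 |X|) ^ 2`. The two events
concern disjoint sets of edges, so `X` is separated with probability of order `1 / |X| ^ 2`
(`IsExtreme.card_separates`, `IsExtreme.prob_separates`). The exponential variables are replaced by
integers computed from `32 * l` random bits, where `l` is the binary length of `n`: Riemann sums
approximate the logarithm, and the loss is a constant factor (`riem_bounds`, `wordPrio_tail`,
`WeightedGraph.IsExtreme.prob_wordPrio`).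

If `X` is separated, a Prim-like search from `x`, which always follows the smallest ratio on an edge
leaving the explored set, cannot leave `X` before it has explored all of it (`HeapInv.root_mem`,
`Grow.extend`). It tests each explored set and returns the first one that qualifies; hence it
returns `X` or an earlier valid set. A number of runs of order `σ ^ 2 * log n` makes the failure
probability at most `n ^ (-c)` (`repeated_bound`, `runs_fail_le`).

The local algorithm keeps the leaving edges in a tournament tree. Explored degrees sum to less than
`2 * ν`, so a run has at most `4 * ν` steps of logarithmic cost. It draws one word per step and
attaches it to the edge met in that step. Since no edge enters the tree twice in one run, the words
seen are distributed like priorities fixed in advance (`searchLabel_injective`, `adaptive_bound`).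

The preprocessing fixes the priorities of all edges for all runs and stores at each vertex its edges
sorted by rank (`RunDone`). A query grows the set by comparing the first useful edge of each
explored vertex. Passing over useless entries costs at most `σ ^ 2` per run altogether, because each
such entry leads to a different explored vertex (`ListInv.passed_le`); so a run takes `O(σ ^ 2)`
steps without any tree (`Grow.budget_lt`).

On the machine side, programs are written in a structured language with variables, arrays and a step
counter, verified by a Hoare calculus (`Tr`), and compiled with constant overhead
(`Stmt.comp_reach`). All coins are flipped in one block (`flipProg_run`). Everything else is
deterministic, so probabilities become counts of bit strings (`toOuterMeasure_map_uniform_le`). -/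

namespace LocalKCut

open Finset Function

/-! ### Deterministic runs of the machine -/

/-- After `k` deterministic steps the configuration `c` has become `c'`. -/
def Reach (M : ℕ) (inp : Input) (k : ℕ) (c c' : Config) : Prop := ∀ T, runFor M inp (k + T) c = runFor M inp T c'

namespace Reach

variable {M : ℕ} {inp : Input}

theorem trans {k l : ℕ} {c c' c'' : Config} (h : Reach M inp k c c') (h' : Reach M inp l c' c'') :
    Reach M inp (k + l) c c'' := fun T => by rw [Nat.add_assoc, h, h']

theorem of_step {c c' : Config} (h : step M inp c = PMF.pure (some c')) : Reach M inp 1 c c' :=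
  fun T => by rw [Nat.add_comm]; simp [runFor, h, PMF.pure_bind]

theorem seq {p q : Prog} {K : List Prog} {s : Store} : Reach M inp 1 (.seq p q :: K, s) (p :: q :: K, s) := of_step rfl

theorem loop {a : ℕ} {p : Prog} {K : List Prog} {s : Store} (h : s.reg a ≠ 0) :
    Reach M inp 1 (.loop a p :: K, s) (p :: .loop a p :: K, s) := of_step (by simp [step, h])

end Reach

/-- In `k` deterministic steps the program `p` turns the store `s` into `s'`. -/
def Runs (M : ℕ) (inp : Input) (k : ℕ) (p : Prog) (s s' : Store) : Prop := ∀ K, Reach M inp k (p :: K, s) (K, s')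

namespace Runs

variable {M : ℕ} {inp : Input} {k l a b d x : ℕ} {o : Op} {p q : Prog} {s s' s'' : Store}

theorem skip : Runs M inp 1 .skip s s := fun _ => .of_step rfl

theorem seq (h : Runs M inp k p s s') (h' : Runs M inp l q s' s'') : Runs M inp (1 + k + l) (.seq p q) s s'' :=
  fun _ => (Reach.seq.trans (h _)).trans (h' _)

theorem const (hx : x < M) : Runs M inp 1 (.const d x) s ⟨update s.reg d x, s.mem⟩ :=
  fun _ => .of_step (by simp [step, writeReg, hx])

theorem op (h : o.eval (s.reg a) (s.reg b) = x) (hx : x < M) :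
    Runs M inp 1 (.op o d a b) s ⟨update s.reg d x, s.mem⟩ :=
  fun _ => .of_step (by simp [step, writeReg, h, hx])

theorem load (h : s.mem (s.reg a) = x) (hx : x < M) : Runs M inp 1 (.load d a) s ⟨update s.reg d x, s.mem⟩ :=
  fun _ => .of_step (by simp [step, writeReg, h, hx])

theorem read {t : ℕ} (hx : inp t (s.reg a) (s.reg b) < M) :
    Runs M inp 1 (.read t d a b) s ⟨update s.reg d (inp t (s.reg a) (s.reg b)), s.mem⟩ :=
  fun _ => .of_step (by simp [step, writeReg, hx])

theorem store (ha : s.reg a = k) (hb : s.reg b = x) : Runs M inp 1 (.store a b) s ⟨s.reg, update s.mem k x⟩ :=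
  fun _ => .of_step (by rw [← ha, ← hb]; rfl)

theorem cond (h : Runs M inp k (if s.reg a ≠ 0 then p else q) s s') : Runs M inp (1 + k) (.cond a p q) s s' :=
  fun K => (Reach.of_step rfl).trans (h K)

theorem loop_done (h : s.reg a = 0) : Runs M inp 1 (.loop a p) s s := fun _ => .of_step (by simp [step, h])

theorem loop_next (h : s.reg a ≠ 0) (h1 : Runs M inp k p s s') (h2 : Runs M inp l (.loop a p) s' s'') :
    Runs M inp (1 + k + l) (.loop a p) s s'' := fun _ => ((Reach.loop h).trans (h1 _)).trans (h2 _)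

end Runs

/-! ### A structured language with arrays -/

/-- Expressions: variables, constants, operations, array accesses, input accesses. -/
inductive Ex
  | v (x : ℕ)
  | c (k : ℕ)
  | bin (o : Op) (e f : Ex)
  | ld (t : ℕ) (e : Ex)
  | rd (q : ℕ) (e f : Ex)

instance : Add Ex := ⟨Ex.bin .add⟩
instance : Sub Ex := ⟨Ex.bin .sub⟩
instance : Mul Ex := ⟨Ex.bin .mul⟩
instance : Div Ex := ⟨Ex.bin .div⟩
instance : Mod Ex := ⟨Ex.bin .mod⟩
instance (n : ℕ) : OfNat Ex n := ⟨Ex.c n⟩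

/-- Statements: assignments, array stores, conditionals, counted loops, and the binary length. -/
inductive Stmt
  | skip
  | set (x : ℕ) (e : Ex)
  | sto (t : ℕ) (e f : Ex)
  | seq (p q : Stmt)
  | ite (e : Ex) (p q : Stmt)
  | loop (x : ℕ) (e : Ex) (p : Stmt)
  | lg (x : ℕ) (e : Ex)

infixr:60 " ;; " => Stmt.seq

/-- Variables, arrays and a step counter. -/
@[ext] structure State where
  reg : ℕ → ℕ
  arr : ℕ → ℕ → ℕ
  time : ℕ

namespace State

/-- Assign to a variable. -/
def set (s : State) (x v : ℕ) : State := ⟨update s.reg x v, s.arr, s.time + 1⟩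

/-- Assign to an array entry. -/
def put (s : State) (t i v : ℕ) : State :=
  ⟨s.reg, update s.arr t (update (s.arr t) i v), s.time + 1⟩

/-- Let `k` time units pass. -/
def tick (s : State) (k : ℕ) : State := ⟨s.reg, s.arr, s.time + k⟩

variable (s : State) (x v t i k : ℕ)

@[simp] theorem set_reg (y : ℕ) : (s.set x v).reg y = if y = x then v else s.reg y := by
  simp [set, update_apply]
@[simp] theorem set_arr : (s.set x v).arr = s.arr := rfl
@[simp] theorem set_time : (s.set x v).time = s.time + 1 := rfl
@[simp] theorem put_reg : (s.put t i v).reg = s.reg := rfl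
@[simp] theorem put_arr (u : ℕ) : (s.put t i v).arr u = if u = t then update (s.arr t) i v else s.arr u := by
  by_cases h : u = t
  · subst h; simp [put]
  · simp [put, h]
@[simp] theorem put_time : (s.put t i v).time = s.time + 1 := rfl
@[simp] theorem tick_reg : (s.tick k).reg = s.reg := rfl
@[simp] theorem tick_arr : (s.tick k).arr = s.arr := rfl
@[simp] theorem tick_time : (s.tick k).time = s.time + k := rfl

end State

/-- The value of an expression. -/
def Ex.eval (inp : Input) (s : State) : Ex → ℕ
  | v x => s.reg x
  | c k => k
  | bin o e f => o.eval (e.eval inp s) (f.eval inp s)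
  | ld t e => s.arr t (e.eval inp s)
  | rd q e f => inp q (e.eval inp s) (f.eval inp s)

/-- Iterate `f 0, …, f (n - 1)`. -/
def loopN {α : Type*} (f : ℕ → α → α) : ℕ → α → α
  | 0, s => s
  | n + 1, s => f n (loopN f n s)

/-- The effect of a statement. -/
def Stmt.run (inp : Input) : Stmt → State → State
  | skip, s => s.tick 1
  | set x e, s => s.set x (e.eval inp s)
  | sto t e f, s => s.put t (e.eval inp s) (f.eval inp s)
  | seq p q, s => q.run inp (p.run inp s)
  | ite e p q, s => if e.eval inp s ≠ 0 then p.run inp (s.tick 1) else q.run inp (s.tick 1)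
  | .loop x e p, s => (loopN (fun i s => p.run inp (s.set x i)) (e.eval inp s) s).tick 1
  | lg x e, s => (s.set x (e.eval inp s).size).tick (e.eval inp s).size

/-- Expressions whose value is smaller than every bound on the store and the input. -/
def Ex.triv : Ex → Prop
  | v _ | c _ | ld _ _ | rd _ _ _ | bin .lt _ _ | bin .eq _ _ => True
  | bin .sub e _ | bin .div e _ | bin .mod e _ => e.triv
  | _ => False

/-- The statement writes only values smaller than `B`. -/
def Stmt.safe (inp : Input) (B : ℕ) : Stmt → State → Prop
  | skip, _ => True
  | set _ e, s => e.triv ∨ e.eval inp s < B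
  | sto _ _ f, s => f.triv ∨ f.eval inp s < B
  | seq p q, s => p.safe inp B s ∧ q.safe inp B (p.run inp s)
  | ite e p q, s => (e.eval inp s ≠ 0 → p.safe inp B (s.tick 1)) ∧ (e.eval inp s = 0 → q.safe inp B (s.tick 1))
  | .loop x e p, s => (e.triv ∨ e.eval inp s < B) ∧ ∀ i < e.eval inp s,
      p.safe inp B ((loopN (fun i s => p.run inp (s.set x i)) i s).set x i)
  | lg _ e, s => e.triv ∨ e.eval inp s < B

/-- Serves as an exponent: when all stored words are below `B`, a subexpression evaluates below `B ^
size`. The `4` for `ld` leaves room for the address `16 * i + t`. Up to a factor `12` the size also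
bounds the running time. -/
def Ex.size : Ex → ℕ
  | v _ | c _ => 1
  | bin _ e f => e.size + f.size + 1
  | ld _ e => e.size + 4
  | rd _ e f => e.size + f.size + 1

/-- Variables are below `d`, array names below `16`, constants at most `C`. -/
def Ex.wf (d C : ℕ) : Ex → Prop
  | v x => x < d
  | c k => k ≤ C
  | bin _ e f => e.wf d C ∧ f.wf d C
  | ld t e => t < 16 ∧ e.wf d C
  | rd _ e f => e.wf d C ∧ f.wf d C

/-- A constant `κ ≥ 20 * size` has two roles in `Stmt.comp_reach`: machine words up to `B ^ κ` hold
all intermediate values, and `κ` machine steps pay for one unit of `State.time`. -/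
def Stmt.size : Stmt → ℕ
  | skip => 1
  | set _ e => e.size + 1
  | sto _ e f => e.size + f.size + 1
  | seq p q => p.size + q.size
  | ite e p q => e.size + p.size + q.size
  | .loop _ e p => e.size + p.size + 1
  | lg _ e => e.size + 1

def Stmt.wf (d C : ℕ) : Stmt → Prop
  | skip => True
  | set x e => x < d ∧ e.wf d C
  | sto t e f => t < 16 ∧ e.wf d C ∧ f.wf d C
  | seq p q => p.wf d C ∧ q.wf d C
  | ite e p q => e.wf d C ∧ p.wf d C ∧ q.wf d C
  | .loop x e p => x < d ∧ e.wf d C ∧ p.wf d C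
  | lg x e => x < d ∧ e.wf d C

/-! ### Compilation -/

/-- Code that evaluates an expression into register `d`, using only registers from `d` on. -/
def Ex.comp : Ex → ℕ → Prog
  | v x, d => .seq (.const d 0) (.op .add d x d)
  | c k, d => .const d k
  | bin o e f, d => .seq (e.comp d) (.seq (f.comp (d + 1)) (.op o d d (d + 1)))
  | ld t e, d => .seq (e.comp d) (.seq (.const (d + 1) 16) (.seq (.op .mul d (d + 1) d)
      (.seq (.const (d + 1) t) (.seq (.op .add d d (d + 1)) (.load d d)))))
  | rd q e f, d => .seq (e.comp d) (.seq (f.comp (d + 1)) (.read q d d (d + 1)))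

/-- Code for a statement, using only variables and registers from `d` on. -/
def Stmt.comp : Stmt → ℕ → Prog
  | skip, _ => .skip
  | set x e, d => .seq (e.comp d) (.seq (.const (d + 1) 0) (.op .add x d (d + 1)))
  | sto t e f, d => .seq (f.comp d) (.seq (e.comp (d + 1)) (.seq (.const (d + 2) 16)
      (.seq (.op .mul (d + 1) (d + 2) (d + 1)) (.seq (.const (d + 2) t)
      (.seq (.op .add (d + 1) (d + 1) (d + 2)) (.store (d + 1) d))))))
  | seq p q, d => .seq (p.comp d) (q.comp d)
  | ite e p q, d => .seq (e.comp d) (.cond d (p.comp d) (q.comp d))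
  | .loop x e p, d => .seq (e.comp d) (.seq (.const (d + 1) 0) (.seq (.op .lt (d + 2) (d + 1) d)
      (.loop (d + 2) (.seq (.const (d + 3) 0) (.seq (.op .add x (d + 1) (d + 3))
        (.seq (p.comp (d + 4)) (.seq (.const (d + 3) 1) (.seq (.op .add (d + 1) (d + 1) (d + 3))
          (.op .lt (d + 2) (d + 1) d)))))))))
  | lg x e, d => .seq (e.comp d) (.seq (.const (d + 1) 1) (.seq (.const (d + 2) 0)
      (.seq (.const (d + 3) 0) (.seq (.op .lt (d + 4) d (d + 1)) (.seq (.op .eq (d + 4) (d + 4) (d + 3))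
      (.seq (.loop (d + 4) (.seq (.op .add (d + 1) (d + 1) (d + 1)) (.seq (.const (d + 5) 1)
        (.seq (.op .add (d + 2) (d + 2) (d + 5)) (.seq (.op .lt (d + 4) d (d + 1))
          (.op .eq (d + 4) (d + 4) (d + 3)))))))
        (.op .add x (d + 2) (d + 3))))))))

/-- All variables, array entries and input words are smaller than `B`. -/
structure Small (inp : Input) (B : ℕ) (s : State) : Prop where
  reg : ∀ i, s.reg i < B
  arr : ∀ t i, s.arr t i < B
  inp : ∀ q a b, inp q a b < B

/-- The registers below `64` and the memory of the machine represent `st`. -/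
structure Sim (st : State) (s : Store) : Prop where
  reg : ∀ i < 64, s.reg i = st.reg i
  mem : ∀ t < 16, ∀ i, s.mem (16 * i + t) = st.arr t i

section Compile

variable {M B C : ℕ} {inp : Input}

/-- Multiplication is the worst case. Positive exponents make both powers at least two, so that `B ^
p + B ^ q ≤ B ^ (p + q)` takes care of sums as well. -/
theorem Op.eval_lt {B p q a b : ℕ} (hB : 2 ≤ B) (hp : 1 ≤ p) (hq : 1 ≤ q) (ha : a < B ^ p)
    (hb : b < B ^ q) (o : Op) : o.eval a b < B ^ (p + q) := by
  have h1 : 2 ≤ B ^ p := hB.trans (Nat.le_self_pow (by omega) B)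
  have h2 : 2 ≤ B ^ q := hB.trans (Nat.le_self_pow (by omega) B)
  have h3 : B ^ p + B ^ q ≤ B ^ (p + q) := by rw [pow_add]; nlinarith
  cases o <;> simp only [Op.eval]
  · omega
  · omega
  · rw [pow_add]; exact Nat.mul_lt_mul'' ha hb
  · exact (Nat.div_le_self a b).trans_lt (by omega)
  · exact (Nat.mod_le a b).trans_lt (by omega)
  · split_ifs <;> omega
  · split_ifs <;> omega

theorem Ex.size_pos (e : Ex) : 1 ≤ e.size := by cases e <;> simp only [Ex.size] <;> omega

/-- Only intermediate results may be this large; values that are stored have to be below `B` itself,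
which is what `Stmt.safe` demands. -/
theorem Ex.eval_lt_pow {st : State} (hB : 2 ≤ B) (hC : C < B) (hs : Small inp B st) :
    ∀ e : Ex, e.wf 64 C → e.eval inp st < B ^ e.size
  | v x, _ => by simpa [Ex.eval, Ex.size] using hs.reg x
  | c k, h => by simp only [Ex.eval, Ex.size, Ex.wf, pow_one] at *; omega
  | bin o e f, h => by
      refine (Op.eval_lt hB e.size_pos f.size_pos (eval_lt_pow hB hC hs e h.1)
        (eval_lt_pow hB hC hs f h.2) o).trans_le ?_
      exact Nat.pow_le_pow_right (by omega) (by simp [Ex.size])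
  | ld t e, _ => (hs.arr _ _).trans_le (Nat.le_self_pow (by simp [Ex.size]) _)
  | rd q e f, _ => (hs.inp _ _ _).trans_le (Nat.le_self_pow (by simp [Ex.size]) _)

theorem Ex.eval_lt_of_triv {st : State} (hB : 2 ≤ B) (hC : C < B) (hs : Small inp B st) :
    ∀ e : Ex, e.wf 64 C → e.triv → e.eval inp st < B
  | v x, _, _ => hs.reg x
  | c k, h, _ => lt_of_le_of_lt h hC
  | ld t e, _, _ => hs.arr _ _
  | rd q e f, _, _ => hs.inp _ _ _
  | bin .lt e f, _, _ | bin .eq e f, _, _ => by simp only [Ex.eval, Op.eval]; split_ifs <;> omega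
  | bin .sub e f, h, h' => (Nat.sub_le _ _).trans_lt (eval_lt_of_triv hB hC hs e h.1 h')
  | bin .div e f, h, h' => (Nat.div_le_self _ _).trans_lt (eval_lt_of_triv hB hC hs e h.1 h')
  | bin .mod e f, h, h' => (Nat.mod_le _ _).trans_lt (eval_lt_of_triv hB hC hs e h.1 h')
  | bin .add e f, _, h' => h'.elim
  | bin .mul e f, _, h' => h'.elim

/-- The register `d` holds the value of `e` after its code has run. -/
theorem Ex.comp_reach {st : State} (hB : 2 ≤ B) (h16 : 16 < B) (hC : C < B) (hs : Small inp B st) :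
    ∀ (e : Ex) (d : ℕ) (s : Store), e.wf 64 C → B ^ (e.size) ≤ M → 64 ≤ d → Sim st s →
      ∃ k s', k ≤ 12 * e.size ∧ Runs M inp k (e.comp d) s s' ∧
        s'.reg d = e.eval inp st ∧ s'.mem = s.mem ∧ ∀ i < d, s'.reg i = s.reg i := by
  intro e
  induction e with
  | v x =>
    intro d s hw hM hd h
    simp only [Ex.wf, Ex.size, pow_one] at *
    have hx : s.reg x = st.reg x := h.reg x (by omega)
    have hne : x ≠ d := by omega
    have := hs.reg x
    refine ⟨_, _, ?_, .seq (.const (by omega)) (.op rfl ?_), ?_, rfl, ?_⟩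
    · simp
    · simp [Op.eval, hne, hx]; omega
    · simp [Op.eval, hne, hx, Ex.eval]
    · grind
  | c k =>
    intro d s hw hM hd h
    simp only [Ex.wf, Ex.size, pow_one] at *
    refine ⟨1, _, by omega, .const (by omega), by simp [Ex.eval], rfl, ?_⟩
    grind
  | bin o e f ihe ihf =>
    intro d s hw hM hd h
    have hve := Ex.eval_lt_pow hB hC hs (bin o e f) hw
    simp only [Ex.size] at *
    obtain ⟨k1, s1, hk1, r1, v1, m1, f1⟩ := ihe d s hw.1 ((Nat.pow_le_pow_right (by omega) (by omega)).trans hM) hd h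
    obtain ⟨k2, s2, hk2, r2, v2, m2, f2⟩ := ihf (d + 1) s1 hw.2
      ((Nat.pow_le_pow_right (by omega) (by omega)).trans hM) (by omega)
      ⟨fun i hi => (f1 i (by omega)).trans (h.reg i hi), m1 ▸ h.mem⟩
    have e1 : s2.reg d = e.eval inp st := (f2 d (by omega)).trans v1
    refine ⟨_, _, ?_, r1.seq (r2.seq (.op rfl ?_)), ?_, ?_, ?_⟩
    · omega
    · rw [e1, v2]; exact hve.trans_le hM
    · simp [e1, v2, Ex.eval]
    · simp [m1, m2]
    · grind
  | ld t e ihe =>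
    intro d s hw hM hd h
    have hve := Ex.eval_lt_pow hB hC hs e hw.2
    simp only [Ex.size, Ex.wf] at *
    obtain ⟨k1, s1, hk1, r1, v1, m1, f1⟩ := ihe d s hw.2 ((Nat.pow_le_pow_right (by omega) (by omega)).trans hM) hd h
    have hp1 : 16 * e.eval inp st + t < M := by
      refine lt_of_lt_of_le ?_ hM
      rw [pow_add]
      have h2 : B ≤ B ^ 4 := Nat.le_self_pow (by omega) _
      nlinarith
    have hM' : B ≤ M := (Nat.le_self_pow (by omega) B).trans hM
    have hl : s.mem (16 * e.eval inp st + t) = st.arr t (e.eval inp st) := h.mem t hw.1 _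
    have hlt := hs.arr t (e.eval inp st)
    refine ⟨_, _, ?_, r1.seq (.seq (.const (by omega)) (.seq (.op rfl ?_) (.seq (.const (by omega)) (.seq (.op rfl ?_)
      (.load rfl ?_))))), ?_, ?_, ?_⟩
    · omega
    · simp [Op.eval, v1]; omega
    · simp [Op.eval, v1]; omega
    · simp [Op.eval, v1, m1, hl]; omega
    · simp [Op.eval, v1, m1, hl, Ex.eval]
    · simp [m1]
    · grind
  | rd q e f ihe ihf =>
    intro d s hw hM hd h
    simp only [Ex.size] at *
    obtain ⟨k1, s1, hk1, r1, v1, m1, f1⟩ := ihe d s hw.1 ((Nat.pow_le_pow_right (by omega) (by omega)).trans hM) hd h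
    obtain ⟨k2, s2, hk2, r2, v2, m2, f2⟩ := ihf (d + 1) s1 hw.2
      ((Nat.pow_le_pow_right (by omega) (by omega)).trans hM) (by omega)
      ⟨fun i hi => (f1 i (by omega)).trans (h.reg i hi), m1 ▸ h.mem⟩
    have e1 : s2.reg d = e.eval inp st := (f2 d (by omega)).trans v1
    have hM' : B ≤ M := (Nat.le_self_pow (by omega) B).trans hM
    refine ⟨_, _, ?_, r1.seq (r2.seq (.read ?_)), ?_, ?_, ?_⟩
    · omega
    · exact (hs.inp _ _ _).trans_le hM'
    · simp [e1, v2, Ex.eval]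
    · simp [m1, m2]
    · grind

theorem Ex.eval_lt {st : State} (hB : 2 ≤ B) (hC : C < B) (hs : Small inp B st) {e : Ex}
    (hw : e.wf 64 C) (h : e.triv ∨ e.eval inp st < B) : e.eval inp st < B :=
  h.elim (eval_lt_of_triv hB hC hs e hw) id

theorem Small.set {st : State} (h : Small inp B st) {v : ℕ} (hv : v < B) (x : ℕ) : Small inp B (st.set x v) :=
  ⟨fun i => by rw [State.set_reg]; split_ifs <;> [exact hv; exact h.reg i], h.arr, h.inp⟩

theorem Small.put {st : State} (h : Small inp B st) {v : ℕ} (hv : v < B) (t i : ℕ) : Small inp B (st.put t i v) :=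
  ⟨h.reg, fun u j => by
    rw [State.put_arr]
    split_ifs with hu
    · rw [update_apply]; split_ifs <;> [exact hv; exact h.arr t j]
    · exact h.arr u j, h.inp⟩

theorem Small.tick {st : State} (h : Small inp B st) (k : ℕ) : Small inp B (st.tick k) := ⟨h.reg, h.arr, h.inp⟩

theorem Sim.set {st : State} {s : Store} (h : Sim st s) {x v : ℕ} {r : ℕ → ℕ} {m : ℕ → ℕ}
    (hm : m = s.mem) (hx : r x = v) (hr : ∀ i < 64, i ≠ x → r i = s.reg i) :
    Sim (st.set x v) ⟨r, m⟩ :=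
  ⟨fun i hi => by
    rw [State.set_reg]
    split_ifs with hix
    · rw [hix]; exact hx
    · exact (hr i hi hix).trans (h.reg i hi), hm ▸ h.mem⟩

theorem Sim.put {st : State} {s : Store} (h : Sim st s) {t i v : ℕ} {r : ℕ → ℕ} (ht : t < 16)
    (hr : ∀ i < 64, r i = s.reg i) :
    Sim (st.put t i v) ⟨r, update s.mem (16 * i + t) v⟩ :=
  ⟨fun i hi => (hr i hi).trans (h.reg i hi), fun u hu j => by
    rw [State.put_arr]
    split_ifs with hut
    · subst hut
      simp only [update_apply]
      by_cases hji : j = i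
      · simp [hji]
      · rw [if_neg (by omega), if_neg hji]; exact h.mem u hu j
    · simp only [update_apply]
      rw [if_neg (by omega)]; exact h.mem u hu j⟩

/-- The loop doubles a power of two until it exceeds `val`; `2 ^ cnt ≤ val` is equivalent to `cnt <
val.size`. The last power may exceed `val` by a factor two, hence the bound on `M`. -/
theorem size_loop_reach {val : ℕ} (hM : 2 * val + 1 < M) (d : ℕ) :
    ∀ (j cnt : ℕ) (s : Store), cnt + j = val.size → s.reg d = val →
      s.reg (d + 1) = 2 ^ cnt → s.reg (d + 2) = cnt → s.reg (d + 3) = 0 →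
      s.reg (d + 4) = (if cnt < val.size then 1 else 0) →
      ∃ k s', k ≤ 10 * j + 1 ∧ Runs M inp k
        (.loop (d + 4) (.seq (.op .add (d + 1) (d + 1) (d + 1)) (.seq (.const (d + 5) 1)
        (.seq (.op .add (d + 2) (d + 2) (d + 5)) (.seq (.op .lt (d + 4) d (d + 1))
          (.op .eq (d + 4) (d + 4) (d + 3))))))) s s' ∧
        s'.reg (d + 2) = val.size ∧ s'.reg (d + 3) = 0 ∧ s'.mem = s.mem ∧ ∀ i < d, s'.reg i = s.reg i := by
  intro j
  induction j with
  | zero =>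
    intro cnt s hc h0 h1 h2 h3 h4
    refine ⟨1, s, by omega, .loop_done (by rw [h4, if_neg (by omega)]), ?_, h3, rfl, fun _ _ => rfl⟩
    omega
  | succ j ih =>
    intro cnt s hc h0 h1 h2 h3 h4
    have hlt : cnt < val.size := by omega
    have hp : 2 ^ cnt ≤ val := Nat.lt_size.mp hlt
    have hc2 : cnt < 2 ^ cnt := Nat.lt_two_pow_self
    have hlt' : (val < 2 ^ (cnt + 1)) ↔ ¬ (cnt + 1 < val.size) := by rw [not_lt, Nat.size_le]
    set s1 : Store := ⟨update s.reg (d + 1) (2 ^ (cnt + 1)), s.mem⟩ with hs1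
    set s2 : Store := ⟨update s1.reg (d + 5) 1, s.mem⟩ with hs2
    set s3 : Store := ⟨update s2.reg (d + 2) (cnt + 1), s.mem⟩ with hs3
    set s4 : Store := ⟨update s3.reg (d + 4) (if val < 2 ^ (cnt + 1) then 1 else 0), s.mem⟩ with hs4
    set s5 : Store := ⟨update s4.reg (d + 4) (if cnt + 1 < val.size then 1 else 0), s.mem⟩ with hs5
    have q1 : Runs M inp 1 (.op .add (d + 1) (d + 1) (d + 1)) s s1 :=
      .op (by simp [Op.eval, h1, pow_succ, Nat.mul_two]) (by omega)
    have q2 : Runs M inp 1 (.const (d + 5) 1) s1 s2 := .const (by omega)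
    have q3 : Runs M inp 1 (.op .add (d + 2) (d + 2) (d + 5)) s2 s3 :=
      .op (by simp [Op.eval, hs2, hs1, h2]) (by omega)
    have q4 : Runs M inp 1 (.op .lt (d + 4) d (d + 1)) s3 s4 :=
      .op (by simp [Op.eval, hs3, hs2, hs1, h0]) (by split_ifs <;> omega)
    have q5 : Runs M inp 1 (.op .eq (d + 4) (d + 4) (d + 3)) s4 s5 :=
      .op (by simp only [Op.eval]; grind) (by split_ifs <;> omega)
    obtain ⟨k, s', hk, r, v2, v3, m, f⟩ := ih (cnt + 1) s5 (by omega) (by simp [hs5, hs4, hs3, hs2, hs1, h0])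
      (by simp [hs5, hs4, hs3, hs2, hs1]) (by simp [hs5, hs4, hs3])
      (by simp [hs5, hs4, hs3, hs2, hs1, h3]) (by simp [hs5])
    refine ⟨_, s', ?_, .loop_next (by simp [h4, hlt]) (q1.seq (q2.seq (q3.seq (q4.seq q5)))) r, v2, v3, m,
      fun i hi => ?_⟩
    · omega
    have n1 : i ≠ d + 1 := by omega
    grind

end Compile

section Compile

variable {M B C κ : ℕ} {inp : Input}

theorem Ex.comp_reach' (h16 : 16 < B) (hC : C < B) (hM : B ^ κ ≤ M) {st : State}
    (hs : Small inp B st) {e : Ex} (hw : e.wf 64 C) (hκ : e.size ≤ κ) {d : ℕ} (hd : 64 ≤ d)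
    {s : Store} (h : Sim st s) : ∃ k s', k ≤ 12 * e.size ∧ Runs M inp k (e.comp d) s s' ∧
        s'.reg d = e.eval inp st ∧ s'.mem = s.mem ∧ (∀ i < d, s'.reg i = s.reg i) ∧ Sim st s' := by
  obtain ⟨k, s', hk, r, v, m, f⟩ := Ex.comp_reach (by omega) h16 hC hs e d s hw
    ((Nat.pow_le_pow_right (by omega) hκ).trans hM) hd h
  exact ⟨k, s', hk, r, v, m, f, fun i hi => (f i (by omega)).trans (h.reg i hi), m ▸ h.mem⟩

/-- The counted loop, from the point where its control registers are set up. -/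
theorem for_loop_reach (h16 : 16 < B) (hM : B ≤ M) {x : ℕ} {p : Stmt} {d : ℕ} (hd : 64 ≤ d) (hx : x < 64) (n : ℕ)
    (hn : n < B) (S : ℕ → State) (hκ : 20 ≤ κ)
    (ih : ∀ i < n, ∀ s, Small inp B (S i) → Sim ((S i).set x i) s →
      ∃ k s', Runs M inp k (p.comp (d + 4)) s s' ∧ Sim (S (i + 1)) s' ∧
        (∀ i, 64 ≤ i → i < d + 4 → s'.reg i = s.reg i) ∧
        k + 1 + κ * ((S i).time + 1) ≤ κ * (S (i + 1)).time ∧ Small inp B (S (i + 1))) :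
    ∀ (j i : ℕ) (s : Store), i + j = n → Small inp B (S i) → Sim (S i) s →
      s.reg d = n → s.reg (d + 1) = i → s.reg (d + 2) = (if i < n then 1 else 0) →
      ∃ k s', Runs M inp k (.loop (d + 2) (.seq (.const (d + 3) 0) (.seq (.op .add x (d + 1) (d + 3))
        (.seq (p.comp (d + 4)) (.seq (.const (d + 3) 1) (.seq (.op .add (d + 1) (d + 1) (d + 3))
          (.op .lt (d + 2) (d + 1) d))))))) s s' ∧ Sim (S n) s' ∧ (∀ i, 64 ≤ i → i < d → s'.reg i = s.reg i) ∧
        k + κ * (S i).time ≤ 1 + κ * (S n).time ∧ Small inp B (S n) := by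
  intro j
  induction j with
  | zero =>
    intro i s hi hsm hsim h0 h1 h2
    obtain rfl : i = n := by omega
    exact ⟨1, s, .loop_done (by simpa using h2), hsim, fun _ _ _ => rfl, le_refl _, hsm⟩
  | succ j ihj =>
    intro i s hi hsm hsim h0 h1 h2
    have hin : i < n := by omega
    rw [if_pos hin] at h2
    set s1 : Store := ⟨update s.reg (d + 3) 0, s.mem⟩ with hs1
    set s2 : Store := ⟨update s1.reg x i, s.mem⟩ with hs2
    have q2 : Runs M inp 1 (.op .add x (d + 1) (d + 3)) s1 s2 := .op (by simp [Op.eval, hs1, h1]) (by omega)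
    have hsim2 : Sim ((S i).set x i) s2 := by
      refine Sim.set (s := s) hsim rfl (by simp) fun y hy hyx => ?_
      grind
    obtain ⟨k, s3, r3, sim3, f3, t3, sm3⟩ := ih i hin s2 hsm hsim2
    have e3 : ∀ y, 64 ≤ y → y < d + 3 → s3.reg y = s.reg y := by
      intro y hy hy'
      have n1 : y ≠ d + 3 := by omega
      have n2 : y ≠ x := by omega
      grind
    have hd0 := e3 d (by omega) (by omega)
    have hd1 := e3 (d + 1) (by omega) (by omega)
    set s4 : Store := ⟨update s3.reg (d + 3) 1, s3.mem⟩ with hs4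
    set s5 : Store := ⟨update s4.reg (d + 1) (i + 1), s3.mem⟩ with hs5
    set s6 : Store := ⟨update s5.reg (d + 2) (if i + 1 < n then 1 else 0), s3.mem⟩ with hs6
    have q5 : Runs M inp 1 (.op .add (d + 1) (d + 1) (d + 3)) s4 s5 :=
      .op (by simp [Op.eval, hs4, hd1, h1]) (by omega)
    have q6 : Runs M inp 1 (.op .lt (d + 2) (d + 1) d) s5 s6 :=
      .op (by simp [Op.eval, hs5, hs4, hd0, h0]) (by split_ifs <;> omega)
    have f6 : ∀ y < d, s6.reg y = s3.reg y := by
      intro y hy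
      have n1 : y ≠ d + 1 := by omega
      have n2 : y ≠ d + 2 := by omega
      have n3 : y ≠ d + 3 := by omega
      simp [hs6, hs5, hs4, n1, n2, n3]
    obtain ⟨k', s', r', sim', f', t', sm'⟩ := ihj (i + 1) s6 (by omega) sm3
      ⟨fun y hy => (f6 y (by omega)).trans (sim3.reg y hy), sim3.mem⟩
      (by simp [hs6, hs5, hs4, hd0, h0]) (by simp [hs6, hs5]) (by simp [hs6])
    refine ⟨_, s', .loop_next (by simp [h2]) (.seq (.const (by omega)) (q2.seq (r3.seq
      (.seq (.const (by omega)) (q5.seq q6))))) r', sim', ?_, ?_, sm'⟩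
    · grind
    · rw [Nat.mul_add] at t3
      omega

/-- Correctness of the compiler. -/
theorem Stmt.comp_reach (h16 : 16 < B) (hC : C < B) (hM : B ^ κ ≤ M) :
    ∀ (P : Stmt) (st : State) (s : Store) (d : ℕ), P.wf 64 C → 20 * P.size ≤ κ → 64 ≤ d →
      Small inp B st → Sim st s → P.safe inp B st →
      ∃ k s', Runs M inp k (P.comp d) s s' ∧ Sim (P.run inp st) s' ∧
        (∀ i, 64 ≤ i → i < d → s'.reg i = s.reg i) ∧
        k + 1 + κ * st.time ≤ κ * (P.run inp st).time ∧ Small inp B (P.run inp st) := by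
  -- The time bound is carried as `k + 1 ≤ κ * (elapsed time)`. The spare step pays for the
  -- machine's `seq`, because sequencing does not advance the step counter of the structured
  -- language.
  intro P
  induction P with
  | skip =>
    intro st s d _ hκ hd hs h _
    simp only [Stmt.size] at hκ
    refine ⟨1, s, .skip, ⟨h.reg, h.mem⟩, fun _ _ _ => rfl, ?_, hs.tick 1⟩
    simp only [run, State.tick_time, Nat.mul_add]
    omega
  | set x e =>
    intro st s d hw hκ hd hs h hsafe
    simp only [Stmt.size] at hκ
    have hBM : B ≤ M := (Nat.le_self_pow (by omega) B).trans hM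
    have hv := Ex.eval_lt (by omega) hC hs hw.2 hsafe
    obtain ⟨k, s1, hk, r, v, m, f, h1⟩ := Ex.comp_reach' h16 hC hM hs hw.2 (by omega) hd h
    have hx := hw.1
    refine ⟨_, _, r.seq (.seq (.const (by omega)) (.op rfl ?_)), Sim.set (s := s) h m ?_ ?_, ?_, ?_, hs.set hv x⟩
    · simp [Op.eval, v]; omega
    · simp [Op.eval, v]
    · grind
    · grind
    · simp only [run, State.set_time, Nat.mul_add]
      omega
  | sto t e f =>
    intro st s d hw hκ hd hs h hsafe
    simp only [Stmt.size] at hκ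
    have hBM : B ≤ M := (Nat.le_self_pow (by omega) B).trans hM
    have hv := Ex.eval_lt (by omega) hC hs hw.2.2 hsafe
    have ht := hw.1
    obtain ⟨k1, s1, hk1, r1, v1, m1, f1, h1⟩ := Ex.comp_reach' h16 hC hM hs hw.2.2 (by omega) hd h
    obtain ⟨k2, s2, hk2, r2, v2, m2, f2, h2⟩ := Ex.comp_reach' h16 hC hM hs hw.2.1 (by omega)
      (show 64 ≤ d + 1 by omega) h1
    have hve := Ex.eval_lt_pow (by omega) hC hs e hw.2.1
    have hp1 : 16 * e.eval inp st + t < M := by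
      refine lt_of_lt_of_le ?_ ((Nat.pow_le_pow_right (by omega) (show e.size + 1 + 1 ≤ κ by omega)).trans hM)
      rw [pow_succ, pow_succ]
      have h1 : 16 * e.eval inp st + t < 16 * B ^ e.size := by omega
      have h2 : B ^ e.size * 16 ≤ B ^ e.size * B := Nat.mul_le_mul_left _ h16.le
      have h3 : B ^ e.size * B ≤ B ^ e.size * B * B := Nat.le_mul_of_pos_right _ (by omega)
      omega
    have ed : s2.reg d = f.eval inp st := (f2 d (by omega)).trans v1
    refine ⟨_, _, r1.seq (r2.seq (.seq (.const (by omega)) (.seq (.op rfl ?_) (.seq (.const (by omega))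
      (.seq (.op rfl ?_) (.store rfl rfl)))))), ?_, ?_, ?_, hs.put hv _ _⟩
    · simp [Op.eval, v2]; omega
    · simp [Op.eval, v2]; omega
    · simp only [Op.eval]
      simp [v2, m2, m1, ed]
      refine Sim.put h ht fun i hi => ?_
      grind
    · grind
    · simp only [run, State.put_time, Nat.mul_add]
      omega
  | seq p q ihp ihq =>
    intro st s d hw hκ hd hs h hsafe
    simp only [Stmt.size] at hκ
    obtain ⟨k1, s1, r1, h1, f1, t1, sm1⟩ := ihp st s d hw.1 (by omega) hd hs h hsafe.1
    obtain ⟨k2, s2, r2, h2, f2, t2, sm2⟩ := ihq _ s1 d hw.2 (by omega) hd sm1 h1 hsafe.2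
    refine ⟨_, s2, r1.seq r2, h2, fun i hi hid => (f2 i hi hid).trans (f1 i hi hid), ?_, sm2⟩
    simp only [run]
    omega
  | ite e p q ihp ihq =>
    intro st s d hw hκ hd hs h hsafe
    simp only [Stmt.size] at hκ
    have hsp := e.size_pos
    obtain ⟨k1, s1, hk1, r1, v1, m1, f1, h1⟩ := Ex.comp_reach' h16 hC hM hs hw.1 (by omega) hd h
    have h1' : Sim (st.tick 1) s1 := ⟨h1.reg, h1.mem⟩
    simp only [run]
    split_ifs with hc
    · obtain ⟨k2, s2, r2, h2, f2, t2, sm2⟩ := ihp _ s1 d hw.2.1 (by omega) hd (hs.tick 1) h1' (hsafe.1 hc)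
      refine ⟨_, s2, r1.seq (k := k1) (l := 1 + k2) (.cond ?_), h2, fun i hi hid => (f2 i hi hid).trans (f1 i hid), ?_, sm2⟩
      · rwa [v1, if_pos hc]
      · simp only [State.tick_time, Nat.mul_add] at t2
        omega
    · rw [not_not] at hc
      obtain ⟨k2, s2, r2, h2, f2, t2, sm2⟩ := ihq _ s1 d hw.2.2 (by omega) hd (hs.tick 1) h1' (hsafe.2 hc)
      refine ⟨_, s2, r1.seq (k := k1) (l := 1 + k2) (.cond ?_), h2, fun i hi hid => (f2 i hi hid).trans (f1 i hid), ?_, sm2⟩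
      · simp_all
      · simp only [State.tick_time, Nat.mul_add] at t2
        omega
  | loop x e p ih =>
    intro st s d hw hκ hd hs h hsafe
    simp only [Stmt.size] at hκ
    have hsp := e.size_pos
    have hBM : B ≤ M := (Nat.le_self_pow (by omega) B).trans hM
    have hx := hw.1
    have hn := Ex.eval_lt (by omega) hC hs hw.2.1 hsafe.1
    obtain ⟨k1, s1, hk1, r1, v1, m1, f1, h1⟩ := Ex.comp_reach' h16 hC hM hs hw.2.1 (by omega) hd h
    set n := e.eval inp st with hndef
    set s2 : Store := ⟨update s1.reg (d + 1) 0, s1.mem⟩ with hs2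
    set s3 : Store := ⟨update s2.reg (d + 2) (if 0 < n then 1 else 0), s1.mem⟩ with hs3
    have q3 : Runs M inp 1 (.op .lt (d + 2) (d + 1) d) s2 s3 :=
      .op (by simp [Op.eval, hs2, v1]) (by split_ifs <;> omega)
    have f3 : ∀ i < d, s3.reg i = s.reg i := by grind
    obtain ⟨k', s', r', sim', f', t', sm'⟩ := for_loop_reach (κ := κ) (p := p) h16 hBM hd hx n hn
      (fun i => loopN (fun i s => p.run inp (s.set x i)) i st) (by omega) (fun i hi s' hsm hsim => by
        obtain ⟨k, s'', r, a, b, c, e'⟩ := ih _ s' (d + 4) hw.2.2 (by omega) (by omega)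
          (hsm.set (by omega) x) hsim (hsafe.2 i hi)
        exact ⟨k, s'', r, a, b, c, e'⟩) n 0 s3 (by omega) hs
        ⟨fun i hi => (f3 i (by omega)).trans (h.reg i hi), by rw [hs3, m1]; exact h.mem⟩
        (by simp [hs3, hs2, v1]) (by simp [hs3, hs2]) (by simp [hs3])
    refine ⟨_, s', r1.seq (.seq (.const (by omega)) (q3.seq r')), ⟨sim'.reg, sim'.mem⟩,
      fun i hi hid => (f' i hi hid).trans (f3 i hid), ?_, sm'.tick 1⟩
    simp only [run, State.tick_time, Nat.mul_add]
    simp only [loopN] at t'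
    rw [← hndef]
    omega
  | lg x e =>
    intro st s d hw hκ hd hs h hsafe
    simp only [Stmt.size] at hκ
    have hsp := e.size_pos
    have hBM : B ≤ M := (Nat.le_self_pow (by omega) B).trans hM
    have hBM2 : B ^ 2 ≤ M := (Nat.pow_le_pow_right (by omega) (by omega)).trans hM
    have hx := hw.1
    have hn := Ex.eval_lt (by omega) hC hs hw.2 hsafe
    obtain ⟨k1, s1, hk1, r1, v1, m1, f1, h1⟩ := Ex.comp_reach' h16 hC hM hs hw.2 (by omega) hd h
    have hsz : (e.eval inp st).size ≤ e.eval inp st := Nat.size_le.mpr Nat.lt_two_pow_self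
    set n := e.eval inp st with hndef
    set s2 : Store := ⟨update s1.reg (d + 1) 1, s1.mem⟩ with hs2
    set s3 : Store := ⟨update s2.reg (d + 2) 0, s1.mem⟩ with hs3
    set s4 : Store := ⟨update s3.reg (d + 3) 0, s1.mem⟩ with hs4
    set s5 : Store := ⟨update s4.reg (d + 4) (if n < 1 then 1 else 0), s1.mem⟩ with hs5
    set s6 : Store := ⟨update s5.reg (d + 4) (if 0 < n.size then 1 else 0), s1.mem⟩ with hs6
    have hnz : 0 < n.size ↔ ¬ (n < 1) := by rw [Nat.lt_size]; simp; omega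
    have q5 : Runs M inp 1 (.op .lt (d + 4) d (d + 1)) s4 s5 :=
      .op (by simp [Op.eval, hs4, hs3, hs2, v1]) (by split_ifs <;> omega)
    have q6 : Runs M inp 1 (.op .eq (d + 4) (d + 4) (d + 3)) s5 s6 :=
      .op (by simp only [Op.eval]; simp_all) (by split_ifs <;> omega)
    have f6 : ∀ i < d, s6.reg i = s.reg i := by grind
    obtain ⟨k', s', hk', r', v2, v3, m', f'⟩ := size_loop_reach (inp := inp) (M := M) (val := n)
      (by nlinarith) d n.size 0 s6 (by omega)
      (by simp [hs6, hs5, hs4, hs3, hs2, v1]) (by simp [hs6, hs5, hs4, hs3, hs2])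
      (by simp [hs6, hs5, hs4, hs3]) (by simp [hs6, hs5, hs4]) (by simp [hs6])
    refine ⟨_, _, r1.seq (.seq (.const (by omega)) (.seq (.const (by omega)) (.seq (.const (by omega))
      (q5.seq (q6.seq (r'.seq (.op rfl ?_))))))), ?_, ?_, ?_, (hs.set (hsz.trans_lt hn) x).tick _⟩
    · simp only [Op.eval, v2, v3]; rw [Nat.add_zero]; exact (hsz.trans_lt hn).trans_le hBM
    · have := Sim.set (s := s) (x := x) (v := n.size) (r := update s'.reg x n.size) (m := s'.mem)
        h (m'.trans m1) (by simp)
        (fun i hi hix => by simp [hix, f' i (by omega), f6 i (by omega)])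
      simp [Op.eval, v2, v3]
      exact ⟨this.reg, this.mem⟩
    · grind
    · simp only [run, State.tick_time, State.set_time, Nat.mul_add]
      have : 20 * n.size ≤ κ * n.size := Nat.mul_le_mul_right _ (by omega)
      rw [← hndef]
      omega

end Compile

/-! ### Reasoning about statements -/

section Eval
variable (inp : Input) (s : State) (e f : Ex) (n x t q : ℕ)
@[simp] theorem Ex.eval_v : (Ex.v x).eval inp s = s.reg x := rfl
@[simp] theorem Ex.eval_ofNat : (no_index (OfNat.ofNat n : Ex)).eval inp s = n := rfl
@[simp] theorem Ex.eval_c : (Ex.c n).eval inp s = n := rfl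
@[simp] theorem Ex.eval_add : (e + f).eval inp s = e.eval inp s + f.eval inp s := rfl
@[simp] theorem Ex.eval_sub : (e - f).eval inp s = e.eval inp s - f.eval inp s := rfl
@[simp] theorem Ex.eval_mul : (e * f).eval inp s = e.eval inp s * f.eval inp s := rfl
@[simp] theorem Ex.eval_div : (e / f).eval inp s = e.eval inp s / f.eval inp s := rfl
@[simp] theorem Ex.eval_mod : (e % f).eval inp s = e.eval inp s % f.eval inp s := rfl
@[simp] theorem Ex.eval_lt' : (Ex.bin .lt e f).eval inp s = if e.eval inp s < f.eval inp s then 1 else 0 := rfl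
@[simp] theorem Ex.eval_eq : (Ex.bin .eq e f).eval inp s = if e.eval inp s = f.eval inp s then 1 else 0 := rfl
@[simp] theorem Ex.eval_ld : (Ex.ld t e).eval inp s = s.arr t (e.eval inp s) := rfl
@[simp] theorem Ex.eval_rd : (Ex.rd q e f).eval inp s = inp q (e.eval inp s) (f.eval inp s) := rfl
@[simp] theorem Ex.triv_v : (Ex.v x).triv ↔ True := Iff.rfl
@[simp] theorem Ex.triv_ofNat : (no_index (OfNat.ofNat n : Ex)).triv ↔ True := Iff.rfl
@[simp] theorem Ex.triv_c : (Ex.c n).triv ↔ True := Iff.rfl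
@[simp] theorem Ex.triv_ld : (Ex.ld t e).triv ↔ True := Iff.rfl
@[simp] theorem Ex.triv_rd : (Ex.rd q e f).triv ↔ True := Iff.rfl
@[simp] theorem Ex.triv_lt : (Ex.bin .lt e f).triv ↔ True := Iff.rfl
@[simp] theorem Ex.triv_eq : (Ex.bin .eq e f).triv ↔ True := Iff.rfl
@[simp] theorem Ex.triv_sub : (e - f).triv ↔ e.triv := Iff.rfl
@[simp] theorem Ex.triv_div : (e / f).triv ↔ e.triv := Iff.rfl
@[simp] theorem Ex.triv_mod : (e % f).triv ↔ e.triv := Iff.rfl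
@[simp] theorem Ex.triv_add : (e + f).triv ↔ False := Iff.rfl
@[simp] theorem Ex.triv_mul : (e * f).triv ↔ False := Iff.rfl
end Eval

/-- The statement assigns to the variable. -/
def Stmt.writes : Stmt → ℕ → Bool
  | skip, _ | sto _ _ _, _ => false
  | set x _, y | lg x _, y => x == y
  | seq p q, y => p.writes y || q.writes y
  | ite _ p q, y => p.writes y || q.writes y
  | .loop x _ p, y => x == y || p.writes y

/-- The statement stores to the array. -/
def Stmt.stores : Stmt → ℕ → Bool
  | skip, _ | set _ _, _ | lg _ _, _ => false
  | sto t _ _, u => t == u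
  | seq p q, y => p.stores y || q.stores y
  | ite _ p q, y => p.stores y || q.stores y
  | .loop _ _ p, y => p.stores y

/-- The states agree on everything that the statement does not write. -/
structure Frame (P : Stmt) (s s' : State) : Prop where
  reg : ∀ y, P.writes y = false → s'.reg y = s.reg y
  arr : ∀ t, P.stores t = false → s'.arr t = s.arr t

theorem Frame.refl (P : Stmt) (s : State) : Frame P s s := ⟨fun _ _ => rfl, fun _ _ => rfl⟩

/-- The two conditions are syntactic and Boolean, so that later frame arguments about concrete
programs are settled by `rfl` or `decide`. -/
theorem Stmt.frame (inp : Input) (P : Stmt) (s : State) : Frame P s (P.run inp s) := by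
  induction P generalizing s with
  | skip => exact ⟨fun _ _ => rfl, fun _ _ => rfl⟩
  | set x e =>
    refine ⟨fun y hy => ?_, fun _ _ => rfl⟩
    have : y ≠ x := by rintro rfl; simp [writes] at hy
    simp [run, this]
  | sto t e f =>
    refine ⟨fun _ _ => rfl, fun u hu => ?_⟩
    have : u ≠ t := by rintro rfl; simp [stores] at hu
    simp [run, this]
  | seq p q ihp ihq =>
    refine ⟨fun y hy => ?_, fun y hy => ?_⟩
    · simp [writes] at hy
      exact ((ihq _).reg y hy.2).trans ((ihp _).reg y hy.1)
    · simp [stores] at hy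
      exact ((ihq _).arr y hy.2).trans ((ihp _).arr y hy.1)
  | ite e p q ihp ihq =>
    refine ⟨fun y hy => ?_, fun y hy => ?_⟩
    · simp [writes] at hy
      simp only [run]
      split_ifs
      · exact (ihp (s.tick 1)).reg y hy.1
      · exact (ihq (s.tick 1)).reg y hy.2
    · simp [stores] at hy
      simp only [run]
      split_ifs
      · exact (ihp (s.tick 1)).arr y hy.1
      · exact (ihq (s.tick 1)).arr y hy.2
  | loop x e p ih =>
    have key : ∀ n, Frame (.loop x e p) s (loopN (fun i s => p.run inp (s.set x i)) n s) := by
      intro n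
      induction n with
      | zero => exact Frame.refl _ _
      | succ n ihn =>
        refine ⟨fun y hy => ?_, fun y hy => ?_⟩
        · have h := hy
          simp [writes, beq_eq_false_iff_ne] at hy
          refine ((ih _).reg y hy.2).trans ?_
          rw [State.set_reg, if_neg (Ne.symm hy.1)]
          exact ihn.reg y h
        · exact ((ih _).arr y hy).trans (ihn.arr y hy)
    exact ⟨(key _).reg, (key _).arr⟩
  | lg x e =>
    refine ⟨fun y hy => ?_, fun _ _ => rfl⟩
    have : y ≠ x := by rintro rfl; simp [writes] at hy
    simp [run, this]

/-- `P` runs safely from `s` and its final state satisfies `Q`. -/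
def Tr (inp : Input) (B : ℕ) (P : Stmt) (s : State) (Q : State → Prop) : Prop := P.safe inp B s ∧ Q (P.run inp s)

section Tr

variable {inp : Input} {B : ℕ} {s : State} {Q Q' : State → Prop}

/-- The frame of `P` is handed to the new postcondition, so specifications need to mention only what
a program changes. -/
theorem Tr.mono {P : Stmt} (h : Tr inp B P s Q) (hQ : ∀ s', Frame P s s' → Q s' → Q' s') :
    Tr inp B P s Q' := ⟨h.1, hQ _ (P.frame inp s) h.2⟩

theorem Tr_skip : Tr inp B .skip s Q ↔ Q (s.tick 1) := by simp [Tr, Stmt.safe, Stmt.run]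

theorem Tr_set {x : ℕ} {e : Ex} :
    Tr inp B (.set x e) s Q ↔ (e.triv ∨ e.eval inp s < B) ∧ Q (s.set x (e.eval inp s)) := Iff.rfl

theorem Tr_sto {t : ℕ} {e f : Ex} : Tr inp B (.sto t e f) s Q ↔
    (f.triv ∨ f.eval inp s < B) ∧ Q (s.put t (e.eval inp s) (f.eval inp s)) := Iff.rfl

theorem Tr_lg {x : ℕ} {e : Ex} : Tr inp B (.lg x e) s Q ↔
    (e.triv ∨ e.eval inp s < B) ∧ Q ((s.set x (e.eval inp s).size).tick (e.eval inp s).size) :=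
  Iff.rfl

theorem Tr_seq {p q : Stmt} : Tr inp B (p ;; q) s Q ↔ Tr inp B p s (fun s' => Tr inp B q s' Q) := by
  simp [Tr, Stmt.safe, Stmt.run, and_assoc]

theorem Tr_ite {e : Ex} {p q : Stmt} : Tr inp B (.ite e p q) s Q ↔ (e.eval inp s ≠ 0 → Tr inp B p (s.tick 1) Q) ∧
      (e.eval inp s = 0 → Tr inp B q (s.tick 1) Q) := by
  by_cases h : e.eval inp s = 0 <;> simp [Tr, Stmt.safe, Stmt.run, h]

/-- Besides the invariant, each round may use that the loop has so far changed only what its text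
can change. The cost `c` of a round includes the unit for setting the counter, since it is measured
from `s'` and not from `s'.set x i`. -/
theorem Tr.loop {x c : ℕ} {e : Ex} {p : Stmt} (I : ℕ → State → Prop) (hn : e.triv ∨ e.eval inp s < B) (h0 : I 0 s)
    (hstep : ∀ i < e.eval inp s, ∀ s', I i s' → Frame (.loop x e p) s s' →
      Tr inp B p (s'.set x i) (fun s'' => I (i + 1) s'' ∧ s''.time ≤ s'.time + c))
    (hQ : ∀ s', I (e.eval inp s) s' → Frame (.loop x e p) s s' → s'.time ≤ s.time + e.eval inp s * c → Q (s'.tick 1)) :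
    Tr inp B (.loop x e p) s Q := by
  set f : ℕ → State → State := fun i s => p.run inp (s.set x i) with hf
  have hfr : ∀ n, Frame (.loop x e p) s (loopN f n s) := by
    intro n
    induction n with
    | zero => exact Frame.refl _ _
    | succ n ihn =>
      have ih := p.frame inp ((loopN f n s).set x n)
      refine ⟨fun y hy => ?_, fun y hy => ?_⟩
      · have h := hy
        simp [Stmt.writes, beq_eq_false_iff_ne] at hy
        refine (ih.reg y hy.2).trans ?_
        rw [State.set_reg, if_neg (Ne.symm hy.1)]
        exact ihn.reg y h
      · exact (ih.arr y hy).trans (ihn.arr y hy)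
  have key : ∀ n ≤ e.eval inp s, I n (loopN f n s) ∧ (loopN f n s).time ≤ s.time + n * c ∧
      ∀ i < n, p.safe inp B ((loopN f i s).set x i) := by
    intro n
    induction n with
    | zero => exact fun _ => ⟨h0, by simp [loopN], fun i hi => absurd hi (Nat.not_lt_zero i)⟩
    | succ n ih =>
      intro hn
      obtain ⟨a, b, d⟩ := ih (by omega)
      obtain ⟨h1, h2, h3⟩ := hstep n (by omega) _ a (hfr n)
      refine ⟨h2, ?_, fun i hi => ?_⟩
      · have : (loopN f (n + 1) s).time ≤ (loopN f n s).time + c := h3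
        rw [Nat.add_mul]; omega
      · grind
  obtain ⟨a, b, d⟩ := key _ le_rfl
  exact ⟨⟨hn, d⟩, hQ _ a (hfr _) b⟩

end Tr

/-! ### Statements that do not use an array -/

def Ex.uses : Ex → ℕ → Bool
  | v _, _ | c _, _ => false
  | bin _ e f, t | rd _ e f, t => e.uses t || f.uses t
  | ld u e, t => u == t || e.uses t

/-- The statement reads or writes the array. -/
def Stmt.uses : Stmt → ℕ → Bool
  | skip, _ => false
  | set _ e, t | lg _ e, t => e.uses t
  | sto u e f, t => u == t || e.uses t || f.uses t
  | seq p q, t => p.uses t || q.uses t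
  | ite e p q, t => e.uses t || p.uses t || q.uses t
  | .loop _ e p, t => e.uses t || p.uses t

/-- The states agree except for the array `t` and the step counter. -/
structure EqOff (t : ℕ) (s s' : State) : Prop where
  reg : s'.reg = s.reg
  arr : ∀ u, u ≠ t → s'.arr u = s.arr u

theorem EqOff.set {t : ℕ} {s s' : State} (h : EqOff t s s') (x v : ℕ) : EqOff t (s.set x v) (s'.set x v) :=
  ⟨by simp [State.set, h.reg], h.arr⟩

theorem Ex.eval_congr {t : ℕ} {s s' : State} (inp : Input) (h : EqOff t s s') :
    ∀ e : Ex, e.uses t = false → e.eval inp s' = e.eval inp s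
  | v _, _ => by simp [h.reg]
  | c _, _ => rfl
  | bin _ e f, hu => by
      simp [uses] at hu
      simp only [eval, eval_congr inp h e hu.1, eval_congr inp h f hu.2]
  | rd _ e f, hu => by
      simp [uses] at hu
      simp only [eval, eval_congr inp h e hu.1, eval_congr inp h f hu.2]
  | ld u e, hu => by
      simp [uses, beq_eq_false_iff_ne] at hu
      simp only [eval, eval_congr inp h e hu.2, h.arr u hu.1]

/-- Noninterference. With `t = 14` it yields that a search depends only on the random words already
read, and with `t = 15` that the raw bits are irrelevant once they have been converted. -/
theorem Stmt.run_congr {t : ℕ} (inp : Input) (P : Stmt) {s s' : State} (hu : P.uses t = false)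
    (h : EqOff t s s') : EqOff t (P.run inp s) (P.run inp s') := by
  induction P generalizing s s' with
  | skip => exact ⟨h.reg, h.arr⟩
  | set x e => simp only [run, e.eval_congr inp h hu]; exact h.set _ _
  | sto u e f =>
    simp [uses, beq_eq_false_iff_ne] at hu
    simp only [run, e.eval_congr inp h hu.1.2, f.eval_congr inp h hu.2]
    refine ⟨h.reg, fun w hw => ?_⟩
    simp [h.arr u hu.1.1, h.arr w hw]
  | seq p q ihp ihq =>
    simp [uses] at hu
    exact ihq hu.2 (ihp hu.1 h)
  | ite e p q ihp ihq =>
    simp [uses] at hu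
    have h' : EqOff t (s.tick 1) (s'.tick 1) := ⟨h.reg, h.arr⟩
    simp only [run, e.eval_congr inp h hu.1.1]
    split_ifs
    · exact ihp hu.1.2 h'
    · exact ihq hu.2 h'
  | loop x e p ih =>
    simp [uses] at hu
    simp only [run, e.eval_congr inp h hu.1]
    have : ∀ n, EqOff t (loopN (fun i s => p.run inp (s.set x i)) n s)
        (loopN (fun i s => p.run inp (s.set x i)) n s') := by
      intro n
      induction n with
      | zero => exact h
      | succ n ihn => exact ih hu.2 (ihn.set x n)
    exact ⟨(this _).reg, (this _).arr⟩
  | lg x e =>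
    simp only [run, e.eval_congr inp h hu]
    exact ⟨(h.set x (e.eval inp s).size).reg, h.arr⟩

/-! ### Coin flips -/

/-- A uniform tuple is a uniform first bit followed by an independent uniform tail; this turns a
loop of single flips into one draw. -/
theorem uniform_bind_cons {α : Type*} (j : ℕ) (h : (Fin (j + 1) → Bool) → PMF α) :
    (PMF.uniformOfFintype (Fin (j + 1) → Bool)).bind h = (PMF.uniformOfFintype Bool).bind (fun b =>
        (PMF.uniformOfFintype (Fin j → Bool)).bind (fun ω => h (Fin.cons b ω))) := by
  ext a
  simp only [PMF.bind_apply, PMF.uniformOfFintype_apply, tsum_fintype]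
  rw [← (Fin.consEquiv (fun _ => Bool)).sum_comp, Fintype.sum_prod_type]
  simp only [mul_sum]
  refine sum_congr rfl fun b _ => sum_congr rfl fun ω _ => ?_
  have e : ((Fintype.card (Fin (j + 1) → Bool) : ENNReal))⁻¹ =
      (Fintype.card Bool : ENNReal)⁻¹ * (Fintype.card (Fin j → Bool) : ENNReal)⁻¹ := by
    rw [← ENNReal.mul_inv (Or.inl (by simp)) (Or.inl (by simp))]
    congr 1
    simp [pow_succ, mul_comm]
  rw [e, mul_assoc]
  rfl

/-- Fill the array `15` with as many random bits as the variable `19` says. -/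
def flipBody : Prog := .seq (.flip 69) (.seq (.store 65 69) (.seq (.op .add 65 65 66) (.op .sub 64 64 67)))

def flipProg : Prog := .seq (.const 65 15) (.seq (.const 66 16) (.seq (.const 67 1) (.seq (.const 68 0)
    (.seq (.op .add 64 19 68) (.loop 64 flipBody)))))

theorem runFor_flip {M : ℕ} (hM : 1 < M) (inp : Input) (d T : ℕ) (K : List Prog) (s : Store) :
    runFor M inp (1 + T) (.flip d :: K, s) = (PMF.uniformOfFintype Bool).bind (fun b =>
      runFor M inp T (K, ⟨update s.reg d b.toNat, s.mem⟩)) := by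
  rw [Nat.add_comm, runFor, step, PMF.bind_map]
  congr 1
  funext b
  have : (if b then 1 else 0) < M := by split_ifs <;> omega
  cases b <;> simp_all [writeReg]

/-- The `j` flips are gathered into one uniform tuple, of which the resulting store is a function. A
round takes eight steps whatever the bit, so all branches stay synchronous. Cell `16 * (i + m) + 15`
is entry `i + m` of array `15`. -/
theorem flip_loop {M : ℕ} (inp : Input) : ∀ (j i : ℕ) (s : Store), 16 * (i + j) + 15 < M →
    s.reg 64 = j → s.reg 65 = 16 * i + 15 → s.reg 66 = 16 → s.reg 67 = 1 →
    ∃ g : (Fin j → Bool) → Store, (∀ K T, runFor M inp (8 * j + 1 + T) (.loop 64 flipBody :: K, s) =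
        (PMF.uniformOfFintype (Fin j → Bool)).bind (fun ω => runFor M inp T (K, g ω))) ∧
      ∀ ω, (∀ y < 64, (g ω).reg y = s.reg y) ∧ (∀ m : Fin j, (g ω).mem (16 * (i + m) + 15) = (ω m).toNat) ∧
        ∀ a, (∀ m : Fin j, a ≠ 16 * (i + m) + 15) → (g ω).mem a = s.mem a := by
  intro j
  induction j with
  | zero =>
    intro i s hM h64 h65 h66 h67
    refine ⟨fun _ => s, fun K T => ?_, fun ω => ⟨fun _ _ => rfl, fun m => m.elim0, fun _ _ => rfl⟩⟩
    rw [PMF.bind_const]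
    exact Runs.loop_done h64 K T
  | succ j ih =>
    intro i s hM h64 h65 h66 h67
    let s' : Bool → Store := fun b => ⟨update (update
      (update s.reg 69 b.toNat) 65 (16 * (i + 1) + 15)) 64 j,
      update s.mem (16 * i + 15) b.toNat⟩
    have hstep : ∀ b, Runs M inp 5 (.seq (.store 65 69) (.seq (.op .add 65 65 66) (.op .sub 64 64 67)))
        ⟨update s.reg 69 b.toNat, s.mem⟩ (s' b) :=
      fun b => show Runs M inp (1 + 1 + (1 + 1 + 1)) _ _ _ from .seq (.store h65 rfl) (.seq
        (.op (x := 16 * (i + 1) + 15) (by simp [Op.eval, h65, h66]; omega) (by omega))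
        (.op (by simp [Op.eval, h64, h67]) (by omega)))
    have H := fun b => ih (i + 1) (s' b) (by omega) (by simp [s']) (by simp [s'])
      (by simp [s', h66]) (by simp [s', h67])
    choose g hg hp using H
    refine ⟨fun ω => g (ω 0) (Fin.tail ω), fun K T => ?_, fun ω => ⟨fun y hy => ?_, ?_, ?_⟩⟩
    · rw [show 8 * (j + 1) + 1 + T = 1 + 1 + (1 + (5 + (8 * j + 1 + T))) by omega,
        ((Reach.loop (p := flipBody) (by rw [h64]; omega)).trans Reach.seq) _,
        runFor_flip (by omega), uniform_bind_cons]
      congr 1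
      funext b
      rw [hstep, hg]
      rfl
    · grind
    · refine Fin.cases ?_ fun m => ?_
      · grind
      · have := (hp (ω 0) (Fin.tail ω)).2.1 m
        rw [Fin.val_succ, show i + (m + 1 : ℕ) = i + 1 + m by omega]
        exact this
    · intro a ha
      rw [(hp _ _).2.2]
      · have : a ≠ 16 * i + 15 := ha 0
        simp [s', this]
      · intro m
        have := ha m.succ
        grind

/-- The array `15` is filled with bits. -/
def State.withBits (s : State) (N : ℕ) (ω : Fin N → Bool) : State := ⟨s.reg, update s.arr 15
    (fun i => if h : i < N then (ω ⟨i, h⟩).toNat else s.arr 15 i), s.time⟩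

/-- The only place where randomness enters. What precedes and what follows is deterministic, so
every outcome is a function of `ω`. -/
theorem flipProg_run {M : ℕ} (inp : Input) {st : State} {s : Store} (h : Sim st s) (hM : 16 * st.reg 19 + 31 < M) :
    ∃ g : (Fin (st.reg 19) → Bool) → Store, (∀ K T, runFor M inp (11 + 8 * st.reg 19 + T) (flipProg :: K, s) =
        (PMF.uniformOfFintype (Fin (st.reg 19) → Bool)).bind (fun ω => runFor M inp T (K, g ω))) ∧
      ∀ ω, Sim (st.withBits _ ω) (g ω) := by
  let s' : Store := ⟨update (update (update (update
    (update s.reg 65 15) 66 16) 67 1) 68 0) 64 (st.reg 19), s.mem⟩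
  have h19 : s.reg 19 = st.reg 19 := h.reg 19 (by norm_num)
  have hs' : ∀ K, Reach M inp 10 (flipProg :: K, s) (.loop 64 flipBody :: K, s') := by
    intro K
    have q : Runs M inp 1 (.op .add 64 19 68) ⟨update (update (update (update s.reg 65 15) 66 16) 67 1) 68 0, s.mem⟩ s' :=
      .op (by simp [Op.eval, h19]) (by omega)
    have c := fun d x (hx : x < 32) (s : Store) => Runs.const (M := M) (inp := inp) (d := d) (s := s) (x := x) (by omega)
    exact ((((((((Reach.seq.trans (c _ _ (by omega) _ _)).trans Reach.seq).trans (c _ _ (by omega) _ _)).trans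
      Reach.seq).trans (c _ _ (by omega) _ _)).trans Reach.seq).trans (c _ _ (by omega) _ _)).trans Reach.seq).trans (q _)
  obtain ⟨g, hg, hp⟩ := flip_loop (M := M) inp (st.reg 19) 0 s' (by omega) (by simp [s'])
    (by simp [s']) (by simp [s']) (by simp [s'])
  refine ⟨g, fun K T => ?_, fun ω => ⟨fun i hi => ?_, fun t ht i => ?_⟩⟩
  · rw [show 11 + 8 * st.reg 19 + T = 10 + (8 * st.reg 19 + 1 + T) by omega, hs', hg]
  · rw [(hp ω).1 i hi]
    have n1 : i ≠ 64 := by omega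
    have n2 : i ≠ 65 := by omega
    have n3 : i ≠ 66 := by omega
    have n4 : i ≠ 67 := by omega
    have n5 : i ≠ 68 := by omega
    simpa [s', n1, n2, n3, n4, n5, State.withBits] using h.reg i hi
  · by_cases htt : t = 15 ∧ i < st.reg 19
    · obtain ⟨rfl, hi⟩ := htt
      have := (hp ω).2.1 ⟨i, hi⟩
      simp at this
      simp [State.withBits, this, hi]
    · rw [(hp ω).2.2]
      · have e : s'.mem = s.mem := rfl
        rw [e, h.mem t ht i]
        by_cases ht' : t = 15
        · subst ht'
          have : ¬ i < st.reg 19 := fun h => htt ⟨rfl, h⟩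
          simp [State.withBits, this]
        · simp [State.withBits, ht']
      · intro m
        have := m.2
        omega

theorem runFor_halted {M : ℕ} (inp : Input) (T : ℕ) (s : Store) :
    runFor M inp T ([], s) = PMF.pure (some ([], s)) := by
  induction T with
  | zero => rfl
  | succ T ih => simp [runFor, step, ih]

theorem exec_of_reach {M : ℕ} {inp : Input} {P : Prog} {s s' : Store} {k T : ℕ} (hk : k ≤ T)
    (h : Reach M inp k ([P], s) ([], s')) : exec M inp P T s = PMF.pure (some s') := by
  obtain ⟨T', rfl⟩ := Nat.exists_eq_add_of_le hk
  rw [exec, h, runFor_halted, PMF.pure_map]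
  rfl

/-- A program that runs a deterministic part, flips all its coins, and then runs another
deterministic part. -/
theorem exec_flip {M : ℕ} {inp : Input} {P R : Prog} {s s₁ : Store} {st₁ : State} {k k' T : ℕ}
    (hP : Runs M inp k P s s₁) (h₁ : Sim st₁ s₁)
    (hM : 16 * st₁.reg 19 + 31 < M) (Φ : (Fin (st₁.reg 19) → Bool) → Store → Prop)
    (hR : ∀ ω s₂, Sim (st₁.withBits _ ω) s₂ → ∃ l ≤ k', ∃ s₃, Reach M inp l ([R], s₂) ([], s₃) ∧ Φ ω s₃)
    (hT : k + 8 * st₁.reg 19 + k' + 13 ≤ T) :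
    ∃ g : (Fin (st₁.reg 19) → Bool) → Store, exec M inp (.seq P (.seq flipProg R)) T s =
        (PMF.uniformOfFintype (Fin (st₁.reg 19) → Bool)).map (fun ω => some (g ω)) ∧
      ∀ ω, Φ ω (g ω) := by
  obtain ⟨f, hf, hs⟩ := flipProg_run (M := M) inp h₁ hM
  choose l hl g hg hΦ using fun ω => hR ω (f ω) (hs ω)
  obtain ⟨T', rfl⟩ := Nat.exists_eq_add_of_le hT
  refine ⟨g, ?_, hΦ⟩
  rw [exec, show k + 8 * st₁.reg 19 + k' + 13 + T' = 1 + k + 1 + (11 + 8 * st₁.reg 19 + (k' + T')) by omega,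
    ((Reach.seq.trans (hP _)).trans Reach.seq) _, hf, PMF.map_bind]
  rw [← PMF.bind_pure_comp]
  congr 1
  funext ω
  obtain ⟨e, he⟩ := Nat.exists_eq_add_of_le (hl ω)
  rw [he, show l ω + e + T' = l ω + (e + T') by omega, hg ω, runFor_halted, PMF.pure_map]
  rfl

/-! ### Output -/

/-- Copy the first `reg 1` entries of the array `9` to the cells from `0` on. -/
def emitBody : Prog := .seq (.op .mul 67 69 64) (.seq (.op .add 67 67 71) (.seq (.load 68 67) (.seq (.store 64 68)
    (.seq (.op .add 64 64 70) (.op .lt 66 64 1)))))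

def emitProg : Prog := .seq (.const 64 0) (.seq (.const 69 16) (.seq (.const 70 1) (.seq (.const 71 9)
    (.seq (.op .lt 66 64 1) (.seq (.loop 66 emitBody) (.const 2 0))))))

/-- Copying in place is safe: the target cell `i` lies below every source cell `16 * m + 9` with `m
> i` that has still to be read. -/
theorem emit_loop {M : ℕ} (inp : Input) {c : ℕ} (f : ℕ → ℕ) (hf : ∀ i, f i < M)
    (hM : 16 * c + 31 < M) : ∀ (j i : ℕ) (s : Store), i + j = c →
    s.reg 64 = i → s.reg 69 = 16 → s.reg 70 = 1 → s.reg 71 = 9 → s.reg 1 = c →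
    s.reg 66 = (if i < c then 1 else 0) → (∀ m < i, s.mem m = f m) →
    (∀ m, i ≤ m → s.mem (16 * m + 9) = f m) →
    ∃ s', Runs M inp (12 * j + 1) (.loop 66 emitBody) s s' ∧
      s'.reg 0 = s.reg 0 ∧ s'.reg 1 = c ∧ ∀ m < c, s'.mem m = f m := by
  intro j
  induction j with
  | zero =>
    intro i s hi h64 h69 h70 h71 h1 h66 hm _
    obtain rfl : i = c := by omega
    exact ⟨s, .loop_done (by simpa using h66), rfl, h1, hm⟩
  | succ j ih =>
    intro i s hi h64 h69 h70 h71 h1 h66 hm hm'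
    have hic : i < c := by omega
    rw [if_pos hic] at h66
    have hfi := hf i
    obtain ⟨s', r, e0, e1, em⟩ := ih (i + 1) ⟨update (update (update (update (update s.reg 67 (16 * i))
        67 (16 * i + 9)) 68 (f i)) 64 (i + 1)) 66 (if i + 1 < c then 1 else 0), update s.mem i (f i)⟩ (by omega)
      (by simp) (by simp [h69]) (by simp [h70]) (by simp [h71]) (by simp [h1]) (by simp)
      (fun m hm1 => by grind) (fun m hm1 => by
        have : 16 * m + 9 ≠ i := by omega
        simp [this, hm' m (by omega)])
    refine ⟨s', ?_, by simpa using e0, e1, em⟩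
    convert Runs.loop_next (by simp [h66]) (.seq (.op (by simp [Op.eval, h69, h64]) (by omega))
      (.seq (.op (by simp [Op.eval, h71]) (by omega)) (.seq (.load (by simp [hm' i le_rfl]) hfi)
      (.seq (.store (by simp [h64]) (by simp)) (.seq (.op (by simp [Op.eval, h64, h70]) (by omega))
      (.op (by simp [Op.eval, h1]) (by split_ifs <;> omega))))))) r using 1 <;> first | rfl | omega

theorem emitProg_run {M B : ℕ} {inp : Input} {st : State} {s : Store} (h : Sim st s)
    (hs : Small inp B st) (hM : B ^ 2 ≤ M) (hB : 48 < B) :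
    ∃ s', Runs M inp (12 * st.reg 1 + 13) emitProg s s' ∧
      s'.reg 0 = st.reg 0 ∧ s'.reg 1 = st.reg 1 ∧ s'.reg 2 = 0 ∧
      ∀ m < st.reg 1, s'.mem m = st.arr 9 m := by
  have h1 : s.reg 1 = st.reg 1 := h.reg 1 (by norm_num)
  have hlt := hs.reg 1
  have hM1 : 48 * B ≤ M := le_trans (by nlinarith) hM
  obtain ⟨s', r, e0, e1, em⟩ := emit_loop (M := M) inp (c := st.reg 1) (st.arr 9)
    (fun i => (hs.arr 9 i).trans_le (by omega)) (by omega) (st.reg 1) 0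
    ⟨update (update (update (update (update s.reg 64 0)
      69 16) 70 1) 71 9) 66 (if 0 < st.reg 1 then 1 else 0), s.mem⟩ (by omega) (by simp) (by simp)
    (by simp) (by simp) (by simp [h1]) (by simp) (fun m hm => absurd hm (Nat.not_lt_zero m))
    (fun m _ => h.mem 9 (by norm_num) m)
  refine ⟨⟨update s'.reg 2 0, s'.mem⟩, ?_, ?_, by simpa using e1, by simp, em⟩
  · rw [show 12 * st.reg 1 + 13 = 1 + 1 + (1 + 1 + (1 + 1 + (1 + 1 + (1 + 1 + (1 + (12 * st.reg 1 + 1) + 1))))) by omega]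
    exact .seq (.const (by omega)) (.seq (.const (by omega)) (.seq (.const (by omega)) (.seq (.const (by omega))
      (.seq (.op (by simp [Op.eval, h1]) (by split_ifs <;> omega)) (r.seq (.const (by omega)))))))
  · have := h.reg 0 (by norm_num)
    simp [OfNat.zero_ne_ofNat, update_of_ne] at e0 ⊢
    rw [e0, this]

/-! ### Cut values, volumes, and the partition inequality for extreme sets -/

namespace WeightedGraph

variable {n : ℕ} (G : WeightedGraph n)

open Classical in
/-- The weight of the pair `u, v`, zero for non-adjacent pairs. -/
noncomputable def wt (u v : Fin n) : ℕ := if G.graph.Adj u v then G.weight s(u, v) else 0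

theorem wt_comm (u v : Fin n) : G.wt u v = G.wt v u := by
  by_cases h : G.graph.Adj u v
  · rw [wt, wt, if_pos h, if_pos h.symm, Sym2.eq_swap]
  · rw [wt, wt, if_neg h, if_neg fun h' => h h'.symm]

theorem wt_self (u : Fin n) : G.wt u u = 0 := by simp [wt]

theorem mem_edges {u v : Fin n} : s(u, v) ∈ G.edges ↔ G.graph.Adj u v := by simp [edges]

theorem weight_le_maxWeight {e : Sym2 (Fin n)} (h : e ∈ G.edges) : G.weight e ≤ G.maxWeight := le_sup h

theorem wt_le_maxWeight (u v : Fin n) : G.wt u v ≤ G.maxWeight := by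
  unfold wt
  split_ifs with h
  · exact G.weight_le_maxWeight (G.mem_edges.mpr h)
  · exact Nat.zero_le _

/-- Each edge of the cut is oriented from its end in `X` to its end outside. As a double sum the cut
value can be split along partitions. -/
theorem cutValue_eq (X : Finset (Fin n)) : G.cutValue X = ∑ u ∈ X, ∑ v ∈ Xᶜ, G.wt u v := by
  classical
  rw [← sum_product']
  simp only [wt]
  rw [← sum_filter, cutValue]
  symm
  refine sum_bij (fun p _ => s(p.1, p.2)) ?_ ?_ ?_ ?_
  · rintro ⟨u, v⟩ h
    simp at h
    simp only [cutSet, mem_filter, mem_edges]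
    grind
  · rintro ⟨u, v⟩ h ⟨u', v'⟩ h' e
    simp at h h'
    grind
  · intro e he
    simp [cutSet] at he
    obtain ⟨h1, u, hu, v, hv, rfl⟩ := he
    exact ⟨(u, v), by simp [hu, hv, G.mem_edges.mp h1], rfl⟩
  · intro p _; rfl

/-- Edges from `v` into `S` leave the cut and edges from `v` to the outside enter it. The form with
sums on both sides avoids truncated subtraction and matches the two accumulators of the search. -/
theorem cutValue_insert {S : Finset (Fin n)} {v : Fin n} (hv : v ∉ S) : G.cutValue (insert v S) + ∑ u ∈ S, G.wt v u =
      G.cutValue S + ∑ u ∈ (insert v S)ᶜ, G.wt v u := by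
  classical
  have hc : Sᶜ = insert v (insert v S)ᶜ := by simp_all
  rw [cutValue_eq, cutValue_eq, sum_insert hv, hc]
  have : ∀ u ∈ S, ∑ b ∈ insert v (insert v S)ᶜ, G.wt u b = G.wt v u + ∑ b ∈ (insert v S)ᶜ, G.wt u b := by
    intro u _
    rw [sum_insert (by simp), G.wt_comm]
  rw [sum_congr rfl this, sum_add_distrib]
  ring

theorem cutValue_empty : G.cutValue ∅ = 0 := by simp [cutValue_eq]

open Classical in
/-- The neighbours of `v` outside `S`. -/
noncomputable def outNbrs (v : Fin n) (S : Finset (Fin n)) : Finset (Fin n) :=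
  univ.filter (fun u => G.graph.Adj v u ∧ u ∉ S)

theorem vol_empty : G.vol ∅ = 0 := by simp [vol]

/-- Edges between `v` and `S` are already counted in the volume of `S`; only those from `v` to the
outside are new. -/
theorem vol_insert {S : Finset (Fin n)} {v : Fin n} (hv : v ∉ S) :
    G.vol (insert v S) = G.vol S + (G.outNbrs v S).card := by
  classical
  have hinj : Set.InjOn (fun u => s(v, u)) (G.outNbrs v S : Set (Fin n)) := by simp
  rw [← card_image_of_injOn hinj, vol, vol, ← card_union_of_disjoint]
  · congr 1
    ext e
    induction e with
    | h a b =>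
      simp only [mem_filter, mem_union, mem_image, mem_insert,
        outNbrs, mem_edges, mem_univ, true_and, Sym2.mem_iff]
      constructor
      · rintro ⟨hab, u, hu, huab⟩
        by_cases hS : ∃ u ∈ S, u = a ∨ u = b
        · exact Or.inl ⟨hab, hS⟩
        · push Not at hS
          right
          rcases hu with rfl | hu
          · rcases huab with rfl | rfl
            · grind
            · exact ⟨a, ⟨hab.symm, fun h => (hS a h).1 rfl⟩, Sym2.eq_swap⟩
          · simp_all
      · rintro (⟨hab, u, hu, h⟩ | ⟨u, ⟨hu, hu'⟩, h⟩)
        · exact ⟨hab, u, Or.inr hu, h⟩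
        · rcases Sym2.eq_iff.mp h with ⟨rfl, rfl⟩ | ⟨rfl, rfl⟩
          · simp_all
          · exact ⟨hu.symm, v, Or.inl rfl, Or.inr rfl⟩
  · rw [disjoint_left]
    intro e he he'
    simp [outNbrs] at he he'
    obtain ⟨u, ⟨hu, hu'⟩, rfl⟩ := he'
    obtain ⟨_, u', hu'S, h⟩ := he
    rcases Sym2.mem_iff.mp h with rfl | rfl
    · exact hv hu'S
    · exact hu' hu'S

theorem vol_mono {S X : Finset (Fin n)} (h : S ⊆ X) : G.vol S ≤ G.vol X := by
  classical
  refine card_le_card fun e he => ?_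
  grind

/-- Every edge that touches `S` comes from at most two ordered pairs. Hence the search may give up
once the explored degrees sum to `2 * ν`. -/
theorem sum_degree_le (S : Finset (Fin n)) [DecidableRel G.graph.Adj] : ∑ u ∈ S, G.graph.degree u ≤ 2 * G.vol S := by
  classical
  have h1 : ∑ u ∈ S, G.graph.degree u = ((S ×ˢ univ).filter (fun p => G.graph.Adj p.1 p.2)).card := by
    rw [card_filter, sum_product]
    refine sum_congr rfl fun u _ => ?_
    rw [← card_filter, ← SimpleGraph.card_neighborFinset_eq_degree]
    congr 1
    ext v; simp
  rw [h1, vol]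
  refine (card_le_mul_card_image (f := fun p => s(p.1, p.2)) _ 2 ?_).trans
    (Nat.mul_le_mul_left 2 (card_le_card ?_))
  · intro e _
    induction e with
    | h a b =>
      refine (card_le_card (t := {(a, b), (b, a)}) ?_).trans card_le_two
      grind
  · intro e he
    simp only [mem_image, mem_filter, mem_product] at he
    obtain ⟨⟨u, v⟩, ⟨⟨hu, _⟩, h⟩, rfl⟩ := he
    simp only [mem_filter, mem_edges]
    grind

/-- Allows `ν` to be replaced by `min ν (n * n)`, so that logarithms of the length of a run are
`O(log n)`. -/
theorem vol_lt_sq (hn : 0 < n) (X : Finset (Fin n)) : G.vol X < n * n := by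
  classical
  have h1 : G.vol X ≤ G.numEdges := card_le_card (filter_subset _ _)
  have h2 : G.numEdges ≤ n.choose 2 := by
    have := SimpleGraph.card_edgeFinset_le_card_choose_two (G := G.graph)
    rw [Fintype.card_fin] at this
    refine le_trans (le_of_eq ?_) this
    rw [numEdges]
    congr 1
    ext e; simp [edges]
  have h3 : n.choose 2 * 2 = n * (n - 1) := by rw [Nat.choose_two_right, Nat.div_mul_cancel (Nat.even_mul_pred_self n).two_dvd]
  have : n * (n - 1) < n * n := Nat.mul_lt_mul_of_pos_left (by omega) hn
  omega

/-- The total weight between different blocks of a partition of an extreme set. -/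
theorem IsExtreme.le_sum_blocks {X : Finset (Fin n)} (hX : G.IsExtreme X) (P : Setoid X)
    [DecidableRel P] [Fintype (Quotient P)] :
    (Fintype.card (Quotient P) - 1) * (G.cutValue X + 1) ≤ ∑ u : X, ∑ v : X, if P u v then 0 else G.wt u v := by
  classical
  set c := Fintype.card (Quotient P)
  rcases Nat.lt_or_ge c 2 with hc | hc
  · rw [show c - 1 = 0 by omega]; simp
  let Y : Quotient P → Finset (Fin n) := fun q =>
    (univ.filter (fun u : X => (⟦u⟧ : Quotient P) = q)).map (Function.Embedding.subtype _)
  have hYX : ∀ q, Y q ⊆ X := by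
    intro q u hu
    simp only [Y, mem_map, mem_filter] at hu
    obtain ⟨a, _, rfl⟩ := hu
    exact a.2
  -- Extremality applies to each block: blocks are nonempty, and strict subsets because there are at
  -- least two of them.
  have hY : ∀ q, G.cutValue X + 1 ≤ G.cutValue (Y q) := by
    intro q
    refine hX (Y q) ?_ ⟨hYX q, fun h => ?_⟩
    · obtain ⟨u, rfl⟩ := Quotient.exists_rep q
      exact ⟨u, by simp [Y]⟩
    · obtain ⟨q', hq'⟩ := Fintype.exists_ne_of_one_lt_card hc q
      obtain ⟨u, rfl⟩ := Quotient.exists_rep q'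
      have := h u.2
      simp [Y] at this
      exact hq' this
  have h1 : c * (G.cutValue X + 1) ≤ ∑ q, G.cutValue (Y q) := by
    simpa [c] using card_nsmul_le_sum univ (fun q => G.cutValue (Y q)) _ (fun q _ => hY q)
  have h2 : ∀ q, G.cutValue (Y q) = ∑ u : X, if (⟦u⟧ : Quotient P) = q then
      (∑ v ∈ Xᶜ, G.wt u v + ∑ v : X, if P u v then 0 else G.wt u v) else 0 := by
    intro q
    rw [cutValue_eq, sum_map, sum_filter]
    refine sum_congr rfl fun u _ => ?_
    split_ifs with hu
    · have : (Y q)ᶜ = Xᶜ ∪ (X \ Y q) := by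
        ext v
        have := @hYX q v
        simp
        tauto
      rw [this, sum_union]
      · congr 1
        have e1 : X \ Y q = (univ.filter (fun v : X => ¬ P u v)).map (Function.Embedding.subtype _) := by
          ext v
          simp only [mem_sdiff, mem_map, mem_filter, mem_univ,
            true_and, Y, Function.Embedding.subtype_apply, ← hu]
          constructor
          · rintro ⟨hv, h⟩
            exact ⟨⟨v, hv⟩, fun h' => h ⟨⟨v, hv⟩, Quotient.sound (P.symm' h'), rfl⟩, rfl⟩
          · rintro ⟨v, h, rfl⟩
            refine ⟨v.2, ?_⟩
            rintro ⟨v', h', e⟩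
            obtain rfl : v' = v := Subtype.ext e
            exact h (P.symm' (Quotient.exact h'))
        rw [e1, sum_map, sum_filter]
        refine sum_congr rfl fun v _ => ?_
        by_cases h : P u v <;> simp [h]
      · rw [disjoint_left]; intro v hv hv'
        simp at hv hv'
        exact hv hv'.1
    · rfl
  -- An edge leaving `X` is cut by one block and an edge between two blocks by both of them; the sum
  -- over ordered pairs accounts for the latter.
  have h3 : ∑ q, G.cutValue (Y q) = G.cutValue X + ∑ u : X, ∑ v : X, if P u v then 0 else G.wt u v := by
    simp_rw [h2]
    rw [sum_comm]
    simp only [sum_ite_eq, mem_univ, if_true]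
    rw [sum_add_distrib, cutValue_eq, ← sum_coe_sort X]
  -- From `c * (λ + 1) ≤ λ + sum` one of the `c` summands is cancelled against `λ`.
  obtain ⟨d, hd⟩ : ∃ d, c = d + 1 := ⟨c - 1, by omega⟩
  rw [hd] at h1 ⊢
  rw [Nat.add_sub_cancel]
  rw [Nat.add_mul] at h1
  omega

end WeightedGraph

/-! ### Random joins -/

section RandomJoin

variable {ι L : Type*} [SemilatticeSup L] [OrderBot L]

/-- The expected value of `f` at the join of the `a e` over the elements `e` of the list that are
open, when each `e` is closed independently with probability `q e`. -/
def expJoin (q : ι → ℝ) (a : ι → L) : List ι → (L → ℝ) → ℝ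
  | [], f => f ⊥
  | e :: l, f => q e * expJoin q a l f + (1 - q e) * expJoin q a l (fun P => f (P ⊔ a e))

variable {q q' : ι → ℝ} {a : ι → L}

theorem expJoin_mono (h0 : ∀ e, 0 ≤ q e) (h1 : ∀ e, q e ≤ 1) (l : List ι) {f g : L → ℝ}
    (h : ∀ P, f P ≤ g P) : expJoin q a l f ≤ expJoin q a l g := by
  induction l generalizing f g with
  | nil => exact h _
  | cons e l ih =>
    have := h1 e
    exact add_le_add (mul_le_mul_of_nonneg_left (ih h) (h0 e))
      (mul_le_mul_of_nonneg_left (ih fun P => h _) (by linarith))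

theorem expJoin_add (l : List ι) (f g : L → ℝ) :
    expJoin q a l (fun P => f P + g P) = expJoin q a l f + expJoin q a l g := by
  induction l generalizing f g with
  | nil => rfl
  | cons e l ih => simp only [expJoin, ih]; ring

theorem expJoin_const_mul (l : List ι) (c : ℝ) (f : L → ℝ) :
    expJoin q a l (fun P => c * f P) = c * expJoin q a l f := by
  induction l generalizing f with
  | nil => rfl
  | cons e l ih => simp only [expJoin, ih]; ring

theorem expJoin_const (l : List ι) (c : ℝ) : expJoin q a l (fun _ => c) = c := by
  induction l with
  | nil => rfl
  | cons e l ih => simp only [expJoin, ih]; ring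

theorem expJoin_sub (l : List ι) (f g : L → ℝ) :
    expJoin q a l (fun P => f P - g P) = expJoin q a l f - expJoin q a l g := by
  have := expJoin_add (q := q) (a := a) l f (fun P => (-1) * g P)
  rw [expJoin_const_mul] at this
  simp only [sub_eq_add_neg]
  rw [← neg_one_mul (expJoin q a l g), ← this]
  simp

theorem expJoin_zero (l : List ι) : expJoin q a l (fun _ => 0) = 0 := expJoin_const l 0

theorem expJoin_list_sum {κ : Type*} (l : List ι) (m : List κ) (g : κ → L → ℝ) :
    expJoin q a l (fun P => (m.map (fun k => g k P)).sum) = (m.map (fun k => expJoin q a l (g k))).sum := by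
  induction m with
  | nil => simpa using expJoin_zero l
  | cons k m ih => simp [expJoin_add, ih]

/-- Closing more elements makes the join smaller, and `f` is antitone. This permits the exact
exponential law to replace an approximate one that is dominated by it. -/
theorem expJoin_le_of_le (h0 : ∀ e, 0 ≤ q e) (h1 : ∀ e, q e ≤ 1) (l : List ι)
    (hq : ∀ e ∈ l, q e ≤ q' e) (h1' : ∀ e, q' e ≤ 1) {f : L → ℝ}
    (hf : ∀ P Q, P ≤ Q → f Q ≤ f P) : expJoin q a l f ≤ expJoin q' a l f := by
  induction l generalizing f with
  | nil => exact le_rfl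
  | cons e l ih =>
    have hl : ∀ e ∈ l, q e ≤ q' e := fun x hx => hq x (List.mem_cons_of_mem _ hx)
    have he := hq e List.mem_cons_self
    have i1 := ih hl hf
    have hf' : ∀ P Q : L, P ≤ Q → f (Q ⊔ a e) ≤ f (P ⊔ a e) := fun P Q h => hf _ _ (sup_le_sup_right h _)
    have i2 := ih hl hf'
    have i3 : expJoin q a l (fun P => f (P ⊔ a e)) ≤ expJoin q a l f :=
      expJoin_mono h0 h1 l fun P => hf _ _ le_sup_left
    have a0 := h0 e
    simp only [expJoin]
    have b1 := h1' e
    nlinarith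

/-- The expectation when `e` has survived an exponential clock of rate `w e` until time `θ`. -/
theorem hasDerivAt_expJoin (w : ι → ℝ) (l : List ι) (f : L → ℝ) (θ : ℝ) :
    HasDerivAt (fun θ => expJoin (fun e => Real.exp (-(θ * w e))) a l f)
      ((l.map (fun e => w e * expJoin (fun e => Real.exp (-(θ * w e))) a l (fun P => f (P ⊔ a e) - f P))).sum) θ := by
  induction l generalizing f with
  | nil => simpa [expJoin] using hasDerivAt_const θ (f ⊥)
  | cons e l ih =>
    have hq : HasDerivAt (fun θ => Real.exp (-(θ * w e))) (Real.exp (-(θ * w e)) * (-(1 * w e))) θ :=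
      (((hasDerivAt_id θ).mul_const (w e)).neg).exp
    have h := (hq.mul (ih f)).add ((hq.const_sub 1).mul (ih (fun P => f (P ⊔ a e))))
    refine h.congr_deriv ?_
    set Q := fun e => Real.exp (-(θ * w e)) with hQ
    simp [expJoin]
    -- Joining `a e` a second time changes nothing, and joins commute. Therefore the term of the
    -- derivative that belongs to `e` may be taken under the full expectation, in which `e` may
    -- already be open.
    have e1 : ∀ P : L, P ⊔ a e ⊔ a e = P ⊔ a e := fun P => by rw [sup_assoc, sup_idem]
    have e2 : ∀ (P : L) (x : ι), P ⊔ a e ⊔ a x = P ⊔ a x ⊔ a e := fun P x => sup_right_comm _ _ _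
    simp [e2, expJoin_zero, mul_zero, expJoin_sub, mul_add]
    have c1 : ∀ (c : ℝ) (g : ι → ℝ), (l.map (fun x => w x * (c * g x))).sum =
        c * (l.map (fun x => w x * g x)).sum := by
      intro c g
      rw [← List.sum_map_mul_left]
      congr 1
      refine List.map_congr_left fun x _ => ?_
      ring
    rw [c1, c1]
    ring

/-- Grönwall: the hypothesis makes the derivative of the expectation at most `-c` times the
expectation, so the product with `exp (θ * c)` is antitone; at `θ = 0` everything is closed and the
join is `⊥`. -/
theorem expJoin_decay (w : ι → ℝ) (l : List ι) (f : L → ℝ) (c : ℝ)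
    (hf : ∀ P, c * f P ≤ (l.map (fun e => w e * (f P - f (P ⊔ a e)))).sum) {θ : ℝ} (hθ : 0 ≤ θ)
    (hw : ∀ e, 0 ≤ w e) :
    expJoin (fun e => Real.exp (-(θ * w e))) a l f ≤ f ⊥ * Real.exp (-(θ * c)) := by
  set E : ℝ → ℝ := fun θ => expJoin (fun e => Real.exp (-(θ * w e))) a l f with hE
  have hd : ∀ θ, HasDerivAt (fun θ => E θ * Real.exp (θ * c)) _ θ := fun θ =>
    (hasDerivAt_expJoin w l f θ).mul (((hasDerivAt_id θ).mul_const c).exp)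
  have hanti : AntitoneOn (fun θ => E θ * Real.exp (θ * c)) (Set.Ici 0) := by
    refine antitoneOn_of_deriv_nonpos (convex_Ici 0) (fun θ _ => (hd θ).continuousAt.continuousWithinAt)
      (fun θ _ => (hd θ).differentiableAt.differentiableWithinAt) fun θ hθ => ?_
    rw [interior_Ici, Set.mem_Ioi] at hθ
    rw [(hd θ).deriv]
    have h0 : ∀ e, 0 ≤ Real.exp (-(θ * w e)) := fun e => (Real.exp_pos _).le
    have h1 : ∀ e, Real.exp (-(θ * w e)) ≤ 1 := fun e =>
      Real.exp_le_one_iff.mpr (by have := mul_nonneg hθ.le (hw e); linarith)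
    have hm := expJoin_mono (a := a) h0 h1 l hf
    rw [expJoin_const_mul, expJoin_list_sum] at hm
    have e1 : (l.map (fun e => expJoin (fun e => Real.exp (-(θ * w e))) a l
        (fun P => w e * (f P - f (P ⊔ a e))))).sum =
        - (l.map (fun e => w e * expJoin (fun e => Real.exp (-(θ * w e))) a l
        (fun P => f (P ⊔ a e) - f P))).sum := by
      rw [← neg_one_mul, ← List.sum_map_mul_left]
      congr 1
      refine List.map_congr_left fun x _ => ?_
      rw [expJoin_const_mul, expJoin_sub, expJoin_sub]
      ring
    rw [e1] at hm
    have he := Real.exp_pos (θ * c)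
    simp [id]
    nlinarith
  have hend : E 0 = f ⊥ := by
    have : ∀ (l : List ι) (f : L → ℝ), expJoin (fun e => Real.exp (-(0 * w e))) a l f = f ⊥ := by
      intro l
      induction l with
      | nil => intro f; rfl
      | cons e l ih => intro f; simp only [expJoin, ih]; simp
    exact this l f
  have := hanti (Set.mem_Ici.mpr le_rfl) (Set.mem_Ici.mpr hθ) hθ
  simp [hend, zero_mul, Real.exp_zero] at this
  rw [Real.exp_neg, ← div_eq_mul_inv, le_div_iff₀ (Real.exp_pos _)]
  exact this

end RandomJoin

/-! ### Counting functions -/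

section Counting

set_option linter.unusedSectionVars false

variable {ι W : Type*} [Fintype ι] [DecidableEq ι] [Fintype W]

/-- Resampling one coordinate preserves the uniform distribution: exchanging `τ e` with the new
value is an involution on pairs. -/
theorem sum_update_eq (h : (ι → W) → ℝ) (e : ι) :
    ∑ τ, ∑ w, h (update τ e w) = Fintype.card W * ∑ τ, h τ := by
  rw [← Fintype.sum_prod_type']
  have : ∑ p : (ι → W) × W, h (update p.1 e p.2) = ∑ p : (ι → W) × W, h p.1 := by
    refine Fintype.sum_bijective (fun p => (update p.1 e p.2, p.1 e)) ?_ _ _ fun p => rfl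
    refine Function.Involutive.bijective fun p => ?_
    simp
  rw [this, Fintype.sum_prod_type]
  simp [mul_sum]

variable {L : Type*} [SemilatticeSup L] [OrderBot L]

open Classical in
/-- The join of the `a e` over the open elements of the list. -/
noncomputable def openJoin (o : ι → W → Prop) (a : ι → L) (τ : ι → W) : List ι → L
  | [] => ⊥
  | e :: l => if o e (τ e) then openJoin o a τ l ⊔ a e else openJoin o a τ l

theorem openJoin_update (o : ι → W → Prop) (a : ι → L) (τ : ι → W) (w : W) {e : ι} (l : List ι)
    (he : e ∉ l) : openJoin o a (update τ e w) l = openJoin o a τ l := by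
  induction l with
  | nil => rfl
  | cons x l ih =>
    have hx : x ≠ e := fun h => he (h ▸ List.mem_cons_self)
    have e1 : update τ e w x = τ x := update_of_ne hx _ _
    have ih := ih fun h => he (List.mem_cons_of_mem _ h)
    by_cases h : o x (τ x)
    · rw [openJoin, openJoin, if_pos h, if_pos (e1.symm ▸ h), ih]
    · rw [openJoin, openJoin, if_neg h, if_neg (e1.symm ▸ h), ih]

theorem openJoin_le (o : ι → W → Prop) (a : ι → L) (τ : ι → W) {l : List ι} {P : L}
    (h : ∀ e ∈ l, o e (τ e) → a e ≤ P) : openJoin o a τ l ≤ P := by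
  induction l with
  | nil => exact bot_le
  | cons x l ih =>
    have ih := ih fun e he => h e (List.mem_cons_of_mem _ he)
    rw [openJoin]
    split_ifs with hx
    · simp_all
    · exact ih

open Classical in
/-- The fraction of the values for which `e` is closed. -/
noncomputable def closedProb (o : ι → W → Prop) (e : ι) : ℝ :=
  ((univ.filter (fun w => ¬ o e w)).card : ℝ) / Fintype.card W

open Classical in
theorem sum_split [Nonempty W] (o : ι → W → Prop) (e : ι) (A B : ℝ) : ∑ w, (if o e w then B else A) =
      Fintype.card W * (closedProb o e * A + (1 - closedProb o e) * B) := by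
  have hW : (Fintype.card W : ℝ) ≠ 0 := Nat.cast_ne_zero.mpr Fintype.card_ne_zero
  have h1 : ((univ.filter (fun w => o e w)).card : ℝ) =
      Fintype.card W - (univ.filter (fun w => ¬ o e w)).card := by
    have := card_filter_add_card_filter_not (s := (univ : Finset W)) (fun w => o e w)
    rw [card_univ] at this
    rw [← this]; push_cast; ring
  rw [sum_ite, sum_const, sum_const, nsmul_eq_mul, nsmul_eq_mul, h1, closedProb]
  field_simp
  ring

/-- Independence in counting form: the coordinate of the head of the list is resampled, and the
remaining join does not depend on it. -/
theorem sum_openJoin [Nonempty W] (o : ι → W → Prop) (a : ι → L) {l : List ι} (hl : l.Nodup)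
    (f : L → ℝ) : ∑ τ : ι → W, f (openJoin o a τ l) = Fintype.card (ι → W) * expJoin (closedProb o) a l f := by
  classical
  have hW : (Fintype.card W : ℝ) ≠ 0 := Nat.cast_ne_zero.mpr Fintype.card_ne_zero
  induction l generalizing f with
  | nil => simp [openJoin, expJoin]
  | cons e l ih =>
    have he := (List.nodup_cons.mp hl).1
    have ih := ih (List.nodup_cons.mp hl).2
    apply mul_left_cancel₀ hW
    rw [← sum_update_eq _ e]
    have : ∀ τ : ι → W, ∑ w, f (openJoin o a (update τ e w) (e :: l)) =
        Fintype.card W * (closedProb o e * f (openJoin o a τ l) +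
          (1 - closedProb o e) * f (openJoin o a τ l ⊔ a e)) := by
      intro τ
      rw [← sum_split]
      refine sum_congr rfl fun w _ => ?_
      simp [openJoin, openJoin_update o a τ w l he]
      split_ifs <;> rfl
    simp only [this]
    rw [← mul_sum, sum_add_distrib, ← mul_sum, ← mul_sum, ih,
      ih (fun P => f (P ⊔ a e)), expJoin]
    ring

-- The elements of `m` are not in `l`, so their being closed is independent of the join over `l`. In
-- the application `m` is the boundary of `X` and `l` its inside.
open Classical in
theorem sum_closed_openJoin [Nonempty W] (o : ι → W → Prop) (a : ι → L) {l m : List ι}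
    (hl : l.Nodup) (hm : m.Nodup) (hml : ∀ e ∈ m, e ∉ l)
    (f : L → ℝ) : ∑ τ : ι → W, (if ∀ e ∈ m, ¬ o e (τ e) then f (openJoin o a τ l) else 0) =
      Fintype.card (ι → W) * ((m.map (closedProb o)).prod * expJoin (closedProb o) a l f) := by
  have hW : (Fintype.card W : ℝ) ≠ 0 := Nat.cast_ne_zero.mpr Fintype.card_ne_zero
  induction m with
  | nil => simpa using sum_openJoin o a hl f
  | cons e m ih =>
    have he := (List.nodup_cons.mp hm).1
    have ih := ih (List.nodup_cons.mp hm).2 fun x hx => hml x (List.mem_cons_of_mem _ hx)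
    apply mul_left_cancel₀ hW
    rw [← sum_update_eq _ e]
    have : ∀ τ : ι → W, ∑ w, (if ∀ x ∈ e :: m, ¬ o x (update τ e w x) then
        f (openJoin o a (update τ e w) l) else 0) =
        Fintype.card W * (closedProb o e * (if ∀ e ∈ m, ¬ o e (τ e) then f (openJoin o a τ l) else 0)
          + (1 - closedProb o e) * 0) := by
      intro τ
      rw [← sum_split]
      refine sum_congr rfl fun w _ => ?_
      rw [openJoin_update o a τ w l (hml e List.mem_cons_self)]
      have h1 : (∀ x ∈ m, ¬ o x (update τ e w x)) ↔ ∀ x ∈ m, ¬ o x (τ x) := by grind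
      simp [h1]
      by_cases ho : o e w <;> simp [ho]
    simp only [this]
    rw [← mul_sum, sum_add_distrib, ← mul_sum, ih, List.map_cons, List.prod_cons]
    simp
    ring

end Counting

/-! ### The probability that an extreme set is separated -/

namespace WeightedGraph

variable {n : ℕ} (G : WeightedGraph n)

/-- With respect to the priorities `p e / w e`, for some threshold the edges below the threshold
connect `X`, and no edge that leaves `X` is below the threshold. -/
def Separates (p : Sym2 (Fin n) → ℕ) (X : Finset (Fin n)) : Prop :=
  ∃ t : ℝ, (∀ S ⊂ X, S.Nonempty → ∃ u ∈ S, ∃ v ∈ X, v ∉ S ∧ 0 < G.wt u v ∧ (p s(u, v) : ℝ) ≤ t * G.wt u v) ∧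
    ∀ u ∈ X, ∀ v, v ∉ X → 0 < G.wt u v → t * G.wt u v < p s(u, v)

open Classical in
/-- The edges of positive weight inside `X`. -/
noncomputable def inner (X : Finset (Fin n)) : Finset (Sym2 (Fin n)) :=
  G.edges.filter (fun e => 0 < G.weight e ∧ ∀ u ∈ e, u ∈ X)

open Classical in
/-- The edges of positive weight that leave `X`. -/
noncomputable def outer (X : Finset (Fin n)) : Finset (Sym2 (Fin n)) := (G.cutSet X).filter (fun e => 0 < G.weight e)

theorem wt_pos_iff {u v : Fin n} : 0 < G.wt u v ↔ G.graph.Adj u v ∧ 0 < G.weight s(u, v) := by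
  unfold wt; split_ifs with h <;> simp [h]

theorem wt_of_adj {u v : Fin n} (h : G.graph.Adj u v) : G.wt u v = G.weight s(u, v) := if_pos h

/-- The number of blocks of a partition, minus one. -/
noncomputable def excess {X : Finset (Fin n)} (P : Setoid X) : ℝ := (Nat.card (Quotient P) : ℝ) - 1

theorem excess_anti {X : Finset (Fin n)} {P Q : Setoid X} (h : P ≤ Q) : excess Q ≤ excess P := by
  classical
  have := Nat.card_le_card_of_surjective (Quotient.map' (s₁ := P) (s₂ := Q) id fun _ _ h' => h h')
    (fun q => Quotient.inductionOn' q fun x => ⟨Quotient.mk'' x, rfl⟩)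
  unfold excess
  have : (Nat.card (Quotient Q) : ℝ) ≤ Nat.card (Quotient P) := Nat.cast_le.mpr this
  linarith

/-- The map between the quotients is surjective but identifies the classes of `u` and `v`, so at
least one block is lost. -/
theorem excess_lt {X : Finset (Fin n)} {P Q : Setoid X} (h : P ≤ Q) {u v : X} (hu : ¬ P u v)
    (hv : Q u v) : excess Q + 1 ≤ excess P := by
  classical
  have := Fintype.ofFinite (Quotient P)
  have := Fintype.ofFinite (Quotient Q)
  have hlt := Fintype.card_lt_of_surjective_not_injective (Quotient.map' (s₁ := P) (s₂ := Q) id fun _ _ h' => h h')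
    (fun q => Quotient.inductionOn' q fun x => ⟨Quotient.mk'' x, rfl⟩)
    (fun hi => hu (Quotient.eq''.mp (hi (a₁ := Quotient.mk'' u) (a₂ := Quotient.mk'' v) (Quotient.sound' hv))))
  unfold excess
  rw [Nat.card_eq_fintype_card, Nat.card_eq_fintype_card]
  have : (Fintype.card (Quotient Q) : ℝ) + 1 ≤ Fintype.card (Quotient P) := by exact_mod_cast hlt
  linarith

/-- The partition of `X` in which only the endpoints of `e` are joined. -/
def joinEdge (X : Finset (Fin n)) (e : Sym2 (Fin n)) : Setoid X :=
  Relation.EqvGen.setoid (fun u v : X => s((u : Fin n), (v : Fin n)) = e)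

theorem joinEdge_rel {X : Finset (Fin n)} {u v : X} {e : Sym2 (Fin n)}
    (h : s((u : Fin n), (v : Fin n)) = e) : joinEdge X e u v := Relation.EqvGen.rel _ _ h

theorem joinEdge_le {X : Finset (Fin n)} {e : Sym2 (Fin n)} {P : Setoid X}
    (h : ∀ u v : X, s((u : Fin n), (v : Fin n)) = e → P u v) : joinEdge X e ≤ P := by
  intro u v huv
  induction huv with
  | rel _ _ h' => exact h _ _ h'
  | refl => exact P.refl' _
  | symm _ _ _ ih => exact P.symm' ih
  | trans _ _ _ _ _ ih ih' => exact P.trans' ih ih'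

/-- The differential inequality for `expJoin_decay`: an edge between two blocks lowers the excess by
at least one when it opens, and the weight of such edges is bounded below by
`IsExtreme.le_sum_blocks`. The division by two is due to ordered pairs. -/
theorem IsExtreme.excess_le {X : Finset (Fin n)} (hX : G.IsExtreme X) (P : Setoid X) :
    ((G.cutValue X + 1 : ℕ) : ℝ) / 2 * excess P ≤ ((G.inner X).toList.map
      (fun e => (G.weight e : ℝ) * (excess P - excess (P ⊔ joinEdge X e)))).sum := by
  classical
  rw [sum_map_toList]
  have := Fintype.ofFinite (Quotient P)
  have h := hX.le_sum_blocks G P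
  let J : Sym2 (Fin n) → Prop := fun e => ∀ u v : X, s((u : Fin n), (v : Fin n)) = e → P u v
  -- Ordered pairs are grouped by their edge; at most two pairs belong to one edge.
  have h1 : ∑ u : X, ∑ v : X, (if P u v then 0 else G.wt u v) ≤
      ∑ e ∈ (G.inner X).filter (fun e => ¬ J e), 2 * G.weight e := by
    rw [← Fintype.sum_prod_type']
    rw [← sum_filter_ne_zero]
    have hm : ∀ p ∈ univ.filter (fun p : X × X => (if P p.1 p.2 then 0 else G.wt p.1 p.2) ≠ 0),
        s((p.1 : Fin n), (p.2 : Fin n)) ∈ (G.inner X).filter (fun e => ¬ J e) := by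
      rintro ⟨u, v⟩ h
      simp [ite_eq_left_iff, Classical.not_imp] at h
      have hw := G.wt_pos_iff.mp (Nat.pos_of_ne_zero h.2)
      simp only [mem_filter, inner, mem_edges]
      refine ⟨⟨hw.1, hw.2, ?_⟩, fun hJ => h.1 (hJ u v rfl)⟩
      intro y hy
      rcases Sym2.mem_iff.mp hy with rfl | rfl
      · exact u.2
      · exact v.2
    rw [← sum_fiberwise_of_maps_to hm]
    refine sum_le_sum fun e _ => ?_
    refine (sum_le_card_nsmul _ _ (G.weight e) ?_).trans ?_
    · rintro ⟨u, v⟩ h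
      simp at h
      obtain ⟨_, rfl⟩ := h
      dsimp only
      split_ifs
      · exact Nat.zero_le _
      · unfold wt; split_ifs
        · exact le_rfl
        · exact Nat.zero_le _
    · rw [smul_eq_mul]
      refine Nat.mul_le_mul_right _ ?_
      by_cases hne : ∃ u v : X, s((u : Fin n), (v : Fin n)) = e
      · obtain ⟨a, b, rfl⟩ := hne
        refine (card_le_card (t := {(a, b), (b, a)}) ?_).trans card_le_two
        rintro ⟨u, v⟩ h
        simp only [mem_filter, Sym2.eq_iff] at h
        simp only [mem_insert, mem_singleton, Prod.mk.injEq, ← Subtype.coe_inj]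
        exact h.2
      · rw [card_eq_zero.mpr]
        · omega
        · refine filter_eq_empty_iff.mpr ?_
          rintro ⟨u, v⟩ _ h
          exact hne ⟨u, v, h⟩
  have h2 : (Fintype.card (Quotient P) - 1) * (G.cutValue X + 1) ≤
      ∑ e ∈ (G.inner X).filter (fun e => ¬ J e), 2 * G.weight e := h.trans h1
  have h3 : excess P * ((G.cutValue X + 1 : ℕ) : ℝ) ≤
      ∑ e ∈ (G.inner X).filter (fun e => ¬ J e), 2 * (G.weight e : ℝ) := by
    have h2' : (((Fintype.card (Quotient P) - 1) * (G.cutValue X + 1) : ℕ) : ℝ) ≤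
      ((∑ e ∈ (G.inner X).filter (fun e => ¬ J e), 2 * G.weight e : ℕ) : ℝ) := by exact_mod_cast h2
    push_cast at h2' ⊢
    refine le_trans (mul_le_mul_of_nonneg_right ?_ (by positivity)) h2'
    unfold excess
    rw [Nat.card_eq_fintype_card]
    have : (Fintype.card (Quotient P) : ℝ) ≤ ((Fintype.card (Quotient P) - 1 : ℕ) : ℝ) + 1 := by
      exact_mod_cast (by omega)
    linarith
  rw [← mul_sum] at h3
  have h4 : ∑ e ∈ (G.inner X).filter (fun e => ¬ J e), (G.weight e : ℝ) ≤
      ∑ e ∈ G.inner X, (G.weight e : ℝ) * (excess P - excess (P ⊔ joinEdge X e)) := by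
    rw [sum_filter]
    refine sum_le_sum fun e _ => ?_
    have hw : (0 : ℝ) ≤ G.weight e := Nat.cast_nonneg _
    split_ifs with hJ
    · have := excess_anti (le_sup_left : P ≤ P ⊔ joinEdge X e)
      exact mul_nonneg hw (by linarith)
    · simp only [J, not_forall] at hJ
      obtain ⟨u, v, he, hP⟩ := hJ
      have := excess_lt (Q := P ⊔ joinEdge X e) le_sup_left hP
        ((le_sup_right : joinEdge X e ≤ P ⊔ joinEdge X e) (joinEdge_rel he))
      nlinarith
  linarith

/-- An excess below one means a single block, so the open edges connect `X`. The boundary is closed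
by the first hypothesis, and the same `t` witnesses both halves. -/
theorem separates_of_openJoin {W : Type*} [Fintype W] {X : Finset (Fin n)} (g : W → ℕ) (t : ℝ) (τ : Sym2 (Fin n) → W)
    (h1 : ∀ e ∈ (G.outer X).toList, ¬ ((g (τ e) : ℝ) ≤ t * G.weight e))
    (h2 : excess (openJoin (fun e w => (g w : ℝ) ≤ t * G.weight e) (joinEdge X) τ (G.inner X).toList) < 1) :
    G.Separates (fun e => g (τ e)) X := by
  classical
  refine ⟨t, fun S hS hne => ?_, fun u hu v hv hw => ?_⟩
  · by_contra hno
    push Not at hno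
    set P := openJoin (fun e w => (g w : ℝ) ≤ t * G.weight e) (joinEdge X) τ (G.inner X).toList
    -- If no open edge left `S`, then all open edges would respect the partition of `X` into `S` and
    -- its complement, and so would the join.
    have hPle : P ≤ Setoid.ker (fun u : X => (u : Fin n) ∈ S) := by
      refine openJoin_le _ _ _ fun e he ho => joinEdge_le fun u v huv => ?_
      rw [Setoid.ker_def]
      subst huv
      rw [mem_toList, inner, mem_filter, mem_edges] at he
      have key : ∀ u v : X, G.graph.Adj u v → 0 < G.weight s((u : Fin n), (v : Fin n)) →
          (g (τ s((u : Fin n), (v : Fin n))) : ℝ) ≤ t * G.weight s((u : Fin n), (v : Fin n)) →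
          (u : Fin n) ∈ S → (v : Fin n) ∈ S := by
        intro u v ha hw ho hu
        by_contra hv
        have := hno u hu v v.2 hv (G.wt_pos_iff.mpr ⟨ha, hw⟩)
        rw [G.wt_of_adj ha] at this
        linarith
      refine propext ⟨key u v he.1 he.2.1 ho, ?_⟩
      rw [Sym2.eq_swap] at ho he
      exact key v u he.1.symm he.2.1 ho
    obtain ⟨u, hu⟩ := hne
    obtain ⟨v, hvX, hvS⟩ := exists_of_ssubset hS
    have hsub : Nat.card (Quotient P) ≤ 1 := by
      unfold excess at h2
      have : (Nat.card (Quotient P) : ℝ) < 2 := by linarith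
      have : Nat.card (Quotient P) < 2 := by exact_mod_cast this
      omega
    have := (Finite.card_le_one_iff_subsingleton.mp hsub).elim (Quotient.mk'' ⟨u, hS.1 hu⟩) (Quotient.mk'' ⟨v, hvX⟩)
    have := hPle (Quotient.eq''.mp this)
    rw [Setoid.ker_def] at this
    exact hvS (this ▸ hu)
  · have hw' := G.wt_pos_iff.mp hw
    rw [G.wt_of_adj hw'.1]
    refine not_le.mp (h1 s(u, v) ?_)
    rw [mem_toList, outer, mem_filter, cutSet, mem_filter, mem_edges]
    exact ⟨⟨hw'.1, u, hu, v, hv, rfl⟩, hw'.2⟩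

-- Markov's inequality: the indicator of a connected inside is at least `1 - excess`, and on the
-- event that the boundary is closed this factor is independent. `S` is the scale of the integer
-- priorities, so the threshold at time `θ` is `θ * S`.
open Classical in
theorem IsExtreme.card_separates {W : Type*} [Fintype W] [Nonempty W] {X : Finset (Fin n)}
    (hX : G.IsExtreme X) (hne : X.Nonempty) (g : W → ℕ) {S θ : ℝ} (hθ : 0 ≤ θ)
    (hU : ∀ u : ℝ, 0 ≤ u → ((univ.filter (fun w => u * S < g w)).card : ℝ) ≤ Fintype.card W * Real.exp (-u)) :
    (Fintype.card (Sym2 (Fin n) → W) : ℝ) * (∏ e ∈ G.outer X,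
        ((univ.filter (fun w => θ * G.weight e * S < g w)).card : ℝ) / Fintype.card W) *
        (1 - (X.card - 1) * Real.exp (-(θ * (((G.cutValue X + 1 : ℕ) : ℝ) / 2)))) ≤
      (univ.filter (fun τ : Sym2 (Fin n) → W => G.Separates (fun e => g (τ e)) X)).card := by
  set o : Sym2 (Fin n) → W → Prop := fun e w => (g w : ℝ) ≤ θ * S * G.weight e with ho
  have hWpos : (0 : ℝ) < Fintype.card W := Nat.cast_pos.mpr Fintype.card_pos
  have hq : ∀ e, closedProb o e =
      ((univ.filter (fun w => θ * G.weight e * S < g w)).card : ℝ) / Fintype.card W := by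
    intro e
    simp only [closedProb, ho, not_le, mul_right_comm]
  have hq0 : ∀ e, 0 ≤ closedProb o e := fun e => by rw [hq]; positivity
  have hqexp : ∀ e, closedProb o e ≤ Real.exp (-(θ * G.weight e)) := fun e => by
    rw [hq, div_le_iff₀ hWpos, mul_comm (Real.exp _)]
    exact hU _ (by positivity)
  have hexp1 : ∀ e, Real.exp (-(θ * (G.weight e : ℝ))) ≤ 1 := fun e =>
    Real.exp_le_one_iff.mpr (by have : 0 ≤ θ * (G.weight e : ℝ) := by positivity
                                linarith)
  have hq1 : ∀ e, closedProb o e ≤ 1 := fun e => (hqexp e).trans (hexp1 e)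
  have hbot : excess (⊥ : Setoid X) = X.card - 1 := by
    unfold excess
    congr 1
    rw [← Fintype.card_coe X, ← Nat.card_eq_fintype_card]
    norm_cast
    refine (Nat.card_congr (Equiv.ofBijective (Quotient.mk'' (s₁ := (⊥ : Setoid X))) ⟨?_, ?_⟩)).symm
    · intro a b h
      exact Quotient.eq''.mp h
    · exact Quotient.mk''_surjective
  have hE : expJoin (closedProb o) (joinEdge X) (G.inner X).toList excess ≤
      (X.card - 1) * Real.exp (-(θ * (((G.cutValue X + 1 : ℕ) : ℝ) / 2))) := by
    refine (expJoin_le_of_le hq0 hq1 _ (fun e _ => hqexp e) hexp1 fun P Q h => excess_anti h).trans ?_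
    rw [← hbot]
    exact expJoin_decay (fun e => (G.weight e : ℝ)) _ excess _
      (fun P => hX.excess_le G P) hθ fun e => Nat.cast_nonneg _
  have hsum := sum_closed_openJoin (W := W) o (joinEdge X) (G.inner X).nodup_toList (G.outer X).nodup_toList (by
      intro e he he'
      rw [mem_toList] at he he'
      simp [inner, outer, cutSet] at he he'
      obtain ⟨⟨_, u, hu, v, hv, rfl⟩, _⟩ := he
      exact hv (he'.2.2 v (Sym2.mem_mk_right u v))) (fun P => 1 - excess P)
  rw [prod_map_toList, expJoin_sub, expJoin_const] at hsum
  calc _ ≤ (Fintype.card (Sym2 (Fin n) → W) : ℝ) * ((∏ e ∈ G.outer X, closedProb o e) *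
        (1 - expJoin (closedProb o) (joinEdge X) (G.inner X).toList excess)) := by
        simp only [← hq]
        rw [mul_assoc]
        refine mul_le_mul_of_nonneg_left (mul_le_mul_of_nonneg_left (by linarith)
          (prod_nonneg fun e _ => hq0 e)) (Nat.cast_nonneg _)
    _ = _ := hsum.symm
    -- Pointwise: if `X` is separated, the excess is still nonnegative; if it is not while the
    -- boundary is closed, the excess is at least one.
    _ ≤ ∑ τ : Sym2 (Fin n) → W, if G.Separates (fun e => g (τ e)) X then 1 else 0 := by
        refine sum_le_sum fun τ _ => ?_
        split_ifs with h1 h2 h2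
        · obtain ⟨x, hx⟩ := hne
          have h3 : 1 ≤ Nat.card (Quotient (openJoin o (joinEdge X) τ (G.inner X).toList)) :=
            Nat.card_pos_iff.mpr ⟨⟨Quotient.mk'' ⟨x, hx⟩⟩, inferInstance⟩
          have h4 : (1 : ℝ) ≤ Nat.card (Quotient (openJoin o (joinEdge X) τ (G.inner X).toList)) := by
            exact_mod_cast h3
          unfold excess
          linarith
        · have : 1 ≤ excess (openJoin o (joinEdge X) τ (G.inner X).toList) := by
            by_contra hlt
            exact h2 (G.separates_of_openJoin g (θ * S) τ h1 (not_le.mp hlt))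
          linarith
        · exact zero_le_one
        · exact le_rfl
    _ = _ := by simp

theorem card_outer_le (hn : 0 < n) (X : Finset (Fin n)) : (G.outer X).card ≤ n * n := by
  classical
  refine le_trans (card_le_card ?_) (G.vol_lt_sq hn X).le
  intro e he
  simp [outer, cutSet] at he ⊢
  grind

theorem sum_outer_le (X : Finset (Fin n)) : ∑ e ∈ G.outer X, (G.weight e : ℝ) ≤ G.cutValue X := by
  classical
  rw [cutValue, Nat.cast_sum]
  exact sum_le_sum_of_subset_of_nonneg (filter_subset _ _) fun _ _ _ => Nat.cast_nonneg _

/-- Each `exp (-(a * w e))` is at least `1 / E`, so the additive error `δ` is a relative error of at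
most `δ * E`. Bernoulli's inequality then bounds the loss over all factors by one half. -/
theorem prod_ge_of_exp_sub_le {ι : Type*} (O : Finset ι) (w f : ι → ℝ) {a δ E : ℝ} (ha : 0 ≤ a)
    (hw : ∀ e, 0 ≤ w e) (hδ : 0 ≤ δ) (hE : Real.exp (a * ∑ e ∈ O, w e) ≤ E)
    (hf : ∀ e ∈ O, Real.exp (-(a * w e)) - δ ≤ f e) (hm : O.card * (δ * E) ≤ 1 / 2) :
    1 / (2 * E) ≤ ∏ e ∈ O, f e := by
  have hE0 : 0 < E := (Real.exp_pos _).trans_le hE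
  rcases Nat.eq_zero_or_pos O.card with hm0 | hm0
  · rw [card_eq_zero.mp hm0] at hE ⊢
    rw [sum_empty, mul_zero, Real.exp_zero] at hE
    rw [prod_empty, div_le_one (by positivity)]
    linarith
  have hm1 : (1 : ℝ) ≤ O.card := by exact_mod_cast hm0
  have hη1 : 0 ≤ 1 - δ * E := by nlinarith
  have hfac : ∀ e ∈ O, Real.exp (-(a * w e)) * (1 - δ * E) ≤ f e := by
    intro e he
    refine le_trans ?_ (hf e he)
    have h1 : Real.exp (a * w e) ≤ E := (Real.exp_le_exp.mpr (mul_le_mul_of_nonneg_left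
      (single_le_sum (fun x _ => hw x) he) ha)).trans hE
    have h2 : Real.exp (-(a * w e)) * Real.exp (a * w e) = 1 := by rw [← Real.exp_add]; simp
    have h3 : 1 ≤ Real.exp (-(a * w e)) * E := h2.symm.le.trans (mul_le_mul_of_nonneg_left h1 (Real.exp_pos _).le)
    nlinarith
  refine le_trans ?_ (prod_le_prod (fun e _ => mul_nonneg (Real.exp_pos _).le hη1) hfac)
  rw [prod_mul_distrib, prod_const, ← Real.exp_sum]
  have e1 : 1 / E ≤ Real.exp (∑ e ∈ O, -(a * w e)) := by
    rw [sum_neg_distrib, ← mul_sum, Real.exp_neg, ← one_div]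
    exact one_div_le_one_div_of_le (Real.exp_pos _) hE
  have e2 : 1 / 2 ≤ (1 - δ * E) ^ O.card := by
    have := one_add_mul_le_pow (a := -(δ * E)) (by linarith) O.card
    grind
  calc 1 / (2 * E) = 1 / E * (1 / 2) := by field_simp
    _ ≤ _ := mul_le_mul e1 e2 (by norm_num) (Real.exp_pos _).le

open Classical in
/-- If the priorities are approximately exponentially distributed, an extreme set is separated with
probability at least inversely proportional to the square of its size. -/
theorem IsExtreme.prob_separates {W : Type*} [Fintype W] [Nonempty W] {X : Finset (Fin n)}
    (hX : G.IsExtreme X) (hne : X.Nonempty) (g : W → ℕ) {S ε δ : ℝ} {l : ℕ} (hl : 1 ≤ l)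
    (hnl : n ≤ 2 ^ l) (hε0 : 0 ≤ ε) (hε : ε ≤ 3 / l) (hδ0 : 0 ≤ δ) (hδ : δ ≤ (1 / 2) ^ (32 * l))
    (hU : ∀ u : ℝ, 0 ≤ u → ((univ.filter (fun w => u * S < g w)).card : ℝ) ≤ Fintype.card W * Real.exp (-u))
    (hL : ∀ u : ℝ, 0 ≤ u → Fintype.card W * (Real.exp (-((1 + ε) * u)) - δ) ≤
      ((univ.filter (fun w => u * S < g w)).card : ℝ)) :
    (Fintype.card (Sym2 (Fin n) → W) : ℝ) * (1 / (2 ^ 16 * (X.card : ℝ) ^ 2)) ≤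
      (univ.filter (fun τ : Sym2 (Fin n) → W => G.Separates (fun e => g (τ e)) X)).card := by
  have hn : 0 < n := hne.elim fun x _ => x.pos
  set s : ℝ := (X.card : ℝ) with hs
  have hs1 : 1 ≤ s := Nat.one_le_cast.mpr (card_pos.mpr hne)
  have hsn : s ≤ n := Nat.cast_le.mpr ((X.card_le_univ).trans_eq (Fintype.card_fin n))
  set lam : ℝ := (G.cutValue X : ℝ) with hlam
  have hlam0 : 0 ≤ lam := Nat.cast_nonneg _
  set Lg : ℝ := Real.log (2 * s) with hLg
  have hLg0 : 0 ≤ Lg := Real.log_nonneg (by linarith)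
  -- The time at which the decay exponent `θ * (lam + 1) / 2` is exactly `log (2 * s)`, which brings
  -- the expected excess down to `(s - 1) / (2 * s)`.
  set θ : ℝ := 2 * Lg / (lam + 1) with hθd
  have hθ : 0 ≤ θ := by positivity
  have hWpos : (0 : ℝ) < Fintype.card W := Nat.cast_pos.mpr Fintype.card_pos
  have hmain := hX.card_separates G hne g hθ hU
  refine le_trans ?_ hmain
  rw [mul_assoc]
  refine mul_le_mul_of_nonneg_left ?_ (Nat.cast_nonneg _)
  have hl' : (1 : ℝ) ≤ l := by exact_mod_cast hl
  have h1 : (1 : ℝ) / 2 ≤ 1 - (s - 1) * Real.exp (-(θ * (((G.cutValue X + 1 : ℕ) : ℝ) / 2))) := by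
    have e1 : θ * (((G.cutValue X + 1 : ℕ) : ℝ) / 2) = Lg := by rw [hθd]; push_cast; rw [← hlam]; field_simp
    rw [e1, Real.exp_neg, Real.exp_log (by linarith)]
    rw [← div_eq_mul_inv]
    have : (s - 1) / (2 * s) ≤ 1 / 2 := by rw [div_le_div_iff₀ (by linarith) (by norm_num)]; linarith
    linarith
  set E : ℝ := Real.exp ((1 + ε) * (2 * Lg)) with hE
  have hEpos : 0 < E := Real.exp_pos _
  have hlogn : Lg ≤ (l + 1) * Real.log 2 := by
    have e2 : ((l : ℝ) + 1) * Real.log 2 = Real.log (2 ^ (l + 1)) := by rw [Real.log_pow]; push_cast; ring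
    rw [e2]
    refine Real.log_le_log (by linarith) ?_
    have : (n : ℝ) ≤ 2 ^ l := by exact_mod_cast hnl
    rw [pow_succ]; linarith
  have hE2 : E ≤ 2 ^ 14 * s ^ 2 := by
    have e1 : E = Real.exp Lg ^ 2 * Real.exp (2 * (ε * Lg)) := by
      rw [hE, ← Real.exp_nat_mul, ← Real.exp_add]; congr 1; push_cast; ring
    -- The relative error `ε ≤ 3 / l` is multiplied by a logarithm of at most `(l + 1) * log 2`;
    -- thus it costs only the factor `2 ^ 12`.
    have e2 : ε * Lg ≤ 6 * Real.log 2 := by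
      have hlog2 : 0 ≤ Real.log 2 := Real.log_nonneg (by norm_num)
      have : ε * l ≤ 3 := by rwa [le_div_iff₀ (by linarith)] at hε
      have : ε ≤ 3 := by nlinarith
      calc ε * Lg ≤ ε * ((l + 1) * Real.log 2) := mul_le_mul_of_nonneg_left hlogn hε0
        _ = (ε * l + ε) * Real.log 2 := by ring
        _ ≤ _ := mul_le_mul_of_nonneg_right (by linarith) hlog2
    have e3 : Real.exp (2 * (ε * Lg)) ≤ 2 ^ 12 := by
      calc _ ≤ Real.exp ((12 : ℕ) * Real.log 2) := Real.exp_le_exp.mpr (by push_cast; linarith)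
        _ = _ := by rw [Real.exp_nat_mul, Real.exp_log (by norm_num)]
    rw [e1, Real.exp_log (by linarith)]
    nlinarith [sq_nonneg s]
  set m : ℕ := (G.outer X).card
  have hmn : (m : ℝ) ≤ (n : ℝ) ^ 2 := by rw [sq]; exact_mod_cast G.card_outer_le hn X
  have hn2 : (n : ℝ) ≤ 2 ^ l := by exact_mod_cast hnl
  -- There are at most `n ^ 2` boundary edges and `E` is at most `2 ^ 14 * n ^ 2`; an error of `2 ^
  -- (-32 * l)` is negligible against both.
  have hmη : m * (δ * E) ≤ 1 / 2 := by
    calc m * (δ * E) ≤ ((2 : ℝ) ^ l) ^ 2 * ((1 / 2) ^ (32 * l) * (2 ^ 14 * (2 ^ l) ^ 2)) := by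
          have hn0 : (0 : ℝ) ≤ n := Nat.cast_nonneg _
          refine mul_le_mul (hmn.trans (pow_le_pow_left₀ hn0 hn2 2)) (mul_le_mul hδ
            (hE2.trans ?_) hEpos.le (by positivity)) (by positivity) (by positivity)
          exact mul_le_mul_of_nonneg_left (pow_le_pow_left₀ (by linarith) (hsn.trans hn2) 2) (by positivity)
      _ = (2 : ℝ) ^ (4 * l + 14) / 2 ^ (32 * l) := by rw [one_div, inv_pow, div_eq_mul_inv]; ring
      _ ≤ 1 / 2 := by
          rw [div_le_div_iff₀ (by positivity) (by norm_num), one_mul, ← pow_succ]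
          exact pow_le_pow_right₀ (by norm_num) (by omega)
  have h2 : 1 / (2 * E) ≤ ∏ e ∈ G.outer X,
      ((univ.filter (fun w => θ * G.weight e * S < g w)).card : ℝ) / Fintype.card W := by
    refine prod_ge_of_exp_sub_le (a := (1 + ε) * θ) _ (fun e => (G.weight e : ℝ)) _
      (by positivity) (fun e => Nat.cast_nonneg _) hδ0 ?_ (fun e _ => ?_) hmη
    · refine Real.exp_le_exp.mpr ?_
      have : θ * ∑ e ∈ G.outer X, (G.weight e : ℝ) ≤ 2 * Lg := by
        calc _ ≤ θ * (lam + 1) :=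
              mul_le_mul_of_nonneg_left (by linarith [G.sum_outer_le X]) hθ
          _ = 2 * Lg := by rw [hθd]; field_simp
      rw [mul_assoc]
      exact mul_le_mul_of_nonneg_left this (by linarith)
    · rw [le_div_iff₀ hWpos, mul_comm, mul_assoc (1 + ε)]
      exact hL (θ * G.weight e) (by positivity)
  calc 1 / (2 ^ 16 * s ^ 2) ≤ 1 / (2 * E) * (1 / 2) := by
        rw [one_div_mul_one_div]
        exact one_div_le_one_div_of_le (by positivity) (by linarith)
    _ ≤ _ := mul_le_mul h2 h1 (by norm_num) (prod_nonneg fun _ _ => by positivity)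

end WeightedGraph

/-! ### Integer approximations of exponential random variables -/

/-- A lower Riemann sum for `S * log (A / (A - x))`. -/
def riem (S A l x : ℕ) : ℕ := ∑ i ∈ range l, S * x / (l * A - i * x)

/-- Double `y` at most `k` times while the result is at most `A`; also count the doublings. -/
def scaleUp (A y : ℕ) : ℕ → ℕ × ℕ
  | 0 => (y, 0)
  | k + 1 => if 2 * (scaleUp A y k).1 ≤ A then (2 * (scaleUp A y k).1, (scaleUp A y k).2 + 1) else scaleUp A y k

/-- An approximation of `S * log (A / y)`. -/
def prio (S A l a y : ℕ) : ℕ := (scaleUp A y a).2 * riem S A l (A / 2) + riem S A l (A - (scaleUp A y a).1)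

theorem riem_le (S A l x : ℕ) : riem S A l x ≤ l * (S * x) := by
  refine (sum_le_card_nsmul _ _ (S * x) fun i _ => Nat.div_le_self _ _).trans ?_
  simp

theorem scaleUp_snd_le (A y k : ℕ) : (scaleUp A y k).2 ≤ k := by
  induction k with
  | zero => simp [scaleUp]
  | succ k ih =>
    rw [scaleUp]; split_ifs
    · exact Nat.succ_le_succ ih
    · omega

theorem scaleUp_fst (A y k : ℕ) : (scaleUp A y k).1 = 2 ^ (scaleUp A y k).2 * y := by
  induction k with
  | zero => simp [scaleUp]
  | succ k ih =>
    rw [scaleUp]; split_ifs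
    · simp only [ih, pow_succ]; ring
    · exact ih

theorem scaleUp_fst_le {A y : ℕ} (hy : y ≤ A) (k : ℕ) : (scaleUp A y k).1 ≤ A := by
  induction k with
  | zero => simpa [scaleUp]
  | succ k ih => rw [scaleUp]; split_ifs with h <;> assumption

theorem prio_le {S A l a y : ℕ} : prio S A l a y ≤ (a + 1) * (l * (S * A)) := by
  have h1 := riem_le S A l (A / 2)
  have h2 := riem_le S A l (A - (scaleUp A y a).1)
  have h3 : l * (S * (A / 2)) ≤ l * (S * A) := by gcongr; exact Nat.div_le_self _ _
  have h4 : l * (S * (A - (scaleUp A y a).1)) ≤ l * (S * A) := by gcongr; exact Nat.sub_le _ _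
  have h5 : (scaleUp A y a).2 * riem S A l (A / 2) ≤ a * (l * (S * A)) :=
    Nat.mul_le_mul (scaleUp_snd_le _ _ _) (h1.trans h3)
  rw [prio, Nat.add_mul]
  omega

/-- If there were still room for a doubling at the end, all `a` doublings would have taken place,
and the result would be `2 ^ a * y ≥ 2 ^ a`. -/
theorem lt_two_mul_scaleUp {a y : ℕ} (hy : 1 ≤ y) : 2 ^ a < 2 * (scaleUp (2 ^ a) y a).1 := by
  by_contra h
  have : ∀ k ≤ a, 2 * (scaleUp (2 ^ a) y k).1 ≤ 2 ^ a ∧ (scaleUp (2 ^ a) y k).2 = k := by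
    intro k hk
    induction k with
    | zero =>
      by_contra h0
      have key : ∀ k, scaleUp (2 ^ a) y k = (y, 0) := by
        intro k
        induction k with
        | zero => rfl
        | succ k ih =>
          rw [scaleUp, ih, if_neg]
          simpa [scaleUp] using h0
      simp_all
    | succ k ih =>
      obtain ⟨h1, h2⟩ := ih (by omega)
      have h3 : (scaleUp (2 ^ a) y (k + 1)).2 = k + 1 := by rw [scaleUp, if_pos h1]; simp [h2]
      refine ⟨?_, h3⟩
      by_contra h4
      have key : ∀ j, scaleUp (2 ^ a) y (k + 1 + j) = scaleUp (2 ^ a) y (k + 1) := by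
        intro j
        induction j with
        | zero => rfl
        | succ j ih => rw [← Nat.add_assoc, scaleUp, ih, if_neg h4]
      have := key (a - (k + 1))
      grind
  obtain ⟨h1, h2⟩ := this a le_rfl
  rw [scaleUp_fst, h2] at h1
  have : 0 < 2 ^ a := by positivity
  nlinarith

section Bounds

variable {S A l x : ℕ}

/-- Riemann sum bounds on both sides. -/
theorem riem_bounds (hl : 1 ≤ l) (hA : 1 ≤ A) (hS : S = A * l ^ 2) (hx : 2 * x ≤ A) :
    (riem S A l x : ℝ) ≤ S * Real.log (A / (A - x)) ∧
      S * Real.log (A / (A - x)) ≤ (1 + 1 / l) ^ 2 * riem S A l x := by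
  have hl' : (1 : ℝ) ≤ l := by exact_mod_cast hl
  have hA' : (1 : ℝ) ≤ A := by exact_mod_cast hA
  have hx' : 2 * (x : ℝ) ≤ A := by exact_mod_cast hx
  have hx0 : (0 : ℝ) ≤ x := by positivity
  have hS' : (S : ℝ) = A * l ^ 2 := by rw [hS]; push_cast; ring
  have hS0 : (0 : ℝ) < S := by rw [hS']; positivity
  have hP : ∀ i : ℕ, i ≤ l → (l : ℝ) * A - i * x ≥ l * x ∧ (0 : ℝ) < l * A - i * x := by
    intro i hi
    have hi' : (i : ℝ) ≤ l := by exact_mod_cast hi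
    constructor <;> nlinarith
  -- The logarithm telescopes over the `l` points `l * A - i * x`; each summand is compared with one
  -- quotient of the Riemann sum.
  have hlog : Real.log (A / (A - x)) =
      ∑ i ∈ range l, (Real.log (l * A - i * x) - Real.log (l * A - (i + 1 : ℕ) * x)) := by
    rw [sum_range_sub' (fun i : ℕ => Real.log (l * A - i * x))]
    have h1 : (A : ℝ) - x ≠ 0 := by linarith
    have h2 : (l : ℝ) ≠ 0 := by linarith
    rw [← Real.log_div (by simpa using (hP 0 (by omega)).2.ne') (hP l le_rfl).2.ne']
    congr 1
    field_simp
    simp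
  have term : ∀ i < l, ((S * x / (l * A - i * x) : ℕ) : ℝ) ≤
      S * (Real.log (l * A - i * x) - Real.log (l * A - (i + 1 : ℕ) * x)) ∧
      S * (Real.log (l * A - i * x) - Real.log (l * A - (i + 1 : ℕ) * x)) ≤
        (1 + 1 / l) ^ 2 * ((S * x / (l * A - i * x) : ℕ) : ℝ) := by
    intro i hi
    obtain ⟨-, h0⟩ := hP i hi.le
    obtain ⟨h1, h2⟩ := hP (i + 1) hi
    have hle : i * x ≤ l * A := by nlinarith
    set P : ℝ := l * A - i * x with hPd
    have hP1 : (l : ℝ) * A - (i + 1 : ℕ) * x = P - x := by rw [hPd]; push_cast; ring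
    have hPn : ((l * A - i * x : ℕ) : ℝ) = P := by rw [Nat.cast_sub hle, hPd]; push_cast; ring
    rw [hP1] at h1 h2 ⊢
    have hdiv : ((S * x / (l * A - i * x) : ℕ) : ℝ) ≤ S * x / P := by
      rw [← hPn]; exact_mod_cast Nat.cast_div_le (α := ℝ) (m := S * x) (n := l * A - i * x)
    rw [← Real.log_div h0.ne' h2.ne']
    have hlow : x / P ≤ Real.log (P / (P - x)) := by
      have := Real.one_sub_inv_le_log_of_pos (div_pos h0 h2)
      rw [inv_div] at this
      grind
    have hup : Real.log (P / (P - x)) ≤ x / (P - x) := by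
      have := Real.log_le_sub_one_of_pos (div_pos h0 h2)
      grind
    refine ⟨hdiv.trans ?_, ?_⟩
    · rw [mul_div_assoc]; exact mul_le_mul_of_nonneg_left hlow hS0.le
    -- Here `2 * x ≤ A` is used: it gives `l * x ≤ P - x`, so the two endpoint estimates of the
    -- logarithm differ by a factor of at most `1 + 1 / l`.
    · have hxP : x / (P - x) ≤ (1 + 1 / l) * (x / P) := by
        rw [div_le_iff₀ h2]
        have e : (1 + 1 / (l : ℝ)) * (x / P) * (P - x) = x / P * ((1 + 1 / l) * (P - x)) := by ring
        have h3 : P ≤ (1 + 1 / l) * (P - x) := by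
          have : x ≤ 1 / l * (P - x) := by rw [one_div, inv_mul_eq_div, le_div_iff₀ (by linarith)]; linarith
          linarith
        rw [e]
        calc (x : ℝ) = x / P * P := by field_simp
          _ ≤ _ := mul_le_mul_of_nonneg_left h3 (by positivity)
      -- The scale `S = A * l ^ 2` makes a nonzero quotient at least `l`, so rounding down costs
      -- only another factor `1 + 1 / l`.
      have hfl : S * x / P ≤ (1 + 1 / l) * ((S * x / (l * A - i * x) : ℕ) : ℝ) := by
        rcases Nat.eq_zero_or_pos x with h | h
        · simp [h]
        have hq : (l : ℝ) ≤ ((S * x / (l * A - i * x) : ℕ) : ℝ) := by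
          have : l ≤ S * x / (l * A - i * x) := by
            rw [Nat.le_div_iff_mul_le (by exact_mod_cast hPn ▸ h0), hS]
            have : l * (l * A - i * x) ≤ l * (l * A) := by gcongr; omega
            nlinarith
          exact_mod_cast this
        have hlt : S * x / P < ((S * x / (l * A - i * x) : ℕ) : ℝ) + 1 := by
          rw [← hPn]
          have := Nat.lt_div_mul_add (a := S * x) (b := l * A - i * x) (by exact_mod_cast hPn ▸ h0)
          rw [div_lt_iff₀ (by rw [hPn]; exact h0)]
          have h5 : ((S * x : ℕ) : ℝ) < ((S * x / (l * A - i * x) * (l * A - i * x) +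
            (l * A - i * x) : ℕ) : ℝ) := by exact_mod_cast this
          grind
        have : (1 : ℝ) ≤ 1 / l * ((S * x / (l * A - i * x) : ℕ) : ℝ) := by
          rw [one_div, inv_mul_eq_div, le_div_iff₀ (by linarith)]; linarith
        linarith
      calc S * Real.log (P / (P - x)) ≤ S * ((1 + 1 / l) * (x / P)) :=
            mul_le_mul_of_nonneg_left (hup.trans hxP) hS0.le
        _ = (1 + 1 / l) * (S * x / P) := by ring
        _ ≤ (1 + 1 / l) * ((1 + 1 / l) * ((S * x / (l * A - i * x) : ℕ) : ℝ)) :=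
            mul_le_mul_of_nonneg_left hfl (by positivity)
        _ = _ := by ring
  rw [hlog, riem, mul_sum]
  push_cast
  rw [mul_sum]
  exact ⟨sum_le_sum fun i hi => by simpa using (term i (mem_range.1 hi)).1,
    sum_le_sum fun i hi => by simpa using (term i (mem_range.1 hi)).2⟩

/-- After `j` doublings `log (A / y) = j * log 2 + log (A / z)` with `z > A / 2`. Both logarithms
are then of the form treated in `riem_bounds`, with `x = A / 2` and `x = A - z`. -/
theorem prio_bounds {a y : ℕ} (hl : 1 ≤ l) (ha : 1 ≤ a) (hA : A = 2 ^ a) (hS : S = A * l ^ 2)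
    (hy : 1 ≤ y) (hyA : y ≤ A) :
    (prio S A l a y : ℝ) ≤ S * Real.log (A / y) ∧ S * Real.log (A / y) ≤ (1 + 1 / l) ^ 2 * prio S A l a y := by
  have hA1 : 1 ≤ A := by rw [hA]; exact Nat.one_le_two_pow
  have h2A : 2 * (A / 2) = A := by rw [hA]; exact Nat.mul_div_cancel' (dvd_pow_self 2 (by omega))
  set z := (scaleUp A y a).1 with hz
  set j := (scaleUp A y a).2 with hj
  have hzA : z ≤ A := scaleUp_fst_le hyA a
  have hz2 : A < 2 * z := by rw [hz, hA]; exact lt_two_mul_scaleUp hy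
  have hzy : z = 2 ^ j * y := scaleUp_fst A y a
  obtain ⟨b1, b2⟩ := riem_bounds (x := A / 2) hl hA1 hS (by omega)
  obtain ⟨c1, c2⟩ := riem_bounds (x := A - z) hl hA1 hS (by omega)
  have hA0 : (0 : ℝ) < A := by exact_mod_cast hA1
  have e1 : (A : ℝ) / (A - (A / 2 : ℕ)) = 2 := by
    have : (2 : ℝ) * (A / 2 : ℕ) = A := by exact_mod_cast h2A
    grind
  have e2 : (A : ℝ) - (A - z : ℕ) = z := by rw [Nat.cast_sub hzA]; ring
  rw [e1] at b1 b2
  rw [e2] at c1 c2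
  have hlog : Real.log (A / y) = j * Real.log 2 + Real.log (A / z) := by
    have : (A : ℝ) / y = 2 ^ j * (A / z) := by rw [hzy]; push_cast; field_simp
    have hz0 : (0 : ℝ) < z := by rw [hzy]; push_cast; positivity
    rw [this, Real.log_mul (by positivity) (by positivity), Real.log_pow]
  rw [hlog, prio]
  push_cast
  have hj0 : (0 : ℝ) ≤ j := by positivity
  constructor
  · nlinarith [mul_le_mul_of_nonneg_left b1 hj0]
  · nlinarith [mul_le_mul_of_nonneg_left b2 hj0]

end Bounds

/-! ### Tail bounds for the priority of a random word -/

/-- The number with the given binary digits, most significant first. -/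
def wordVal (β : ℕ → ℕ) : ℕ → ℕ
  | 0 => 0
  | j + 1 => 2 * wordVal β j + β j

theorem wordVal_lt {β : ℕ → ℕ} (hβ : ∀ j, β j ≤ 1) (a : ℕ) : wordVal β a < 2 ^ a := by
  induction a with
  | zero => simp [wordVal]
  | succ a ih => rw [wordVal, pow_succ]; have := hβ a; omega

theorem wordVal_congr {β γ : ℕ → ℕ} {a : ℕ} (h : ∀ j < a, β j = γ j) : wordVal β a = wordVal γ a := by
  induction a with
  | zero => rfl
  | succ a ih => rw [wordVal, wordVal, ih fun j hj => h j (by omega), h a (by omega)]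

theorem wordVal_inj {β γ : ℕ → ℕ} (hβ : ∀ j, β j ≤ 1) (hγ : ∀ j, γ j ≤ 1) {a : ℕ}
    (h : wordVal β a = wordVal γ a) : ∀ j < a, β j = γ j := by
  induction a with
  | zero => intro j hj; omega
  | succ a ih =>
    rw [wordVal, wordVal] at h
    grind

/-- The binary digits of a tuple of bits, extended by zero. -/
def bitFun {a : ℕ} (w : Fin a → Bool) (j : ℕ) : ℕ := if h : j < a then (w ⟨j, h⟩).toNat else 0

theorem bitFun_le {a : ℕ} (w : Fin a → Bool) (j : ℕ) : bitFun w j ≤ 1 := by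
  rw [bitFun]; split_ifs
  · exact Bool.toNat_le _
  · omega

/-- The priority given by a word of random bits. -/
def wordPrio (l a : ℕ) (w : Fin a → Bool) : ℕ := prio (2 ^ a * l ^ 2) (2 ^ a) l a (wordVal (bitFun w) a + 1)

/-- Reading binary digits is a bijection from bit tuples to the numbers below `2 ^ a`. -/
theorem card_wordVal (a : ℕ) (p : ℕ → Prop) [DecidablePred p] :
    ((univ : Finset (Fin a → Bool)).filter (fun w => p (wordVal (bitFun w) a))).card =
      ((range (2 ^ a)).filter p).card := by
  have hinj : Function.Injective (fun w : Fin a → Bool => wordVal (bitFun w) a) := by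
    intro w w' h
    funext j
    have := wordVal_inj (bitFun_le w) (bitFun_le w') h j j.2
    simp only [bitFun, j.2, dif_pos] at this
    revert this
    cases w j <;> cases w' j <;> simp
  have himg : (univ : Finset (Fin a → Bool)).image (fun w => wordVal (bitFun w) a) = range (2 ^ a) := by
    refine eq_of_subset_of_card_le ?_ ?_
    · intro v hv
      obtain ⟨w, -, rfl⟩ := mem_image.1 hv
      exact mem_range.2 (wordVal_lt (bitFun_le w) a)
    · rw [card_image_of_injective _ hinj]; simp
  rw [← himg, filter_image, card_image_of_injective _ hinj]

theorem card_succ_lt {A : ℕ} {t : ℝ} (ht : 0 ≤ t) (htA : t ≤ A) :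
    t - 1 ≤ (((range A).filter fun v : ℕ => ((v : ℝ) + 1 < t)).card : ℝ) ∧
      (((range A).filter fun v : ℕ => ((v : ℝ) + 1 < t)).card : ℝ) ≤ t := by
  have : (range A).filter (fun v : ℕ => ((v : ℝ) + 1 < t)) = range (⌈t⌉₊ - 1) := by
    ext v
    simp
    have h1 : (v : ℝ) + 1 < t ↔ v + 1 < ⌈t⌉₊ := by rw [Nat.lt_ceil]; push_cast; rfl
    rw [h1]
    have : ⌈t⌉₊ ≤ A := Nat.ceil_le.2 htA
    omega
  rw [this, card_range]
  have h1 := Nat.le_ceil t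
  have h2 := Nat.ceil_lt_add_one ht
  constructor
  · have : (⌈t⌉₊ : ℝ) ≤ ((⌈t⌉₊ - 1 : ℕ) : ℝ) + 1 := by
      have : ⌈t⌉₊ ≤ ⌈t⌉₊ - 1 + 1 := by omega
      exact_mod_cast this
    linarith
  · rcases Nat.eq_zero_or_pos ⌈t⌉₊ with h | h
    · simpa [h]
    · rw [Nat.cast_sub h]; push_cast; linarith

/-- For `y` uniform in `1, …, 2 ^ a` the variable `log (2 ^ a / y)` is exponential up to the
rounding error of counting integers below a real threshold, which is the term `(1 / 2) ^ a`. The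
factor `(1 + 1 / l) ^ 2` comes from `prio_bounds`. -/
theorem wordPrio_tail {l a : ℕ} (hl : 1 ≤ l) (ha : 1 ≤ a) {u : ℝ} (hu : 0 ≤ u) :
    (((univ : Finset (Fin a → Bool)).filter
        (fun w => u * ((2 ^ a * l ^ 2 : ℕ) : ℝ) < wordPrio l a w)).card : ℝ) ≤
      Fintype.card (Fin a → Bool) * Real.exp (-u) ∧
    Fintype.card (Fin a → Bool) * (Real.exp (-((1 + 1 / (l : ℝ)) ^ 2 * u)) - (1 / 2) ^ a) ≤
      (((univ : Finset (Fin a → Bool)).filter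
        (fun w => u * ((2 ^ a * l ^ 2 : ℕ) : ℝ) < wordPrio l a w)).card : ℝ) := by
  classical
  have hcard : (Fintype.card (Fin a → Bool) : ℝ) = 2 ^ a := by simp
  have hS0 : (0 : ℝ) < ((2 ^ a * l ^ 2 : ℕ) : ℝ) := by push_cast; positivity
  have hp : ∀ w : Fin a → Bool, ((wordPrio l a w : ℝ) ≤ ((2 ^ a * l ^ 2 : ℕ) : ℝ) *
      Real.log (2 ^ a / (wordVal (bitFun w) a + 1)) ∧ ((2 ^ a * l ^ 2 : ℕ) : ℝ) *
      Real.log (2 ^ a / (wordVal (bitFun w) a + 1)) ≤ (1 + 1 / l) ^ 2 * wordPrio l a w) := by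
    intro w
    have := prio_bounds (l := l) (a := a) (y := wordVal (bitFun w) a + 1) hl ha rfl rfl (by omega)
      (wordVal_lt (bitFun_le w) a)
    push_cast at this ⊢
    exact this
  rw [hcard]
  have hlt : ∀ (v : ℕ) (t : ℝ), t < Real.log (2 ^ a / ((v : ℝ) + 1)) ↔ (v : ℝ) + 1 < 2 ^ a * Real.exp (-t) := by
    intro v t
    have hv : (0 : ℝ) < (v : ℝ) + 1 := by positivity
    rw [Real.lt_log_iff_exp_lt (by positivity), lt_div_iff₀ hv, Real.exp_neg,
      ← div_eq_mul_inv, lt_div_iff₀ (Real.exp_pos _), mul_comm]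
  have bnd : ∀ t : ℝ, 0 ≤ t → 0 ≤ 2 ^ a * Real.exp (-t) ∧ 2 ^ a * Real.exp (-t) ≤ ((2 ^ a : ℕ) : ℝ) := by
    intro t ht
    refine ⟨by positivity, ?_⟩
    simp_all
  constructor
  · refine le_trans ?_ (card_succ_lt (bnd u hu).1 (bnd u hu).2).2
    rw [← card_wordVal a (fun v : ℕ => ((v : ℝ) + 1 < 2 ^ a * Real.exp (-u)))]
    refine Nat.cast_le.2 (card_le_card fun w hw => ?_)
    rw [mem_filter] at hw ⊢
    refine ⟨hw.1, ?_⟩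
    replace hw := hw.2
    rw [← hlt]
    have := (hp w).1
    by_contra hcon
    rw [not_lt] at hcon
    have := mul_le_mul_of_nonneg_left hcon hS0.le
    linarith
  · set c : ℝ := (1 + 1 / (l : ℝ)) ^ 2 with hc
    have hc0 : 0 < c := by positivity
    have hcu : 0 ≤ c * u := by positivity
    refine le_trans ?_ ((card_succ_lt (bnd _ hcu).1 (bnd _ hcu).2).1.trans ?_)
    · rw [mul_sub, ← mul_pow]; norm_num
    · rw [← card_wordVal a (fun v : ℕ => ((v : ℝ) + 1 < 2 ^ a * Real.exp (-(c * u))))]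
      refine Nat.cast_le.2 (card_le_card fun w hw => ?_)
      rw [mem_filter] at hw ⊢
      refine ⟨hw.1, ?_⟩
      replace hw := hw.2
      rw [← hlt] at hw
      have := (hp w).2
      have h2 := mul_lt_mul_of_pos_left hw hS0
      have h3 : c * (u * ((2 ^ a * l ^ 2 : ℕ) : ℝ)) < c * wordPrio l a w := by linarith
      exact lt_of_mul_lt_mul_left h3 hc0.le

open Ex (v ld rd)
open Stmt (set sto ite lg)

section

variable {inp : Input} {B : ℕ}

/-! ### Conversion of random bits to priorities -/

/-- Variable `24` becomes the Riemann sum for variable `23`. -/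
def riemProg : Stmt := set 24 0 ;; .loop 21 (v 5) (set 24 (v 24 + v 8 * v 23 / (v 5 * v 7 - v 21 * v 23)))

theorem riemProg_tr {s : State} (hx : s.reg 23 ≤ s.reg 7) (hB : s.reg 5 * (s.reg 8 * s.reg 7) < B) :
    Tr inp B riemProg s (fun s' => s'.reg 24 = riem (s.reg 8) (s.reg 7) (s.reg 5) (s.reg 23) ∧
      s'.time ≤ s.time + 2 * s.reg 5 + 2) := by
  have hmono : ∀ i ≤ s.reg 5, ∑ j ∈ range i, s.reg 8 * s.reg 23 / (s.reg 5 * s.reg 7 - j * s.reg 23) < B := by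
    intro i hi
    refine lt_of_le_of_lt ((sum_le_sum_of_subset (range_mono hi)).trans
      ((riem_le (s.reg 8) (s.reg 7) (s.reg 5) (s.reg 23)).trans ?_)) hB
    gcongr
  rw [riemProg, Tr_seq, Tr_set]
  refine ⟨by simp, ?_⟩
  refine Tr.loop (c := 2) (fun i s' => s'.reg 24 = ∑ j ∈ range i, s.reg 8 * s.reg 23 /
      (s.reg 5 * s.reg 7 - j * s.reg 23)) (by simp) (by simp) ?_ ?_
  · intro i hi s' hI hF
    have e5 := hF.reg 5 rfl
    have e7 := hF.reg 7 rfl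
    have e8 := hF.reg 8 rfl
    have e23 := hF.reg 23 rfl
    simp at e5 e7 e8 e23 hi
    rw [Tr_set]
    have := hmono (i + 1) (by omega)
    rw [sum_range_succ, ← hI] at this
    simp
    norm_num [e5, e7, e8, e23]
    exact ⟨this, by rw [hI, sum_range_succ]⟩
  · intro s' hI hF ht
    simp at hI ht ⊢
    exact ⟨hI, by omega⟩

/-- Array `14` at variable `27` becomes the priority given by the bits of word number `27`. -/
def wordBody : Stmt := set 20 0 ;; .loop 21 (v 6) (set 20 (2 * v 20 + ld 15 (v 27 * v 6 + v 21))) ;;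
  set 20 (v 20 + 1) ;; set 22 0 ;;
  .loop 21 (v 6) (ite (.bin .lt (v 7) (2 * v 20)) .skip (set 20 (2 * v 20) ;; set 22 (v 22 + 1))) ;;
  set 23 (v 7 - v 20) ;; riemProg ;; sto 14 (v 27) (v 22 * v 9 + v 24)

/-- The priority given by the digits `β`. -/
def digitsPrio (l a : ℕ) (β : ℕ → ℕ) : ℕ := prio (2 ^ a * l ^ 2) (2 ^ a) l a (wordVal β a + 1)

/-- Constants for the computation of priorities. -/
structure PrioRegs (s : State) : Prop where
  pow : s.reg 7 = 2 ^ s.reg 6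
  scale : s.reg 8 = 2 ^ s.reg 6 * s.reg 5 ^ 2
  ln : s.reg 9 = riem (s.reg 8) (s.reg 7) (s.reg 5) (s.reg 7 / 2)

theorem PrioRegs.frame {P : Stmt} {s s' : State} (h : PrioRegs s) (hF : Frame P s s')
    (h5 : P.writes 5 = false) (h6 : P.writes 6 = false) (h7 : P.writes 7 = false)
    (h8 : P.writes 8 = false) (h9 : P.writes 9 = false) : PrioRegs s' := by
  have e5 := hF.reg 5 h5
  have e6 := hF.reg 6 h6
  have e7 := hF.reg 7 h7
  have e8 := hF.reg 8 h8
  have e9 := hF.reg 9 h9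
  exact ⟨by rw [e7, e6]; exact h.pow, by rw [e8, e6, e5]; exact h.scale, by rw [e9, e8, e7, e5]; exact h.ln⟩

theorem wordBody_tr {s : State} (h : PrioRegs s) (hbit : ∀ j, s.arr 15 j ≤ 1)
    (hB : (s.reg 6 + 1) * (s.reg 5 * (s.reg 8 * s.reg 7)) < B) (h2 : 2 * s.reg 7 + 1 < B) :
    Tr inp B wordBody s (fun s' => s'.arr 14 = update (s.arr 14) (s.reg 27)
        (digitsPrio (s.reg 5) (s.reg 6) (fun j => s.arr 15 (s.reg 27 * s.reg 6 + j))) ∧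
      s'.time ≤ s.time + 6 * s.reg 6 + 2 * s.reg 5 + 12) := by
  set β : ℕ → ℕ := fun j => s.arr 15 (s.reg 27 * s.reg 6 + j) with hβ
  have hβ1 : ∀ j, β j ≤ 1 := fun j => hbit _
  set A := s.reg 7 with hA
  have hy : wordVal β (s.reg 6) + 1 ≤ A := by rw [hA, h.pow]; exact wordVal_lt hβ1 _
  have hsB : s.reg 5 * (s.reg 8 * A) < B := by grind
  rw [wordBody, Tr_seq, Tr_set]
  refine ⟨by simp, ?_⟩
  rw [Tr_seq]
  refine Tr.loop (c := 2) (fun i s' => s'.reg 20 = wordVal β i) (by simp) (by simp [wordVal]) ?_ ?_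
  · intro i hi s' hI hF
    have e6 := hF.reg 6 rfl
    have e27 := hF.reg 27 rfl
    have e15 := hF.arr 15 rfl
    simp at e6 e27 e15 hi
    rw [Tr_set]
    have hlt : wordVal β (i + 1) < B := by
      have := wordVal_lt hβ1 (i + 1)
      have h3 : 2 ^ (i + 1) ≤ 2 ^ (s.reg 6) := Nat.pow_le_pow_right (by omega) (by omega)
      rw [← h.pow] at h3
      omega
    rw [wordVal, ← hI] at hlt
    simp
    norm_num [e6, e27, e15]
    exact ⟨by simpa [hβ] using hlt, by rw [wordVal, hI]⟩
  intro s1 hI1 hF1 ht1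
  have f1 : ∀ y, y ≠ 20 → y ≠ 21 → s1.reg y = s.reg y := fun y h20 h21 => by
    rw [hF1.reg y (by simp [Stmt.writes, h20.symm, h21.symm])]; simp [h20]
  have a1 : s1.arr = s.arr := funext fun t => by rw [hF1.arr t rfl]; rfl
  simp at hI1 ht1
  rw [Tr_seq, Tr_set]
  refine ⟨by simp [hI1]; omega, ?_⟩
  rw [Tr_seq, Tr_set]
  refine ⟨by simp, ?_⟩
  rw [Tr_seq]
  refine Tr.loop (c := 4) (fun i s' => s'.reg 20 = (scaleUp A (wordVal β (s.reg 6) + 1) i).1 ∧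
    s'.reg 22 = (scaleUp A (wordVal β (s.reg 6) + 1) i).2) (by simp)
    (by simp [hI1, scaleUp]) ?_ ?_
  · rintro i hi s' ⟨hI, hI'⟩ hF
    have e7 := hF.reg 7 rfl
    simp [f1] at e7 hi
    have hle := scaleUp_fst_le hy i
    have hle2 := scaleUp_snd_le A (wordVal β (s.reg 6) + 1) i
    have ha : s.reg 6 < A := by rw [hA, h.pow]; exact Nat.lt_two_pow_self
    rw [Tr_ite]
    constructor
    · intro hc
      rw [Tr_skip]
      simp [hI, e7] at hc
      rw [scaleUp, if_neg (by omega)]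
      simp [hI, hI']
    · intro hc
      simp [hI, e7] at hc
      rw [scaleUp, if_pos (by omega)]
      simp [Tr_seq, Tr_set, hI, hI']
      omega
  rintro s2 ⟨hI2, hI2'⟩ hF2 ht2
  have f2 : ∀ y, y ≠ 20 → y ≠ 21 → y ≠ 22 → s2.reg y = s.reg y := fun y h20 h21 h22 => by
    rw [hF2.reg y (by simp [Stmt.writes, h20.symm, h21.symm, h22.symm])]
    simp [h20, h22, f1 y h20 h21]
  have a2 : s2.arr = s.arr := funext fun t => by rw [hF2.arr t rfl, ← a1]; rfl
  have e6 : (Ex.v 6).eval inp (((s1.tick 1).set 20 ((v 20 + 1 : Ex).eval inp (s1.tick 1))).set 22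
      ((0 : Ex).eval inp ((s1.tick 1).set 20 ((v 20 + 1 : Ex).eval inp (s1.tick 1))))) = s.reg 6 := by
    simp [f1]
  rw [e6] at hI2 hI2' ht2
  simp at ht2
  rw [Tr_seq, Tr_set]
  refine ⟨by simp, ?_⟩
  rw [Tr_seq]
  refine (riemProg_tr (inp := inp) (B := B) ?_ ?_).mono ?_
  · simp [f2]
  · simpa [f2] using hsB
  rintro s3 hF3 ⟨hI3, ht3⟩
  have f3 : ∀ y, y ≠ 20 → y ≠ 21 → y ≠ 22 → y ≠ 23 → y ≠ 24 → s3.reg y = s.reg y := fun y h20 h21 h22 h23 h24 => by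
      rw [hF3.reg y (by simp [riemProg, Stmt.writes, h21.symm, h24.symm])]
      simp [h23, f2 y h20 h21 h22]
  have a3 : s3.arr = s.arr := funext fun t => by rw [hF3.arr t rfl, ← a2]; rfl
  have e22 : s3.reg 22 = (scaleUp A (wordVal β (s.reg 6) + 1) (s.reg 6)).2 := by rw [hF3.reg 22 rfl]; simpa using hI2'
  have hval : s3.reg 22 * s3.reg 9 + s3.reg 24 = digitsPrio (s.reg 5) (s.reg 6) β := by
    rw [e22, f3 9 (by omega) (by omega) (by omega) (by omega) (by omega), h.ln, hI3, digitsPrio, prio]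
    simp [f2, hI2, hA, h.pow, h.scale]
  rw [Tr_sto]
  simp only [Ex.eval_add, Ex.eval_mul, Ex.eval_v, State.put_arr, State.put_time, ↓reduceIte, hval, a3,
    f3 27 (by omega) (by omega) (by omega) (by omega) (by omega)]
  refine ⟨Or.inr (lt_of_le_of_lt ?_ hB), trivial, ?_⟩
  · rw [hA, h.scale, h.pow]
    exact prio_le
  · simp [f2] at ht3
    omega

/-- Array `14` becomes the list of priorities of the first words of random bits. -/
def wordsProg : Stmt := .loop 27 (v 10) wordBody

theorem wordsProg_tr {s : State} (h : PrioRegs s) (hbit : ∀ j, s.arr 15 j ≤ 1)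
    (hB : (s.reg 6 + 1) * (s.reg 5 * (s.reg 8 * s.reg 7)) < B) (h2 : 2 * s.reg 7 + 1 < B) :
    Tr inp B wordsProg s (fun s' => (∀ i < s.reg 10, s'.arr 14 i =
        digitsPrio (s.reg 5) (s.reg 6) (fun j => s.arr 15 (i * s.reg 6 + j))) ∧
      s'.time ≤ s.time + s.reg 10 * (6 * s.reg 6 + 2 * s.reg 5 + 13) + 1) := by
  refine Tr.loop (c := 6 * s.reg 6 + 2 * s.reg 5 + 13) (fun n s' => ∀ i < n, s'.arr 14 i =
        digitsPrio (s.reg 5) (s.reg 6) (fun j => s.arr 15 (i * s.reg 6 + j))) (by simp)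
    (fun i hi => absurd hi (Nat.not_lt_zero i)) ?_ ?_
  · intro n hn s' hI hF
    have e5 := hF.reg 5 rfl
    have e6 := hF.reg 6 rfl
    have e7 := hF.reg 7 rfl
    have e8 := hF.reg 8 rfl
    have e15 := hF.arr 15 rfl
    have hp : PrioRegs (s'.set 27 n) := by
      have := h.frame hF rfl rfl rfl rfl rfl
      exact ⟨by simpa using this.pow, by simpa using this.scale, by simpa using this.ln⟩
    refine (wordBody_tr hp ?_ ?_ ?_).mono ?_
    · simpa [e15] using hbit
    · simpa [e5, e6, e7, e8] using hB
    · simpa [e7] using h2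
    · rintro s'' hF'' ⟨h14, ht⟩
      simp [e5, e6, e15] at h14 ht
      refine ⟨fun i hi => ?_, by omega⟩
      rw [h14]
      rcases Nat.lt_succ_iff_lt_or_eq.1 hi with hi | rfl
      · rw [update_of_ne (by omega), hI i hi]
      · simp
  · intro s' hI hF ht
    simp at hI ht ⊢
    exact ⟨hI, ht⟩

/-! ### Tournament trees -/

section Tournament

variable {g w t : ℕ → ℕ} {D : ℕ}

/-- The item of smaller ratio `g / w`. -/
def pick (g w : ℕ → ℕ) (a b : ℕ) : ℕ := if g b * w a < g a * w b then b else a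

/-- Every inner node of the tree holds the winner of its children. -/
def Tourn (g w t : ℕ → ℕ) (D : ℕ) : Prop := ∀ i, 1 ≤ i → i < 2 ^ D → t i = pick g w (t (2 * i)) (t (2 * i + 1))

/-- Transitivity of comparing fractions by cross multiplication. It could fail only if the fraction
in the middle were `0 / 0`, which the first hypothesis rules out. -/
theorem cross_trans {a b c d e f : ℕ} (hd : 0 < c ∨ 0 < d) (h1 : a * d ≤ c * b)
    (h2 : c * f ≤ e * d) : a * f ≤ e * b := by
  rcases Nat.eq_zero_or_pos d with h | h
  · subst h
    have hc : 0 < c := by omega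
    have hf : f = 0 := by nlinarith
    simp [hf]
  · refine Nat.le_of_mul_le_mul_right ?_ h
    calc a * f * d = a * d * f := by ring
      _ ≤ c * b * f := Nat.mul_le_mul_right _ h1
      _ = c * f * b := by ring
      _ ≤ e * d * b := Nat.mul_le_mul_right _ h2
      _ = e * b * d := by ring

/-- The leaves below node `j` at height `h` are `j * 2 ^ h + q`. Induction on the height: the
winners of the two children are compared, and the loser's leaves are covered by `cross_trans`. -/
theorem Tourn.subtree (hT : Tourn g w t D) {j : ℕ} (hj : 1 ≤ j) {h : ℕ} (h1 : 2 ^ D ≤ j * 2 ^ h)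
    (h2 : j * 2 ^ h < 2 * 2 ^ D) (hv : ∀ q < 2 ^ D, 0 < g (t (2 ^ D + q)) ∨ 0 < w (t (2 ^ D + q))) :
    (∃ q < 2 ^ h, t j = t (j * 2 ^ h + q)) ∧
      ∀ q < 2 ^ h, g (t j) * w (t (j * 2 ^ h + q)) ≤ g (t (j * 2 ^ h + q)) * w (t j) := by
  induction h generalizing j with
  | zero => exact ⟨⟨0, by simp⟩, fun q hq => by simp at hq; simp [hq]⟩
  | succ h ih =>
    rw [pow_succ] at h1 h2
    have h3 : j < 2 ^ D := by
      by_contra hc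
      have : 2 ^ D * 1 ≤ j * 2 ^ h := Nat.mul_le_mul (not_lt.1 hc) Nat.one_le_two_pow
      nlinarith
    have hlev : j * 2 ^ h < 2 ^ D := by nlinarith
    have hlev2 : (j + 1) * 2 ^ h ≤ 2 ^ D := by
      rcases le_or_gt h D with hh | hh
      · obtain ⟨e, rfl⟩ := Nat.exists_eq_add_of_le hh
        rw [pow_add] at hlev ⊢
        rw [mul_comm] at hlev ⊢
        simp_all
      · have : 2 ^ D < 2 ^ h := Nat.pow_lt_pow_right (by omega) hh
        nlinarith
    obtain ⟨⟨p, hp, ep⟩, lp⟩ := ih (j := 2 * j) (by omega) (by nlinarith) (by nlinarith)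
    obtain ⟨⟨q, hq, eq⟩, lq⟩ := ih (j := 2 * j + 1) (by omega) (by nlinarith) (by nlinarith)
    have el : ∀ r, 2 * j * 2 ^ h + r = j * 2 ^ (h + 1) + r := fun r => by rw [pow_succ]; ring
    have er : ∀ r, (2 * j + 1) * 2 ^ h + r = j * 2 ^ (h + 1) + (2 ^ h + r) := fun r => by rw [pow_succ]; ring
    have hv' : ∀ i, 2 ^ D ≤ i → i < 2 * 2 ^ D → 0 < g (t i) ∨ 0 < w (t i) := by
      intro i hi1 hi2
      have := hv (i - 2 ^ D) (by omega)
      simp_all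
    have vl : 0 < g (t (2 * j)) ∨ 0 < w (t (2 * j)) := by rw [ep]; exact hv' _ (by nlinarith) (by nlinarith)
    have vr : 0 < g (t (2 * j + 1)) ∨ 0 < w (t (2 * j + 1)) := by rw [eq]; exact hv' _ (by nlinarith) (by nlinarith)
    have hsplit : ∀ r < 2 ^ (h + 1), r < 2 ^ h ∨ ∃ r' < 2 ^ h, r = 2 ^ h + r' := by
      intro r hr
      rw [pow_succ] at hr
      rcases lt_or_ge r (2 ^ h) with h' | h'
      · exact Or.inl h'
      · exact Or.inr ⟨r - 2 ^ h, by omega, by omega⟩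
    have ht := hT j hj h3
    rw [pick] at ht
    split_ifs at ht with hc
    · refine ⟨⟨2 ^ h + q, by omega, ?_⟩, fun r hr => ?_⟩
      · rw [ht, eq, er]
      · rw [ht]
        rcases hsplit r hr with h' | ⟨r', h', rfl⟩
        · rw [← el]; exact cross_trans vl hc.le (lp r h')
        · rw [← er]; exact lq r' h'
    · refine ⟨⟨p, by omega, ?_⟩, fun r hr => ?_⟩
      · rw [ht, ep, el]
      · rw [ht]
        rcases hsplit r hr with h' | ⟨r', h', rfl⟩
        · rw [← el]; exact lp r h'
        · rw [← er]; exact cross_trans vr (not_lt.1 hc) (lq r' h')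

theorem Tourn.root (hT : Tourn g w t D) (hv : ∀ q < 2 ^ D, 0 < g (t (2 ^ D + q)) ∨ 0 < w (t (2 ^ D + q))) :
    (∃ q < 2 ^ D, t 1 = t (2 ^ D + q)) ∧ ∀ q < 2 ^ D, g (t 1) * w (t (2 ^ D + q)) ≤ g (t (2 ^ D + q)) * w (t 1) := by
  simpa using hT.subtree le_rfl (h := D) (by simp) (by simp) hv

/-- The winner at any node is one of the items at the leaves; `d` only serves for a downward
induction on `j`. -/
theorem Tourn.node_mem (hT : Tourn g w t D) {d : ℕ} :
    ∀ j, 1 ≤ j → 2 ^ D ≤ j + d → j < 2 * 2 ^ D → ∃ q < 2 ^ D, t j = t (2 ^ D + q) := by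
  induction d with
  | zero => intro j h1 h2 h3; exact ⟨j - 2 ^ D, by omega, by rw [Nat.add_sub_cancel' (by omega)]⟩
  | succ d ih =>
    intro j h1 h2 h3
    rcases lt_or_ge j (2 ^ D) with h | h
    · obtain ⟨p, hp, ep⟩ := ih (2 * j) (by omega) (by omega) (by omega)
      obtain ⟨q, hq, eq⟩ := ih (2 * j + 1) (by omega) (by omega) (by omega)
      rw [hT j h1 h, pick]
      grind
    · grind

/-- Only items present at leaves are ever compared. Data may therefore be written for an item before
it is put into the tree. -/
theorem Tourn.congr (hT : Tourn g w t D) {g' w' : ℕ → ℕ} (h : ∀ q < 2 ^ D, g' (t (2 ^ D + q)) = g (t (2 ^ D + q)) ∧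
      w' (t (2 ^ D + q)) = w (t (2 ^ D + q))) : Tourn g' w' t D := by
  intro i h1 h2
  obtain ⟨p, hp, ep⟩ := hT.node_mem (d := 2 ^ D) (2 * i) (by omega) (by omega) (by omega)
  obtain ⟨q, hq, eq⟩ := hT.node_mem (d := 2 ^ D) (2 * i + 1) (by omega) (by omega) (by omega)
  rw [hT i h1 h2, pick, pick, ep, eq, (h p hp).1, (h p hp).2, (h q hq).1, (h q hq).2]

theorem Tourn.of_zero (h : ∀ i < 2 * 2 ^ D, t i = 0) : Tourn g w t D := by
  intro i h1 h2
  rw [h i (by omega), h (2 * i) (by omega), h (2 * i + 1) (by omega), pick]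
  simp

end Tournament

/-- Put variable `45` into leaf number `44`. -/
def updProg : Stmt := set 46 (v 14 + v 44) ;; sto 11 (v 46) (v 45) ;;
  .loop 50 (v 13) (set 46 (v 46 / 2) ;; set 47 (ld 11 (2 * v 46)) ;; set 48 (ld 11 (2 * v 46 + 1)) ;;
    ite (.bin .lt (ld 8 (v 48) * ld 13 (v 47)) (ld 8 (v 47) * ld 13 (v 48)))
      (sto 11 (v 46) (v 48)) (sto 11 (v 46) (v 47)))

/-- A changed leaf can invalidate only its ancestors, and these are recomputed from the bottom to
the root. -/
theorem updProg_tr {s : State} (hD : s.reg 14 = 2 ^ s.reg 13) (hpos : s.reg 44 < s.reg 14)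
    (hT : Tourn (s.arr 8) (s.arr 13) (s.arr 11) (s.reg 13)) (hB : 2 * s.reg 14 < B) :
    Tr inp B updProg s (fun s' => Tourn (s.arr 8) (s.arr 13) (s'.arr 11) (s.reg 13) ∧
      (∀ q, s'.arr 11 (s.reg 14 + q) = if q = s.reg 44 then s.reg 45 else s.arr 11 (s.reg 14 + q)) ∧
      s'.time ≤ s.time + 6 * s.reg 13 + 3) := by
  set N := s.reg 14 + s.reg 44 with hN
  rw [updProg, Tr_seq, Tr_set]
  refine ⟨by simp; omega, ?_⟩
  rw [Tr_seq, Tr_sto]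
  refine ⟨by simp, ?_⟩
  -- After `d` rounds all inner nodes are correct except perhaps the ancestors `N / 2 ^ e` with `e >
  -- d` of the changed leaf `N`.
  refine Tr.loop (c := 6) (fun d s' => s'.reg 46 = N / 2 ^ d ∧
    (∀ i, 1 ≤ i → i < s.reg 14 → (∀ e, d < e → i ≠ N / 2 ^ e) →
      s'.arr 11 i = pick (s.arr 8) (s.arr 13) (s'.arr 11 (2 * i)) (s'.arr 11 (2 * i + 1))) ∧
    (∀ q, s'.arr 11 (s.reg 14 + q) = if q = s.reg 44 then s.reg 45 else s.arr 11 (s.reg 14 + q)))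
    (by simp) ?_ ?_ ?_
  · simp only [Ex.eval_add, Ex.eval_v, State.put_reg, State.set_reg, State.put_arr, State.set_arr, ↓reduceIte, ← hN]
    refine ⟨by simp, fun i h1 h2 h3 => ?_, fun q => ?_⟩
    · have h4 : i ≠ N / 2 := by simpa using h3 1 (by omega)
      rw [update_of_ne (by omega), update_of_ne (by omega), update_of_ne (by omega)]
      exact hT i h1 (by omega)
    · simp [update_apply, hN]
  · rintro d hd s' ⟨h46, hinv, hleaf⟩ hF
    have a8 : s'.arr 8 = s.arr 8 := by rw [hF.arr 8 rfl]; simp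
    have a13 : s'.arr 13 = s.arr 13 := by rw [hF.arr 13 rfl]; simp
    set j := N / 2 ^ (d + 1) with hj
    have hj2 : N / 2 ^ d / 2 = j := by rw [Nat.div_div_eq_div_mul, hj, pow_succ]
    have hjlt : j < s.reg 14 := by
      rw [hj, pow_succ']
      rw [← Nat.div_div_eq_div_mul]
      exact (Nat.div_le_self _ _).trans_lt (by omega)
    have hput : ∀ x, x = pick (s.arr 8) (s.arr 13) (s'.arr 11 (2 * j)) (s'.arr 11 (2 * j + 1)) →
        (∀ i, 1 ≤ i → i < s.reg 14 → (∀ e, d + 1 < e → i ≠ N / 2 ^ e) →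
          update (s'.arr 11) j x i = pick (s.arr 8) (s.arr 13)
          (update (s'.arr 11) j x (2 * i)) (update (s'.arr 11) j x (2 * i + 1))) ∧
        (∀ q, update (s'.arr 11) j x (s.reg 14 + q) =
          if q = s.reg 44 then s.reg 45 else s.arr 11 (s.reg 14 + q)) := by
      intro x hx
      refine ⟨fun i h1 h2 h3 => ?_, fun q => ?_⟩
      · have h4 : i ≠ j / 2 := by
          have := h3 (d + 2) (by omega)
          rwa [pow_succ, ← Nat.div_div_eq_div_mul] at this
        rw [update_of_ne (show 2 * i ≠ j by omega), update_of_ne (show 2 * i + 1 ≠ j by omega)]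
        by_cases hij : i = j
        · subst hij; simpa using hx
        · rw [update_of_ne hij]
          refine hinv i h1 h2 fun e he => ?_
          rcases Nat.lt_or_ge (d + 1) e with h5 | h5
          · exact h3 e h5
          · obtain rfl : e = d + 1 := by omega
            exact hij
      · rw [update_of_ne (by omega), hleaf]
    simp only [Tr_seq, Tr_set, Tr_ite, Tr_sto]
    simp only [Ex.eval_v, Ex.eval_div, Ex.eval_ofNat, State.set_reg, State.tick_reg, Ex.eval_ld,
      Ex.eval_mul, Ex.eval_add, State.set_arr, State.tick_arr, Ex.eval_lt', State.put_arr,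
      State.put_reg, State.put_time, State.set_time, State.tick_time, Ex.triv_v, Ex.triv_div,
      Ex.triv_ld, true_or, true_and, Nat.reduceEqDiff, ↓reduceIte, h46, hj2,
      a8, a13]
    constructor
    · intro hc
      have hc' : s.arr 8 (s'.arr 11 (2 * j + 1)) * s.arr 13 (s'.arr 11 (2 * j)) <
        s.arr 8 (s'.arr 11 (2 * j)) * s.arr 13 (s'.arr 11 (2 * j + 1)) := by
        by_contra h; simp [h] at hc
      obtain ⟨p1, p2⟩ := hput (s'.arr 11 (2 * j + 1)) (by rw [pick, if_pos hc'])
      exact ⟨⟨p1, p2⟩, by omega⟩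
    · intro hc
      have hc' : ¬ s.arr 8 (s'.arr 11 (2 * j + 1)) * s.arr 13 (s'.arr 11 (2 * j)) <
        s.arr 8 (s'.arr 11 (2 * j)) * s.arr 13 (s'.arr 11 (2 * j + 1)) := by
        intro h; simp [h] at hc
      obtain ⟨p1, p2⟩ := hput (s'.arr 11 (2 * j)) (by rw [pick, if_neg hc'])
      exact ⟨⟨p1, p2⟩, by omega⟩
  · rintro s' ⟨h46, hinv, hleaf⟩ hF ht
    simp at hinv hleaf ht ⊢
    refine ⟨fun i h1 h2 => hinv i h1 (by omega) fun e he => ?_, hleaf, by omega⟩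
    -- Above the root there are no ancestors left, so the list of exceptions is empty.
    have : N / 2 ^ e = 0 := by
      apply Nat.div_eq_of_lt
      have : 2 ^ (s.reg 13 + 1) ≤ 2 ^ e := Nat.pow_le_pow_right (by omega) (by omega)
      rw [pow_succ] at this
      omega
    omega

end

section

variable {n : ℕ} {G : WeightedGraph n}

/-! ### Invariants of the search -/

/-- The heap of edges leaving the explored set `S`: the edges from the vertex `v` to the vertices
in `L` are still missing. -/
structure HeapInv (G : WeightedGraph n) (S : Finset (Fin n)) (v : Fin n) (L : List (Fin n))
    (i D : ℕ) (T g W Fr To : ℕ → ℕ) (good : Prop) (pr : Sym2 (Fin n) → ℕ) : Prop where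
  tourn : Tourn g W T D
  zero : g 0 = 1 ∧ W 0 = 0
  leaf : ∀ q < 2 ^ D, T (2 ^ D + q) = 0 ∨ (q < i ∧ T (2 ^ D + q) = q + 1 ∧ ∃ u ∈ S, ∃ w : Fin n,
    Fr (q + 1) = u ∧ To (q + 1) = w ∧ W (q + 1) = G.wt u w ∧ 0 < G.wt u w ∧
    (good → g (q + 1) = pr s(u, w)))
  full : ∀ u ∈ S, ∀ w ∉ S, 0 < G.wt u w → (u = v ∧ w ∈ L) ∨
    ∃ q < 2 ^ D, T (2 ^ D + q) = q + 1 ∧ Fr (q + 1) = u ∧ To (q + 1) = w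

/-- The number of items in the heap. -/
def heapCard (T : ℕ → ℕ) (D : ℕ) : ℕ := ((range (2 ^ D)).filter fun q => T (2 ^ D + q) ≠ 0).card

theorem heapCard_update {T T' : ℕ → ℕ} {D q x : ℕ} (hq : q < 2 ^ D)
    (h : ∀ p, T' (2 ^ D + p) = if p = q then x else T (2 ^ D + p)) :
    heapCard T' D + (if T (2 ^ D + q) = 0 then 0 else 1) = heapCard T D + (if x = 0 then 0 else 1) := by
  have key : ∀ U : ℕ → ℕ, heapCard U D = (((range (2 ^ D)).erase q).filter
      fun p => U (2 ^ D + p) ≠ 0).card + (if U (2 ^ D + q) = 0 then 0 else 1) := by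
    intro U
    rw [heapCard, ← insert_erase (mem_range.2 hq), filter_insert]
    by_cases h0 : U (2 ^ D + q) = 0
    · simp [h0]
    · rw [if_pos h0, card_insert_of_notMem (by simp)]
      simp [h0]
  have e : (((range (2 ^ D)).erase q).filter fun p => T' (2 ^ D + p) ≠ 0) =
      ((range (2 ^ D)).erase q).filter fun p => T (2 ^ D + p) ≠ 0 := by
    apply filter_congr
    intro p hp
    rw [h p, if_neg (ne_of_mem_erase hp)]
  rw [key T, key T', e, h q, if_pos rfl]
  omega

namespace HeapInv

variable {S : Finset (Fin n)} {v : Fin n} {L : List (Fin n)} {i D : ℕ} {T g W Fr To : ℕ → ℕ} {good : Prop}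
  {pr : Sym2 (Fin n) → ℕ}

theorem valid (h : HeapInv G S v L i D T g W Fr To good pr) :
    ∀ q < 2 ^ D, 0 < g (T (2 ^ D + q)) ∨ 0 < W (T (2 ^ D + q)) := by
  cases h
  grind

/-- Item `0` stands for an empty leaf and has the ratio `1 / 0`. It loses to every real item, since
these have positive weight; hence it can win only in an empty tree. -/
theorem root_eq_zero (h : HeapInv G S v L i D T g W Fr To good pr) (h0 : T 1 = 0) :
    ∀ q < 2 ^ D, T (2 ^ D + q) = 0 := by
  intro q hq
  have := (h.tourn.root h.valid).2 q hq
  rw [h0, h.zero.1, h.zero.2] at this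
  rcases h.leaf q hq with h0 | ⟨-, h1, u, -, w, -, -, h2, h3, -⟩
  · exact h0
  · rw [h1, h2] at this; omega

theorem root_item (h : HeapInv G S v L i D T g W Fr To good pr) (h0 : T 1 ≠ 0) :
    ∃ q < 2 ^ D, q < i ∧ T 1 = q + 1 ∧ T (2 ^ D + q) = q + 1 ∧ ∃ u ∈ S, ∃ w : Fin n,
      Fr (q + 1) = u ∧ To (q + 1) = w ∧ W (q + 1) = G.wt u w ∧ 0 < G.wt u w ∧
      (good → g (q + 1) = pr s(u, w)) := by
  obtain ⟨q, hq, e⟩ := (h.tourn.root h.valid).1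
  rcases h.leaf q hq with h1 | ⟨h1, h2, h3⟩
  · exact absurd (e.trans h1) h0
  · exact ⟨q, hq, h1, e.trans h2, h2, h3⟩

/-- Item `i + 1` is not yet in the tree, so its priority can be overwritten. The search loads a
fresh word in each step, whether or not an edge is found for it. -/
theorem load (h : HeapInv G S v L i D T g W Fr To good pr) (x : ℕ) :
    HeapInv G S v L i D T (update g (i + 1) x) W Fr To good pr := by
  have hg : ∀ q < i, update g (i + 1) x (q + 1) = g (q + 1) := fun q hq =>
    update_of_ne (by omega) _ _
  have hg0 : update g (i + 1) x 0 = g 0 := update_of_ne (by omega) _ _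
  refine ⟨h.tourn.congr fun q hq => ?_, by rw [hg0]; exact h.zero, fun q hq => ?_, h.full⟩
  · rcases h.leaf q hq with h0 | ⟨h0, h1, -⟩
    · rw [h0, hg0]; simp
    · rw [h1, hg q h0]; simp
  · rcases h.leaf q hq with h0 | ⟨h0, h1, h2⟩
    · exact Or.inl h0
    · right; rw [hg q h0]; exact ⟨h0, h1, h2⟩

theorem skip {u : Fin n} (h : HeapInv G S v (u :: L) i D T g W Fr To good pr)
    (hu : u ∈ S ∨ G.wt v u = 0) : HeapInv G S v L (i + 1) D T g W Fr To good pr := by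
  cases h
  constructor <;> grind

/-- The contents of a new slot are irrelevant. -/
theorem tourn_congr (h : HeapInv G S v L i D T g W Fr To good pr) (x : ℕ) :
    Tourn g (update W (i + 1) x) T D := by
  refine h.tourn.congr fun q hq => ?_
  rcases h.leaf q hq with h0 | ⟨h0, h1, -⟩
  · rw [h0]; simp
  · rw [h1, update_of_ne (by omega)]; simp

theorem push {u : Fin n} {T' : ℕ → ℕ} (h : HeapInv G S v (u :: L) i D T g W Fr To good pr)
    (hv : v ∈ S) (hw : 0 < G.wt v u) (hi : i < 2 ^ D) (hg : good → g (i + 1) = pr s(v, u))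
    (hT : Tourn g (update W (i + 1) (G.wt v u)) T' D)
    (hT' : ∀ p, T' (2 ^ D + p) = if p = i then i + 1 else T (2 ^ D + p)) :
    HeapInv G S v L (i + 1) D T' g (update W (i + 1) (G.wt v u))
      (update Fr (i + 1) v) (update To (i + 1) u) good pr := by
  refine ⟨hT, ⟨h.zero.1, ?_⟩, fun q hq => ?_, fun a ha w hw h0 => ?_⟩
  · rw [update_of_ne (by omega)]; exact h.zero.2
  · rw [hT']
    by_cases hqi : q = i
    · subst hqi
      right
      exact ⟨by omega, by simp, v, hv, u, by simp, by simp, by simp, hw, hg⟩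
    · rw [if_neg hqi, update_of_ne (by omega), update_of_ne (by omega),
        update_of_ne (by omega)]
      rcases h.leaf q hq with h0 | ⟨h0, h1, h2⟩
      · exact Or.inl h0
      · exact Or.inr ⟨by omega, h1, h2⟩
  · have hold : (∃ q < 2 ^ D, T (2 ^ D + q) = q + 1 ∧ Fr (q + 1) = a ∧ To (q + 1) = w) → 
        ∃ q < 2 ^ D, T' (2 ^ D + q) = q + 1 ∧ update Fr (i + 1) (v : ℕ) (q + 1) = a ∧
          update To (i + 1) (u : ℕ) (q + 1) = w := by
      rintro ⟨q, h1, h2, h3, h4⟩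
      have hqi : q < i := by
        rcases h.leaf q h1 with h5 | ⟨h5, -⟩
        · omega
        · exact h5
      refine ⟨q, h1, ?_, ?_, ?_⟩
      · rw [hT', if_neg (by omega), h2]
      · rw [update_of_ne (by omega), h3]
      · rw [update_of_ne (by omega), h4]
    rcases h.full a ha w hw h0 with ⟨rfl, h2⟩ | h2
    · rcases List.mem_cons.1 h2 with rfl | h2
      · exact Or.inr ⟨i, hi, by simp [hT'], by simp, by simp⟩
      · exact Or.inl ⟨rfl, h2⟩
    · exact Or.inr (hold h2)

/-- An edge whose far end has been explored may be dropped, because `full` speaks only of edges to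
unexplored vertices. -/
theorem pop {T' : ℕ → ℕ} {q₀ : ℕ} {w₀ : Fin n} (h : HeapInv G S v L i D T g W Fr To good pr) (hT : Tourn g W T' D)
    (hT' : ∀ p, T' (2 ^ D + p) = if p = q₀ then 0 else T (2 ^ D + p))
    (hw₀ : To (q₀ + 1) = w₀) (hS : w₀ ∈ S) :
    HeapInv G S v L (i + 1) D T' g W Fr To good pr := by
  refine ⟨hT, h.zero, fun q hq => ?_, fun a ha w hw h0 => ?_⟩
  · rw [hT']
    split_ifs
    · exact Or.inl rfl
    · rcases h.leaf q hq with h0 | ⟨h0, h1, h2⟩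
      · exact Or.inl h0
      · exact Or.inr ⟨by omega, h1, h2⟩
  · rcases h.full a ha w hw h0 with h2 | ⟨q, h1, h2, h3, h4⟩
    · exact Or.inl h2
    · refine Or.inr ⟨q, h1, ?_, h3, h4⟩
      rw [hT', if_neg, h2]
      rintro rfl
      rw [h4] at hw₀
      rw [Fin.val_injective hw₀] at hw
      exact hw hS

/-- All edges of the new vertex `z` are pending in its adjacency list. Other items that lead to `z`
become useless but remain in the tree until they are popped. -/
theorem add {T' : ℕ → ℕ} {q₀ : ℕ} {z : Fin n} {L' : List (Fin n)}
    (h : HeapInv G S v [] i D T g W Fr To good pr) (hT : Tourn g W T' D)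
    (hT' : ∀ p, T' (2 ^ D + p) = if p = q₀ then 0 else T (2 ^ D + p))
    (hz : To (q₀ + 1) = z) (hL : ∀ u, G.graph.Adj z u → u ∈ L') :
    HeapInv G (insert z S) z L' (i + 1) D T' g W Fr To good pr := by
  cases h
  constructor <;> grind [G.wt_pos_iff]

/-- If the priorities separate `X` from its complement, the search does not leave `X`. -/
theorem root_mem {X : Finset (Fin n)} (h : HeapInv G S v [] i D T g W Fr To good pr)
    (hgood : good) (hX : G.Separates pr X) (hSX : S ⊂ X) (hne : S.Nonempty) :
    T 1 ≠ 0 ∧ ∀ q, T 1 = q + 1 → ∀ z : Fin n, To (q + 1) = z → z ∈ X := by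
  obtain ⟨t, h1, h2⟩ := hX
  obtain ⟨a, ha, b, hb, hbS, hab, hle⟩ := h1 S hSX hne
  rcases h.full a ha b hbS hab with ⟨-, h3⟩ | ⟨q, hq, hTq, hFr, hTo⟩
  · simp at h3
  have hgq : W (q + 1) = G.wt a b ∧ g (q + 1) = pr s(a, b) := by
    rcases h.leaf q hq with h0 | ⟨-, -, u, -, w, e1, e2, e3, -, e4⟩
    · omega
    · rw [hFr] at e1
      rw [hTo] at e2
      rw [Fin.val_injective e1, Fin.val_injective e2]
      exact ⟨e3, e4 hgood⟩
  refine ⟨fun h0 => ?_, fun q' hq' z hz => ?_⟩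
  · have := h.root_eq_zero h0 q hq
    omega
  · obtain ⟨q₀, -, -, e0, -, u, hu, w, -, e2, e3, e4, e5⟩ := h.root_item (by omega)
    obtain rfl : q' = q₀ := by omega
    rw [hz] at e2
    obtain rfl := Fin.val_injective e2
    by_contra hzX
    -- If the winning edge left `X`, its ratio would exceed the threshold `t`, whereas the edge from
    -- `a` to `b` is also in the tree and has ratio at most `t`.
    have hm := (h.tourn.root h.valid).2 q hq
    rw [hTq, e0, e3, e5 hgood, hgq.1, hgq.2] at hm
    have hgt := h2 u (hSX.1 hu) z hzX e4
    have hab' : (0 : ℝ) < G.wt a b := by exact_mod_cast hab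
    have huz : (0 : ℝ) < G.wt u z := by exact_mod_cast e4
    have hm' : (pr s(u, z) : ℝ) * G.wt a b ≤ pr s(a, b) * G.wt u z := by exact_mod_cast hm
    nlinarith [mul_lt_mul_of_pos_right hgt hab', mul_le_mul_of_nonneg_right hle huz.le]

end HeapInv

/-- The partial sums while the adjacency list of `v` is scanned: `L` is the remaining list. -/
structure ScanInv (G : WeightedGraph n) (S : Finset (Fin n)) (v : Fin n) (L : List (Fin n))
    (cutA cutB vol : ℕ) : Prop where
  cut : cutA + (L.map fun u => if u ∈ S then 0 else G.wt v u).sum =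
    G.cutValue S + cutB + (L.map fun u => if u ∈ S then G.wt v u else 0).sum
  vol : vol + (L.map fun u => if u ∈ S then 0 else 1).sum = G.vol S

namespace ScanInv

variable {S : Finset (Fin n)} {v u : Fin n} {L : List (Fin n)} {cutA cutB vol : ℕ}

theorem mem (h : ScanInv G S v (u :: L) cutA cutB vol) (hu : u ∈ S) : ScanInv G S v L cutA (cutB + G.wt v u) vol := by
  cases h
  constructor <;> grind

theorem notMem (h : ScanInv G S v (u :: L) cutA cutB vol) (hu : u ∉ S) :
    ScanInv G S v L (cutA + G.wt v u) cutB (vol + 1) := by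
  cases h
  constructor <;> grind

/-- When `z` is added, the cut of the enlarged set differs from the old one by exactly the
contributions of the list of `z` that are still to be scanned. The number `cutA - cutB` is
maintained as two accumulators, so nothing is ever subtracted. -/
theorem insert (A : AdjLists G) {z : Fin n} (hz : z ∉ S) (hc : cutA = G.cutValue S + cutB)
    (hv : vol = G.vol S) : ScanInv G (Insert.insert z S) z (A.nbrs z) cutA cutB vol := by
  have hsum : ∀ f : Fin n → ℕ, ((A.nbrs z).map f).sum = ∑ u ∈ (A.nbrs z).toFinset, f u :=
    fun f => (List.sum_toFinset f (A.nodup z)).symm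
  have hadj : ∀ u, u ∈ (A.nbrs z).toFinset ↔ G.graph.Adj z u := fun u => by rw [List.mem_toFinset, A.mem_iff]
  have hwt : ∀ u, u ∉ (A.nbrs z).toFinset → G.wt z u = 0 := fun u hu => by
    rw [hadj] at hu; simp [WeightedGraph.wt, hu]
  have e1 : ((A.nbrs z).map fun u => if u ∈ Insert.insert z S then 0 else G.wt z u).sum =
      ∑ u ∈ (Insert.insert z S)ᶜ, G.wt z u := by
    rw [hsum, sum_subset (subset_univ _) (fun u _ hu => by simp [hwt u hu]),
      ← sum_filter_add_sum_filter_not univ (fun u => u ∈ Insert.insert z S)]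
    rw [sum_eq_zero (s := univ.filter fun u => u ∈ Insert.insert z S), zero_add]
    · refine sum_congr (by ext; simp) fun u hu => ?_
      rw [if_neg (mem_compl.1 hu)]
    · intro u hu; rw [if_pos (mem_filter.1 hu).2]
  have e2 : ((A.nbrs z).map fun u => if u ∈ Insert.insert z S then G.wt z u else 0).sum = ∑ u ∈ S, G.wt z u := by
    rw [hsum, sum_subset (subset_univ _) (fun u _ hu => by simp [hwt u hu]), ← sum_filter]
    refine Eq.trans (sum_congr (by ext; simp) fun u hu => rfl)
      (sum_insert_of_eq_zero_if_notMem (a := z) (s := S) fun _ => G.wt_self z)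
  have e3 : ((A.nbrs z).map fun u => if u ∈ Insert.insert z S then 0 else 1).sum = (G.outNbrs z S).card := by
    simp_rw [hsum, ← ite_not (_ ∈ _)]
    rw [← card_filter]
    congr 1
    ext u
    simp only [mem_filter, hadj, WeightedGraph.outNbrs, mem_univ, true_and, mem_insert, not_or]
    exact ⟨fun h => ⟨h.1, h.2.2⟩, fun h => ⟨h.1, fun e => G.graph.irrefl (e ▸ h.1), h.2⟩⟩
  refine ⟨?_, ?_⟩
  · rw [e1, e2, hc]
    have := G.cutValue_insert hz
    omega
  · rw [e3, hv, G.vol_insert hz]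

end ScanInv

end

section

/-! ### The search with adjacency lists -/

/-- Examine the next neighbour of the current vertex. -/
def scanProg : Stmt := set 40 (rd 1 (v 32) (v 33)) ;; set 41 (rd 2 (v 32) (v 33)) ;; set 33 (v 33 + 1) ;;
  ite (.bin .eq (ld 10 (v 40)) (v 28)) (set 37 (v 37 + v 41)) (set 36 (v 36 + v 41) ;; set 38 (v 38 + 1) ;;
      ite (v 41) (sto 13 (v 27 + 1) (v 41) ;; sto 12 (v 27 + 1) (v 40) ;; sto 7 (v 27 + 1) (v 32) ;;
        set 44 (v 27) ;; set 45 (v 27 + 1) ;; updProg) .skip)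

/-- Add vertex `40` to the explored set, or give up. -/
def addProg : Stmt := set 41 (rd 0 (v 40) 0) ;; ite (.bin .lt (v 39 + 1) (v 3) * .bin .lt (v 35 + v 41) (2 * v 2))
    (sto 10 (v 40) (v 28) ;; sto 9 (v 39) (v 40) ;; set 39 (v 39 + 1) ;; set 35 (v 35 + v 41) ;;
      set 32 (v 40) ;; set 33 0 ;; set 34 (v 41))
    (set 31 0)

/-- Return the explored set, or pop an edge from the heap. -/
def decideProg : Stmt := ite (.bin .lt (v 38) (v 2) * .bin .lt (v 36) (v 4 + v 37)) (set 30 1 ;; set 31 0)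
    (set 46 (ld 11 1) ;; ite (v 46) (set 40 (ld 12 (v 46)) ;; set 44 (v 46 - 1) ;; set 45 0 ;;
          ite (.bin .eq (ld 10 (v 40)) (v 28)) .skip addProg ;; updProg)
        (set 31 0))

/-- Step `i` of run `r` reads the random word `r * I + i` and no other. This fixed schedule is what
makes the adaptive argument applicable. -/
def stepProg : Stmt := sto 8 (v 27 + 1) (ld 14 (v 26 * v 12 + v 27)) ;;
  ite (v 31) (ite (.bin .lt (v 33) (v 34)) scanProg decideProg) .skip

/-- Start a search from the vertex `1`. -/
def initProg : Stmt := .loop 20 (2 * v 14) (sto 11 (v 20) 0) ;; set 28 (v 26 + 1) ;; sto 10 (v 1) (v 28) ;;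
    sto 9 0 (v 1) ;; set 39 1 ;; set 32 (v 1) ;; set 33 0 ;; set 34 (rd 0 (v 1) 0) ;; set 35 (v 34) ;;
    set 36 0 ;; set 37 0 ;; set 38 0 ;; set 31 (.bin .lt (v 34) (2 * v 2))

/-- One search from the vertex `1`. -/
def runProg : Stmt := ite (v 30) .skip (initProg ;; .loop 27 (v 12) stepProg)

/-- The first assignment gives the empty item `0` the ratio `1 / 0`. Between runs array `10` is not
cleared, since each run marks with its own number. -/
def mainProg : Stmt := sto 8 0 1 ;; set 30 0 ;; .loop 26 (v 11) runProg

variable {n : ℕ} {G : WeightedGraph n} (A : AdjLists G)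

theorem AdjLists.input_zero (u : Fin n) (i : ℕ) : A.input 0 u i = (A.nbrs u).length := by simp [AdjLists.input, u.2]

theorem AdjLists.input_one (u : Fin n) {i : ℕ} {L : List (Fin n)} {w : Fin n}
    (h : (A.nbrs u).drop i = w :: L) : A.input 1 u i = w := by
  have hi : i < (A.nbrs u).length := by
    by_contra hi
    rw [List.drop_eq_nil_of_le (by omega)] at h
    exact List.cons_ne_nil _ _ h.symm
  rw [List.drop_eq_getElem_cons hi, List.cons.injEq] at h
  simp [AdjLists.input, u.2, hi, h.1]

theorem AdjLists.input_two (u : Fin n) {i : ℕ} {L : List (Fin n)} {w : Fin n}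
    (h : (A.nbrs u).drop i = w :: L) : A.input 2 u i = G.wt u w := by
  have hi : i < (A.nbrs u).length := by
    by_contra hi
    rw [List.drop_eq_nil_of_le (by omega)] at h
    exact List.cons_ne_nil _ _ h.symm
  rw [List.drop_eq_getElem_cons hi, List.cons.injEq] at h
  have hadj : G.graph.Adj u w := by rw [← A.mem_iff, ← h.1]; exact List.getElem_mem hi
  simp [AdjLists.input, u.2, hi, h.1, WeightedGraph.wt, hadj]

open Classical in
/-- The edge that is put into the heap in the next step. -/
noncomputable def edgeAt (s : State) : Option (Sym2 (Fin n)) := if h : s.reg 32 < n then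
    if s.reg 31 = 0 then none else ((A.nbrs ⟨s.reg 32, h⟩).drop (s.reg 33)).head?.bind fun u =>
        if s.arr 10 u = s.reg 28 ∨ G.wt ⟨s.reg 32, h⟩ u = 0 then none else some s(⟨s.reg 32, h⟩, u)
  else none

/-- The search is active: `S` is the explored set, and `u` the vertex added last. -/
structure Active (x : Fin n) (ν σ D : ℕ) (X : Finset (Fin n)) (good : Prop) (pr : Sym2 (Fin n) → ℕ)
    (f : ℕ → Option (Sym2 (Fin n))) (i : ℕ) (s : State) (S : Finset (Fin n)) (u : Fin n) : Prop where
  fnd : s.reg 30 = 0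
  cur : s.reg 32 = u
  cur_mem : u ∈ S
  root_mem : x ∈ S
  ptr : s.reg 33 ≤ (A.nbrs u).length
  deg : s.reg 34 = (A.nbrs u).length
  marks : ∀ w : Fin n, s.arr 10 w = s.reg 28 ↔ w ∈ S
  card : s.reg 39 = S.card
  card_lt : S.card < σ
  list : (range S.card).image (s.arr 9) = S.image Fin.val
  sum : s.reg 35 = ∑ w ∈ S, (A.nbrs w).length
  sum_lt : s.reg 35 < 2 * ν
  scan : ScanInv G S u ((A.nbrs u).drop (s.reg 33)) (s.reg 36) (s.reg 37) (s.reg 38)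
  heap : HeapInv G S u ((A.nbrs u).drop (s.reg 33)) i D (s.arr 11) (s.arr 8) (s.arr 13) (s.arr 7) (s.arr 12) good pr
  count : i + heapCard (s.arr 11) D + 2 * s.reg 34 ≤ 2 * s.reg 35 + 2 * s.reg 33
  sub : good → S ⊆ X
  hist : ∀ q < i, ∀ e, f q = some e → ∃ a ∈ S, ∃ b, e = s(a, b) ∧ (a = u → b ∈ (A.nbrs u).take (s.reg 33))
  bound : s.reg 36 ≤ i * G.maxWeight ∧ s.reg 37 ≤ i * G.maxWeight ∧ s.reg 38 ≤ i

/-- The search has returned a set. -/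
def Found (G : WeightedGraph n) (x : Fin n) (ν σ k : ℕ) (s : State) : Prop :=
  ∃ S, G.IsLocalSet x ν σ k S ∧ s.reg 39 = S.card ∧ (range S.card).image (s.arr 9) = S.image Fin.val

/-- The invariant of the search. -/
structure SearchInv (x : Fin n) (ν σ k D : ℕ) (X : Finset (Fin n)) (good : Prop)
    (pr : Sym2 (Fin n) → ℕ) (f : ℕ → Option (Sym2 (Fin n))) (i : ℕ) (s : State) : Prop where
  zero : s.arr 8 0 = 1 ∧ s.arr 13 0 = 0
  marks : ∀ u, s.arr 10 u ≤ s.reg 28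
  active : s.reg 31 ≠ 0 → ∃ S u, Active A x ν σ D X good pr f i s S u
  found : s.reg 30 ≠ 0 → Found G x ν σ k s
  good : good → s.reg 30 ≠ 0 ∨ s.reg 31 ≠ 0

/-- The constants of the search. -/
structure SearchRegs (G : WeightedGraph n) (x : Fin n) (ν σ k D I r : ℕ) (s : State) : Prop where
  x : s.reg 1 = x
  vol : s.reg 2 = ν
  size : s.reg 3 = σ
  cut : s.reg 4 = k
  len : s.reg 12 = I
  depth : s.reg 13 = D
  cap : s.reg 14 = 2 ^ D
  run : s.reg 26 = r

variable {A} {x : Fin n} {ν σ k D I r : ℕ} {X : Finset (Fin n)} {good : Prop} {pr : Sym2 (Fin n) → ℕ}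
  {f : ℕ → Option (Sym2 (Fin n))} {i : ℕ} {s : State} {S : Finset (Fin n)} {u : Fin n} {B : ℕ}

theorem Active.edgeAt_eq (h : Active A x ν σ D X good pr f i s S u) (ha : s.reg 31 ≠ 0) {w : Fin n}
    {L : List (Fin n)} (hL : (A.nbrs u).drop (s.reg 33) = w :: L) (hw : w ∉ S)
    (h0 : G.wt u w ≠ 0) : edgeAt A s = some s(u, w) := by
  have h1 : s.reg 32 < n := by rw [h.cur]; exact u.2
  have h2 : (⟨s.reg 32, h1⟩ : Fin n) = u := Fin.ext h.cur
  rw [edgeAt, dif_pos h1, if_neg ha, h2, hL]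
  have : s.arr 10 w ≠ s.reg 28 := fun h3 => hw ((h.marks w).1 h3)
  simp [this, h0]

theorem Active.of_edgeAt (h : Active A x ν σ D X good pr f i s S u) {e : Sym2 (Fin n)}
    (he : edgeAt A s = some e) : ∃ w L, (A.nbrs u).drop (s.reg 33) = w :: L ∧ w ∉ S ∧ G.wt u w ≠ 0 ∧ e = s(u, w) := by
  have h1 : s.reg 32 < n := by rw [h.cur]; exact u.2
  have h2 : (⟨s.reg 32, h1⟩ : Fin n) = u := Fin.ext h.cur
  rw [edgeAt, dif_pos h1, h2] at he
  by_cases ha : s.reg 31 = 0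
  · simp [ha] at he
  rw [if_neg ha] at he
  cases hd : (A.nbrs u).drop (s.reg 33) with
  | nil => rw [hd] at he; simp at he
  | cons w L =>
    rw [hd] at he
    simp [h.marks] at he
    simp_all

/-- An edge seen before had an explored end `a`. If `a` is the current vertex, the other end
precedes the pointer in a list without repetitions; if `a` is the far end, then that end is explored
and the edge would not be inserted now. -/
theorem Active.edge_new (h : Active A x ν σ D X good pr f i s S u) {e : Sym2 (Fin n)}
    (he : edgeAt A s = some e) {q : ℕ} (hq : q < i) : f q ≠ some e := by
  intro hfq
  obtain ⟨w, L, hL, hw, -, rfl⟩ := h.of_edgeAt he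
  obtain ⟨a, ha, b, hab, h1⟩ := h.hist q hq _ hfq
  rcases Sym2.eq_iff.1 hab with ⟨rfl, rfl⟩ | ⟨rfl, rfl⟩
  · have hd := List.disjoint_take_drop (A.nodup u) (le_refl (s.reg 33))
    exact hd (h1 rfl) (by rw [hL]; simp)
  · exact hw ha

/-- Advancing the pointer raises the right side of `count` by two: one unit pays for the step, one
for an item that may enter the heap. -/
theorem scanProg_tr (hp : SearchRegs G x ν σ k D I r s) (ha : s.reg 31 ≠ 0)
    (h : Active A x ν σ D X good pr f i s S u) (hI : I ≤ 2 ^ D) (hi : i < I) (h27 : s.reg 27 = i)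
    (hf : f i = edgeAt A s) (hlab : good → ∀ e, f i = some e → s.arr 8 (i + 1) = pr e)
    (hlt : s.reg 33 < s.reg 34) (hB1 : (I + 1) * (G.maxWeight + 1) < B) (hB2 : 2 * 2 ^ D < B)
    (hdeg : ∀ w, (A.nbrs w).length < B) :
    Tr A.input B scanProg s (fun s' => s'.reg 31 = s.reg 31 ∧
      Active A x ν σ D X good pr f (i + 1) s' S u ∧ s'.arr 8 = s.arr 8 ∧ s'.arr 13 0 = s.arr 13 0 ∧
      s'.time ≤ s.time + 6 * D + 20) := by
  obtain ⟨w, L, hL⟩ : ∃ w L, (A.nbrs u).drop (s.reg 33) = w :: L :=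
    ⟨_, _, List.drop_eq_getElem_cons (by rw [← h.deg]; exact hlt)⟩
  have hL' : (A.nbrs u).drop (s.reg 33 + 1) = L := by rw [← List.tail_drop, hL, List.tail_cons]
  have htake : (A.nbrs u).take (s.reg 33 + 1) = (A.nbrs u).take (s.reg 33) ++ [w] := by rw [List.take_add, hL]; rfl
  have hsub : ∀ b, b ∈ (A.nbrs u).take (s.reg 33) → b ∈ (A.nbrs u).take (s.reg 33 + 1) := by simp_all
  have e1 : A.input 1 (s.reg 32) (s.reg 33) = w := by rw [h.cur]; exact A.input_one u hL
  have e2 : A.input 2 (s.reg 32) (s.reg 33) = G.wt u w := by rw [h.cur]; exact A.input_two u hL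
  have hwt := G.wt_le_maxWeight u w
  have hd := hdeg u
  have hdd := h.deg
  obtain ⟨b1, b2, b3⟩ := h.bound
  have him : i * G.maxWeight + G.maxWeight ≤ I * G.maxWeight := by
    rw [← Nat.succ_mul]; exact Nat.mul_le_mul_right _ hi
  have hIm : I * G.maxWeight + I < B := by linarith
  have hist : ∀ q < i + 1, ∀ e, f q = some e → ∃ a ∈ S, ∃ b, e = s(a, b) ∧
      (a = u → b ∈ (A.nbrs u).take (s.reg 33 + 1)) := by
    intro q hq e he
    rcases Nat.lt_succ_iff_lt_or_eq.1 hq with hq | rfl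
    · obtain ⟨a, h1, b, h2, h3⟩ := h.hist q hq e he
      exact ⟨a, h1, b, h2, fun h4 => hsub b (h3 h4)⟩
    · rw [hf] at he
      obtain ⟨w', L', h1, -, -, h4⟩ := h.of_edgeAt he
      rw [hL, List.cons.injEq] at h1
      exact ⟨u, h.cur_mem, w', h4, fun _ => by rw [htake, h1.1]; simp⟩
  have hcount := h.count
  have hscan := h.scan
  have hheap := h.heap
  rw [hL] at hscan hheap
  have hmw : s.arr 10 w = s.reg 28 ↔ w ∈ S := h.marks w
  rw [scanProg]
  simp only [Tr_seq, Tr_set, Tr_ite]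
  simp only [Ex.eval_v, Ex.eval_add, Ex.eval_rd, Ex.eval_eq, Ex.eval_ld, Ex.eval_ofNat,
    State.set_reg, State.set_arr, State.tick_reg, State.tick_arr, e1, e2, Nat.reduceEqDiff,
    ↓reduceIte, Ex.triv_rd, true_or, true_and, Ex.triv_add, false_or]
  refine ⟨by omega, ?_, ?_⟩
  · intro hc
    have hw : w ∈ S := by by_contra h0; simp [hmw, h0] at hc
    refine ⟨by omega, ?_, by simp; omega⟩
    cases h
    constructor
    all_goals first | assumption | simp <;> first | assumption | omega | skip
    · simpa [hL'] using hscan.mem hw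
    · simpa [hL'] using hheap.skip (Or.inl hw)
    · rw [Nat.add_mul]; omega
  · intro hc
    have hw : w ∉ S := by intro h0; simp [hmw, h0] at hc
    refine ⟨by omega, by omega, ?_, ?_⟩
    · intro h0
      simp only [Tr_sto, Ex.eval_v, Ex.eval_add, Ex.eval_ofNat, State.set_reg,
        State.tick_reg, State.put_reg, Nat.reduceEqDiff,
        ↓reduceIte, Ex.triv_v, true_or, true_and, h27]
      have h2D : i < 2 ^ D := by omega
      have htc := hheap.tourn_congr (G.wt u w)
      refine ⟨by omega, (updProg_tr ?_ ?_ ?_ ?_).mono ?_⟩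
      · simp [hp.cap, hp.depth]
      · simp [hp.cap, h2D]
      · simpa [hp.depth] using htc
      · simpa [hp.cap] using hB2
      rintro s' hF ⟨t1, t2, t3⟩
      have hr : ∀ y, y < 44 → y ≠ 33 → y ≠ 36 → y ≠ 38 → y ≠ 40 → y ≠ 41 → s'.reg y = s.reg y := by
        intro y h1 h2 h3 h4 h5 h6
        have e' : ∀ m, 44 ≤ m → y ≠ m := fun m hm => by omega
        rw [hF.reg y (by simp [updProg, Stmt.writes]; omega)]
        simp [h2, h3, h4, h5, h6, e' 44, e' 45]
      have r33 : s'.reg 33 = s.reg 33 + 1 := by rw [hF.reg 33 rfl]; simp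
      have r36 : s'.reg 36 = s.reg 36 + G.wt u w := by rw [hF.reg 36 rfl]; simp
      have r38 : s'.reg 38 = s.reg 38 + 1 := by rw [hF.reg 38 rfl]; simp
      have a9 : s'.arr 9 = s.arr 9 := by rw [hF.arr 9 rfl]; simp
      have a10 : s'.arr 10 = s.arr 10 := by rw [hF.arr 10 rfl]; simp
      have a8 : s'.arr 8 = s.arr 8 := by rw [hF.arr 8 rfl]; simp
      have a13 : s'.arr 13 = update (s.arr 13) (i + 1) (G.wt u w) := by rw [hF.arr 13 rfl]; simp
      have a12 : s'.arr 12 = update (s.arr 12) (i + 1) w := by rw [hF.arr 12 rfl]; simp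
      have a7 : s'.arr 7 = update (s.arr 7) (i + 1) u := by rw [hF.arr 7 rfl]; simp [h.cur]
      simp [hp.cap, hp.depth] at t1 t2 t3
      have hpush := hheap.push h.cur_mem (by omega) h2D
        (fun hgd => hlab hgd _ (hf.trans (h.edgeAt_eq ha hL hw h0))) t1 t2
      have hcard := heapCard_update h2D t2
      have hs := hscan.notMem hw
      simp only [hr, ne_eq, Nat.reduceLT, Nat.reduceEqDiff, not_false_eq_true, true_and]
      refine ⟨?_, a8, by rw [a13, update_of_ne (by omega)], by omega⟩
      rw [← hL'] at hs hpush
      cases h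
      constructor <;> try simp only [hr, r33, r36, r38, a8, a9, a10, a13, a12, a7, ne_eq, Nat.reduceLT,
        Nat.reduceEqDiff, not_false_eq_true]
      all_goals first | assumption | skip
      · omega
      · rw [if_neg i.succ_ne_zero] at hcard
        omega
      · rw [Nat.add_mul]; omega
    · intro h0
      rw [Tr_skip]
      refine ⟨by simp, ?_, by simp, by simp, by simp; omega⟩
      cases h
      constructor
      all_goals first | assumption | simp <;> first | assumption | omega | skip
      · simpa [hL'] using hscan.notMem hw
      · simpa [hL'] using hheap.skip (Or.inr h0)
      · rw [Nat.add_mul]; omega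

end

/-! ### The decision step: return, pop, add or give up -/

section

variable {n : ℕ} {G : WeightedGraph n} {A : AdjLists G}
variable {x : Fin n} {ν σ k D I r : ℕ} {X : Finset (Fin n)} {good : Prop} {pr : Sym2 (Fin n) → ℕ}
  {f : ℕ → Option (Sym2 (Fin n))} {i : ℕ} {s : State} {S : Finset (Fin n)} {u : Fin n} {B : ℕ}

theorem AdjLists.sum_length_le (A : AdjLists G) (S : Finset (Fin n)) : ∑ w ∈ S, (A.nbrs w).length ≤ 2 * G.vol S := by
  classical
  refine le_trans (le_of_eq (sum_congr rfl fun w _ => ?_)) (G.sum_degree_le S)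
  rw [← List.toFinset_card_of_nodup (A.nodup w), ← SimpleGraph.card_neighborFinset_eq_degree]
  congr 1
  ext z
  simp [A.mem_iff]

theorem edgeAt_congr {s s' : State} (h28 : s'.reg 28 = s.reg 28) (h31 : s'.reg 31 = s.reg 31)
    (h32 : s'.reg 32 = s.reg 32) (h33 : s'.reg 33 = s.reg 33) (h10 : s'.arr 10 = s.arr 10) :
    edgeAt A s' = edgeAt A s := by
  unfold edgeAt
  simp only [h28, h31, h32, h33, h10]

/-- When the list is exhausted the accumulators give the true volume and cut value of `S`. A pop
lowers the size of the heap by one and so pays for itself in `count`; after adding `z` the terms for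
its degree balance on both sides. -/
theorem decideProg_tr (hp : SearchRegs G x ν σ k D I r s) (ha : s.reg 31 ≠ 0)
    (hz : s.arr 8 0 = 1 ∧ s.arr 13 0 = 0) (hm : ∀ u, s.arr 10 u ≤ s.reg 28)
    (h : Active A x ν σ D X good pr f i s S u)
    (hgood : good → G.IsLocalSet x ν σ k X ∧ G.Separates pr X)
    (hf : f i = edgeAt A s) (hlt : ¬ s.reg 33 < s.reg 34)
    (hB1 : 2 * ν < B) (hB2 : 2 * 2 ^ D < B) (hB3 : σ < B) :
    Tr A.input B decideProg s (fun s' => SearchInv A x ν σ k D X good pr f (i + 1) s' ∧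
      s'.time ≤ s.time + 6 * D + 25) := by
  have hptr : s.reg 33 = (A.nbrs u).length := by have := h.ptr; have := h.deg; omega
  have hdeg := h.deg
  have hL : (A.nbrs u).drop (s.reg 33) = [] := List.drop_eq_nil_of_le hptr.ge
  have hfi : f i = none := by
    rw [hf]
    by_contra hc
    obtain ⟨e, he⟩ := Option.ne_none_iff_exists'.1 hc
    obtain ⟨w, L, h1, -⟩ := h.of_edgeAt he
    rw [hL] at h1
    simp at h1
  have hscan := h.scan
  have hheap := h.heap
  rw [hL] at hscan hheap
  have hcut := hscan.cut
  have hvol := hscan.vol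
  simp at hcut hvol
  have hlocal : s.reg 38 < ν → s.reg 36 < k + s.reg 37 → G.IsLocalSet x ν σ k S :=
    fun h1 h2 => ⟨h.root_mem, by omega, h.card_lt, by omega⟩
  have hcount := h.count
  have hcd := h.card
  have hcl := h.card_lt
  have hsl := h.sum_lt
  obtain ⟨b1, b2, b3⟩ := h.bound
  -- The set `X` would pass the test, so a failed test means that `S` is still a strict subset of
  -- `X`.
  have hsub : ¬ (s.reg 38 < ν ∧ s.reg 36 < k + s.reg 37) → good → S ⊂ X := by
    intro hc hg
    refine ⟨h.sub hg, fun hXS => hc ?_⟩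
    obtain rfl : S = X := Finset.Subset.antisymm (h.sub hg) hXS
    obtain ⟨-, h1, -, h2⟩ := (hgood hg).1
    omega
  rw [decideProg, Tr_ite]
  simp only [Ex.eval_mul, Ex.eval_lt', Ex.eval_v, Ex.eval_add, hp.vol, hp.cut]
  constructor
  · intro hc
    have hc1 : s.reg 38 < ν ∧ s.reg 36 < k + s.reg 37 := by simp_all
    simp only [Tr_seq, Tr_set, Ex.triv_ofNat, true_or, true_and, Ex.eval_ofNat]
    exact ⟨⟨by simpa using hz, by simpa using hm, by simp, fun _ => ⟨S, hlocal hc1.1 hc1.2,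
      by simpa using hcd, by simpa using h.list⟩, fun _ => by simp⟩, by simp; omega⟩
  · intro hc
    have hc1 : ¬ (s.reg 38 < ν ∧ s.reg 36 < k + s.reg 37) := by intro h0; simp [h0] at hc
    have hroot : good → s.arr 11 1 ≠ 0 ∧ ∀ q, s.arr 11 1 = q + 1 →
        ∀ z : Fin n, s.arr 12 (q + 1) = z → z ∈ X := fun hg =>
      hheap.root_mem hg (hgood hg).2 (hsub hc1 hg) ⟨u, h.cur_mem⟩
    simp only [Tr_seq, Tr_set, Tr_ite]
    simp only [Ex.eval_v, Ex.eval_ld, Ex.eval_ofNat, State.set_reg, State.set_arr, State.tick_reg,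
      State.tick_arr, Nat.reduceEqDiff, ↓reduceIte, Ex.triv_ld, true_or, true_and, Ex.triv_sub,
      Ex.triv_v, Ex.triv_ofNat, Ex.eval_sub, Ex.eval_eq]
    constructor
    · intro h0
      obtain ⟨q, hq, hqi, hT1, hTq, a, haS, z, e1, e2, e3, e4, e5⟩ := hheap.root_item h0
      have hzX : good → z ∈ X := fun hg => (hroot hg).2 q hT1 z e2
      have hmz := h.marks z
      rw [hT1, e2, Nat.add_sub_cancel]
      have hcard : ∀ T' : ℕ → ℕ, (∀ p, T' (2 ^ D + p) = if p = q then 0 else s.arr 11 (2 ^ D + p)) →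
          heapCard T' D + 1 = heapCard (s.arr 11) D := by
        intro T' hT'
        have := heapCard_update hq hT'
        simpa [hTq] using this
      constructor
      · intro hc
        have hzS : z ∈ S := by by_contra h1; simp [hmz, h1] at hc
        rw [Tr_skip]
        refine (updProg_tr ?_ ?_ ?_ ?_).mono ?_
        · simp [hp.cap, hp.depth]
        · simpa [hp.cap] using hq
        · simpa [hp.depth] using hheap.tourn
        · simpa [hp.cap] using hB2
        rintro s' hF ⟨t1, t2, t3⟩
        have hr : ∀ y, y < 44 → y ≠ 40 → s'.reg y = s.reg y := by
          intro y h1 h2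
          rw [hF.reg y (by simp [updProg, Stmt.writes]; omega)]
          simp [h2, show y ≠ 44 by omega, show y ≠ 45 by omega, show y ≠ 46 by omega]
        have har : ∀ t, t ≠ 11 → s'.arr t = s.arr t := by
          intro t ht
          rw [hF.arr t (by simpa [updProg, Stmt.stores] using ht.symm)]; simp
        simp [hp.cap, hp.depth] at t1 t2 t3
        have hhp := hheap.pop t1 t2 e2 hzS
        have hcT := hcard _ t2
        refine ⟨⟨by rw [har 8 (by omega), har 13 (by omega)]; exact hz,
          by rw [har 10 (by omega), hr 28 (by omega) (by omega)]; exact hm,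
          fun _ => ⟨S, u, ?_⟩, fun h30 => absurd (hr 30 (by omega) (by omega) ▸ h.fnd) h30,
          fun _ => Or.inr (by rw [hr 31 (by omega) (by omega)]; exact ha)⟩, by omega⟩
        have h' := h
        cases h'
        constructor <;> try simp only [hr, har, hL, ne_eq, Nat.reduceLT, Nat.reduceEqDiff, not_false_eq_true]
        all_goals first | assumption | skip
        · omega
        · grind
        · rw [Nat.add_mul]; omega
      · intro hc
        have hzS : z ∉ S := by intro h1; simp [hmz, h1] at hc
        have hdz := A.input_zero z 0
        have hsum : ∑ w ∈ insert z S, (A.nbrs w).length = (A.nbrs z).length + s.reg 35 := by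
          rw [sum_insert hzS, h.sum]
        have hcardz : (insert z S).card = S.card + 1 := card_insert_of_notMem hzS
        simp only [addProg, Tr_seq, Tr_set, Tr_ite]
        simp only [Ex.eval_v, Ex.eval_rd, Ex.eval_ofNat, State.set_reg, State.tick_reg,
          Nat.reduceEqDiff, ↓reduceIte, Ex.triv_rd, true_or, true_and,
          Ex.triv_v, Ex.triv_ofNat, Ex.eval_lt', Ex.eval_mul, Ex.eval_add, hdz, hp.size, hp.vol]
        constructor
        · intro hd
          have hd1 : s.reg 39 + 1 < σ ∧ s.reg 35 + (A.nbrs z).length < 2 * ν := by grind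
          simp only [Tr_sto, Ex.eval_v, State.set_reg,
            State.tick_reg, State.put_reg, Nat.reduceEqDiff,
            ↓reduceIte, Ex.triv_v, true_or, true_and, Ex.triv_add, false_or]
          refine ⟨by omega, by omega, (updProg_tr ?_ ?_ ?_ ?_).mono ?_⟩
          · simp [hp.cap, hp.depth]
          · simpa [hp.cap] using hq
          · simpa [hp.depth] using hheap.tourn
          · simpa [hp.cap] using hB2
          rintro s' hF ⟨t1, t2, t3⟩
          have hr : ∀ y, y < 32 → s'.reg y = s.reg y := by
            intro y h1
            rw [hF.reg y (by simp [updProg, Stmt.writes]; omega)]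
            have : ∀ m, 32 ≤ m → y ≠ m := by omega
            simp [this]
          have r32 : s'.reg 32 = z := by rw [hF.reg 32 rfl]; simp
          have r33 : s'.reg 33 = 0 := by rw [hF.reg 33 rfl]; simp
          have r34 : s'.reg 34 = (A.nbrs z).length := by rw [hF.reg 34 rfl]; simp
          have r35 : s'.reg 35 = s.reg 35 + (A.nbrs z).length := by rw [hF.reg 35 rfl]; simp
          have r36 : s'.reg 36 = s.reg 36 := by rw [hF.reg 36 rfl]; simp
          have r37 : s'.reg 37 = s.reg 37 := by rw [hF.reg 37 rfl]; simp
          have r38 : s'.reg 38 = s.reg 38 := by rw [hF.reg 38 rfl]; simp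
          have r39 : s'.reg 39 = s.reg 39 + 1 := by rw [hF.reg 39 rfl]; simp
          have har : ∀ t, t ≠ 11 → t ≠ 10 → t ≠ 9 → s'.arr t = s.arr t := by
            intro t h1 h2 h3
            rw [hF.arr t (by simpa [updProg, Stmt.stores] using h1.symm)]; simp [h2, h3]
          have a9 : s'.arr 9 = update (s.arr 9) (s.reg 39) z := by rw [hF.arr 9 rfl]; simp
          have a10 : s'.arr 10 = update (s.arr 10) z (s.reg 28) := by rw [hF.arr 10 rfl]; simp
          simp [hp.cap, hp.depth] at t1 t2 t3
          have hha := hheap.add t1 t2 e2 (fun w hw => (A.mem_iff z w).2 hw)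
          have hcT := hcard _ t2
          refine ⟨⟨by rw [har 8 (by omega) (by omega) (by omega), har 13 (by omega) (by omega) (by omega)]; exact hz,
            ?_, fun _ => ⟨insert z S, z, ?_⟩,
            fun h30 => absurd (hr 30 (by omega) ▸ h.fnd) h30,
            fun _ => Or.inr (by rw [hr 31 (by omega)]; exact ha)⟩, by omega⟩
          · intro w
            rw [a10, hr 28 (by omega), update_apply]
            split_ifs
            · exact le_rfl
            · exact hm w
          have h' := h
          cases h'
          constructor <;> try simp only [hr, har, r33, r36, r37, r38, hcardz, ne_eq, Nat.reduceLT, Nat.reduceEqDiff,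
            not_false_eq_true]
          all_goals first | assumption | omega | skip
          · exact mem_insert_self _ _
          · exact mem_insert_of_mem h.root_mem
          · intro w
            rw [a10, update_apply, mem_insert]
            by_cases hwz : w = z
            · simp [hwz]
            · rw [if_neg fun h1 => hwz (Fin.val_injective h1), h.marks w]; simp [hwz]
          · rw [a9, range_add_one, image_insert, image_insert, hcd, update_self, ← h.list]
            congr 1
            refine image_congr fun j hj => update_of_ne ?_ _ _
            have := mem_range.1 hj
            omega
          · exact ScanInv.insert A hzS (by omega) (by omega)
          · grind
          · intro p hpi e he
            rcases Nat.lt_succ_iff_lt_or_eq.1 hpi with hpi | rfl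
            · obtain ⟨a, h1, b, h2, -⟩ := h.hist p hpi e he
              exact ⟨a, mem_insert_of_mem h1, b, h2, fun h3 => absurd (h3 ▸ h1) hzS⟩
            · rw [hfi] at he; simp at he
          · rw [Nat.add_mul]; omega
        · intro hd
          refine (updProg_tr ?_ ?_ ?_ ?_).mono ?_
          · simp [hp.cap, hp.depth]
          · simpa [hp.cap] using hq
          · simpa [hp.depth] using hheap.tourn
          · simpa [hp.cap] using hB2
          rintro s' hF ⟨-, -, t3⟩
          have hr : ∀ y, y < 31 → s'.reg y = s.reg y := by
            intro y h1
            rw [hF.reg y (by simp [updProg, Stmt.writes]; omega)]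
            have : ∀ m, 31 ≤ m → y ≠ m := by omega
            simp [this]
          have r31 : s'.reg 31 = 0 := by rw [hF.reg 31 rfl]; simp
          have har : ∀ t, t ≠ 11 → s'.arr t = s.arr t := by
            intro t ht
            rw [hF.arr t (by simpa [updProg, Stmt.stores] using ht.symm)]; simp
          simp [hp.depth] at t3
          refine ⟨⟨by rw [har 8 (by omega), har 13 (by omega)]; exact hz,
            by rw [har 10 (by omega), hr 28 (by omega)]; exact hm,
            fun h31 => absurd r31 h31, fun h30 => absurd (hr 30 (by omega) ▸ h.fnd) h30,
            fun hg => ?_⟩, by omega⟩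
          -- In a good run giving up is impossible: the enlarged set lies in `X`, so its size is
          -- below `σ` and its degree sum is at most `2 * vol X < 2 * ν`.
          exfalso
          obtain ⟨⟨-, l1, l2, -⟩, -⟩ := hgood hg
          have hins : insert z S ⊆ X := by grind
          have c1 := card_le_card hins
          have c2 := A.sum_length_le (insert z S)
          have c3 := G.vol_mono hins
          have d1 : s.reg 39 + 1 < σ := by omega
          have d2 : s.reg 35 + (A.nbrs z).length < 2 * ν := by omega
          simp [d1, d2] at hd
    · intro h0
      refine ⟨⟨by simpa using hz, by simpa using hm, by simp, fun h30 => absurd h.fnd (by simpa using h30),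
        fun hg => absurd h0 (hroot hg).1⟩, by simp; omega⟩

theorem stepProg_tr (hp : SearchRegs G x ν σ k D I r s) (h : SearchInv A x ν σ k D X good pr f i s)
    (hgood : good → G.IsLocalSet x ν σ k X ∧ G.Separates pr X) (hI : I ≤ 2 ^ D) (hi : i < I)
    (hf : f i = edgeAt A s)
    (hlab : good → ∀ e, f i = some e → s.arr 14 (r * I + i) = pr e)
    (hB1 : (I + 1) * (G.maxWeight + 1) < B) (hB2 : 2 * 2 ^ D < B)
    (hB3 : σ < B) (hB4 : 2 * ν < B) (hdeg : ∀ w, (A.nbrs w).length < B) :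
    Tr A.input B stepProg (s.set 27 i) (fun s' => SearchInv A x ν σ k D X good pr f (i + 1) s' ∧
      s'.time ≤ s.time + (6 * D + 30)) := by
  set y := s.arr 14 (r * I + i) with hy
  set s1 := (s.set 27 i).put 8 (i + 1) y with hs1
  have e1 : (Stmt.sto 8 (v 27 + 1) (ld 14 (v 26 * v 12 + v 27))).run A.input (s.set 27 i) = s1 := by
    simp [Stmt.run, hs1, hp.run, hp.len, hy]
  have hr : ∀ y, y ≠ 27 → s1.reg y = s.reg y := by intro y h0; simp [hs1, h0]
  have har : ∀ t, t ≠ 8 → s1.arr t = s.arr t := by intro t h0; simp [hs1, h0]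
  have a8 : s1.arr 8 = update (s.arr 8) (i + 1) y := by simp [hs1]
  have t1 : s1.time = s.time + 2 := rfl
  have hp1 : SearchRegs G x ν σ k D I r s1 := by
    cases hp
    constructor <;> simp only [hr, ne_eq, Nat.reduceEqDiff, not_false_eq_true] <;> assumption
  have hz1 : s1.arr 8 0 = 1 ∧ s1.arr 13 0 = 0 := by
    rw [a8, har 13 (by omega), update_of_ne (by omega)]; exact h.zero
  have hm1 : ∀ u, s1.arr 10 u ≤ s1.reg 28 := by rw [har 10 (by omega), hr 28 (by omega)]; exact h.marks
  have hedge : edgeAt A (s1.tick 1 |>.tick 1) = edgeAt A s := by rfl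
  rw [stepProg, Tr_seq]
  refine ⟨by simp [Stmt.safe], ?_⟩
  beta_reduce
  rw [e1, Tr_ite]
  simp only [Ex.eval_v]
  constructor
  · intro h31
    rw [hr 31 (by omega)] at h31
    obtain ⟨S, u, hact⟩ := h.active h31
    have hact2 : Active A x ν σ D X good pr f i (s1.tick 1 |>.tick 1) S u := by
      have q : ∀ y, y ≠ 27 → (s1.tick 1 |>.tick 1).reg y = s.reg y := hr
      have qa : ∀ t, t ≠ 8 → (s1.tick 1 |>.tick 1).arr t = s.arr t := har
      have qa8 : (s1.tick 1 |>.tick 1).arr 8 = _ := a8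
      have hh := hact.heap.load y
      cases hact
      constructor <;> try simp only [q, qa, qa8, ne_eq, Nat.reduceEqDiff, not_false_eq_true]
      all_goals assumption
    have hp2 : SearchRegs G x ν σ k D I r (s1.tick 1 |>.tick 1) :=
      ⟨hp1.1, hp1.2, hp1.3, hp1.4, hp1.5, hp1.6, hp1.7, hp1.8⟩
    have h31' : (s1.tick 1 |>.tick 1).reg 31 ≠ 0 := by positivity
    rw [Tr_ite]
    simp only [Ex.eval_lt', Ex.eval_v, State.tick_reg]
    constructor
    · intro hc
      have hlt : s1.reg 33 < s1.reg 34 := by by_contra h0; simp [h0] at hc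
      refine (scanProg_tr hp2 h31' hact2 hI hi (by simp [hs1]) (hf.trans hedge.symm) ?_ hlt hB1 hB2 hdeg).mono ?_
      · intro hg e he
        rw [show (s1.tick 1 |>.tick 1).arr 8 = _ from a8]
        simpa using hlab hg e he
      · rintro s' hF ⟨g1, g2, g3, g4, g5⟩
        have m10 : s'.arr 10 = s1.arr 10 := hF.arr 10 rfl
        have m28 : s'.reg 28 = s1.reg 28 := hF.reg 28 rfl
        refine ⟨⟨?_, by rw [m10, m28]; exact hm1, fun _ => ⟨S, u, g2⟩, fun h30 => absurd g2.fnd h30,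
          fun _ => Or.inr (by rw [g1]; exact h31')⟩, ?_⟩
        · rw [g3, g4]; exact hz1
        · simp [t1] at g5; omega
    · intro hc
      have hlt : ¬ s1.reg 33 < s1.reg 34 := by intro h0; simp [h0] at hc
      refine (decideProg_tr hp2 h31' hz1 hm1 hact2 hgood (hf.trans hedge.symm) hlt hB4 hB2 hB3).mono ?_
      rintro s' - ⟨g1, g5⟩
      simp [t1] at g5
      exact ⟨g1, by omega⟩
  · intro h31
    rw [Tr_skip]
    refine ⟨⟨hz1, hm1, fun h0 => absurd h31 h0, fun h30 => ?_, fun hg => ?_⟩, by simp [t1]; omega⟩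
    · obtain ⟨T, l1, l2, l3⟩ := h.found (by rw [← hr 30 (by omega)]; exact h30)
      refine ⟨T, l1, ?_, ?_⟩
      · simp only [State.tick_reg]; rw [hr 39 (by omega)]; exact l2
      · simp only [State.tick_arr]; rw [har 9 (by omega)]; exact l3
    · simp only [State.tick_reg]
      rw [hr 30 (by omega), hr 31 (by omega)]; exact h.good hg

end

/-! ### A whole search, and the random words on which it depends -/

section

variable {n : ℕ} {G : WeightedGraph n} {A : AdjLists G}
variable {x : Fin n} {ν σ k D I r : ℕ} {X : Finset (Fin n)} {good : Prop} {pr : Sym2 (Fin n) → ℕ}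
  {f : ℕ → Option (Sym2 (Fin n))} {i : ℕ} {s : State} {B : ℕ}

theorem SearchRegs.frame {P : Stmt} {s s' : State} (h : SearchRegs G x ν σ k D I r s)
    (hF : Frame P s s') (hw : ∀ y ∈ [1, 2, 3, 4, 12, 13, 14, 26], P.writes y = false) :
    SearchRegs G x ν σ k D I r s' := by
  simp only [List.forall_mem_cons] at hw
  cases h
  constructor <;> rw [hF.reg _ (by tauto)] <;> assumption

/-- All old marks are at most `r`, so the mark `r + 1` is fresh. In a good run the degree of `x` is
below `2 * ν`, because `x` belongs to `X`. -/
theorem initProg_tr (hp : SearchRegs G x ν σ k D I r s) (hz : s.arr 8 0 = 1 ∧ s.arr 13 0 = 0)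
    (hm : ∀ u, s.arr 10 u ≤ r) (h30 : s.reg 30 = 0) (hσ : 2 ≤ σ)
    (hgood : good → G.IsLocalSet x ν σ k X)
    (hB1 : 2 * 2 ^ D < B) (hB2 : r + 1 < B) :
    Tr A.input B initProg s (fun s' => SearchInv A x ν σ k D X good pr f 0 s' ∧
      s'.reg 28 = r + 1 ∧ s'.time ≤ s.time + 4 * 2 ^ D + 20) := by
  rw [initProg, Tr_seq]
  refine Tr.loop (c := 2) (fun p s' => ∀ j < p, s'.arr 11 j = 0) (Or.inr (by simpa [hp.cap])) (by simp) ?_ ?_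
  · intro p hpn s' hI hF
    rw [Tr_sto]
    simp
    intro j hj
    rcases Nat.lt_or_eq_of_le hj with hj | rfl
    · rw [update_of_ne (by omega), hI j hj]
    · simp
  intro s1 hI hF ht
  simp [hp.cap] at hI ht
  have hr : ∀ y, y ≠ 20 → s1.reg y = s.reg y := fun y hy => hF.reg y (by simp [Stmt.writes, hy.symm])
  have har : ∀ t, t ≠ 11 → s1.arr t = s.arr t := fun t ht => hF.arr t (by simp [Stmt.stores, ht.symm])
  have r1 := (hr 1 (by omega)).trans hp.x
  have r2 := (hr 2 (by omega)).trans hp.vol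
  have r26 := (hr 26 (by omega)).trans hp.run
  have r30 := (hr 30 (by omega)).trans h30
  have e0 := A.input_zero x 0
  simp only [Tr_seq, Tr_set, Tr_sto]
  simp only [Ex.eval_v, Ex.eval_rd, Ex.eval_ofNat, State.set_reg, State.tick_reg,
    State.put_reg, Nat.reduceEqDiff, ↓reduceIte, Ex.triv_rd, true_or, true_and,
    Ex.triv_v, Ex.triv_ofNat, Ex.eval_lt', Ex.eval_mul, Ex.eval_add, r1, r2, r26, e0, Ex.triv_add,
    false_or, Ex.triv_lt]
  refine ⟨hB2, ⟨?_, ?_, ?_, ?_, ?_⟩, by simp; omega⟩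
  · simpa [har 8, har 13] using hz
  · intro u
    simp [har 10, update_apply]
    split_ifs
    · exact le_rfl
    · exact (hm u).trans (by omega)
  · intro h31
    have hlt : (A.nbrs x).length < 2 * ν := by by_contra h0; simp [h0] at h31
    have htree : Tourn (s.arr 8) (s.arr 13) (s1.arr 11) D := Tourn.of_zero hI
    refine ⟨{x}, x, ?_⟩
    constructor <;> try first | (simp; done) | simpa | (simp; omega) | (intro _ h; omega)
    · intro w
      simp [har 10, update_apply]
      grind
    · simp
      exact ScanInv.insert A (S := ∅) (by simp) (by simp [G.cutValue_empty]) (by simp [G.vol_empty])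
    · simp [har 8, har 13]
      refine ⟨htree, hz, fun q hq => Or.inl (hI _ (by omega)), fun u hu w hw h0 => Or.inl ?_⟩
      rw [mem_singleton] at hu
      subst hu
      exact ⟨rfl, (A.mem_iff _ _).2 (G.wt_pos_iff.1 h0).1⟩
    · have : heapCard (s1.arr 11) D = 0 := by
        rw [heapCard, card_eq_zero, filter_eq_empty_iff]
        grind
      simp [this]
    · intro hg; simpa using (hgood hg).1
  · simp [r30]
  · intro hg
    right
    have h1 := A.sum_length_le {x}
    have h2 := G.vol_mono (singleton_subset_iff.2 (hgood hg).1)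
    have h3 := (hgood hg).2.1
    rw [sum_singleton] at h1
    have : (A.nbrs x).length < 2 * ν := by omega
    simp [this]

/-- The states of a search. -/
def searchState (inp : Input) (s : State) (q : ℕ) : State := loopN (fun i s => stepProg.run inp (s.set 27 i)) q s

/-- The edges that are put into the heap. -/
noncomputable def searchLabel (A : AdjLists G) (s : State) (q : ℕ) : Option (Sym2 (Fin n)) :=
  edgeAt A (searchState A.input (initProg.run A.input (s.tick 1)) q)

/-- Here `f` is a ghost record of the edges actually inserted, and `hlab` ties the words read for
them to the priorities `pr`. Words read in steps without an insertion are unconstrained. -/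
theorem searchState_inv (hp : SearchRegs G x ν σ k D I r s) (h : SearchInv A x ν σ k D X good pr f 0 s)
    (hgood : good → G.IsLocalSet x ν σ k X ∧ G.Separates pr X) (hI : I ≤ 2 ^ D)
    (hf : ∀ i < I, f i = edgeAt A (searchState A.input s i))
    (hlab : good → ∀ i < I, ∀ e, f i = some e → s.arr 14 (r * I + i) = pr e)
    (hB1 : (I + 1) * (G.maxWeight + 1) < B) (hB2 : 2 * 2 ^ D < B)
    (hB3 : σ < B) (hB4 : 2 * ν < B) (hdeg : ∀ w, (A.nbrs w).length < B) :
    ∀ i ≤ I, SearchRegs G x ν σ k D I r (searchState A.input s i) ∧ (searchState A.input s i).arr 14 = s.arr 14 ∧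
      (searchState A.input s i).reg 28 = s.reg 28 ∧
      SearchInv A x ν σ k D X good pr f i (searchState A.input s i) ∧
      (searchState A.input s i).time ≤ s.time + i * (6 * D + 30) ∧
      ∀ j < i, stepProg.safe A.input B ((searchState A.input s j).set 27 j) := by
  intro i
  induction i with
  | zero => exact fun _ => ⟨hp, rfl, rfl, h, by simp [searchState, loopN], fun j hj => by omega⟩
  | succ i ih =>
    intro hi
    obtain ⟨h1, h2, h6, h3, h4, h5⟩ := ih (by omega)
    obtain ⟨s1, s2, s3⟩ := stepProg_tr h1 h3 hgood hI hi (hf i hi)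
      (fun hg e he => by rw [h2]; exact hlab hg i hi e he) hB1 hB2 hB3 hB4 hdeg
    have hF := stepProg.frame A.input ((searchState A.input s i).set 27 i)
    refine ⟨?_, ?_, ?_, s2, ?_, fun j hj => ?_⟩
    · refine SearchRegs.frame (P := stepProg) (s := (searchState A.input s i).set 27 i) ?_ hF (by decide)
      cases h1
      constructor <;> simpa
    · exact (hF.arr 14 (by decide)).trans h2
    · exact (hF.reg 28 (by decide)).trans (by simpa using h6)
    · rw [Nat.add_mul, one_mul]; exact s3.trans (by omega)
    · grind

/-- What holds before and after the searches. -/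
structure BetweenInv (G : WeightedGraph n) (x : Fin n) (ν σ k r : ℕ) (s : State) : Prop where
  zero : s.arr 8 0 = 1 ∧ s.arr 13 0 = 0
  marks : ∀ u, s.arr 10 u ≤ r
  found : s.reg 30 ≠ 0 → Found G x ν σ k s

/-- The proposition `good` lets one verification serve two purposes: with `False` it gives safety,
running time and soundness for arbitrary random bits; with `True` it gives success when the words
agree with priorities that separate `X`. -/
theorem runProg_tr (hp : SearchRegs G x ν σ k D I r s) (h : BetweenInv G x ν σ k r s)
    (hgood : good → G.IsLocalSet x ν σ k X ∧ G.Separates pr X) (hI : I ≤ 2 ^ D) (hI4 : I = 4 * ν)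
    (hlab : good → ∀ i < I, ∀ e, searchLabel A s i = some e → s.arr 14 (r * I + i) = pr e)
    (hσ : 2 ≤ σ)
    (hB1 : (I + 1) * (G.maxWeight + 1) < B) (hB2 : 2 * 2 ^ D < B)
    (hB3 : σ < B) (hB4 : r + 1 < B) (hdeg : ∀ w, (A.nbrs w).length < B) :
    Tr A.input B runProg s (fun s' => BetweenInv G x ν σ k (r + 1) s' ∧
      (s.reg 30 ≠ 0 → s'.reg 30 ≠ 0) ∧ (good → s'.reg 30 ≠ 0) ∧
      s'.time ≤ s.time + (I * (6 * D + 30) + 4 * 2 ^ D + 25)) := by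
  rw [runProg, Tr_ite]
  simp only [Ex.eval_v]
  constructor
  · intro h30
    rw [Tr_skip]
    exact ⟨⟨h.zero, fun u => (h.marks u).trans (by omega), fun _ => h.found h30⟩, fun _ => h30, fun _ => h30, by simp⟩
  · intro h30
    rw [Tr_seq]
    have hp' : SearchRegs G x ν σ k D I r (s.tick 1) := by cases hp; constructor <;> assumption
    obtain ⟨i1, i2, i3, i4⟩ := initProg_tr (A := A) (f := searchLabel A s) (pr := pr) hp' h.zero
      h.marks h30 hσ (fun hg => (hgood hg).1) hB2 hB4
    refine ⟨i1, ?_⟩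
    set s0 := initProg.run A.input (s.tick 1) with hs0
    have hF := initProg.frame A.input (s.tick 1)
    rw [← hs0] at hF
    have hp0 : SearchRegs G x ν σ k D I r s0 := hp'.frame hF (by decide)
    have a14 : s0.arr 14 = s.arr 14 := hF.arr 14 (by decide)
    have key := searchState_inv hp0 i2 hgood hI (fun i _ => rfl)
      (fun hg i hi e he => by rw [a14]; exact hlab hg i hi e he) hB1 hB2 hB3
      (by have : I * 1 ≤ I * (G.maxWeight + 1) := Nat.mul_le_mul_left _ (by omega)
          rw [Nat.add_mul] at hB1
          omega) hdeg
    have e12 : (v 12).eval A.input s0 = I := hp0.len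
    obtain ⟨-, -, k28, k3, k4, k5⟩ := key I le_rfl
    refine ⟨⟨Or.inl trivial, by rw [e12]; exact k5⟩, ?_⟩
    simp only [Stmt.run, e12]
    change BetweenInv G x ν σ k (r + 1) ((searchState A.input s0 I).tick 1) ∧ (_ → (searchState A.input s0 I).reg 30 ≠ 0) ∧
      (good → (searchState A.input s0 I).reg 30 ≠ 0) ∧ (searchState A.input s0 I).time + 1 ≤ _
    refine ⟨⟨k3.zero, ?_, k3.found⟩, fun h0 => absurd h30 h0, fun hg => ?_, ?_⟩
    · intro u
      have := k3.marks u
      rw [k28, i3] at this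
      exact this
    · rcases k3.good hg with h0 | h0
      · exact h0
      -- A search still active after `I = 4 * ν` steps contradicts `count`: there the number of
      -- steps is at most twice the sum of the degrees, which is below `2 * ν`.
      · obtain ⟨S, u, hact⟩ := k3.active h0
        have h1 := hact.count
        have h2 := hact.ptr
        have h3 := hact.deg
        have h4 := hact.sum_lt
        omega
    · simp only [State.tick_time] at i4; omega

/-- No assumption on the priorities is needed, so the invariant is used with `good := False`. The
bound `B` is auxiliary and chosen large enough for the safety conditions. -/
theorem searchLabel_injective (hp : SearchRegs G x ν σ k D I r s) (h : BetweenInv G x ν σ k r s)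
    (h30 : s.reg 30 = 0) (hI : I ≤ 2 ^ D) (hσ : 2 ≤ σ) {i j : ℕ} (hij : i < j) (hj : j < I)
    {e : Sym2 (Fin n)} (he : searchLabel A s j = some e) : searchLabel A s i ≠ some e := by
  obtain ⟨B, hB⟩ : ∃ B, B = (I + 1) * (G.maxWeight + 1) + 2 * 2 ^ D + σ + (r + 1) + 2 * ν +
    (∑ w, (A.nbrs w).length) + 1 := ⟨_, rfl⟩
  have hp' : SearchRegs G x ν σ k D I r (s.tick 1) := by cases hp; constructor <;> assumption
  obtain ⟨i1, i2, i3, i4⟩ := initProg_tr (A := A) (f := searchLabel A s) (pr := fun _ => 0)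
    (X := ∅) (good := False) (B := B) hp' h.zero h.marks h30 hσ (fun hg => hg.elim) (by omega) (by omega)
  set s0 := initProg.run A.input (s.tick 1) with hs0
  have hF := initProg.frame A.input (s.tick 1)
  rw [← hs0] at hF
  have hp0 : SearchRegs G x ν σ k D I r s0 := hp'.frame hF (by decide)
  obtain ⟨-, -, -, k3, -⟩ := searchState_inv hp0 i2 (fun hg => hg.elim) hI (fun i _ => rfl)
      (fun hg => hg.elim) (B := B) (by omega) (by omega) (by omega) (by omega)
      (fun w => by
        have := single_le_sum (f := fun w => (A.nbrs w).length) (fun _ _ => Nat.zero_le _) (mem_univ w)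
        omega) j hj.le
  have h31 : (searchState A.input s0 j).reg 31 ≠ 0 := by
    intro h0
    rw [searchLabel, ← hs0, edgeAt] at he
    split_ifs at he
  obtain ⟨S, u, hact⟩ := k3.active h31
  exact hact.edge_new he hij

/-- After the first assignment the step does not use array `14`, so two states that agree outside it
and in the word of this step remain in agreement. -/
theorem stepProg_congr {inp : Input} {s s' : State} {q : ℕ} (h : EqOff 14 s s')
    (ha : s'.arr 14 (s.reg 26 * s.reg 12 + q) = s.arr 14 (s.reg 26 * s.reg 12 + q)) :
    EqOff 14 (stepProg.run inp (s.set 27 q)) (stepProg.run inp (s'.set 27 q)) := by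
  refine Stmt.run_congr inp (ite (v 31) (ite (.bin .lt (v 33) (v 34)) scanProg decideProg) .skip)
    (s := (sto 8 (v 27 + 1) (ld 14 (v 26 * v 12 + v 27))).run inp (s.set 27 q))
    (s' := (sto 8 (v 27 + 1) (ld 14 (v 26 * v 12 + v 27))).run inp (s'.set 27 q)) (by decide) ?_
  simp only [Stmt.run]
  refine ⟨?_, fun t ht => ?_⟩
  · simp [State.put, State.set, h.reg]
  · simp [h.reg, ha, h.arr t ht, h.arr 8]

theorem searchState_frame (inp : Input) (s : State) (q : ℕ) :
    (searchState inp s q).reg 26 = s.reg 26 ∧ (searchState inp s q).reg 12 = s.reg 12 ∧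
      (searchState inp s q).arr 14 = s.arr 14 := by
  induction q with
  | zero => exact ⟨rfl, rfl, rfl⟩
  | succ q ih =>
    have hF := stepProg.frame inp ((searchState inp s q).set 27 q)
    refine ⟨(hF.reg 26 (by decide)).trans ?_, (hF.reg 12 (by decide)).trans ?_, (hF.arr 14 (by decide)).trans ih.2.2⟩
    · simpa using ih.1
    · simpa using ih.2.1

theorem searchState_congr {inp : Input} {s s' : State} {q : ℕ} (h : EqOff 14 s s')
    (ha : ∀ i < q, s'.arr 14 (s.reg 26 * s.reg 12 + i) = s.arr 14 (s.reg 26 * s.reg 12 + i)) :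
    EqOff 14 (searchState inp s q) (searchState inp s' q) := by
  induction q with
  | zero => exact h
  | succ q ih =>
    refine stepProg_congr (ih fun i hi => ha i (by omega)) ?_
    change (searchState inp s' q).arr 14 ((searchState inp s q).reg 26 *
      (searchState inp s q).reg 12 + q) = (searchState inp s q).arr 14 ((searchState inp s q).reg 26 *
      (searchState inp s q).reg 12 + q)
    obtain ⟨h1, h2, h3⟩ := searchState_frame inp s q
    rw [h1, h2, h3, (searchState_frame inp s' q).2.2]
    exact ha q (by omega)

theorem initProg_congr {inp : Input} {s s' : State} (h : EqOff 14 s s') :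
    EqOff 14 (initProg.run inp (s.tick 1)) (initProg.run inp (s'.tick 1)) :=
  Stmt.run_congr inp initProg (by decide) ⟨h.reg, h.arr⟩

theorem initProg_frame (inp : Input) (s : State) : (initProg.run inp (s.tick 1)).reg 26 = s.reg 26 ∧
      (initProg.run inp (s.tick 1)).reg 12 = s.reg 12 ∧
      (initProg.run inp (s.tick 1)).arr 14 = s.arr 14 := by
  have hF := initProg.frame inp (s.tick 1)
  exact ⟨hF.reg 26 (by decide), hF.reg 12 (by decide), hF.arr 14 (by decide)⟩

/-- The edge met in step `q` is determined by the words of the earlier steps. Its own word is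
attached to it only afterwards, as `adaptive_bound` requires. -/
theorem searchLabel_congr {s s' : State} {q : ℕ} (h : EqOff 14 s s')
    (ha : ∀ i < q, s'.arr 14 (s.reg 26 * s.reg 12 + i) = s.arr 14 (s.reg 26 * s.reg 12 + i)) :
    searchLabel A s' q = searchLabel A s q := by
  obtain ⟨h1, h2, h3⟩ := initProg_frame A.input s
  have := searchState_congr (inp := A.input) (q := q) (initProg_congr (inp := A.input) h) (by
    rw [h1, h2, h3, (initProg_frame A.input s').2.2]; exact ha)
  exact edgeAt_congr (by rw [this.reg]) (by rw [this.reg]) (by rw [this.reg]) (by rw [this.reg])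
    (this.arr 10 (by omega))

/-- A run depends only on its own block of words, which makes different runs independent. -/
theorem runProg_congr {inp : Input} {s s' : State} (h : EqOff 14 s s')
    (ha : ∀ i < s.reg 12, s'.arr 14 (s.reg 26 * s.reg 12 + i) = s.arr 14 (s.reg 26 * s.reg 12 + i)) :
    EqOff 14 (runProg.run inp s) (runProg.run inp s') := by
  by_cases h30 : s.reg 30 = 0
  · simp only [runProg, Stmt.run, Ex.eval_v, h.reg, h30, ne_eq, not_true_eq_false, if_false]
    obtain ⟨h1, h2, h3⟩ := initProg_frame inp s
    have hi := initProg_congr (inp := inp) h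
    have := searchState_congr (inp := inp) (q := (initProg.run inp (s.tick 1)).reg 12) hi (by
      rw [h1, h2, h3, (initProg_frame inp s').2.2]; exact ha)
    rw [hi.reg]
    exact ⟨this.reg, this.arr⟩
  · simp only [runProg, Stmt.run, Ex.eval_v, h.reg, h30, ne_eq, not_false_eq_true, if_true]
    exact ⟨h.reg, h.arr⟩

end

/-! ### Adaptive reading of independent variables -/

section Adaptive

open Classical in
/-- Functions with prescribed values at the points of an injective family. -/
theorem card_prescribed {ι E W : Type*} [Fintype ι] [DecidableEq E] [Fintype E] [Fintype W] {f : ι → E}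
    (hf : Function.Injective f) (b : ι → W) :
    ((univ : Finset (E → W)).filter (fun τ => ∀ i, τ (f i) = b i)).card =
      Fintype.card W ^ (Fintype.card E - Fintype.card ι) := by
  have : (univ : Finset (E → W)).filter (fun τ => ∀ i, τ (f i) = b i) =
      Fintype.piFinset fun e => if h : ∃ i, f i = e then {b h.choose} else univ := by
    ext τ
    simp [Fintype.mem_piFinset]
    constructor
    · intro h e
      split_ifs with he
      · rw [mem_singleton, ← h he.choose, he.choose_spec]
      · exact mem_univ _
    · intro h i
      have h1 := h (f i)
      have he : ∃ j, f j = f i := ⟨i, rfl⟩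
      rw [dif_pos he, mem_singleton] at h1
      rw [h1, hf he.choose_spec]
  rw [this, Fintype.card_piFinset]
  have h2 : ∀ e, (if h : ∃ i, f i = e then ({b h.choose} : Finset W) else univ).card =
      if e ∈ univ.image f then 1 else Fintype.card W := by
    intro e
    by_cases he : ∃ i, f i = e
    · simp [he]
    · simp [he]
  rw [prod_congr rfl fun e _ => h2 e, prod_ite]
  simp only [prod_const_one, one_mul, prod_const]
  congr 1
  have : (univ.filter fun e => e ∉ univ.image f) = (univ.image f)ᶜ := by ext; simp
  rw [this, card_compl, card_image_of_injective _ hf, card_univ]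

open Classical in
/-- If an adaptive strategy never reads a variable twice, then the values that it sees are
uniformly distributed. -/
theorem adaptive_bound {E W : Type*} [DecidableEq E] [Fintype E] [Fintype W] [Nonempty W] {I : ℕ}
    (f : (Fin I → W) → Fin I → Option E)
    (hdep : ∀ b b' i, (∀ j < i, b j = b' j) → f b i = f b' i)
    (hinj : ∀ b i j, i < j → ∀ e, f b j = some e → f b i ≠ some e)
    (P : (Fin I → W) → Prop) (Q : (E → W) → Prop)
    (h : ∀ b τ, (∀ i e, f b i = some e → τ e = b i) → Q τ → P b) {p : ℝ}
    (hQ : Fintype.card (E → W) * p ≤ ((univ.filter Q).card : ℝ)) :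
    ((univ.filter fun b => ¬ P b).card : ℝ) ≤ (1 - p) * Fintype.card (Fin I → W) := by
  -- A step that reads nothing is given a dummy variable of its own, so that always exactly `I`
  -- distinct variables of `E ⊕ Fin I` are read.
  let g : (Fin I → W) → Fin I → E ⊕ Fin I := fun b i => (f b i).elim (Sum.inr i) Sum.inl
  have gs : ∀ b i e, f b i = some e → g b i = Sum.inl e := fun b i e he => by simp [g, he]
  have gn : ∀ b i, f b i = none → g b i = Sum.inr i := fun b i he => by simp [g, he]
  have hne : ∀ b i j, i < j → g b i ≠ g b j := by
    intro b i j hij heq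
    cases hj : f b j with
    | none =>
      rw [gn b j hj] at heq
      cases hi : f b i with
      | none => rw [gn b i hi, Sum.inr.injEq] at heq; exact hij.ne heq
      | some e => rw [gs b i e hi] at heq; simp at heq
    | some e =>
      rw [gs b j e hj] at heq
      cases hi : f b i with
      | none => rw [gn b i hi] at heq; simp at heq
      | some e' =>
        grind
  have ginj : ∀ b, Function.Injective (g b) := by
    intro b i j hij
    grind
  -- The assignments on which the strategy would see exactly `b`. These classes are disjoint and
  -- equally large, which is the claimed uniformity.
  let T : (Fin I → W) → Finset (E ⊕ Fin I → W) := fun b => univ.filter fun τ => ∀ i, τ (g b i) = b i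
  have hdisj : ∀ b b' τ, τ ∈ T b → τ ∈ T b' → b = b' := by
    intro b b' τ h1 h2
    have h1 := (mem_filter.1 h1).2
    have h2 := (mem_filter.1 h2).2
    -- Two transcripts of the same assignment agree step by step: equal pasts lead to the same
    -- variable, hence to the same value.
    have key : ∀ m : ℕ, ∀ i : Fin I, (i : ℕ) = m → b i = b' i := by
      intro m
      induction m using Nat.strong_induction_on with
      | _ m ih =>
        grind
    exact funext fun i => key i i rfl
  have hT : ∀ b, (T b).card = Fintype.card (E → W) := by
    intro b
    refine Eq.trans ?_ ((card_prescribed (ginj b) b).trans ?_)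
    · simp only [T]; congr
    · simp
  have hsub : (univ.filter fun b => ¬ P b).biUnion T ⊆
      univ.filter fun τ : E ⊕ Fin I → W => ¬ Q (τ ∘ Sum.inl) := by
    intro τ hτ
    obtain ⟨b, hb, hτb⟩ := mem_biUnion.1 hτ
    refine mem_filter.2 ⟨mem_univ _, fun hq => (mem_filter.1 hb).2 ?_⟩
    refine h b _ (fun i e he => ?_) hq
    have := (mem_filter.1 hτb).2 i
    rwa [gs b i e he] at this
  have hcard := card_le_card hsub
  rw [card_biUnion (fun b _ b' _ hbb' => disjoint_left.2 fun τ h1 h2 =>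
    hbb' (hdisj b b' τ h1 h2)), sum_congr rfl (fun b _ => hT b), sum_const,
    smul_eq_mul] at hcard
  have hprod : (univ.filter fun τ : E ⊕ Fin I → W => ¬ Q (τ ∘ Sum.inl)).card =
      (univ.filter fun τ : E → W => ¬ Q τ).card * Fintype.card (Fin I → W) := by
    rw [← card_univ (α := Fin I → W), ← card_product]
    refine card_bij' (fun τ _ => (τ ∘ Sum.inl, τ ∘ Sum.inr)) (fun q _ => Sum.elim q.1 q.2) ?_ ?_ ?_ ?_
    · intro τ hτ; simpa using hτ
    · intro q hq; simpa using hq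
    · intro τ _; simp
    · intro q _; simp
  rw [hprod] at hcard
  have hcompl : ((univ.filter fun τ : E → W => ¬ Q τ).card : ℝ) ≤ (1 - p) * Fintype.card (E → W) := by
    have := card_filter_add_card_filter_not (s := (univ : Finset (E → W))) Q
    rw [card_univ] at this
    have h3 : ((univ.filter Q).card : ℝ) + ((univ.filter fun τ => ¬ Q τ).card : ℝ) =
        Fintype.card (E → W) := by exact_mod_cast this
    linarith
  have hpos : (0 : ℝ) < Fintype.card (E → W) := by exact_mod_cast Fintype.card_pos
  have hc' : ((univ.filter fun b => ¬ P b).card : ℝ) * Fintype.card (E → W) ≤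
      ((univ.filter fun τ : E → W => ¬ Q τ).card : ℝ) * Fintype.card (Fin I → W) := by
    exact_mod_cast hcard
  have h4 : (0 : ℝ) ≤ Fintype.card (Fin I → W) := by positivity
  refine le_of_mul_le_mul_right ?_ hpos
  nlinarith [mul_le_mul_of_nonneg_right hcompl h4]

open Classical in
/-- Repeated independent attempts. -/
theorem repeated_bound {V : Type*} [Fintype V] [Nonempty V] {R : ℕ}
    (bad : ℕ → (Fin R → V) → Prop) {p : ℝ} (hp : p ≤ 1)
    (hmono : ∀ r < R, ∀ ω, bad (r + 1) ω → bad r ω)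
    (hdep : ∀ (r : Fin R) ω v, bad r (update ω r v) → bad r ω)
    (hstep : ∀ (r : Fin R) ω, bad r ω → ((univ.filter fun v => bad (r + 1) (update ω r v)).card : ℝ) ≤
        (1 - p) * Fintype.card V) :
    ((univ.filter fun ω => bad R ω).card : ℝ) ≤ (1 - p) ^ R * Fintype.card (Fin R → V) := by
  have hV : (0 : ℝ) < Fintype.card V := by exact_mod_cast Fintype.card_pos
  have key : ∀ r ≤ R, ((univ.filter fun ω => bad r ω).card : ℝ) ≤ (1 - p) ^ r * Fintype.card (Fin R → V) := by
    intro r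
    induction r with
    | zero =>
      intro _
      rw [pow_zero, one_mul]
      exact_mod_cast card_le_univ _
    | succ r ih =>
      intro hr
      let r' : Fin R := ⟨r, hr⟩
      -- Coordinate `r` is resampled. It does not influence whether the first `r` attempts fail, so
      -- the conditional bound of `hstep` applies for every choice of the other coordinates.
      have hs := sum_update_eq (fun ω : Fin R → V => if bad (r + 1) ω then (1 : ℝ) else 0) r'
      have h1 : ∀ ω : Fin R → V, (∑ v, if bad (r + 1) (update ω r' v) then (1 : ℝ) else 0) ≤
          if bad r ω then (1 - p) * Fintype.card V else 0 := by
        intro ω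
        split_ifs with hb
        · have := hstep r' ω hb
          simpa using this
        · refine (sum_eq_zero fun v _ => ?_).le
          rw [if_neg]
          intro hb'
          exact hb (hdep r' ω v (hmono r hr _ hb'))
      have h2 : (Fintype.card V : ℝ) * ((univ.filter fun ω => bad (r + 1) ω).card : ℝ) ≤
          (1 - p) * Fintype.card V * ((univ.filter fun ω => bad r ω).card : ℝ) := by
        have h3 := sum_le_sum (s := univ) fun ω _ => h1 ω
        rw [hs] at h3
        simp only [sum_boole] at h3
        refine h3.trans (le_of_eq ?_)
        rw [← sum_filter, sum_const, nsmul_eq_mul, mul_comm]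
      have h5 := ih (by omega)
      have h6 : ((univ.filter fun ω => bad (r + 1) ω).card : ℝ) ≤
          (1 - p) * ((univ.filter fun ω => bad r ω).card : ℝ) := by
        refine le_of_mul_le_mul_left ?_ hV
        linarith
      rw [pow_succ]
      nlinarith
  exact key R le_rfl

end Adaptive

/-! ### The failure probability of repeated searches -/

section

variable {n : ℕ} {G : WeightedGraph n}

-- Instance of `IsExtreme.prob_separates` with relative error `(1 + 1 / l) ^ 2 - 1 ≤ 3 / l` and
-- rounding error `2 ^ (-32 * l)`.
open Classical in
theorem WeightedGraph.IsExtreme.prob_wordPrio {X : Finset (Fin n)} (hX : G.IsExtreme X)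
    (hne : X.Nonempty) {l : ℕ} (hl : 1 ≤ l) (hnl : n ≤ 2 ^ l) :
    (Fintype.card (Sym2 (Fin n) → (Fin (32 * l) → Bool)) : ℝ) * (1 / (2 ^ 16 * (X.card : ℝ) ^ 2)) ≤
      (univ.filter (fun τ : Sym2 (Fin n) → (Fin (32 * l) → Bool) =>
        G.Separates (fun e => wordPrio l (32 * l) (τ e)) X)).card := by
  have hl' : (1 : ℝ) ≤ l := by exact_mod_cast hl
  have hl0 : (0 : ℝ) < l := by linarith
  have hinv : (1 : ℝ) / l ≤ 1 := by rw [div_le_one hl0]; exact hl'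
  have hinv0 : (0 : ℝ) < 1 / l := by positivity
  have := hX.prob_separates G hne (wordPrio l (32 * l)) (S := ((2 ^ (32 * l) * l ^ 2 : ℕ) : ℝ))
    (ε := (1 + 1 / (l : ℝ)) ^ 2 - 1) (δ := (1 / 2) ^ (32 * l)) hl hnl (by nlinarith)
    (by
      have : (3 : ℝ) / l = 3 * (1 / l) := by ring
      rw [this]; nlinarith) (by positivity) le_rfl
    (fun u hu => by convert (wordPrio_tail (a := 32 * l) hl (by omega) hu).1)
    (fun u hu => by
      have := (wordPrio_tail (a := 32 * l) hl (by omega) hu).2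
      rw [show 1 + ((1 + 1 / (l : ℝ)) ^ 2 - 1) = (1 + 1 / (l : ℝ)) ^ 2 by ring]
      convert this)
  convert this

variable {A : AdjLists G}
variable {x : Fin n} {ν σ k D I R : ℕ} {s : State} {B : ℕ}

/-- The states of the main program. -/
def runState (inp : Input) (s : State) (r : ℕ) : State := loopN (fun i s => runProg.run inp (s.set 26 i)) r s

theorem runState_succ (inp : Input) (s : State) (r : ℕ) :
    runState inp s (r + 1) = runProg.run inp ((runState inp s r).set 26 r) := rfl

theorem BetweenInv.set {r : ℕ} (h : BetweenInv G x ν σ k r s) (y : ℕ) :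
    BetweenInv G x ν σ k r (s.set 26 y) := ⟨h.zero, h.marks, h.found⟩

/-- Holds for arbitrary bits: `runProg_tr` is iterated with `good := False`. -/
theorem runState_inv (hp : ∀ r, SearchRegs G x ν σ k D I r (s.set 26 r))
    (h : BetweenInv G x ν σ k 0 s) (hI : I ≤ 2 ^ D) (hI4 : I = 4 * ν) (hσ : 2 ≤ σ)
    (hB1 : (I + 1) * (G.maxWeight + 1) < B) (hB2 : 2 * 2 ^ D < B)
    (hB3 : σ < B) (hB4 : R + 1 < B) (hdeg : ∀ w, (A.nbrs w).length < B) :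
    ∀ r ≤ R, (∀ q, SearchRegs G x ν σ k D I q ((runState A.input s r).set 26 q)) ∧
      BetweenInv G x ν σ k r (runState A.input s r) ∧
      (runState A.input s r).arr 14 = s.arr 14 ∧
      (runState A.input s r).time ≤ s.time + r * (I * (6 * D + 30) + 4 * 2 ^ D + 26) ∧
      ∀ j < r, runProg.safe A.input B ((runState A.input s j).set 26 j) := by
  intro r
  induction r with
  | zero => exact fun _ => ⟨hp, h, rfl, by simp [runState, loopN], fun j hj => by omega⟩
  | succ r ih =>
    intro hr
    obtain ⟨h1, h2, h3, h4, h5⟩ := ih (by omega)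
    obtain ⟨s1, s2, -, -, s3⟩ := runProg_tr (A := A) (X := ∅) (good := False) (pr := fun _ => 0) (h1 r)
      (h2.set r) (fun hg => hg.elim) hI hI4 (fun hg => hg.elim) hσ hB1 hB2 hB3 (by omega) hdeg
    have hF := runProg.frame A.input ((runState A.input s r).set 26 r)
    have hp1 := (h1 r).frame hF (by decide)
    refine ⟨fun q => ?_, s2, (hF.arr 14 (by decide)).trans h3, ?_, fun j hj => ?_⟩
    · rw [runState_succ]
      constructor
      · simpa using hp1.x
      · simpa using hp1.vol
      · simpa using hp1.size
      · simpa using hp1.cut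
      · simpa using hp1.len
      · simpa using hp1.depth
      · simpa using hp1.cap
      · simp
    · rw [Nat.add_mul, one_mul]
      simp at s3
      exact s3.trans (by omega)
    · grind

theorem runState_congr {inp : Input} {s s' : State} (h : EqOff 14 s s') {r : ℕ}
    (ha : ∀ i < r * s.reg 12, s'.arr 14 i = s.arr 14 i) :
    EqOff 14 (runState inp s r) (runState inp s' r) ∧
      (runState inp s r).reg 12 = s.reg 12 ∧ (runState inp s r).arr 14 = s.arr 14 ∧
      (runState inp s' r).arr 14 = s'.arr 14 := by
  induction r with
  | zero => exact ⟨h, rfl, rfl, rfl⟩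
  | succ r ih =>
    obtain ⟨h1, h2, h3, h4⟩ := ih fun i hi => ha i (by rw [Nat.add_mul]; omega)
    have hF := runProg.frame inp ((runState inp s r).set 26 r)
    have hF' := runProg.frame inp ((runState inp s' r).set 26 r)
    refine ⟨?_, (hF.reg 12 (by decide)).trans (by simpa using h2),
      (hF.arr 14 (by decide)).trans h3, (hF'.arr 14 (by decide)).trans h4⟩
    rw [runState_succ, runState_succ]
    refine runProg_congr (h1.set 26 r) fun i hi => ?_
    simp [h2, h3, h4] at hi ⊢
    grind

open Classical in
/-- The searches rarely all miss an extreme set. -/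
theorem card_bad_le {l : ℕ} (hl : 1 ≤ l) (hnl : n ≤ 2 ^ l) {X : Finset (Fin n)}
    (hX : G.IsLocalExtremeSet x ν σ k X) (s : (Fin R → Fin I → Fin (32 * l) → Bool) → State)
    (hs : ∀ ω ω', EqOff 14 (s ω) (s ω'))
    (h14 : ∀ ω (r : Fin R) (i : Fin I), (s ω).arr 14 (r * I + i) = wordPrio l (32 * l) (ω r i))
    (hp : ∀ ω r, SearchRegs G x ν σ k D I r ((s ω).set 26 r))
    (h : ∀ ω, BetweenInv G x ν σ k 0 (s ω)) (hI : I ≤ 2 ^ D) (hI4 : I = 4 * ν) (hσ : 2 ≤ σ) :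
    ((univ.filter fun ω => (runState A.input (s ω) R).reg 30 = 0).card : ℝ) ≤
      (1 - 1 / (2 ^ 16 * (σ : ℝ) ^ 2)) ^ R * Fintype.card (Fin R → Fin I → Fin (32 * l) → Bool) := by
  -- Only the resulting states matter here, so the word bound is any number that is large enough.
  obtain ⟨B, hB⟩ : ∃ B, B = (I + 1) * (G.maxWeight + 1) + 2 * 2 ^ D + σ + (R + 2) +
    (∑ w, (A.nbrs w).length) + 1 := ⟨_, rfl⟩
  have hne : X.Nonempty := ⟨x, hX.1.1⟩
  have hdeg : ∀ w, (A.nbrs w).length < B := fun w => by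
    have := single_le_sum (f := fun w => (A.nbrs w).length) (fun _ _ => Nat.zero_le _) (mem_univ w)
    omega
  have hinv : ∀ ω, ∀ r ≤ R, _ := fun ω => runState_inv (A := A) (R := R) (B := B) (hp ω) (h ω) hI hI4 hσ
    (by omega) (by omega) (by omega) (by omega) hdeg
  have h12 : ∀ ω, (s ω).reg 12 = I := fun ω => by simpa using (hp ω 0).len
  have hXc : (1 : ℝ) ≤ X.card := by exact_mod_cast card_pos.2 hne
  have hXσ : (X.card : ℝ) ≤ σ := by exact_mod_cast hX.1.2.2.1.le
  -- words up to run `r`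
  have hpre : ∀ (ω ω' : Fin R → Fin I → Fin (32 * l) → Bool) (r : ℕ), r ≤ R →
      (∀ q : Fin R, (q : ℕ) < r → ω q = ω' q) →
      EqOff 14 (runState A.input (s ω) r) (runState A.input (s ω') r) := by
    intro ω ω' r hr hq
    refine (runState_congr (hs ω ω') fun i hi => ?_).1
    rw [h12] at hi
    have hI0 : 0 < I := by grind
    have h1 : i / I < r := Nat.div_lt_of_lt_mul (by rw [mul_comm]; exact hi)
    have h2 : i = i / I * I + i % I := by rw [mul_comm]; exact (Nat.div_add_mod i I).symm
    have e1 := h14 ω ⟨i / I, by omega⟩ ⟨i % I, Nat.mod_lt _ hI0⟩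
    have e2 := h14 ω' ⟨i / I, by omega⟩ ⟨i % I, Nat.mod_lt _ hI0⟩
    simp only [← h2] at e1 e2
    rw [e1, e2, hq _ h1]
  have hupd : ∀ (r : Fin R) ω v, EqOff 14 (runState A.input (s ω) r)
      (runState A.input (s (update ω r v)) r) := fun r ω v =>
    hpre _ _ r r.2.le fun q hq => (update_of_ne (by rintro rfl; exact lt_irrefl _ hq) _ _).symm
  have key := repeated_bound (R := R) (fun r ω => (runState A.input (s ω) r).reg 30 = 0)
    (p := 1 / (2 ^ 16 * (σ : ℝ) ^ 2))
  refine le_of_eq_of_le ?_ (key ?_ ?_ ?_ ?_)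
  · congr!
  · rw [div_le_one (by nlinarith)]
    nlinarith
  · intro r hr ω hb
    by_contra h0
    obtain ⟨i1, i2, -⟩ := hinv ω r hr.le
    obtain ⟨-, -, s3, -⟩ := runProg_tr (A := A) (X := ∅) (good := False) (pr := fun _ => 0) (i1 r)
      (i2.set r) (fun hg => hg.elim) hI hI4 (fun hg => hg.elim) hσ (B := B) (by omega) (by omega)
      (by omega) (by omega) hdeg
    exact s3 (by simpa using h0) hb
  · intro r ω v hb
    rw [← hb, (hupd r ω v).reg]
  · intro r ω hb
    -- The states in which run `r` starts, as its own words `v` vary and all others are fixed. They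
    -- differ only in array `14`, so the strategy of the run is well defined.
    set t : (Fin I → Fin (32 * l) → Bool) → State := fun v =>
      (runState A.input (s (update ω r v)) r).set 26 r with ht
    have i1 : ∀ v, SearchRegs G x ν σ k D I r (t v) := fun v => (hinv (update ω r v) r r.2.le).1 r
    have i2 : ∀ v, BetweenInv G x ν σ k r (t v) := fun v => (hinv (update ω r v) r r.2.le).2.1.set r
    have h30 : ∀ v, (t v).reg 30 = 0 := fun v => by
      simp only [ht, State.set_reg]
      rw [if_neg (by omega), (hupd r ω v).reg]
      exact hb
    have htt : ∀ v v', EqOff 14 (t v) (t v') := fun v v' =>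
      (hpre _ _ r r.2.le fun q hq => by
        have : q ≠ r := by rintro rfl; exact lt_irrefl _ hq
        rw [update_of_ne this, update_of_ne this]).set 26 r
    have t14 : ∀ v (i : Fin I), (t v).arr 14 (r * I + i) = wordPrio l (32 * l) (v i) := fun v i => by
      have := h14 (update ω r v) r i
      rw [update_self] at this
      rw [← this, ← (hinv (update ω r v) r r.2.le).2.2.1]
      rfl
    have hQ : (Fintype.card (Sym2 (Fin n) → Fin (32 * l) → Bool) : ℝ) *
        (1 / (2 ^ 16 * (X.card : ℝ) ^ 2)) ≤ ((univ.filter fun τ : Sym2 (Fin n) → Fin (32 * l) → Bool =>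
            G.Separates (fun e => wordPrio l (32 * l) (τ e)) X).card : ℝ) := by
      have := hX.2.prob_wordPrio hne hl hnl
      convert this
    -- The three open hypotheses are proved below: edges depend on earlier words only, no edge is
    -- met twice, and agreement with separating priorities forces success.
    have hab := fun h1 h2 h3 => adaptive_bound (W := Fin (32 * l) → Bool) (fun v i => searchLabel A (t v) i) h1 h2
      (fun v => (runState A.input (s (update ω r v)) (r + 1)).reg 30 ≠ 0)
      (fun τ => G.Separates (fun e => wordPrio l (32 * l) (τ e)) X) h3 hQ
    have hstep := hab ?_ ?_ ?_
    · refine le_trans (le_of_eq ?_) (hstep.trans ?_)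
      · simp only [ne_eq, not_not]
        congr!
      · refine mul_le_mul_of_nonneg_right ?_ (by positivity)
        have : 1 / (2 ^ 16 * (σ : ℝ) ^ 2) ≤ 1 / (2 ^ 16 * (X.card : ℝ) ^ 2) := by gcongr
        linarith
    · intro v v' i hvv
      refine searchLabel_congr (htt v' v) fun j hj => ?_
      rw [(i1 v').run, (i1 v').len]
      have hjI : j < I := hj.trans i.2
      have e1 := t14 v ⟨j, hjI⟩
      have e2 := t14 v' ⟨j, hjI⟩
      rw [hvv ⟨j, hjI⟩ (by exact hj)] at e1
      exact e1.trans e2.symm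
    · intro v i j hij e he
      exact searchLabel_injective (i1 v) (i2 v) (h30 v) hI hσ hij j.2 he
    · intro v τ hτ hsep
      obtain ⟨-, -, -, s3, -⟩ := runProg_tr (A := A) (X := X) (good := True)
        (pr := fun e => wordPrio l (32 * l) (τ e)) (B := B) (i1 v) (i2 v)
        (fun _ => ⟨hX.1, hsep⟩) hI hI4 (fun _ i hi e he => by
          rw [hτ ⟨i, hi⟩ e he]; exact t14 v ⟨i, hi⟩) hσ (by omega) (by omega)
        (by omega) (by omega) hdeg
      exact s3 trivial

end

/-! ### Execution of compiled programs -/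

/-- The initial state with the given parameters. -/
def startState (l : List ℕ) (a : ℕ → ℕ → ℕ) : State := ⟨paramRegs l, a, 0⟩

/-- The answer of `emitProg`. -/
structure Emitted (st : State) (s : Store) : Prop where
  flag : s.reg 0 = st.reg 0
  size : s.reg 1 = st.reg 1
  addr : s.reg 2 = 0
  mem : ∀ m < st.reg 1, s.mem m = st.arr 9 m

section Exec

variable {M B κ C T : ℕ} {inp : Input} {P Q : Stmt} {l : List ℕ}

theorem Small.withBits {st : State} (h : Small inp B st) (hB : 2 ≤ B) (N : ℕ) (ω : Fin N → Bool) :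
    Small inp B (st.withBits N ω) := by
  refine ⟨h.reg, fun t i => ?_, h.inp⟩
  by_cases ht : t = 15
  · subst ht
    simp only [State.withBits, update_self]
    split_ifs
    · exact (Bool.toNat_le _).trans_lt (by omega)
    · exact h.arr 15 i
  · simpa [State.withBits, ht] using h.arr t i

theorem exec_comp_flip (h48 : 48 < B) (hC : C < B) (hM : B ^ κ ≤ M) (hwP : P.wf 64 C) (hκP : 20 * P.size ≤ κ)
    (hs : Small inp B (startState l fun _ _ => 0)) (hP : P.safe inp B (startState l fun _ _ => 0))
    {st : State} (hst : P.run inp (startState l fun _ _ => 0) = st) (h19 : 16 * st.reg 19 + 31 < M) {R : Prog}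
    {Φ : (Fin (st.reg 19) → Bool) → Store → Prop} {T' : ℕ} (hR : ∀ ω s₂, Sim (st.withBits (st.reg 19) ω) s₂ →
      Small inp B (st.withBits (st.reg 19) ω) → ∃ k s₃, Reach M inp k ([R], s₂) ([], s₃) ∧ Φ ω s₃ ∧
        k + κ * st.time ≤ T') (hT : T' + 8 * st.reg 19 + 13 ≤ T) :
    ∃ g : (Fin (st.reg 19) → Bool) → Store,
      exec M inp (.seq (P.comp 64) (.seq flipProg R)) T ⟨paramRegs l, fun _ => 0⟩ =
        (PMF.uniformOfFintype (Fin (st.reg 19) → Bool)).map (fun ω => some (g ω)) ∧ ∀ ω, Φ ω (g ω) := by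
  obtain ⟨k, s₁, r, hsim, -, hk, hsm⟩ := P.comp_reach (M := M) (by omega) hC hM _
    ⟨paramRegs l, fun _ => 0⟩ 64 hwP hκP le_rfl hs ⟨fun _ _ => rfl, fun _ _ _ => rfl⟩ hP
  rw [hst] at hsim hk hsm
  have hk0 : k + 1 ≤ κ * st.time := by simpa [startState] using hk
  -- One sample outcome, all bits false, is inspected only to learn that `κ * st.time ≤ T'`;
  -- otherwise the truncated subtraction below would lose information.
  obtain ⟨g, -, hg⟩ := flipProg_run (M := M) inp hsim h19
  obtain ⟨_, _, _, _, h⟩ := hR _ _ (hg fun _ => false) (hsm.withBits (by omega) _ _)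
  refine exec_flip (k' := T' - κ * st.time) r hsim h19 Φ (fun ω s₂ h₂ => ?_) (by omega)
  obtain ⟨k', s₃, r', hΦ, hk'⟩ := hR ω s₂ h₂ (hsm.withBits (by omega) _ ω)
  exact ⟨k', by omega, s₃, r', hΦ⟩

/-- A program that runs `P`, flips coins, and runs `Q`. -/
theorem exec_comp_flip_comp (h48 : 48 < B) (hC : C < B) (hM : B ^ κ ≤ M)
    (hwP : P.wf 64 C) (hκP : 20 * P.size ≤ κ) (hwQ : Q.wf 64 C) (hκQ : 20 * Q.size ≤ κ)
    (hs : Small inp B (startState l fun _ _ => 0)) (hP : P.safe inp B (startState l fun _ _ => 0))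
    {st : State} (hst : P.run inp (startState l fun _ _ => 0) = st)
    (h19 : 16 * st.reg 19 + 31 < M) (hQ : ∀ ω, Q.safe inp B (st.withBits (st.reg 19) ω))
    (hT : ∀ ω, κ * (Q.run inp (st.withBits (st.reg 19) ω)).time + 8 * st.reg 19 + 13 ≤ T) :
    ∃ g : (Fin (st.reg 19) → Bool) → Store,
      exec M inp (.seq (P.comp 64) (.seq flipProg (Q.comp 64))) T ⟨paramRegs l, fun _ => 0⟩ =
        (PMF.uniformOfFintype (Fin (st.reg 19) → Bool)).map (fun ω => some (g ω)) ∧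
      ∀ ω, Sim (Q.run inp (st.withBits (st.reg 19) ω)) (g ω) ∧ Small inp B (Q.run inp (st.withBits (st.reg 19) ω)) := by
  have hT0 := hT fun _ => false
  refine exec_comp_flip h48 hC hM hwP hκP hs hP hst h19 (T := T) (Φ := fun ω s => Sim (Q.run inp (st.withBits _ ω)) s ∧
    Small inp B (Q.run inp (st.withBits _ ω))) (T' := T - 8 * st.reg 19 - 13) (fun ω s₂ h₂ h₃ => ?_)
    (by omega)
  obtain ⟨k, s₃, r, hsim, -, hk, hsm⟩ := Q.comp_reach (M := M) (by omega) hC hM _ s₂ 64 hwQ hκQ le_rfl h₃ h₂ (hQ ω)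
  have hk' : k + 1 + κ * st.time ≤ κ * (Q.run inp (st.withBits (st.reg 19) ω)).time := hk
  have := hT ω
  exact ⟨k, s₃, r [], ⟨hsim, hsm⟩, by omega⟩

/-- A program that runs `P`, flips coins, runs `Q`, and emits the answer. -/
theorem exec_comp_flip_emit (h48 : 48 < B) (hC : C < B) (hM : B ^ κ ≤ M) (h2 : 2 ≤ κ)
    (hwP : P.wf 64 C) (hκP : 20 * P.size ≤ κ) (hwQ : Q.wf 64 C) (hκQ : 20 * Q.size ≤ κ)
    (hs : Small inp B (startState l fun _ _ => 0)) (hP : P.safe inp B (startState l fun _ _ => 0))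
    {st : State} (hst : P.run inp (startState l fun _ _ => 0) = st)
    (h19 : 16 * st.reg 19 + 31 < M) (hQ : ∀ ω, Q.safe inp B (st.withBits (st.reg 19) ω))
    (hT : ∀ ω, κ * (Q.run inp (st.withBits (st.reg 19) ω)).time + 8 * st.reg 19 +
      12 * (Q.run inp (st.withBits (st.reg 19) ω)).reg 1 + 28 ≤ T) :
    ∃ g : (Fin (st.reg 19) → Bool) → Store,
      exec M inp (.seq (P.comp 64) (.seq flipProg (.seq (Q.comp 64) emitProg))) T ⟨paramRegs l, fun _ => 0⟩ =
        (PMF.uniformOfFintype (Fin (st.reg 19) → Bool)).map (fun ω => some (g ω)) ∧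
      ∀ ω, Emitted (Q.run inp (st.withBits (st.reg 19) ω)) (g ω) := by
  have hT0 := hT fun _ => false
  refine exec_comp_flip h48 hC hM hwP hκP hs hP hst h19 (T := T) (Φ := fun ω => Emitted (Q.run inp (st.withBits _ ω)))
    (T' := T - 8 * st.reg 19 - 13) (fun ω s₂ h₂ h₃ => ?_)
    (by omega)
  obtain ⟨k, s₃, r, hsim, -, hk, hsm⟩ := Q.comp_reach (M := M) (by omega) hC hM _ s₂ 64 hwQ hκQ le_rfl h₃ h₂ (hQ ω)
  have hk' : k + 1 + κ * st.time ≤ κ * (Q.run inp (st.withBits (st.reg 19) ω)).time := hk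
  obtain ⟨s₄, r4, e0, e1, e2, e3⟩ := emitProg_run (M := M) hsim hsm
    ((Nat.pow_le_pow_right (by omega) h2).trans hM) h48
  have := hT ω
  exact ⟨_, s₄, r.seq r4 [], ⟨e0, e1, e2, e3⟩, by omega⟩

theorem exec_comp_emit (h48 : 48 < B) (hC : C < B) (hM : B ^ κ ≤ M) (h2 : 2 ≤ κ)
    (hwP : P.wf 64 C) (hκP : 20 * P.size ≤ κ) {a : ℕ → ℕ → ℕ}
    (hs : Small inp B (startState l a)) (hP : P.safe inp B (startState l a))
    {s : Store} (hsim : ∀ t < 16, ∀ i, s.mem (16 * i + t) = a t i)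
    (hT : κ * (P.run inp (startState l a)).time + 12 * (P.run inp (startState l a)).reg 1 + 13 ≤ T) :
    ∃ s', exec M inp (.seq (P.comp 64) emitProg) T ⟨paramRegs l, s.mem⟩ = PMF.pure (some s') ∧
      Emitted (P.run inp (startState l a)) s' := by
  obtain ⟨k, s₁, r, hs₁, -, hk, hsm⟩ := P.comp_reach (M := M) (by omega) hC hM _
    ⟨paramRegs l, s.mem⟩ 64 hwP hκP le_rfl hs ⟨fun _ _ => rfl, hsim⟩ hP
  obtain ⟨s₄, r4, e0, e1, e2, e3⟩ := emitProg_run (M := M) hs₁ hsm ((Nat.pow_le_pow_right (by omega) h2).trans hM) h48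
  simp only [startState, Nat.mul_zero, Nat.add_zero] at hk
  refine ⟨s₄, exec_of_reach ?_ (r.seq r4 []), e0, e1, e2, e3⟩
  simp only [startState] at hT ⊢
  omega

end Exec

/-- The probability of an event about the final store. -/
theorem toOuterMeasure_map_uniform_le {Ω α : Type*} [Fintype Ω] [Nonempty Ω] (g : Ω → α) (S : Set α)
    (bad : Ω → Prop) [DecidablePred bad] (hbad : ∀ ω, g ω ∈ S → bad ω) {q : ENNReal} {q' : ℝ}
    (hq : ENNReal.ofReal q' ≤ q) (h : ((univ.filter bad).card : ℝ) ≤ q' * Fintype.card Ω) :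
    ((PMF.uniformOfFintype Ω).map g).toOuterMeasure S ≤ q := by
  classical
  rw [PMF.toOuterMeasure_map_apply, PMF.toOuterMeasure_uniformOfFintype_apply]
  refine le_trans ?_ hq
  have hc : (0 : ℝ) < Fintype.card Ω := by exact_mod_cast Fintype.card_pos
  have h1 : (Fintype.card (g ⁻¹' S : Set Ω)) ≤ (univ.filter bad).card := by
    rw [Fintype.card_subtype]
    refine card_le_card fun ω hω => ?_
    simp only [mem_filter, mem_univ, true_and] at hω ⊢
    exact hbad ω hω
  refine ENNReal.div_le_of_le_mul ?_
  rw [← ENNReal.ofReal_natCast (Fintype.card Ω), ← ENNReal.ofReal_mul' hc.le, ← ENNReal.ofReal_natCast]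
  refine ENNReal.ofReal_le_ofReal (le_trans ?_ h)
  exact_mod_cast h1

theorem none_notMem_support_map {Ω : Type*} [Fintype Ω] [Nonempty Ω] (g : Ω → Store) :
    none ∉ ((PMF.uniformOfFintype Ω).map fun ω => some (g ω)).support := by
  simp

section

variable {inp : Input} {B : ℕ}

/-! ### Preparation -/

/-- Variable `y` becomes the power of two with exponent in variable `x`. -/
def powProg (x y : ℕ) : Stmt := set y 1 ;; .loop 21 (v x) (set y (2 * v y))

theorem powProg_tr {s : State} {x y : ℕ} (hxy : x ≠ y) (hy : y ≠ 21) (hB : 2 ^ s.reg x < B) :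
    Tr inp B (powProg x y) s (fun s' => s'.reg y = 2 ^ s.reg x ∧ s'.time ≤ s.time + 2 * s.reg x + 3) := by
  rw [powProg, Tr_seq, Tr_set]
  refine ⟨by simp, ?_⟩
  refine Tr.loop (c := 2) (fun i s' => s'.reg y = 2 ^ i) (by simp) (by simp) ?_ ?_
  · intro i hi s' hI hF
    simp [hxy] at hi
    have : 2 * 2 ^ i = 2 ^ (i + 1) := by ring
    have h2 : 2 ^ (i + 1) ≤ 2 ^ s.reg x := Nat.pow_le_pow_right (by norm_num) hi
    rw [Tr_set]
    simp [hy, hI, this]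
    omega
  · intro s' hI hF ht
    simp [hxy] at hI ht ⊢
    exact ⟨hI, by omega⟩

/-- From `n` in variable `0`, `σ` in variable `3` and the length of a run in variable `12` compute
the constants for the priorities, the number of runs, the depth of the tournament and the number of
random bits. -/
def prepProg (c : ℕ) : Stmt :=
  lg 5 (v 0) ;; set 6 (32 * v 5) ;; powProg 6 7 ;; set 8 (v 7 * (v 5 * v 5)) ;; set 23 (v 7 / 2) ;;
  riemProg ;; set 9 (v 24) ;; set 11 (.c (c) * (v 3 * v 3 * v 5)) ;; lg 13 (v 12) ;;
  powProg 13 14 ;; set 10 (v 11 * v 12) ;; set 19 (v 10 * v 6)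

/-- The result of the preparation. -/
structure Prepared (c n σ I : ℕ) (s : State) : Prop extends PrioRegs s where
  len : s.reg 5 = n.size
  bits : s.reg 6 = 32 * n.size
  runs : s.reg 11 = c * (σ * σ * n.size)
  run : s.reg 12 = I
  depth : s.reg 13 = I.size
  cap : s.reg 14 = 2 ^ I.size
  words : s.reg 10 = c * (σ * σ * n.size) * I
  flips : s.reg 19 = c * (σ * σ * n.size) * I * (32 * n.size)

theorem prepProg_tr {c : ℕ} {s : State}
    (hB : ((32 * (s.reg 0).size) + 1) * ((s.reg 0).size * (2 ^ (32 * (s.reg 0).size) *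
      ((s.reg 0).size * (s.reg 0).size) * 2 ^ (32 * (s.reg 0).size))) < B)
    (hB1 : 2 ^ (32 * (s.reg 0).size) < B)
    (hB2 : 2 ^ (s.reg 12).size < B) 
    (hB3 : c * (s.reg 3 * s.reg 3 * (s.reg 0).size) < B)
    (hB4 : c * (s.reg 3 * s.reg 3 * (s.reg 0).size) * s.reg 12 < B)
    (hB5 : c * (s.reg 3 * s.reg 3 * (s.reg 0).size) * s.reg 12 * (32 * (s.reg 0).size) < B) :
    Tr inp B (prepProg c) s (fun s' => Prepared c (s.reg 0) (s.reg 3) (s.reg 12) s' ∧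
      s'.time ≤ s.time + 80 * (s.reg 0).size + 4 * (s.reg 12).size + 20) := by
  set ℓ := (s.reg 0).size with hℓ
  have h32 : 32 * ℓ < B := (Nat.lt_two_pow_self).trans hB1
  rw [prepProg, Tr_seq, Tr_lg]
  refine ⟨by simp, ?_⟩
  rw [Tr_seq, Tr_set]
  refine ⟨by simp [← hℓ, h32], ?_⟩
  rw [Tr_seq]
  refine (powProg_tr (by norm_num) (by norm_num) (by simpa [← hℓ] using hB1)).mono ?_
  rintro s1 hF1 ⟨h7, t1⟩
  have f1 : ∀ y, y ≠ 21 → y ≠ 7 → y ≠ 6 → y ≠ 5 → s1.reg y = s.reg y := fun y a b c d => by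
    rw [hF1.reg y (by simp [powProg, Stmt.writes]; omega)]; simp [c, d]
  have e5 : s1.reg 5 = ℓ := by rw [hF1.reg 5 rfl]; simp [hℓ]
  have e6 : s1.reg 6 = 32 * ℓ := by rw [hF1.reg 6 rfl]; simp [hℓ]
  simp [← hℓ] at h7 t1
  have hS : 2 ^ (32 * ℓ) * (ℓ * ℓ) < B := by
    refine lt_of_le_of_lt ?_ hB
    rcases Nat.eq_zero_or_pos ℓ with h | h
    · simp [h]
    · have hp : 1 ≤ 2 ^ (32 * ℓ) := Nat.one_le_two_pow
      calc 2 ^ (32 * ℓ) * (ℓ * ℓ) = 1 * (1 * (2 ^ (32 * ℓ) * (ℓ * ℓ) * 1)) := by ring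
        _ ≤ _ := by gcongr <;> omega
  have hSS : ℓ * (2 ^ (32 * ℓ) * (ℓ * ℓ) * 2 ^ (32 * ℓ)) < B := by grind
  rw [Tr_seq, Tr_set]
  refine ⟨by simp [e5, h7, hS], ?_⟩
  rw [Tr_seq, Tr_set]
  refine ⟨by simp, ?_⟩
  rw [Tr_seq]
  refine (riemProg_tr (by simp [h7]; omega) (by simpa [e5, h7] using hSS)).mono ?_
  rintro s2 hF2 ⟨h24, t2⟩
  have f2 : ∀ y, s2.reg y = if y = 21 ∨ y = 24 then s2.reg y else if y = 23 then 2 ^ (32 * ℓ) / 2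
      else if y = 8 then 2 ^ (32 * ℓ) * (ℓ * ℓ) else s1.reg y := fun y => by
    split_ifs with a b c
    · rfl
    · rw [hF2.reg y (by simp [riemProg, Stmt.writes]; omega)]; simp [b, h7]
    · rw [hF2.reg y (by simp [riemProg, Stmt.writes]; omega)]; simp [c, h7, e5]
    · rw [hF2.reg y (by simp [riemProg, Stmt.writes]; omega)]; simp [b, c]
  have g5 := f2 5
  have g6 := f2 6
  have g7 := f2 7
  have g8 := f2 8
  have g3 := f2 3
  have g12 := f2 12
  simp [e5, e6, h7, f1] at g5 g6 g7 g8 g3 g12 h24 t2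
  rw [Tr_seq, Tr_set]
  refine ⟨by simp, ?_⟩
  rw [Tr_seq, Tr_set]
  refine ⟨by simp [g3, g5, hB3], ?_⟩
  rw [Tr_seq, Tr_lg]
  refine ⟨by simp, ?_⟩
  rw [Tr_seq]
  refine (powProg_tr (by norm_num) (by norm_num) (by simpa [g12] using hB2)).mono ?_
  rintro s3 hF3 ⟨h14, t3⟩
  have j5 := hF3.reg 5 rfl
  have j6 := hF3.reg 6 rfl
  have j7 := hF3.reg 7 rfl
  have j8 := hF3.reg 8 rfl
  have j9 := hF3.reg 9 rfl
  have j11 := hF3.reg 11 rfl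
  have j12 := hF3.reg 12 rfl
  have j13 := hF3.reg 13 rfl
  simp [g3, g5, g6, g7, g8, g12, h24] at j5 j6 j7 j8 j9 j11 j12 j13 h14 t3
  rw [Tr_seq, Tr_set]
  refine ⟨by simp [j11, j12, hB4], ?_⟩
  rw [Tr_set]
  refine ⟨by simp [j11, j12, j6, hB5], ⟨⟨?_, ?_, ?_⟩, ?_, ?_, ?_, ?_, ?_, ?_, ?_, ?_⟩, ?_⟩
  · simp [j7, j6]
  · simp [j8, j6, j5, sq]
  · simp [j9, j8, j7, j5]
  · simp [j5, ← hℓ]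
  · simp [j6, ← hℓ]
  · simp [j11, ← hℓ]
  · simp [j12]
  · simp [j13]
  · simp [h14]
  · simp [j11, j12, ← hℓ]
  · simp [j11, j12, j6, ← hℓ]
  · simp; omega

/-! ### Bounds on the parameters -/

/-- For `n ≥ 2` the binary length is at most `1 + log₂ n ≤ 2 * log₂ n`, and `2 / log 2 < 3`. -/
theorem size_le_log {n : ℕ} (hn : 2 ≤ n) : (n.size : ℝ) ≤ 3 * Real.log n := by
  have h1 : 2 ^ (n.size - 1) ≤ n := Nat.lt_size.1 (by
    have : 0 < n.size := Nat.size_pos.2 (by omega)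
    omega)
  have h2 : ((n.size - 1 : ℕ) : ℝ) * Real.log 2 ≤ Real.log n := by
    rw [← Real.log_pow]
    exact Real.log_le_log (by positivity) (by exact_mod_cast h1)
  have h3 : Real.log 2 ≤ Real.log n := Real.log_le_log (by norm_num) (by exact_mod_cast hn)
  have h4 : ((n.size - 1 : ℕ) : ℝ) = n.size - 1 := by rw [Nat.cast_sub (Nat.size_pos.2 (by omega))]; simp
  rw [h4] at h2
  have := Real.log_two_gt_d9
  nlinarith

/-- The probability that all runs fail. -/
theorem runs_fail_le {n σ : ℕ} (hn : 1 ≤ n) (hσ : 2 ≤ σ) (c : ℕ) :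
    ENNReal.ofReal ((1 - 1 / (2 ^ 16 * (σ : ℝ) ^ 2)) ^ (2 ^ 16 * c * (σ * σ * n.size))) ≤ ((n : ENNReal) ^ c)⁻¹ := by
  have hσ' : (2 : ℝ) ≤ σ := by exact_mod_cast hσ
  have hn' : (1 : ℝ) ≤ n := by exact_mod_cast hn
  have hp : 1 / (2 ^ 16 * (σ : ℝ) ^ 2) ≤ 1 := by rw [div_le_one (by positivity)]; nlinarith
  have h1 : (1 - 1 / (2 ^ 16 * (σ : ℝ) ^ 2)) ^ (2 ^ 16 * c * (σ * σ * n.size)) ≤ ((n : ℝ) ^ c)⁻¹ := by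
    have h0 := Real.one_sub_le_exp_neg (1 / (2 ^ 16 * (σ : ℝ) ^ 2))
    refine (pow_le_pow_left₀ (by linarith) h0 _).trans ?_
    rw [← Real.exp_nat_mul, ← Real.exp_log (show (0 : ℝ) < (n : ℝ) ^ c by positivity),
      ← Real.exp_neg, Real.exp_le_exp, Real.log_pow]
    have h2 : Real.log n ≤ n.size := by
      have h3 : (n : ℝ) ≤ 2 ^ n.size := by exact_mod_cast (Nat.lt_size_self n).le
      have h4 := Real.log_le_log (by linarith) h3
      rw [Real.log_pow] at h4
      have := Real.log_two_lt_d9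
      nlinarith
    -- The number of runs is chosen so that in the exponent everything but `c * n.size` cancels.
    have h5 : ((2 ^ 16 * c * (σ * σ * n.size) : ℕ) : ℝ) * -(1 / (2 ^ 16 * (σ : ℝ) ^ 2)) = -(c * n.size) := by
      push_cast; field_simp; ring
    nlinarith
  refine (ENNReal.ofReal_le_ofReal h1).trans (le_of_eq ?_)
  rw [ENNReal.ofReal_inv_of_pos (by positivity), ENNReal.ofReal_pow (by positivity), ENNReal.ofReal_natCast]

/-! ### From coin flips to priorities -/

/-- Split a sequence of bits into words, and the words into runs. -/
def bitsEquiv {N R I a : ℕ} (h : N = R * I * a) : (Fin N → Bool) ≃ (Fin R → Fin I → Fin a → Bool) :=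
  (Equiv.arrowCongr ((finCongr h).trans (finProdFinEquiv.symm.trans
    (Equiv.prodCongr finProdFinEquiv.symm (Equiv.refl _)))) (Equiv.refl Bool)).trans
  ((Equiv.curry _ _ _).trans (Equiv.curry _ _ _))

theorem bitsEquiv_apply {N R I a : ℕ} (h : N = R * I * a) (ω : Fin N → Bool) (r : Fin R) (i : Fin I)
    (j : Fin a) (hj : (r * I + i) * a + j < N) :
    bitsEquiv h ω r i j = ω ⟨(r * I + i) * a + j, hj⟩ := by
  subst h
  simp only [bitsEquiv, Equiv.trans_apply, Equiv.curry_apply, curry_apply,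
    Equiv.arrowCongr_apply, Equiv.coe_refl, comp_apply, id_eq]
  congr 1
  ext
  simp [finProdFinEquiv]
  ring

theorem wordIndex_lt {R I r i : ℕ} (hr : r < R) (hi : i < I) : r * I + i < R * I := by nlinarith

/-- Forget the auxiliary variables of `wordsProg`. -/
def clearProg : Stmt := set 20 0 ;; set 21 0 ;; set 22 0 ;; set 23 0 ;; set 24 0 ;; set 27 0

/-- The result of `wordsProg` and `clearProg`. -/
structure Words (R I l : ℕ) (b : Fin R → Fin I → Fin (32 * l) → Bool) (st s : State) : Prop where
  reg : ∀ y, s.reg y = if y ∈ [20, 21, 22, 23, 24, 27] then 0 else st.reg y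
  arr : ∀ t, t ≠ 14 → t ≠ 15 → s.arr t = st.arr t
  word : ∀ (r : Fin R) (i : Fin I), s.arr 14 (r * I + i) = wordPrio l (32 * l) (b r i)

/-- Scratch variables depend on the bits. After clearing them, outcomes for different bits differ
only in arrays `14` and `15`, as the independence arguments need. -/
theorem words_tr {c n σ I R N : ℕ} {st : State} (h : Prepared c n σ I st)
    (hR : R = c * (σ * σ * n.size)) (hN : N = R * I * (32 * n.size)) (h0 : ∀ j, st.arr 15 j = 0)
    (hB : ((32 * n.size) + 1) * (n.size * (2 ^ (32 * n.size) *
      (n.size * n.size) * 2 ^ (32 * n.size))) < B) (h2 : 2 * 2 ^ (32 * n.size) + 1 < B)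
    (ω : Fin N → Bool) :
    Tr inp B (wordsProg ;; clearProg) (st.withBits N ω) (fun s => Words R I n.size (bitsEquiv hN ω) st s ∧
        s.time ≤ st.time + R * I * (194 * n.size + 13) + 7) := by
  set st' := st.withBits N ω with hst'
  have e10 : st'.reg 10 = R * I := by rw [hR]; exact h.words
  have e5 : st'.reg 5 = n.size := h.len
  have e6 : st'.reg 6 = 32 * n.size := h.bits
  have e7 : st'.reg 7 = 2 ^ (32 * n.size) := by rw [← h.bits]; exact h.pow
  have e8 : st'.reg 8 = 2 ^ (32 * n.size) * n.size ^ 2 := by rw [← h.bits, ← h.len]; exact h.scale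
  have hp : PrioRegs st' := ⟨h.pow, h.scale, h.ln⟩
  rw [Tr_seq]
  refine (wordsProg_tr hp (fun j => ?_) (by rw [e5, e6, e7, e8, sq]; exact hB) (by rw [e7]; exact h2)).mono ?_
  · simp only [hst', State.withBits, update_self]
    split_ifs
    · exact Bool.toNat_le _
    · simp [h0]
  · rintro s1 hF ⟨hw, ht⟩
    rw [e5, e6, e10] at hw ht
    refine ⟨by simp [clearProg, Stmt.safe], ⟨fun y => ?_, fun t h1 h2 => ?_, fun r i => ?_⟩, ?_⟩
    · by_cases hy : y ∈ [20, 21, 22, 23, 24, 27]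
      · simp at hy
        simp [clearProg, Stmt.run, hy]
        omega
      · simp at hy
        have e : s1.reg y = st.reg y := hF.reg y (by simp [wordsProg, wordBody, riemProg, Stmt.writes]; omega)
        simp [clearProg, Stmt.run, hy, e]
    · refine Eq.trans (b := s1.arr t) (by simp [clearProg, Stmt.run]) ?_
      rw [hF.arr t (by simp [wordsProg, wordBody, riemProg, Stmt.stores, h1.symm])]
      simp [hst', State.withBits, h2]
    · refine Eq.trans (b := s1.arr 14 (r * I + i)) (by simp [clearProg, Stmt.run]) ?_
      rw [hw _ (wordIndex_lt r.2 i.2), digitsPrio, wordPrio]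
      congr 2
      refine wordVal_congr fun j hj => ?_
      have hlt : (r * I + i) * (32 * n.size) + j < N := by rw [hN]; exact wordIndex_lt (wordIndex_lt r.2 i.2) hj
      simp only [hst', State.withBits, update_self, bitFun, hlt, hj, dif_pos,
        bitsEquiv_apply hN ω r i ⟨j, hj⟩ hlt]
    · have : s1.time ≤ st.time + R * I * (194 * n.size + 13) + 1 :=
        ht.trans (le_of_eq (by simp only [hst', State.withBits]; ring))
      simp [clearProg, Stmt.run]
      omega

/-- The words of the machine are large enough for the preparation. -/
structure PrepBounds (c n σ I B : ℕ) : Prop where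
  prio : ((32 * n.size) + 1) * (n.size * (2 ^ (32 * n.size) * (n.size * n.size) * 2 ^ (32 * n.size))) < B
  pow : 2 * 2 ^ (32 * n.size) + 1 < B
  cap : 2 * 2 ^ I.size + 1 < B
  runs : c * (σ * σ * n.size) + 1 < B
  words : c * (σ * σ * n.size) * I < B
  bits : 16 * (c * (σ * σ * n.size) * I * (32 * n.size)) + 31 < B

theorem mul_le_pow {N a b i j : ℕ} (ha : a ≤ N ^ i) (hb : b ≤ N ^ j) : a * b ≤ N ^ (i + j) := by
  rw [pow_add]; exact Nat.mul_le_mul ha hb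

theorem two_pow_size_le {m : ℕ} : 2 ^ m.size ≤ 2 * m + 1 := by
  rcases Nat.eq_zero_or_pos m with rfl | hm
  · simp
  · have h1 : 2 ^ (m.size - 1) ≤ m := Nat.lt_size.1 (by
      have := Nat.size_pos.2 hm
      omega)
    have : m.size = m.size - 1 + 1 := by have := Nat.size_pos.2 hm; omega
    rw [this, pow_succ]; omega

/-- Each quantity is bounded by an explicit power of `N`. The largest contributions come from `2 ^
(32 * n.size) ≤ N ^ 64`, which follows from `2 ^ n.size ≤ 2 * n + 1 ≤ N ^ 2`, and from the constant
`c ≤ N ^ c`. -/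
theorem prepBounds {N n σ I : ℕ} (hN : 2 ≤ N) (hn : n < N) (hσ : σ ≤ N) (hI : I ≤ N ^ 4) (c : ℕ) :
    PrepBounds (2 ^ 16 * c) n σ I (N ^ (200 + c)) := by
  have two : ∀ k, 2 ^ k ≤ N ^ k := fun k => Nat.pow_le_pow_left hN k
  have hsz : n.size ≤ N ^ 1 := by rw [pow_one, Nat.size_le]; exact hn.trans Nat.lt_two_pow_self
  have h32 : 32 * n.size ≤ N ^ 6 := mul_le_pow (i := 5) (two 5) hsz
  have hp : 2 ^ (32 * n.size) ≤ N ^ 64 := by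
    rw [mul_comm, pow_mul, show 64 = 2 * 32 by norm_num, pow_mul]
    refine Nat.pow_le_pow_left ((two_pow_size_le (m := n)).trans ?_) 32
    nlinarith
  have hone : ∀ k, 1 ≤ N ^ k := fun k => Nat.one_le_pow _ _ (by omega)
  have hadd : ∀ {a k : ℕ}, a ≤ N ^ k → a + 31 ≤ N ^ (k + 5) := fun {a k} ha => by
    have := two 5
    have := hone k
    rw [pow_add]; nlinarith
  have hlt : ∀ {a k : ℕ}, a ≤ N ^ k → k < 200 + c → a < N ^ (200 + c) := fun ha hk =>
    ha.trans_lt (Nat.pow_lt_pow_right (by omega) hk)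
  have hc : 2 ^ 16 * c ≤ N ^ (16 + c) := mul_le_pow (two 16) (Nat.lt_two_pow_self.le.trans (two c))
  have hR : 2 ^ 16 * c * (σ * σ * n.size) ≤ N ^ (19 + c) := by
    rw [show 19 + c = 16 + c + (1 + 1 + 1) by ring]
    exact mul_le_pow hc (mul_le_pow (mul_le_pow (by simpa using hσ) (by simpa using hσ)) hsz)
  have hpow := mul_le_pow (i := 1) (two 1) hp
  have hcap : 2 ^ I.size ≤ N ^ 9 := (two_pow_size_le (m := I)).trans (by
    have := two 4
    have := two 5
    nlinarith)
  have hcap2 := mul_le_pow (i := 1) (two 1) hcap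
  have hRI := mul_le_pow hR hI
  have hbits := mul_le_pow (i := 4) (two 4) (mul_le_pow hRI h32)
  refine ⟨?_, ?_, ?_, ?_, hlt hRI (by omega), hlt (hadd hbits) (by omega)⟩
  · refine hlt (mul_le_pow (i := 11) (le_trans (by omega) (hadd h32))
      (mul_le_pow hsz (mul_le_pow (mul_le_pow hp (mul_le_pow hsz hsz)) hp))) (by omega)
  · exact lt_of_le_of_lt (by omega) (hlt (hadd hpow) (by omega))
  · exact lt_of_le_of_lt (by omega) (hlt (hadd hcap2) (by omega))
  · exact lt_of_le_of_lt (by omega) (hlt (hadd hR) (by omega))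

end

section

variable {n : ℕ} {G : WeightedGraph n} {A : AdjLists G} {x : Fin n} {ν σ k : ℕ} {B : ℕ}

/-! ### The local algorithm -/

/-- Everything before the coin flips. -/
def localPrep (c : ℕ) : Stmt := ite (.bin .lt 1 (v 0) * .bin .lt 0 (v 2) * .bin .lt 1 (v 3))
    (ite (.bin .lt (v 0 * v 0) (v 2)) (set 2 (v 0 * v 0)) .skip ;; set 12 (4 * v 2) ;; prepProg c) .skip

/-- Everything after the coin flips. -/
def localMain : Stmt := ite (v 10) ((wordsProg ;; clearProg) ;; mainProg) .skip ;;
  ite (v 30) (set 0 1 ;; set 1 (v 39)) (set 0 0 ;; set 1 0)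

theorem uses_runState {inp : Input} {t : ℕ} {s s' : State} (hu : runProg.uses t = false)
    (h : EqOff t s s') (r : ℕ) : EqOff t (runState inp s r) (runState inp s' r) := by
  induction r with
  | zero => exact h
  | succ r ih => exact Stmt.run_congr inp _ hu (ih.set 26 r)

/-- The answer in the variables. -/
structure Answers (G : WeightedGraph n) (x : Fin n) (ν σ k : ℕ) (s : State) : Prop where
  found : s.reg 0 ≠ 0 → s.reg 0 = 1 ∧ ∃ S, G.IsLocalSet x ν σ k S ∧ s.reg 1 = S.card ∧
    (range S.card).image (s.arr 9) = S.image Fin.val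
  size : s.reg 1 ≤ σ ∧ s.reg 1 ≤ n

theorem Answers.solves {s : State} {s' : Store} (h : Answers G x ν σ k s) (he : Emitted s s')
    (h0 : s.reg 0 = 0 → ¬ ∃ X, G.IsLocalExtremeSet x ν σ k X) : Solves G x ν σ k s' := by
  by_cases hz : s.reg 0 = 0
  · exact Or.inr ⟨he.flag.trans hz, h0 hz⟩
  · obtain ⟨h1, S, hS, hc, hi⟩ := h.found hz
    refine Or.inl ⟨S, ⟨he.flag.trans h1, he.size.trans hc, ?_⟩, hS⟩
    rw [← hi]
    refine image_congr fun i hi => ?_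
    rw [he.addr, Nat.zero_add, he.mem i (by rw [hc]; simpa using hi)]

theorem answers_tr {inp : Input} {s : State} (h : s.reg 30 ≠ 0 → Found G x ν σ k s) :
    Tr inp B (ite (v 30) (set 0 1 ;; set 1 (v 39)) (set 0 0 ;; set 1 0)) s (fun s' =>
      Answers G x ν σ k s' ∧ (s'.reg 0 = 0 ↔ s.reg 30 = 0) ∧ s'.time = s.time + 3) := by
  rw [Tr_ite]
  constructor
  · intro h30
    obtain ⟨S, hS, hc, hi⟩ := h (by simpa using h30)
    simp only [Tr_seq, Tr_set]
    simp at h30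
    refine ⟨by simp, by simp, ⟨fun _ => ⟨by simp, S, hS, by simp [hc], by simpa using hi⟩, ?_⟩,
      by simp [h30], by simp⟩
    simpa [hc, hS.2.2.1.le] using S.card_le_univ
  · intro h30
    simp only [Tr_seq, Tr_set]
    simp at h30
    exact ⟨by simp, by simp, ⟨by simp, by simp⟩, by simp [h30], by simp⟩

theorem AdjLists.length_le (A : AdjLists G) (w : Fin n) : (A.nbrs w).length ≤ n := by
  simpa using (A.nodup w).length_le_card

/-- The state in which the runs of the local algorithm start. -/
structure LocalStart (x : Fin n) (ν σ k R I : ℕ) (s : State) : Prop where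
  x : s.reg 1 = x
  vol : s.reg 2 = ν
  size : s.reg 3 = σ
  cut : s.reg 4 = k
  runs : s.reg 11 = R
  len : s.reg 12 = I
  depth : s.reg 13 = I.size
  cap : s.reg 14 = 2 ^ I.size
  marks : ∀ u, s.arr 10 u = 0
  zero : s.arr 13 0 = 0

theorem LocalStart.searchRegs {R I : ℕ} {s : State} (h : LocalStart x ν σ k R I s) (r : ℕ) :
    SearchRegs G x ν σ k I.size I r (((s.put 8 0 1).set 30 0).set 26 r) := by
  constructor <;> simp [h.x, h.vol, h.size, h.cut, h.len, h.depth, h.cap]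

theorem LocalStart.betweenInv {R I : ℕ} {s : State} (h : LocalStart x ν σ k R I s) :
    BetweenInv G x ν σ k 0 ((s.put 8 0 1).set 30 0) :=
  ⟨by simp [h.zero], fun u => by simp [h.marks], by simp⟩

theorem mainProg_tr {R I : ℕ} {s : State} (h : LocalStart x ν σ k R I s) (hI4 : I = 4 * ν)
    (hσ : 2 ≤ σ) (hB1 : (I + 1) * (G.maxWeight + 1) < B) (hB2 : 2 * 2 ^ I.size < B)
    (hB3 : σ < B) (hB4 : R + 1 < B) (hB5 : n < B) :
    Tr A.input B mainProg s (fun s' => (s'.reg 30 ≠ 0 → Found G x ν σ k s') ∧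
      s'.reg 30 = (runState A.input ((s.put 8 0 1).set 30 0) R).reg 30 ∧
      s'.time ≤ s.time + R * (I * (6 * I.size + 30) + 4 * 2 ^ I.size + 26) + 3) := by
  have key := runState_inv (A := A) (R := R) (B := B) (h.searchRegs (G := G)) h.betweenInv
    (Nat.lt_size_self I).le hI4 hσ hB1 hB2 hB3 hB4 fun w => (A.length_le w).trans_lt hB5
  obtain ⟨-, hb, -, ht, hs⟩ := key R le_rfl
  rw [mainProg, Tr_seq, Tr_sto]
  refine ⟨by simp, ?_⟩
  rw [Tr_seq, Tr_set]
  refine ⟨by simp, ⟨by simp, fun i hi => ?_⟩, ?_⟩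
  · simp only [Ex.eval_v, State.set_reg, State.put_reg] at hi
    exact hs i (by simpa [h.runs] using hi)
  · have e : (Stmt.loop 26 (v 11) runProg).run A.input ((s.put 8 0 1).set 30 0) =
        (runState A.input ((s.put 8 0 1).set 30 0) R).tick 1 := by
      simp only [Stmt.run, Ex.eval_v]
      rw [show ((s.put 8 0 1).set 30 0).reg 11 = R by simp [h.runs]]
      rfl
    have e' : (s.put 8 (Ex.eval A.input s 0) (Ex.eval A.input s 1)).set 30
      (Ex.eval A.input (s.put 8 (Ex.eval A.input s 0) (Ex.eval A.input s 1)) 0) =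
      (s.put 8 0 1).set 30 0 := rfl
    beta_reduce
    rw [e', e]
    refine ⟨hb.found, rfl, ?_⟩
    simp only [State.tick_time, State.set_time, State.put_time] at ht ⊢
    omega

/-- The state before the coin flips. -/
structure LocalPrepared (c : ℕ) (x : Fin n) (ν σ k : ℕ) (st : State) : Prop extends Prepared c n σ (4 * ν) st where
  start : st.reg 1 = x
  vol : st.reg 2 = ν
  size : st.reg 3 = σ
  cut : st.reg 4 = k
  found : st.reg 30 = 0
  arr : ∀ t i, st.arr t i = 0
  time : st.time ≤ 80 * n.size + 4 * (4 * ν).size + 30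

/-- The local algorithm after the coin flips. -/
theorem localMain_tr {c R N : ℕ} {st : State} (h : LocalPrepared c x ν σ k st) (hN : N = R * (4 * ν) * (32 * n.size))
    (hR : R = c * (σ * σ * n.size)) (hσ : 2 ≤ σ) (hb : PrepBounds c n σ (4 * ν) B)
    (hB1 : (4 * ν + 1) * (G.maxWeight + 1) < B) (hB3 : σ < B) (hB5 : n < B) (ω : Fin N → Bool) :
    Tr A.input B localMain (st.withBits N ω) (fun s' => Answers G x ν σ k s' ∧
      (R * (4 * ν) ≠ 0 → ∃ s, Words R (4 * ν) n.size (bitsEquiv hN ω) st s ∧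
        (s'.reg 0 = 0 ↔ (runState A.input ((s.put 8 0 1).set 30 0) R).reg 30 = 0)) ∧
      s'.time ≤ st.time + R * (4 * ν) * (194 * n.size + 13) + R * (4 * ν * (6 * (4 * ν).size + 30) + 4 * 2 ^ (4 * ν).size + 26) + 14) := by
  have e10 : (st.withBits N ω).reg 10 = R * (4 * ν) := by rw [hR]; exact h.words
  have ha := h.arr
  rw [localMain, Tr_seq, Tr_ite]
  constructor
  · intro h10
    rw [Tr_seq]
    have hw := words_tr (inp := A.input) (st := st.tick 1) ⟨⟨h.pow, h.scale, h.ln⟩, h.len, h.bits, h.runs, h.run, h.depth, h.cap, h.words, h.flips⟩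
      hR hN (fun j => ha _ _) hb.prio hb.pow ω
    refine Tr.mono hw ?_
    rintro s - ⟨hs, ts⟩
    have hst : LocalStart x ν σ k R (4 * ν) s := by
      constructor <;> first | (rw [hs.reg]; simp [h.start, h.vol, h.size, h.cut, h.runs, hR, h.run, h.depth, h.cap]) |
        (intro u; rw [hs.arr _ (by norm_num) (by norm_num)]; exact ha _ _) |
        (rw [hs.arr _ (by norm_num) (by norm_num)]; exact ha _ _)
    have hcap := hb.cap
    have hruns := hb.runs
    refine (mainProg_tr hst rfl hσ hB1 (by omega) hB3 (by omega) hB5).mono ?_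
    rintro s1 - ⟨hf, hr, ht⟩
    refine (answers_tr hf).mono ?_
    rintro s2 - ⟨q1, q2, q3⟩
    refine ⟨q1, fun _ => ⟨s, ⟨hs.reg, hs.arr, hs.word⟩, q2.trans (by rw [hr])⟩, ?_⟩
    rw [q3]
    simp only [State.tick_time] at ts
    omega
  -- Without random words no run is made and `⊥` is returned.
  · intro h10
    rw [Tr_skip]
    refine (answers_tr (G := G) (x := x) (ν := ν) (σ := σ) (k := k)
      (s := ((st.withBits N ω).tick 1).tick 1) fun h' => absurd h.found h').mono ?_
    rintro s2 - ⟨q1, q2, q3⟩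
    refine ⟨q1, fun hne => absurd (e10 ▸ h10) hne, ?_⟩
    rw [q3]
    simp [State.withBits]
    omega

-- The count over bit strings is transported along `bitsEquiv` to the count over words in
-- `card_bad_le`. For this the raw bits in array `15` are erased, which no search can notice.
open Classical in
theorem localMain_fail {c l R N : ℕ} {st : State} (hn : n ≤ 2 ^ l) (hl : 1 ≤ l)
    (hN : N = R * (4 * ν) * (32 * l)) (h : LocalPrepared c x ν σ k st) (hR : R = c * (σ * σ * n.size)) (hσ : 2 ≤ σ) {X : Finset (Fin n)} (hX : G.IsLocalExtremeSet x ν σ k X)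
    (f : (Fin N → Bool) → State) (hf : ∀ ω, Words R (4 * ν) l (bitsEquiv hN ω) st (f ω)) :
    ((univ.filter fun ω => (runState A.input (((f ω).put 8 0 1).set 30 0) R).reg 30 = 0).card : ℝ) ≤
      (1 - 1 / (2 ^ 16 * (σ : ℝ) ^ 2)) ^ R * Fintype.card (Fin N → Bool) := by
  set e := bitsEquiv hN
  set g : (Fin R → Fin (4 * ν) → Fin (32 * l) → Bool) → State := fun τ =>
    ⟨(f (e.symm τ)).reg, update (f (e.symm τ)).arr 15 (fun _ => 0), 0⟩ with hg
  have hst : ∀ τ, LocalStart x ν σ k R (4 * ν) (g τ) := fun τ => by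
    have hs := hf (e.symm τ)
    constructor <;> first | (simp only [hg]; rw [hs.reg]; simp [h.start, h.vol, h.size, h.cut, h.runs, hR, h.run, h.depth, h.cap]) |
      (intro u; simp only [hg]; rw [update_of_ne (by norm_num),
        hs.arr _ (by norm_num) (by norm_num)]; exact h.arr _ _) |
      (simp only [hg]; rw [update_of_ne (by norm_num), hs.arr _ (by norm_num) (by norm_num)]; exact h.arr _ _)
  have hreg : ∀ ω ω', (f ω').reg = (f ω).reg := fun ω ω' => by funext y; rw [(hf ω).reg, (hf ω').reg]
  have key := card_bad_le (A := A) hl hn hX (R := R) (I := 4 * ν) (D := (4 * ν).size)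
    (fun τ => ((g τ).put 8 0 1).set 30 0) ?_ ?_ (fun τ r => (hst τ).searchRegs r)
    (fun τ => (hst τ).betweenInv) (Nat.lt_size_self _).le rfl hσ
  · rw [← Fintype.card_congr e] at key
    refine le_of_eq_of_le ?_ key
    congr 1
    refine card_equiv e fun ω => ?_
    simp only [mem_filter, mem_univ, true_and]
    have h15 : EqOff 15 (((f ω).put 8 0 1).set 30 0) (((g (e ω)).put 8 0 1).set 30 0) := by
      refine ⟨by simp [hg, State.set, State.put], fun t ht => ?_⟩
      simp_all
    rw [(uses_runState (by decide) h15 R).reg]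
  · intro τ τ'
    refine ⟨by simp [hg, State.set, State.put, hreg (e.symm τ) (e.symm τ')], fun t ht => ?_⟩
    have : ∀ t, t ≠ 14 → (g τ').arr t = (g τ).arr t := fun t ht => by
      by_cases h15 : t = 15
      · simp [hg, h15]
      · simp [hg, h15, (hf _).arr t ht h15]
    by_cases h8 : t = 8
    · subst h8; simp [this 8]
    · simp [h8, this t ht]
  · intro τ r i
    have := (hf (e.symm τ)).word r i
    rw [Equiv.apply_symm_apply] at this
    simpa [hg] using this

/-- Every volume is below `n * n`, so a larger `ν` imposes no condition. With the smaller value the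
depth of the tournament is `O(log n)` for all `ν`. -/
theorem WeightedGraph.isLocalSet_min (hn : 0 < n) (X : Finset (Fin n)) :
    G.IsLocalSet x (min ν (n * n)) σ k X ↔ G.IsLocalSet x ν σ k X := by
  simp [WeightedGraph.IsLocalSet, vol_lt_sq G hn X]

theorem localPrep_tr {inp : Input} {c : ℕ} (hn : 2 ≤ n) (hν : 1 ≤ ν) (hσ : 2 ≤ σ)
    (hb : PrepBounds c n σ (4 * min ν (n * n)) B) (hB : 4 * min ν (n * n) < B) :
    Tr inp B (localPrep c) (startState [n, x, ν, σ, k] fun _ _ => 0) (LocalPrepared c x (min ν (n * n)) σ k) := by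
  set s := startState [n, x, ν, σ, k] fun _ _ => 0 with hs
  have r0 : s.reg 0 = n := rfl
  have r2 : s.reg 2 = ν := rfl
  have r3 : s.reg 3 = σ := rfl
  have rt : s.time = 0 := rfl
  have hb1 := hb.pow
  have hb2 := hb.cap
  have hb3 := hb.runs
  have hb5 := hb.bits
  rw [localPrep, Tr_ite]
  refine ⟨fun _ => ?_, fun h => ?_⟩
  · rw [Tr_seq]
    have : Tr inp B (ite (.bin .lt (v 0 * v 0) (v 2)) (set 2 (v 0 * v 0)) .skip) (s.tick 1)
        (fun s' => s'.reg 2 = min ν (n * n) ∧ s'.time ≤ 3) := by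
      rw [Tr_ite]
      constructor
      · intro h
        simp [r0, r2] at h
        rw [min_eq_right h.le] at hB ⊢
        rw [Tr_set]
        simp [r0, rt]
        omega
      · intro h
        simp [r0, r2] at h
        rw [min_eq_left h, Tr_skip]
        simp [r2, rt]
    refine this.mono ?_
    rintro s1 hF ⟨h2, ht⟩
    have q0 : s1.reg 0 = n := hF.reg 0 rfl
    have q1 : s1.reg 1 = x := hF.reg 1 rfl
    have q3 : s1.reg 3 = σ := hF.reg 3 rfl
    have q4 : s1.reg 4 = k := hF.reg 4 rfl
    have q30 : s1.reg 30 = 0 := hF.reg 30 rfl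
    rw [Tr_seq, Tr_set]
    refine ⟨by simp [h2, hB], ?_⟩
    refine (prepProg_tr ?_ ?_ ?_ ?_ ?_ ?_).mono ?_
    · simpa [q0] using hb.prio
    · simp [q0]; omega
    · simp [h2]; omega
    · simp [q0, q3]; omega
    · simpa [q0, q3, h2] using hb.words
    · simp [q0, q3, h2]; omega
    · rintro s2 hF2 ⟨hp, ht2⟩
      have f1 := hF2.reg 1 rfl
      have f2 := hF2.reg 2 rfl
      have f3 := hF2.reg 3 rfl
      have f4 := hF2.reg 4 rfl
      have f30 := hF2.reg 30 rfl
      simp [q0, q1, q3, q4, q30, h2] at f1 f2 f3 f4 f30 hp ht2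
      refine ⟨hp, f1, f2, f3, f4, f30, fun t i => ?_, by omega⟩
      have fa := hF2.arr t rfl
      simp at fa
      rw [fa, hF.arr t rfl]
      rfl
  · simp [r0, r2, r3] at h
    omega

end

/-! ### Resource bounds and assembly of the local algorithm -/

section

section Wf
variable (d C k : ℕ) (e f : Ex)
@[simp] theorem Ex.wf_ofNat : (no_index (OfNat.ofNat k : Ex)).wf d C ↔ k ≤ C := Iff.rfl
@[simp] theorem Ex.wf_v : (v k).wf d C ↔ k < d := Iff.rfl
@[simp] theorem Ex.wf_add : (e + f).wf d C ↔ e.wf d C ∧ f.wf d C := Iff.rfl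
@[simp] theorem Ex.wf_sub : (e - f).wf d C ↔ e.wf d C ∧ f.wf d C := Iff.rfl
@[simp] theorem Ex.wf_mul : (e * f).wf d C ↔ e.wf d C ∧ f.wf d C := Iff.rfl
@[simp] theorem Ex.wf_div : (e / f).wf d C ↔ e.wf d C ∧ f.wf d C := Iff.rfl
@[simp] theorem Ex.wf_mod : (e % f).wf d C ↔ e.wf d C ∧ f.wf d C := Iff.rfl
end Wf

theorem paramRegs_lt {B : ℕ} (hB : 0 < B) (l : List ℕ) (h : ∀ a ∈ l, a < B) (i : ℕ) : paramRegs l i < B := by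
  rw [paramRegs, List.getD_eq_getElem?_getD]
  by_cases hi : i < l.length
  · simp_all
  · simp_all

variable {n : ℕ} {G : WeightedGraph n}

theorem WeightedGraph.weight_le (G : WeightedGraph n) {e : Sym2 (Fin n)} (h : e ∈ G.edges) :
    G.weight e ≤ G.maxWeight :=
  le_sup (f := G.weight) h

theorem AdjLists.input_le (A : AdjLists G) (q a b : ℕ) : A.input q a b ≤ n + G.maxWeight := by
  by_cases ha : a < n
  · have hd := A.length_le ⟨a, ha⟩
    rcases q with _ | _ | _ | q <;> simp only [AdjLists.input, ha, dif_pos]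
    · omega
    · split_ifs <;> omega
    · split_ifs with hb
      · refine (G.weight_le ?_).trans (by omega)
        simpa [WeightedGraph.edges] using (A.mem_iff _ _).1 (List.getElem_mem hb)
      · omega
    · omega
  · simp [AdjLists.input, ha]

theorem size_le_three_mul {n I : ℕ} (hn : 2 ≤ n) (h : I ≤ 4 * (n * n)) : I.size ≤ 3 * n.size := by
  have hl2 : 2 ≤ n.size := Nat.lt_size.2 (by simpa using hn)
  have h1 : n < 2 ^ n.size := Nat.lt_size_self n
  rw [Nat.size_le]
  calc I ≤ 4 * (n * n) := h
    _ < 4 * (2 ^ n.size * 2 ^ n.size) := by nlinarith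
    _ = 2 ^ (n.size + n.size + 2) := by rw [pow_add, pow_add]; ring
    _ ≤ 2 ^ (3 * n.size) := Nat.pow_le_pow_right (by norm_num) (by omega)

/-- The words of the machine are large enough. -/
structure WordBounds (N n σ W c B : ℕ) : Prop where
  self : N < B
  flips : 48 < B
  const : c + 64 < B
  table : (n + 1) * (W + 1) < B
  sums : σ * (n * (W + 1) + 1) < B
  steps : 4 * (σ * σ) < B
  codes : (n * n + 2) * (n + 1) < B

theorem wordBounds {N n σ W : ℕ} (hN : n + σ + W + 2 ≤ N) (c : ℕ) :
    WordBounds N n σ W (2 ^ 16 * c) (N ^ (200 + c)) := by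
  have hN2 : 2 ≤ N := by omega
  have two : ∀ k, 2 ^ k ≤ N ^ k := fun k => Nat.pow_le_pow_left hN2 k
  have hlt : ∀ {a : ℕ} (j : ℕ), a ≤ N ^ j → j < 200 + c → a < N ^ (200 + c) := fun j ha hj =>
    ha.trans_lt (Nat.pow_lt_pow_right (by omega) hj)
  have le1 : ∀ {a : ℕ}, a ≤ N → a ≤ N ^ 1 := fun h => by rwa [pow_one]
  have hn2 : n * n + 2 ≤ N ^ 2 := by nlinarith
  refine ⟨hlt 1 (by simp) (by omega), hlt 6 (le_trans (by norm_num) (two 6)) (by omega), ?_,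
    hlt 2 (mul_le_pow (i := 1) (j := 1) (le1 (by omega)) (le1 (by omega))) (by omega), ?_,
    hlt 4 (mul_le_pow (i := 2) (j := 2) (two 2) (mul_le_pow (i := 1) (j := 1) (le1 (by omega)) (le1 (by omega))))
      (by omega), hlt 3 (mul_le_pow (j := 1) hn2 (le1 (by omega))) (by omega)⟩
  · refine hlt (17 + c) ?_ (by omega)
    have h1 : 2 ^ 16 * c ≤ N ^ (16 + c) := mul_le_pow (two 16) (Nat.lt_two_pow_self.le.trans (two c))
    have h2 : 64 ≤ N ^ (16 + c) :=
      le_trans (by norm_num) ((two 16).trans (Nat.pow_le_pow_right (by omega) (by omega)))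
    calc 2 ^ 16 * c + 64 ≤ 2 * N ^ (16 + c) := by omega
      _ ≤ N * N ^ (16 + c) := Nat.mul_le_mul_right _ hN2
      _ = N ^ (17 + c) := by rw [← pow_succ']; congr 1; omega
  · have h1 : n * (W + 1) + 1 ≤ N ^ 2 := by nlinarith
    exact hlt 3 (mul_le_pow (i := 1) (le1 (by omega)) h1) (by omega)

/-- Every contribution is a multiple of `W = ν * σ ^ 2 * l ^ 2`: there are `R = c * σ ^ 2 * l` runs
of `4 * ν` words or steps, each at cost `O(l)`. The numerical constants only collect the factors. -/
theorem local_time_le {n ν σ c κ t r w : ℕ} (hn : 2 ≤ n) (hν : 1 ≤ ν) (hνn : ν ≤ n * n) (hσ : 2 ≤ σ)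
    {I R : ℕ} (hI : I = 4 * ν) (hR : R = c * (σ * σ * n.size))
    (ht : t ≤ 80 * n.size + 4 * I.size + 30 + R * I * (194 * n.size + 13) +
      R * (I * (6 * I.size + 30) + 4 * 2 ^ I.size + 26) + 14)
    (hr : r = R * I * (32 * n.size)) (hw : w ≤ σ) :
    κ * t + 8 * r + 12 * w + 28 ≤ (κ * (1082 * c + 136) + 1024 * c + 40) * (ν * (σ * σ) * (n.size * n.size)) := by
  set l := n.size with hl
  have hl2 : 2 ≤ l := Nat.lt_size.2 (by simpa using hn)
  have hD : I.size ≤ 3 * l := size_le_three_mul hn (by omega)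
  have h2D : 2 ^ I.size ≤ 9 * ν := two_pow_size_le.trans (by omega)
  set W := ν * (σ * σ) * (l * l) with hW
  have hσσ : 1 ≤ σ * σ := Nat.mul_pos (by omega) (by omega)
  have hνσ : 1 ≤ ν * (σ * σ) := Nat.mul_pos hν hσσ
  have hlW : l ≤ W := by nlinarith
  have hσW : σ ≤ W := by
    have : 1 ≤ ν * σ * (l * l) := Nat.mul_pos (Nat.mul_pos hν (by omega)) (Nat.mul_pos (by omega) (by omega))
    calc σ = σ * 1 := by ring
      _ ≤ σ * (ν * σ * (l * l)) := by gcongr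
      _ = W := by rw [hW]; ring
  have a1 : R * I * (194 * l + 13) ≤ 828 * c * W := by
    calc R * I * (194 * l + 13) ≤ R * I * (207 * l) := Nat.mul_le_mul_left _ (by omega)
      _ = 828 * c * W := by rw [hR, hI, hW]; ring
  have a2 : R * (I * (6 * I.size + 30) + 4 * 2 ^ I.size + 26) ≤ 254 * c * W := by
    have b1 : I * (6 * I.size + 30) ≤ 4 * ν * (48 * l) := by rw [hI] at hD ⊢; exact Nat.mul_le_mul_left _ (by omega)
    have b2 : ν ≤ ν * l := Nat.le_mul_of_pos_right _ (by omega)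
    calc _ ≤ R * (254 * (ν * l)) := Nat.mul_le_mul_left _ (by nlinarith)
      _ = 254 * c * W := by rw [hR, hW]; ring
  have a3 : 8 * r = 1024 * c * W := by rw [hr, hR, hI, hW]; ring
  have a4 : t ≤ (1082 * c + 136) * W := by linarith
  have a5 := Nat.mul_le_mul_left κ a4
  have : (κ * (1082 * c + 136) + 1024 * c + 40) * W = κ * ((1082 * c + 136) * W) + 1024 * c * W + 40 * W := by ring
  omega

/-- The factor `9` is the square of the `3` in `size_le_log`. -/
theorem le_floor_local (C σ : ℕ) {n μ ν : ℕ} (hn : 2 ≤ n) (h : μ ≤ ν) : C * (μ * (σ * σ) * (n.size * n.size)) ≤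
      ⌊(9 * C : ℝ) * ((ν : ℝ) * (σ : ℝ) ^ 2 * Real.log n ^ 2 + 1)⌋₊ := by
  refine Nat.le_floor ?_
  have hlog := size_le_log hn
  push_cast
  have h4 : (μ : ℝ) ≤ ν := by exact_mod_cast h
  have h5 : (n.size : ℝ) * n.size ≤ 9 * Real.log n ^ 2 := by nlinarith
  have h6 : (C : ℝ) * (μ * (σ * σ) * (n.size * n.size)) ≤ C * (ν * (σ * σ) * (9 * Real.log n ^ 2)) := by gcongr
  calc _ ≤ _ := h6
    _ = 9 * C * (ν * σ ^ 2 * Real.log n ^ 2) := by ring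
    _ ≤ _ := by gcongr; linarith

theorem localPrep_wf (c : ℕ) : (localPrep c).wf 64 (c + 64) := by
  simp [localPrep, prepProg, powProg, riemProg, Stmt.wf, Ex.wf]

theorem localMain_wf (c : ℕ) : localMain.wf 64 (c + 64) := by
  simp [localMain, wordsProg, wordBody, riemProg, clearProg, mainProg, runProg, initProg, stepProg,
    scanProg, addProg, decideProg, updProg, Stmt.wf, Ex.wf]

theorem solves_min {x : Fin n} {ν σ k : ℕ} (hn : 0 < n) (s : Store) :
    Solves G x (min ν (n * n)) σ k s ↔ Solves G x ν σ k s := by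
  simp only [Solves, WeightedGraph.IsLocalExtremeSet, WeightedGraph.isLocalSet_min hn]

theorem toOuterMeasure_fails_le {x : Fin n} {ν σ k : ℕ} {Ω : Type*} [Fintype Ω] [Nonempty Ω] {g : Ω → Store}
    (h : ∀ ω, Solves G x ν σ k (g ω)) (q : ENNReal) :
    ((PMF.uniformOfFintype Ω).map fun ω => some (g ω)).toOuterMeasure {o | Fails G x ν σ k o} ≤ q := by
  refine toOuterMeasure_map_uniform_le _ _ (fun _ => False) (fun ω hω => ?_) (q' := 0) (by simp) (by simp)
  exact hω ⟨_, rfl, h ω⟩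

/-- The local algorithm with `2 ^ 16 * c` times `σ ^ 2 * log n` runs. -/
theorem exists_local_algorithm (c : ℕ) : ∃ (P : Prog) (C : ℝ) (K : ℕ),
      ∀ (n : ℕ) (G : WeightedGraph n) (A : AdjLists G) (x : Fin n) (ν σ k : ℕ),
        let T : ℕ := ⌊C * ((ν : ℝ) * (σ : ℝ) ^ 2 * Real.log n ^ 2 + 1)⌋₊
        let M : ℕ := (n + ν + σ + k + G.maxWeight + 2) ^ K
        let D : PMF (Option Store) := exec M A.input P T ⟨paramRegs [n, x, ν, σ, k], fun _ => 0⟩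
        none ∉ D.support ∧ D.toOuterMeasure {o | Fails G x ν σ k o} ≤ ((n : ENNReal) ^ c)⁻¹ := by
  classical
  set c' := 2 ^ 16 * c with hc'
  obtain ⟨κ, hκ⟩ : ∃ κ, κ = 20 * ((localPrep c').size + localMain.size) + 2 := ⟨_, rfl⟩
  obtain ⟨Cn, hCn⟩ : ∃ Cn, Cn = κ * (1082 * c' + 136) + 1024 * c' + 40 := ⟨_, rfl⟩
  refine ⟨.seq ((localPrep c').comp 64) (.seq flipProg (.seq (localMain.comp 64) emitProg)),
    9 * Cn, (200 + c) * κ, ?_⟩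
  intro n G A x ν σ k T M
  have hn1 : 1 ≤ n := by have := x.2; omega
  obtain ⟨N, hN⟩ : ∃ N, N = n + ν + σ + k + G.maxWeight + 2 := ⟨_, rfl⟩
  have hN2 : 2 ≤ N := by omega
  set B := N ^ (200 + c) with hB
  have hM : M = B ^ κ := by rw [hB, ← pow_mul, hN]
  have hwb := wordBounds (n := n) (σ := σ) (W := G.maxWeight) (N := N) (by omega) c
  rw [← hB, ← hc'] at hwb
  have hNB := hwb.self
  have h48 := hwb.flips
  have hBM : B ≤ M := hM ▸ Nat.le_self_pow (by omega) B
  have hx := x.2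
  have hsm : Small A.input B (startState [n, x, ν, σ, k] fun _ _ => 0) := by
    refine ⟨paramRegs_lt (by omega) _ fun a ha => ?_, fun _ _ => by simp [startState]; omega,
      fun q a b => (A.input_le q a b).trans_lt (by omega)⟩
    simp at ha
    omega
  have hl3 : (1 : ℝ) ≤ Cn := by simp; omega
  have hwP := localPrep_wf c'
  have hwQ := localMain_wf c'
  by_cases hgood : 2 ≤ n ∧ 1 ≤ ν ∧ 2 ≤ σ
  · obtain ⟨hn, hν, hσ⟩ := hgood
    set μ := min ν (n * n) with hμ
    have hμ1 : 1 ≤ μ := le_min hν (Nat.mul_pos (by omega) (by omega))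
    have hI : 4 * μ ≤ N ^ 3 := by
      calc 4 * μ ≤ 2 ^ 2 * N := by omega
        _ ≤ N ^ 2 * N := Nat.mul_le_mul_right _ (Nat.pow_le_pow_left hN2 2)
        _ = N ^ 3 := by ring
    have hb := prepBounds hN2 (show n < N by omega) (show σ ≤ N by omega)
      (hI.trans (Nat.pow_le_pow_right (by omega) (by norm_num : 3 ≤ 4))) c
    rw [← hB, ← hc'] at hb
    have hW : (4 * μ + 1) * (G.maxWeight + 1) < B := by
      refine lt_of_le_of_lt ?_ (Nat.pow_lt_pow_right (m := 5) (by omega) (by omega))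
      calc (4 * μ + 1) * (G.maxWeight + 1) ≤ (N ^ 3 * N) * N := by
            gcongr
            · have h1 : 1 ≤ N ^ 3 := Nat.one_le_pow _ _ (by omega)
              have h2 : N ^ 3 * 2 ≤ N ^ 3 * N := Nat.mul_le_mul_left _ hN2
              omega
            · omega
        _ = N ^ 5 := by ring
    obtain ⟨hsafe, hst⟩ := localPrep_tr (inp := A.input) (x := x) (k := k) hn hν hσ hb
      ((Nat.le_mul_of_pos_right _ (Nat.succ_pos _)).trans_lt ((Nat.mul_le_mul_right _ (Nat.le_succ _)).trans_lt hW))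
    obtain ⟨st, hst'⟩ : ∃ st, st = (localPrep c').run A.input (startState [n, x, ν, σ, k] fun _ _ => 0) := ⟨_, rfl⟩
    rw [← hst'] at hst
    obtain ⟨R, hR⟩ : ∃ R, R = c' * (σ * σ * n.size) := ⟨_, rfl⟩
    have h19 : st.reg 19 = R * (4 * μ) * (32 * n.size) := by rw [hR]; exact hst.flips
    have hmain := fun ω : Fin (st.reg 19) → Bool => localMain_tr (A := A) hst h19 hR hσ hb hW (by omega) (by omega) ω
    have h19B : 16 * st.reg 19 + 31 < B := by rw [h19, hR]; exact hb.bits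
    have hT : ∀ ω, κ * (localMain.run A.input (st.withBits (st.reg 19) ω)).time + 8 * st.reg 19 +
        12 * (localMain.run A.input (st.withBits (st.reg 19) ω)).reg 1 + 28 ≤ T := by
      intro ω
      obtain ⟨h1, -, h3⟩ := (hmain ω).2
      have h2 := hst.time
      refine (local_time_le (κ := κ) hn hμ1 (min_le_right _ _) hσ rfl hR (h3.trans ?_) h19 h1.size.1).trans ?_
      · rw [← hμ] at h2 ⊢; omega
      · rw [← hCn]; exact le_floor_local Cn σ hn (min_le_left _ _)
    obtain ⟨g, hg, he⟩ := exec_comp_flip_emit (T := T) hwb.flips hwb.const hM.ge (by omega) hwP (by omega) hwQ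
      (by omega) hsm hsafe hst'.symm (by omega) (fun ω => (hmain ω).1) hT
    · simp only
      rw [hg]
      refine ⟨none_notMem_support_map _, ?_⟩
      have hrun := fun ω => (hmain ω).2
      by_cases hX : ∃ X, G.IsLocalExtremeSet x μ σ k X
      · obtain ⟨X, hX⟩ := hX
        refine toOuterMeasure_map_uniform_le _ _ (fun ω =>
          (localMain.run A.input (st.withBits (st.reg 19) ω)).reg 0 = 0) (fun ω hω => ?_)
          (runs_fail_le hn1 hσ c) ?_
        · by_contra h0
          exact hω ⟨_, rfl, (solves_min hn1 _).1 ((hrun ω).1.solves (he ω) fun h => absurd h h0)⟩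
        · rw [← hc', ← hR]
          -- This happens only for `c = 0`; then there are no runs and the bound to be shown is
          -- trivial.
          by_cases hRI : R * (4 * μ) = 0
          · have hR0 : R = 0 := by
              rcases Nat.mul_eq_zero.1 hRI with h | h
              · exact h
              · omega
            rw [hR0, pow_zero, one_mul]
            exact_mod_cast card_le_univ _
          · choose f hf hf' using fun ω => (hrun ω).2.1 hRI
            simp only [hf']
            exact localMain_fail (Nat.lt_size_self n).le (Nat.size_pos.2 hn1) h19 hst hR hσ hX f hf
      · exact toOuterMeasure_fails_le (fun ω => (solves_min hn1 _).1 ((hrun ω).1.solves (he ω) fun _ => hX)) _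
  -- Degenerate parameters: the program stops at once and answers `⊥`.
  · obtain ⟨st, hst⟩ : ∃ st, st = ((startState [n, x, ν, σ, k] fun _ _ => 0).tick 1).tick 1 := ⟨_, rfl⟩
    have he0 : (.bin .lt 1 (v 0) * .bin .lt 0 (v 2) * .bin .lt 1 (v 3) : Ex).eval A.input
        (startState [n, x, ν, σ, k] fun _ _ => 0) = 0 := by
      simp [startState, paramRegs]
      omega
    have hr : ∀ y, 5 ≤ y → st.reg y = 0 := fun y hy => by
      rw [hst]
      simp [startState, paramRegs, List.getElem?_eq_none (l := [n, x, ν, σ, k]) (i := y) (by simpa using hy)]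
    have hprep : (localPrep c').run A.input (startState [n, x, ν, σ, k] fun _ _ => 0) = st := by
      rw [hst, localPrep, Stmt.run, if_neg (by simp [he0])]
      rfl
    have hsafe : (localPrep c').safe A.input B (startState [n, x, ν, σ, k] fun _ _ => 0) :=
      ⟨fun h => absurd he0 h, fun _ => trivial⟩
    have hmain : ∀ ω : Fin (st.reg 19) → Bool, Tr A.input B localMain (st.withBits (st.reg 19) ω)
        (fun s' => Answers G x ν σ k s' ∧ s'.reg 0 = 0 ∧ s'.time ≤ 8 ∧ s'.reg 1 = 0) := by
      intro ω
      have h10 : (st.withBits (st.reg 19) ω).reg 10 = 0 := hr 10 (by norm_num)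
      have h30 : (st.withBits (st.reg 19) ω).reg 30 = 0 := hr 30 (by norm_num)
      have ht : (st.withBits (st.reg 19) ω).time = 2 := show st.time = 2 by rw [hst]; rfl
      rw [localMain, Tr_seq, Tr_ite]
      refine ⟨fun h => absurd h10 h, fun _ => ?_⟩
      rw [Tr_skip, Tr_ite]
      refine ⟨fun h => absurd h30 h, fun _ => ?_⟩
      simp only [Tr_seq, Tr_set]
      exact ⟨by simp, by simp, ⟨by simp, by simp⟩, by simp, by simp [ht], by simp⟩
    have h19 := hr 19 (by norm_num)
    obtain ⟨g, hg, he⟩ := exec_comp_flip_emit (T := T) hwb.flips hwb.const hM.ge (by omega) hwP (by omega) hwQ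
      (by omega) hsm hsafe hprep (by omega) (fun ω => (hmain ω).1) (fun ω => by
        obtain ⟨-, -, h3, h4⟩ := (hmain ω).2
        rw [h4]
        refine le_trans (b := Cn) ?_ (Nat.le_floor ?_)
        · have : κ * 8 ≤ κ * (1082 * c' + 136) := Nat.mul_le_mul_left _ (by omega)
          have := Nat.mul_le_mul_left κ h3
          omega
        · have : (0 : ℝ) ≤ (ν : ℝ) * (σ : ℝ) ^ 2 * Real.log n ^ 2 := by positivity
          nlinarith)
    simp only
    rw [hg]
    refine ⟨none_notMem_support_map _, ?_⟩
    -- For `n = 1` the allowed failure probability is one. Otherwise `ν = 0` or `σ ≤ 1`, no local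
    -- set exists, and `⊥` is correct.
    rcases Nat.lt_or_ge n 2 with hn | hn
    · obtain rfl : n = 1 := by omega
      exact toOuterMeasure_map_uniform_le _ _ (fun ω => True) (fun _ _ => trivial) (q' := 1) (by simp) (by simp)
    · refine toOuterMeasure_fails_le (fun ω => (hmain ω).2.1.solves (he ω) fun _ ⟨X, hX⟩ => ?_) _
      obtain ⟨h1, h2, h3, -⟩ := hX.1
      have := card_pos.2 ⟨x, h1⟩
      omega

end

section

variable {n : ℕ} {G : WeightedGraph n}

/-! ### Adjacency tables from a list of edges -/

/-- Enter the edge number `v 27` into the tables `0` (weights), `1` (degrees), `2` (weighted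
degrees) and `13` (weights by number). -/
def tableStep : Stmt := set 40 (rd 0 (v 27) 0) ;; set 41 (rd 1 (v 27) 0) ;; set 42 (rd 2 (v 27) 0) ;;
  sto 13 (v 27 + 1) (v 42) ;; sto 0 (v 40 * v 0 + v 41) (v 42 + 1) ;;
  sto 0 (v 41 * v 0 + v 40) (v 42 + 1) ;; sto 1 (v 40) (ld 1 (v 40) + 1) ;;
  sto 1 (v 41) (ld 1 (v 41) + 1) ;; sto 2 (v 40) (ld 2 (v 40) + v 42) ;;
  sto 2 (v 41) (ld 2 (v 41) + v 42)

def tableProg : Stmt := .loop 27 (v 1) tableStep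

/-- Two-digit numbers in base `n`: used both for addresses of tables and for the codes `rank * n +
vertex`. -/
theorem pair_inj {n a b c d : ℕ} (hb : b < n) (hd : d < n) : a * n + b = c * n + d ↔ a = c ∧ b = d := by
  refine ⟨fun h => ?_, fun h => by rw [h.1, h.2]⟩
  have h1 : (a * n + b) / n = (c * n + d) / n := by rw [h]
  have hn : 0 < n := by omega
  rw [mul_comm a, mul_comm c, Nat.mul_add_div hn, Nat.mul_add_div hn, Nat.div_eq_of_lt hb, Nat.div_eq_of_lt hd] at h1
  simp_all

namespace EdgeList

variable (L : EdgeList G)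

/-- The `i`-th edge and its two ends. -/
def edge (i : ℕ) (hi : i < L.list.length) : Sym2 (Fin n) := s(L.list[i].1, L.list[i].2)

open Classical in
/-- The first `i` edges. -/
noncomputable def upTo (i : ℕ) : Finset (Sym2 (Fin n)) := ((L.list.map (fun p => s(p.1, p.2))).take i).toFinset

theorem mem_upTo {i : ℕ} {e : Sym2 (Fin n)} :
    e ∈ L.upTo i ↔ ∃ j, ∃ hj : j < L.list.length, j < i ∧ L.edge j hj = e := by
  rw [upTo, List.mem_toFinset, List.mem_iff_getElem]
  simp [edge]
  exact ⟨fun ⟨j, h1, h2⟩ => ⟨j, h1.1, h1.2, h2⟩, fun ⟨j, h1, h2, h3⟩ => ⟨j, ⟨h1, h2⟩, h3⟩⟩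

theorem length_eq : L.list.length = G.numEdges := by
  classical
  have h := List.toFinset_card_of_nodup L.nodup
  rw [List.length_map] at h
  rw [← h, WeightedGraph.numEdges]
  congr 1
  ext e
  rw [List.mem_toFinset, L.mem_iff]

theorem edge_inj {i j : ℕ} {hi : i < L.list.length} {hj : j < L.list.length}
    (h : L.edge i hi = L.edge j hj) : i = j :=
  (List.Nodup.getElem_inj_iff L.nodup (hi := by simpa using hi) (hj := by simpa using hj)).1 (by simpa [edge] using h)

theorem edge_mem {i : ℕ} (hi : i < L.list.length) : L.edge i hi ∈ G.edges :=
  (L.mem_iff _).1 (List.mem_map.2 ⟨L.list[i], List.getElem_mem hi, rfl⟩)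

theorem exists_edge {e : Sym2 (Fin n)} (he : e ∈ G.edges) : ∃ i, ∃ hi : i < L.list.length, L.edge i hi = e := by
  obtain ⟨i, hi, h⟩ := List.mem_iff_getElem.1 ((L.mem_iff e).2 he)
  exact ⟨i, by simpa using hi, by simpa [edge] using h⟩

theorem upTo_all : L.upTo G.numEdges = G.edges := by
  ext e
  rw [mem_upTo]
  constructor
  · rintro ⟨j, hj, -, rfl⟩
    exact L.edge_mem hj
  · intro he
    obtain ⟨i, hi, h⟩ := L.exists_edge he
    exact ⟨i, hi, L.length_eq ▸ hi, h⟩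

theorem mem_upTo_succ {i : ℕ} (hi : i < L.list.length) {e : Sym2 (Fin n)} :
    e ∈ L.upTo (i + 1) ↔ e ∈ L.upTo i ∨ e = L.edge i hi := by
  simp only [mem_upTo]
  constructor
  · rintro ⟨j, hj, h1, h2⟩
    rcases Nat.lt_succ_iff_lt_or_eq.1 h1 with h | rfl
    · exact Or.inl ⟨j, hj, h, h2⟩
    · exact Or.inr h2.symm
  · rintro (⟨j, hj, h1, h2⟩ | h)
    · exact ⟨j, hj, by omega, h2⟩
    · exact ⟨i, hi, by omega, h.symm⟩

theorem edge_notMem_upTo {i : ℕ} (hi : i < L.list.length) : L.edge i hi ∉ L.upTo i := by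
  rw [mem_upTo]
  rintro ⟨j, hj, h1, h2⟩
  exact absurd (L.edge_inj h2) (by omega)

theorem src_ne_dst {i : ℕ} (hi : i < L.list.length) : L.list[i].1 ≠ L.list[i].2 := by
  have h := L.edge_mem hi
  rw [edge, G.mem_edges] at h
  exact h.ne

theorem input_lt_iff {i : ℕ} (hi : i < L.list.length) (b : ℕ) :
    L.input 0 i b = L.list[i].1 ∧ L.input 1 i b = L.list[i].2 ∧ L.input 2 i b = G.weight (L.edge i hi) := by
  simp [EdgeList.input, hi, edge]

theorem input_le (q a b : ℕ) : L.input q a b ≤ n + G.maxWeight := by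
  by_cases ha : a < L.list.length
  · have h1 := L.list[a].1.2
    have h2 := L.list[a].2.2
    have h3 := G.weight_le (L.edge_mem ha)
    rcases q with _ | _ | _ | q <;> simp only [EdgeList.input, ha, dif_pos]
    · omega
    · omega
    · exact h3.trans (by omega)
    · omega
  · simp [EdgeList.input, ha]

open Classical in
/-- The sum of `f` over the first `i` edges at the vertex `u`. -/
noncomputable def sumAt (f : Sym2 (Fin n) → ℕ) (i : ℕ) (u : Fin n) : ℕ :=
  ∑ w, if s(u, w) ∈ L.upTo i then f s(u, w) else 0

theorem sumAt_succ (f : Sym2 (Fin n) → ℕ) {i : ℕ} (hi : i < L.list.length) (u : Fin n) :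
    L.sumAt f (i + 1) u = L.sumAt f i u + if u = L.list[i].1 ∨ u = L.list[i].2 then f (L.edge i hi) else 0 := by
  classical
  have hne := L.src_ne_dst hi
  have hnot := L.edge_notMem_upTo hi
  have key : ∀ w, (if s(u, w) ∈ L.upTo (i + 1) then f s(u, w) else 0) =
      (if s(u, w) ∈ L.upTo i then f s(u, w) else 0) + if s(u, w) = L.edge i hi then f (L.edge i hi) else 0 := by
    intro w
    by_cases h : s(u, w) = L.edge i hi
    · rw [h]; simp [L.mem_upTo_succ hi, hnot]
    · simp [L.mem_upTo_succ hi, h]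
  rw [sumAt, sumAt, sum_congr rfl fun w _ => key w, sum_add_distrib]
  congr 1
  by_cases h1 : u = L.list[i].1
  · have : ∀ w, s(u, w) = L.edge i hi ↔ w = L.list[i].2 := fun w => by rw [edge, h1, Sym2.eq_iff]; simp [hne]
    simp_rw [this]; simp [h1]
  · by_cases h2 : u = L.list[i].2
    · have : ∀ w, s(u, w) = L.edge i hi ↔ w = L.list[i].1 := fun w => by rw [edge, h2, Sym2.eq_iff]; simp [hne.symm]
      simp_rw [this]; simp [h2]
    · have : ∀ w, s(u, w) ≠ L.edge i hi := fun w => by rw [edge, Ne, Sym2.eq_iff]; simp [h1, h2]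
      simp [this, h1, h2]

theorem sumAt_le (f : Sym2 (Fin n) → ℕ) {b : ℕ} (hf : ∀ e ∈ G.edges, f e ≤ b) (i : ℕ) (u : Fin n) :
    L.sumAt f i u ≤ n * b := by
  classical
  refine (sum_le_card_nsmul _ _ b fun w _ => ?_).trans (by simp)
  split_ifs with h
  · obtain ⟨j, hj, -, he⟩ := L.mem_upTo.1 h
    exact he ▸ hf _ (L.edge_mem hj)
  · omega

end EdgeList

open Classical in
/-- The tables for the first `i` edges. -/
structure Tables (L : EdgeList G) (i : ℕ) (a : ℕ → ℕ → ℕ) : Prop where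
  weight : ∀ u w : Fin n, a 0 (u * n + w) = if s(u, w) ∈ L.upTo i then G.weight s(u, w) + 1 else 0
  deg : ∀ u : Fin n, a 1 u = L.sumAt (fun _ => 1) i u
  wdeg : ∀ u : Fin n, a 2 u = L.sumAt G.weight i u
  item : ∀ j, ∀ hj : j < L.list.length, j < i → a 13 (j + 1) = G.weight (L.edge j hj)
  zero : a 13 0 = 0

/-- The table stores weight plus one, so an edge of weight zero, which counts for the volume, is
distinguished from a missing edge. -/
theorem tableProg_tr {B : ℕ} {L : EdgeList G} {s : State} (h0 : s.reg 0 = n)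
    (h1 : s.reg 1 = G.numEdges) (ha : ∀ t ∈ [0, 1, 2, 13], ∀ i, s.arr t i = 0)
    (hB : (n + 1) * (G.maxWeight + 1) < B) :
    Tr L.input B tableProg s (fun s' => Tables L G.numEdges s'.arr ∧ s'.time ≤ s.time + G.numEdges * 11 + 1) := by
  classical
  refine Tr.loop (c := 11) (fun i s' => Tables L i s'.arr) (by simp) ?_ ?_ ?_
  · have : ∀ e, e ∉ L.upTo 0 := fun e he => by
      obtain ⟨j, -, hj, -⟩ := L.mem_upTo.1 he
      omega
    constructor <;> simp [ha, EdgeList.sumAt, this]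
  · intro i hi s' hI hF
    have hi' : i < L.list.length := by rw [L.length_eq]; simpa [h1] using hi
    obtain ⟨i0, i1, i2⟩ := L.input_lt_iff hi' 0
    have e0 : s'.reg 0 = n := (hF.reg 0 (by decide)).trans h0
    have hw := G.weight_le (L.edge_mem hi')
    have hne : (L.list[i].1 : ℕ) ≠ L.list[i].2 := fun h => L.src_ne_dst hi' (Fin.ext h)
    have ha := L.list[i].1.2
    have hb := L.list[i].2.2
    have hidx : (L.list[i].1 : ℕ) * n + L.list[i].2 ≠ L.list[i].2 * n + L.list[i].1 := fun h =>
      hne ((pair_inj hb ha).1 h).1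
    have hle : ∀ (f : Sym2 (Fin n) → ℕ) (b : ℕ), (∀ e ∈ G.edges, f e ≤ b) → b ≤ G.maxWeight + 1 →
        ∀ u, u = L.list[i].1 ∨ u = L.list[i].2 → L.sumAt f i u + f (L.edge i hi') < B :=
      fun f b hf hb u hu => by
        have h1 := L.sumAt_succ f hi' u
        have h2 := L.sumAt_le f hf (i + 1) u
        rw [if_pos hu] at h1
        have : n * b ≤ (n + 1) * (G.maxWeight + 1) := Nat.mul_le_mul (by omega) hb
        omega
    have d1 := hle (fun _ => 1) 1 (fun _ _ => le_rfl) (by omega) _ (Or.inl rfl)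
    have d2 := hle (fun _ => 1) 1 (fun _ _ => le_rfl) (by omega) _ (Or.inr rfl)
    have w1 := hle G.weight _ (fun e he => G.weight_le he) (Nat.le_succ _) _ (Or.inl rfl)
    have w2 := hle G.weight _ (fun e he => G.weight_le he) (Nat.le_succ _) _ (Or.inr rfl)
    have hwB : G.weight (L.edge i hi') + 1 < B := by nlinarith
    simp only [tableStep, Tr_seq, Tr_set, Tr_sto]
    simp [i0, i1, i2, e0, hI.deg, hI.wdeg, hne.symm, d1, d2, w1, w2, hwB]
    refine ⟨fun u w => ?_, fun u => ?_, fun u => ?_, fun j hj hji => ?_, ?_⟩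
    · have hs : s(u, w) = L.edge i hi' ↔ (u = L.list[i].1 ∧ w = L.list[i].2) ∨
          (u = L.list[i].2 ∧ w = L.list[i].1) := by rw [EdgeList.edge, Sym2.eq_iff]
      simp [update_apply, pair_inj, hI.weight, L.mem_upTo_succ hi', Fin.val_inj]
      by_cases hc : s(u, w) = L.edge i hi'
      · rw [if_pos (Or.inr hc), hc]
        rcases hs.1 hc with h | h
        · rw [if_pos h, ite_self]
        · rw [if_pos h]
      · have := (not_congr hs).1 hc
        push Not at this
        rw [if_neg fun h => this.2 h.1 h.2, if_neg fun h => this.1 h.1 h.2]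
        simp [hc]
    · simp [update_apply, L.sumAt_succ _ hi', Fin.val_inj, hI.deg]
      split_ifs <;> simp_all
    · simp [update_apply, L.sumAt_succ _ hi', Fin.val_inj, hI.wdeg]
      split_ifs <;> simp_all
    · simp [update_apply]
      split_ifs with hj'
      · subst hj'; rfl
      · exact hI.item j hj (by omega)
    · simp [hI.zero]
  · intro s' hI hF ht
    simp [h1] at hI ht ⊢
    exact ⟨hI, by omega⟩

/-! ### Sorting the edges of a run -/

/-- The increasing list `f 0, …, f (cnt - 1)` of the elements of `C`, followed by zeros. -/
structure ListInv (f : ℕ → ℕ) (cnt : ℕ) (C : Set ℕ) : Prop where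
  zero : ∀ t, cnt ≤ t → f t = 0
  mono : ∀ t t', t < t' → t' < cnt → f t < f t'
  mem : ∀ c, c ∈ C ↔ ∃ t < cnt, f t = c
  pos : 0 ∉ C

theorem ListInv.append {f : ℕ → ℕ} {cnt x : ℕ} {C : Set ℕ} (h : ListInv f cnt C) (hx : ∀ c ∈ C, c < x) (h0 : x ≠ 0) :
    ListInv (update f cnt x) (cnt + 1) (insert x C) := by
  refine ⟨fun t ht => ?_, fun t t' h1 h2 => ?_, fun c => ?_, ?_⟩
  · rw [update_of_ne (by omega), h.zero t (by omega)]
  · rw [update_of_ne (show t ≠ cnt by omega)]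
    rcases Nat.lt_succ_iff_lt_or_eq.1 h2 with h3 | rfl
    · rw [update_of_ne (by omega)]
      exact h.mono t t' h1 h3
    · rw [update_self]
      exact hx _ ((h.mem _).2 ⟨t, h1, rfl⟩)
  · rw [Set.mem_insert_iff, h.mem]
    constructor
    · rintro (rfl | ⟨t, h1, rfl⟩)
      · exact ⟨cnt, by omega, update_self _ _ _⟩
      · exact ⟨t, by omega, update_of_ne (by omega) _ _⟩
    · rintro ⟨t, h1, rfl⟩
      rcases Nat.lt_succ_iff_lt_or_eq.1 h1 with h3 | rfl
      · exact Or.inr ⟨t, h3, (update_of_ne (by omega) _ _).symm⟩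
      · exact Or.inl (update_self _ _ _)
  · rw [Set.mem_insert_iff]
    rintro (h1 | h1)
    · exact h0 h1.symm
    · exact h.pos h1

/-- Append the word in variable `y` to the list of the vertex in variable `x`. -/
def appendProg (x y : ℕ) : Stmt :=
  set 41 (v 26 * v 0 + v x) ;; sto 3 (ld 4 (v 41) * v 16 + v 41) (v y) ;; sto 4 (v 41) (ld 4 (v 41) + 1)

/-- Take the smallest edge out of the tournament and append it to the lists of its ends. -/
def popStep : Stmt := set 43 (ld 11 1) ;;
  ite (v 43) (set 44 (v 43 - 1) ;; set 38 (rd 0 (v 44) 0) ;; set 39 (rd 1 (v 44) 0) ;;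
    set 42 ((v 27 + 1) * v 0 + v 39) ;; appendProg 38 42 ;;
    set 42 ((v 27 + 1) * v 0 + v 38) ;; appendProg 39 42 ;; set 45 0 ;; updProg) .skip

/-- The list of the vertex `u` in the run `r`. -/
def entries (n R r : ℕ) (a : ℕ → ℕ → ℕ) (u t : ℕ) : ℕ := a 3 (t * (R * n) + (r * n + u))

theorem appendProg_tr {inp : Input} {B R r : ℕ} {s : State} {x y : ℕ} {u : Fin n} (hr : r < R)
    (h0 : s.reg 0 = n) (h16 : s.reg 16 = R * n) (h26 : s.reg 26 = r) (hx : s.reg x = u)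
    (hy : y ≠ 41) (hB : R * n < B) (hc : s.arr 4 (r * n + u) + 1 < B) :
    Tr inp B (appendProg x y) s (fun s' =>
      (∀ q < R, ∀ w : Fin n, q ≠ r ∨ w ≠ u → entries n R q s'.arr w = entries n R q s.arr w ∧
        s'.arr 4 (q * n + w) = s.arr 4 (q * n + w)) ∧
      entries n R r s'.arr u = update (entries n R r s.arr u) (s.arr 4 (r * n + u)) (s.reg y) ∧
      s'.arr 4 (r * n + u) = s.arr 4 (r * n + u) + 1 ∧ s'.time = s.time + 3) := by
  have hu := u.2
  have hlt := wordIndex_lt hr hu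
  simp only [appendProg, Tr_seq, Tr_set, Tr_sto]
  refine ⟨by simp [h0, h26, hx]; omega, by simp, by simp [h0, h26, hx, hc], ?_⟩
  simp [h0, h26, h16, hx, hy]
  refine ⟨fun q hq w hw => ⟨?_, ?_⟩, ?_⟩
  · funext t
    simp only [entries]
    simp [update_apply,
      pair_inj (wordIndex_lt hq w.2) hlt, pair_inj w.2 hu, Fin.val_inj]
    intro _ h1 h2
    exact absurd h2 (hw.resolve_left (not_not.2 h1))
  · rw [update_of_ne]
    rw [Ne, pair_inj w.2 hu, Fin.val_inj]
    tauto
  · funext t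
    simp only [entries]
    simp [update_apply, entries,
      show R ≠ 0 by omega, show n ≠ 0 by omega]

/-- The words in the list of the vertex `u` for the ranks `rk` of the edges. -/
def codes (L : EdgeList G) (rk : ℕ → ℕ) (u : Fin n) : Set ℕ :=
  {c | ∃ q, ∃ hq : q < L.list.length, ∃ w, L.edge q hq = s(u, w) ∧ rk q ≠ 0 ∧ c = rk q * n + w}

/-- After `p` steps of a run the edges with `rk q ≠ 0` have been sorted. -/
structure SortInv (L : EdgeList G) (R r D p : ℕ) (rk : ℕ → ℕ) (a : ℕ → ℕ → ℕ) : Prop where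
  tourn : Tourn (a 8) (a 13) (a 11) D
  leaf : ∀ q < 2 ^ D, a 11 (2 ^ D + q) = if 0 < L.input 2 q 0 ∧ rk q = 0 then q + 1 else 0
  le : ∀ q, rk q ≤ p
  inj : ∀ q q', rk q ≠ 0 → rk q = rk q' → q = q'
  supp : ∀ q, rk q ≠ 0 → q < L.list.length ∧ 0 < L.input 2 q 0
  order : ∀ q q', rk q ≠ 0 → 0 < L.input 2 q' 0 → rk q' = 0 ∨ rk q ≤ rk q' →
    a 8 (q + 1) * L.input 2 q' 0 ≤ a 8 (q' + 1) * L.input 2 q 0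
  lists : ∀ u : Fin n, ListInv (entries n R r a u) (a 4 (r * n + u)) (codes L rk u)
  cnt : ∀ u : Fin n, a 4 (r * n + u) ≤ p
  count : a 11 1 ≠ 0 → ((range L.list.length).filter fun q => rk q ≠ 0).card = p

theorem EdgeList.lt_of_input_pos {L : EdgeList G} {q b : ℕ} (h : 0 < L.input 2 q b) : q < L.list.length := by
  by_contra hq
  simp [EdgeList.input, hq] at h

/-- Arrays that are not changed by sorting: constants of the tournament. -/
structure ItemArrs (L : EdgeList G) (D : ℕ) (a : ℕ → ℕ → ℕ) : Prop where
  one : a 8 0 = 1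
  zero : a 13 0 = 0
  item : ∀ q < L.list.length, a 13 (q + 1) = L.input 2 q 0
  cap : L.list.length ≤ 2 ^ D

/-- Item `0` has the ratio `1 / 0` and wins only against nothing; any other winner has the smallest
ratio among the unsorted edges. -/
theorem SortInv.root {L : EdgeList G} {R r D p : ℕ} {rk : ℕ → ℕ} {a : ℕ → ℕ → ℕ}
    (h : SortInv L R r D p rk a) (hc : ItemArrs L D a) :
    (a 11 1 = 0 ∧ ∀ q, 0 < L.input 2 q 0 → rk q ≠ 0) ∨
    ∃ q, ∃ _ : q < L.list.length, q < 2 ^ D ∧ a 11 1 = q + 1 ∧ 0 < L.input 2 q 0 ∧ rk q = 0 ∧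
      ∀ q', 0 < L.input 2 q' 0 → rk q' = 0 → a 8 (q + 1) * L.input 2 q' 0 ≤ a 8 (q' + 1) * L.input 2 q 0 := by
  have hval : ∀ q < 2 ^ D, 0 < a 8 (a 11 (2 ^ D + q)) ∨ 0 < a 13 (a 11 (2 ^ D + q)) := by
    intro q hq
    rw [h.leaf q hq]
    split_ifs with h1
    · right; rw [hc.item q (EdgeList.lt_of_input_pos h1.1)]; exact h1.1
    · left; rw [hc.one]; omega
  obtain ⟨⟨q, hq, e⟩, hmin⟩ := h.tourn.root hval
  have hle : ∀ q', 0 < L.input 2 q' 0 → rk q' = 0 → a 8 (a 11 1) * L.input 2 q' 0 ≤ a 8 (q' + 1) * a 13 (a 11 1) := by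
    intro q' h1 h2
    have hl := EdgeList.lt_of_input_pos h1
    have := hmin q' (hl.trans_le hc.cap)
    rwa [h.leaf q' (hl.trans_le hc.cap), if_pos ⟨h1, h2⟩, hc.item q' hl] at this
  rw [h.leaf q hq] at e
  split_ifs at e with h1
  · have hl := EdgeList.lt_of_input_pos h1.1
    refine Or.inr ⟨q, hl, hq, e, h1.1, h1.2, fun q' h2 h3 => ?_⟩
    have := hle q' h2 h3
    rwa [e, hc.item q hl] at this
  · refine Or.inl ⟨e, fun q' h2 h3 => ?_⟩
    have := hle q' h2 h3
    rw [e, hc.one, hc.zero] at this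
    omega

theorem codes_update {L : EdgeList G} {rk : ℕ → ℕ} {q x : ℕ} (hq : q < L.list.length)
    (h0 : rk q = 0) (hx : x ≠ 0) (u : Fin n) : codes L (update rk q x) u =
      {c | ∃ w, L.edge q hq = s(u, w) ∧ c = x * n + w} ∪ codes L rk u := by
  ext c
  constructor
  · rintro ⟨q', hq', w, e, h1, rfl⟩
    by_cases h : q' = q
    · subst h; exact Or.inl ⟨w, e, by simp⟩
    · rw [update_of_ne h] at h1 ⊢
      exact Or.inr ⟨q', hq', w, e, h1, rfl⟩
  · rintro (⟨w, e, rfl⟩ | ⟨q', hq', w, e, h1, rfl⟩)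
    · exact ⟨q, hq, w, e, by simpa, by simp⟩
    · have : q' ≠ q := by rintro rfl; exact h1 h0
      exact ⟨q', hq', w, e, by rwa [update_of_ne this], by rw [update_of_ne this]⟩

/-- Ranks are handed out in increasing order, so the next code exceeds all codes in any list and
appending keeps the list sorted. -/
theorem codes_lt {L : EdgeList G} {rk : ℕ → ℕ} {p : ℕ} (h : ∀ q, rk q ≤ p) (u w : Fin n) :
    ∀ c ∈ codes L rk u, c < (p + 1) * n + w := by
  rintro c ⟨q, _, w, _, _, rfl⟩
  have := Nat.mul_le_mul_right n (h q)
  rw [Nat.succ_mul]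
  omega

/-- The winner receives the next rank and is entered at both of its ends. Only lists of the run `r`
are touched, so finished runs stay intact. -/
theorem popStep_tr {L : EdgeList G} {B R r D : ℕ} {rk : ℕ → ℕ} {s : State} (hr : r < R)
    (h0 : s.reg 0 = n) (h13 : s.reg 13 = D) (h14 : s.reg 14 = 2 ^ D) (h16 : s.reg 16 = R * n)
    (h26 : s.reg 26 = r) (hI : ItemArrs L D s.arr) (hS : SortInv L R r D (s.reg 27) rk s.arr)
    (hB : R * n < B) (hB2 : 2 * 2 ^ D < B) (hB3 : (s.reg 27 + 2) * (n + 1) < B) :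
    Tr L.input B popStep s (fun s' => (∃ rk', SortInv L R r D (s.reg 27 + 1) rk' s'.arr) ∧
      (∀ q < R, q ≠ r → ∀ w : Fin n, entries n R q s'.arr w = entries n R q s.arr w ∧
        s'.arr 4 (q * n + w) = s.arr 4 (q * n + w)) ∧ s'.time ≤ s.time + (6 * D + 20)) := by
  rw [popStep, Tr_seq, Tr_set]
  refine ⟨by simp, ?_⟩
  rw [Tr_ite]
  constructor
  · intro hne
    simp at hne
    rcases hS.root hI with ⟨e, -⟩ | ⟨q, hq, hqD, hroot, hpos, hrk, hmin⟩
    · exact absurd e hne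
    obtain ⟨i0, i1, -⟩ := L.input_lt_iff hq 0
    have hne' := L.src_ne_dst hq
    set u := L.list[q].1 with hu
    set w := L.list[q].2 with hw
    have hun := u.2
    have hwn := w.2
    have hcu := hS.cnt u
    have hcw := hS.cnt w
    have hexp : (s.reg 27 + 2) * (n + 1) = (s.reg 27 + 1) * n + n + s.reg 27 + 2 := by ring
    simp only [Tr_seq, Tr_set]
    refine ⟨by simp, by simp, by simp, by simp [h0, hroot, i0, i1]; omega, ?_⟩
    refine (appendProg_tr (u := u) hr (by simp [h0]) (by simp [h16]) (by simp [h26])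
      (by simp [hroot, i0]) (by decide) hB (by simp; omega)).mono ?_
    rintro s1 hF1 ⟨k1, e1, c1, t1⟩
    have a4 : ∀ y, y ≠ 41 → s1.reg y = _ := fun y hy => hF1.reg y (by simp [appendProg, Stmt.writes, hy.symm])
    have kw := k1 r hr w (Or.inr hne'.symm)
    refine ⟨by simp [a4, h0, hroot, i0, i1]; omega, ?_⟩
    refine (appendProg_tr (u := w) hr (by simp [a4, h0]) (by simp [a4, h16]) (by simp [a4, h26])
      (by simp [a4, hroot, i1]) (by decide) hB (by simp [kw.2]; omega)).mono ?_
    rintro s2 hF2 ⟨k2, e2, c2, t2⟩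
    have b4 : ∀ y, y ≠ 41 → s2.reg y = _ := fun y hy => hF2.reg y (by simp [appendProg, Stmt.writes, hy.symm])
    have f2 : ∀ t, t ≠ 3 → t ≠ 4 → s2.arr t = s.arr t := fun t h3 h4 => by
      rw [hF2.arr t (by simp [appendProg, Stmt.stores, h3.symm, h4.symm]), State.set_arr,
        hF1.arr t (by simp [appendProg, Stmt.stores, h3.symm, h4.symm])]; simp
    refine ⟨by simp, (updProg_tr ?_ ?_ ?_ ?_).mono ?_⟩
    · simp [b4, a4, h13, h14]
    · simp [b4, a4, h14, hroot, hqD]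
    · simp [b4, a4, f2, h13]; exact hS.tourn
    · simpa [b4, a4, h14] using hB2
    rintro s3 hF3 ⟨hT, hl, t3⟩
    have g3 : s3.arr 3 = s2.arr 3 := hF3.arr 3 rfl
    have g4 : s3.arr 4 = s2.arr 4 := hF3.arr 4 rfl
    have g8 : s3.arr 8 = s.arr 8 := by rw [hF3.arr 8 rfl]; simp [f2]
    have g13 : s3.arr 13 = s.arr 13 := by rw [hF3.arr 13 rfl]; simp [f2]
    have ge : ∀ q (w : Fin n), entries n R q s3.arr w = entries n R q s2.arr w := fun q w => by
      funext t; simp [entries, g3]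
    simp [b4, a4, h0, h13, h14, hroot, i0, i1, f2] at hT hl e1 e2 c1 c2 t1 t2 t3 k1 k2
    have hlist : ∀ (u w : Fin n), entries n R r s3.arr u = update (entries n R r s.arr u)
        (s.arr 4 (r * n + u)) ((s.reg 27 + 1) * n + w) → s3.arr 4 (r * n + u) = s.arr 4 (r * n + u) + 1 →
        (∀ w', L.edge q hq = s(u, w') ↔ w' = w) → ListInv (entries n R r s3.arr u) (s3.arr 4 (r * n + u))
          (codes L (update rk q (s.reg 27 + 1)) u) ∧ s3.arr 4 (r * n + u) ≤ s.reg 27 + 1 := by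
      intro u w he hc hw'
      have := hS.cnt u
      have hw := w.2
      have hpos : s.reg 27 * n + n + w ≠ 0 := by omega
      have hset : ({c | ∃ w', L.edge q hq = s(u, w') ∧ c = (s.reg 27 + 1) * n + ↑w'} : Set ℕ) =
          {(s.reg 27 + 1) * n + (w : ℕ)} := by
        ext c; simp [hw']
      rw [he, hc, codes_update hq hrk (by omega), hset, ← Set.insert_eq]
      refine ⟨(hS.lists u).append (codes_lt hS.le u w) (by rw [Nat.succ_mul]; omega), by omega⟩
    have hall : ∀ u' : Fin n, ListInv (entries n R r s3.arr u') (s3.arr 4 (r * n + u'))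
          (codes L (update rk q (s.reg 27 + 1)) u') ∧ s3.arr 4 (r * n + u') ≤ s.reg 27 + 1 := by
      intro u'
      by_cases h1 : u' = u
      · subst h1
        have kk := k2 r hr u (Or.inr hne')
        refine hlist u w ?_ ?_ fun w' => ?_
        · rw [ge, kk.1, e1]
        · rw [g4, kk.2, c1]
        · rw [EdgeList.edge, Sym2.eq_iff]
          simp [← hu, ← hw]
          constructor
          · rintro (h | ⟨h, h'⟩)
            · exact h.symm
            · exact absurd h'.symm hne'
          · rintro rfl; exact Or.inl rfl
      · by_cases h2 : u' = w
        · subst h2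
          refine hlist w u ?_ ?_ fun w' => ?_
          · rw [ge, e2, kw.2]; congr 1; exact kw.1
          · rw [g4, c2]; rw [kw.2]; rfl
          · rw [EdgeList.edge, Sym2.eq_iff]
            simp [← hu, ← hw]
            constructor
            · rintro (⟨h, h'⟩ | h)
              · exact absurd h hne'
              · exact h.symm
            · rintro rfl; exact Or.inr rfl
        · have kk := k2 r hr u' (Or.inr h2)
          have kk1 := k1 r hr u' (Or.inr h1)
          rw [codes_update hq hrk (by omega), ge, g4, kk.1, kk.2, kk1.1, kk1.2]
          have hset : ({c | ∃ w', L.edge q hq = s(u', w') ∧ c = (s.reg 27 + 1) * n + ↑w'} : Set ℕ) = ∅ := by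
            ext c
            simp only [Set.mem_ofPred_eq, Set.mem_empty_iff_false, iff_false]
            rintro ⟨w', h, -⟩
            rw [EdgeList.edge, Sym2.eq_iff] at h
            omega
          rw [hset, Set.empty_union]
          exact ⟨hS.lists u', (hS.cnt u').trans (Nat.le_succ _)⟩
    -- The new rank is above all old ones, which are at most `s.reg 27`; this keeps ranks distinct,
    -- and the minimality of the root gives the order condition.
    refine ⟨⟨update rk q (s.reg 27 + 1), ?_, fun j hj => ?_, fun j => ?_, fun j j' h1 h2 => ?_,
      fun j hj => ?_, fun j j' h1 h2 h3 => ?_, fun u' => (hall u').1, fun u' => (hall u').2, fun _ => ?_⟩,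
      fun j hj hjr u' => ?_, ?_⟩
    · rw [g8, g13]; exact hT
    · rw [hl j, hS.leaf j hj]
      by_cases h : j = q
      · simp [h]
      · simp [h]
    · by_cases h : j = q
      · simp [h]
      · simpa [h] using (hS.le j).trans (Nat.le_succ _)
    · have l1 := hS.le j
      have l2 := hS.le j'
      by_cases h : j = q <;> by_cases h' : j' = q
      · rw [h, h']
      · simp [h, h'] at h2; omega
      · simp [h, h'] at h2; omega
      · simp [h, h'] at h1 h2; exact hS.inj j j' h1 h2
    · by_cases h : j = q
      · subst h; exact ⟨hq, hpos⟩
      · simp [h] at hj; exact hS.supp j hj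
    · rw [g8]
      by_cases h : j = q
      · subst h
        by_cases h' : j' = j
        · subst h'; exact le_rfl
        · simp [h'] at h3
          have := hS.le j'
          exact hmin j' h2 (by omega)
      · simp [h] at h1 h3
        by_cases h' : j' = q
        · subst h'; exact hS.order j j' h1 h2 (Or.inl hrk)
        · simp [h'] at h3; exact hS.order j j' h1 h2 h3
    · have : ((range L.list.length).filter fun j => update rk q (s.reg 27 + 1) j ≠ 0) =
          insert q ((range L.list.length).filter fun j => rk j ≠ 0) := by
        ext j
        by_cases h : j = q
        · subst h; simp [hq]
        · simp [h]
      rw [this, card_insert_of_notMem (by simp [hrk]), hS.count hne]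
    · rw [ge, g4, (k2 j hj u' (Or.inl hjr)).1, (k2 j hj u' (Or.inl hjr)).2]
      exact k1 j hj u' (Or.inl hjr)
    · omega
  · intro h
    simp at h
    rw [Tr_skip]
    refine ⟨⟨rk, hS.tourn, hS.leaf, fun q => (hS.le q).trans (Nat.le_succ _), hS.inj, hS.supp, hS.order,
      hS.lists, fun u => (hS.cnt u).trans (Nat.le_succ _), fun hc => absurd h hc⟩, fun q _ _ w => ⟨rfl, rfl⟩, ?_⟩
    simp; omega

/-- Build the tournament of the edges of positive weight with the priorities of the run. -/
def treeProg : Stmt := .loop 27 (2 * v 14) (sto 11 (v 27) 0) ;;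
  .loop 27 (v 1) (sto 8 (v 27 + 1) (ld 14 (v 26 * v 12 + v 27)) ;;
    ite (ld 13 (v 27 + 1)) (set 44 (v 27) ;; set 45 (v 27 + 1) ;; updProg) .skip)

/-- Sort the edges for the run in variable `26`. -/
def sortRun : Stmt := treeProg ;; .loop 27 (v 1) popStep

/-- Sort the edges for all runs. -/
def sortProg : Stmt := set 16 (v 11 * v 0) ;; sto 8 0 1 ;; .loop 26 (v 11) sortRun

/-- The variables for sorting. -/
structure SortRegs (L : EdgeList G) (R D : ℕ) (s : State) : Prop where
  order : s.reg 0 = n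
  size : s.reg 1 = L.list.length
  runs : s.reg 11 = R
  len : s.reg 12 = L.list.length
  depth : s.reg 13 = D
  cap : s.reg 14 = 2 ^ D
  stride : s.reg 16 = R * n
  items : ItemArrs L D s.arr

theorem SortRegs.keep {L : EdgeList G} {R D : ℕ} {s s' : State} (h : SortRegs L R D s)
    (hr : ∀ y ∈ [0, 1, 11, 12, 13, 14, 16], s'.reg y = s.reg y) (h8 : s'.arr 8 0 = s.arr 8 0)
    (h13 : s'.arr 13 = s.arr 13) : SortRegs L R D s' := by
  simp at hr
  obtain ⟨r0, r1, r11, r12, r13, r14, r16⟩ := hr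
  exact ⟨r0.trans h.order, r1.trans h.size, r11.trans h.runs, r12.trans h.len, r13.trans h.depth,
    r14.trans h.cap, r16.trans h.stride, h8.trans h.items.one, by rw [h13]; exact h.items.zero,
    by rw [h13]; exact h.items.item, h.items.cap⟩

theorem treeProg_tr {L : EdgeList G} {B R D r : ℕ} {s : State} (h : SortRegs L R D s)
    (h26 : s.reg 26 = r) (hl : ∀ (u : Fin n) t, entries n R r s.arr u t = 0)
    (hc : ∀ u : Fin n, s.arr 4 (r * n + u) = 0) (hB : 2 * 2 ^ D < B) :
    Tr L.input B treeProg s (fun s' => SortInv L R r D 0 (fun _ => 0) s'.arr ∧ s'.arr 8 0 = 1 ∧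
      (∀ q < L.list.length, s'.arr 8 (q + 1) = s.arr 14 (r * L.list.length + q)) ∧
      s'.time ≤ s.time + 4 * 2 ^ D + L.list.length * (6 * D + 9) + 2) := by
  have hle := h.items.cap
  rw [treeProg, Tr_seq]
  refine Tr.loop (c := 2) (fun i s' => ∀ j < i, s'.arr 11 j = 0) (by simp [h.cap, hB]) (by simp) ?_ ?_
  · intro i hi s' hI hF
    rw [Tr_sto]
    refine ⟨by simp, fun j hj => ?_, by simp⟩
    rcases Nat.lt_succ_iff_lt_or_eq.1 hj with h1 | rfl
    · simp [update_of_ne (show j ≠ i by omega), hI j h1]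
    · simp
  intro s1 hI hF t1
  have f : ∀ y, y ≠ 27 → s1.reg y = s.reg y := fun y hy => hF.reg y (by simp [Stmt.writes, hy.symm])
  have a : ∀ t, t ≠ 11 → s1.arr t = s.arr t := fun t ht => hF.arr t (by simp [Stmt.stores, ht.symm])
  simp [h.cap] at hI t1
  refine Tr.loop (c := 6 * D + 9) (fun i s' => Tourn (s'.arr 8) (s'.arr 13) (s'.arr 11) D ∧
    (∀ q < 2 ^ D, s'.arr 11 (2 ^ D + q) = if q < i ∧ 0 < L.input 2 q 0 then q + 1 else 0) ∧
    s'.arr 8 0 = 1 ∧ ∀ q < i, s'.arr 8 (q + 1) = s.arr 14 (r * L.list.length + q)) (by simp) ?_ ?_ ?_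
  · refine ⟨Tourn.of_zero hI, fun q hq => ?_, ?_, fun q hq => absurd hq (Nat.not_lt_zero q)⟩
    · simpa using hI (2 ^ D + q) (by omega)
    · simp [a, h.items.one]
  · rintro i hi s2 ⟨hT, hleaf, h80, h8⟩ hF2
    simp [f, h.size] at hi
    have f2 : ∀ y ∈ [0, 1, 11, 12, 13, 14, 16, 26], s2.reg y = s.reg y := fun y hy => by
      rw [hF2.reg y (by revert y; decide)]
      exact f y (by rintro rfl; simp at hy)
    simp [h.cap, h.len, h.depth, h26] at f2
    have a13 : s2.arr 13 = s.arr 13 := by rw [hF2.arr 13 rfl]; simp [a]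
    have a14 : s2.arr 14 = s.arr 14 := by rw [hF2.arr 14 rfl]; simp [a]
    have hlt : i < 2 ^ D := by omega
    have hT' : Tourn (update (s2.arr 8) (i + 1) (s.arr 14 (r * L.list.length + i))) (s2.arr 13)
        (s2.arr 11) D := by
      refine hT.congr fun q hq => ⟨update_of_ne ?_ _ _, rfl⟩
      rw [hleaf q hq]
      split_ifs <;> omega
    have h8' : ∀ q < i + 1, update (s2.arr 8) (i + 1) (s.arr 14 (r * L.list.length + i)) (q + 1) =
        s.arr 14 (r * L.list.length + q) := fun q hq => by
      rcases Nat.lt_succ_iff_lt_or_eq.1 hq with h1 | rfl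
      · rw [update_of_ne (by omega), h8 q h1]
      · simp
    rw [Tr_seq, Tr_sto]
    refine ⟨by simp, ?_⟩
    rw [Tr_ite]
    constructor
    · intro hne
      simp [a13, h.items.item i hi] at hne
      simp only [Tr_seq, Tr_set]
      refine ⟨by simp, by simp; omega, (updProg_tr ?_ ?_ ?_ ?_).mono ?_⟩
      · simp [f2]
      · simp [f2, hlt]
      · simpa [f2, a14] using hT'
      · simp [f2, hB]
      rintro s3 hF3 ⟨p1, p2, p3⟩
      simp [f2, a14] at p1 p2 p3
      have g8 := hF3.arr 8 rfl
      have g13 := hF3.arr 13 rfl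
      simp [f2, a14] at g8 g13
      refine ⟨⟨by rw [g8, g13]; exact p1, fun q hq => ?_, by rw [g8]; simpa using h80, by rw [g8]; exact h8'⟩, by omega⟩
      rw [p2 q, hleaf q hq]
      by_cases hqi : q = i
      · subst hqi; simp; omega
      · simp [hqi]
        have : q ≤ i ↔ q < i := by omega
        simp only [this]
    · intro h0
      simp [a13, h.items.item i hi] at h0
      rw [Tr_skip]
      refine ⟨⟨by simpa [f2, a14] using hT', fun q hq => ?_, by simpa using h80,
        by simpa [f2, a14] using h8'⟩, by simp; omega⟩
      simp
      rw [hleaf q hq]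
      by_cases hqi : q = i
      · subst hqi; simp [h0]
      · have : q ≤ i ↔ q < i := by omega
        simp only [this]
  · rintro s2 ⟨hT, hleaf, h80, h8⟩ hF2 t2
    simp [f, h.size] at hT hleaf h80 h8 t2
    have a3 : s2.arr 3 = s.arr 3 := by rw [hF2.arr 3 rfl]; simp [a]
    have a4 : s2.arr 4 = s.arr 4 := by rw [hF2.arr 4 rfl]; simp [a]
    have he : ∀ u : Fin n, entries n R r s2.arr u = fun _ => 0 := fun u => by
      funext t; simp only [entries, a3]; exact hl u t
    refine ⟨⟨hT, fun q hq => ?_, by simp, by simp, by simp, by simp, fun u => ?_, fun u => ?_, by simp⟩,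
      h80, h8, by simp; omega⟩
    · simp [hleaf q hq]
      split_ifs with h1 h2 h2
      · rfl
      · exact absurd h1.2 h2
      · exact absurd ⟨EdgeList.lt_of_input_pos h2, h2⟩ h1
      · rfl
    · simp
      rw [a4, hc, he]
      refine ⟨fun _ _ => rfl, fun t t' _ h => by omega, fun c => ?_, ?_⟩ <;> simp [codes]
    · simp [a4, hc]

/-- The lists of the run `r` are sorted by the ratio of priority and weight. -/
def RunDone (G : WeightedGraph n) (R r : ℕ) (pr : Sym2 (Fin n) → ℕ) (a : ℕ → ℕ → ℕ) : Prop :=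
  ∃ rank : Sym2 (Fin n) → ℕ, (∀ u v, 0 < G.wt u v → rank s(u, v) ≠ 0) ∧
    (∀ e ∈ G.edges, ∀ e' ∈ G.edges, 0 < G.weight e → 0 < G.weight e' → rank e ≤ rank e' →
      pr e * G.weight e' ≤ pr e' * G.weight e) ∧
    ∀ u : Fin n, ∃ cnt, ListInv (entries n R r a u) cnt {c | ∃ v : Fin n, 0 < G.wt u v ∧ c = rank s(u, v) * n + v}

/-- If the root were not empty after as many steps as there are edges, then every step would have
ranked an edge, so no edge would be left for the root. -/
theorem SortInv.runDone {L : EdgeList G} {R r D : ℕ} {rk : ℕ → ℕ} {a : ℕ → ℕ → ℕ}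
    (h : SortInv L R r D L.list.length rk a) (hc : ItemArrs L D a) {pr : Sym2 (Fin n) → ℕ}
    (hp : ∀ q, ∀ hq : q < L.list.length, pr (L.edge q hq) = a 8 (q + 1)) : RunDone G R r pr a := by
  classical
  have hall : ∀ q, 0 < L.input 2 q 0 → rk q ≠ 0 := by
    rcases h.root hc with ⟨-, h1⟩ | ⟨q, hq, -, h1, -, h2, -⟩
    · exact h1
    · have := h.count (by omega)
      have hlt := card_lt_card (filter_ssubset (p := fun q => rk q ≠ 0) |>.2 ⟨q, mem_range.2 hq, not_not.2 h2⟩)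
      simp_all
  -- Ranks of list positions become ranks of edges; this is well defined because each edge is listed
  -- once.
  obtain ⟨rank, hrank⟩ : ∃ rank : Sym2 (Fin n) → ℕ, ∀ q, ∀ hq : q < L.list.length, rank (L.edge q hq) = rk q := by
    refine ⟨fun e => if h : ∃ q, ∃ hq : q < L.list.length, L.edge q hq = e then rk h.choose else 0, fun q hq => ?_⟩
    have hex : ∃ q', ∃ hq' : q' < L.list.length, L.edge q' hq' = L.edge q hq := ⟨q, hq, rfl⟩
    simp only [dif_pos hex]
    rw [L.edge_inj hex.choose_spec.choose_spec]
  have hw : ∀ q, ∀ hq : q < L.list.length, L.input 2 q 0 = G.weight (L.edge q hq) := fun q hq =>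
    (L.input_lt_iff hq 0).2.2
  have hadj : ∀ {u v : Fin n}, 0 < G.wt u v → ∃ q, ∃ hq : q < L.list.length, L.edge q hq = s(u, v) ∧
      0 < L.input 2 q 0 := fun {u v} huv => by
    have := (G.wt_pos_iff).1 huv
    obtain ⟨q, hq, e⟩ := L.exists_edge ((G.mem_edges).2 this.1)
    exact ⟨q, hq, e, by rw [hw q hq, e]; exact this.2⟩
  refine ⟨rank, fun u v huv => ?_, fun e he e' he' h1 h2 h3 => ?_, fun u => ⟨a 4 (r * n + u), ?_⟩⟩
  · obtain ⟨q, hq, e, hpos⟩ := hadj huv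
    rw [← e, hrank]
    exact hall q hpos
  · obtain ⟨q, hq, rfl⟩ := L.exists_edge he
    obtain ⟨q', hq', rfl⟩ := L.exists_edge he'
    rw [hrank, hrank] at h3
    rw [← hw] at h1 h2
    rw [hp, hp, ← hw, ← hw]
    exact h.order q q' (hall q h1) h2 (Or.inr h3)
  · convert h.lists u using 1
    ext c
    constructor
    · rintro ⟨v, huv, rfl⟩
      obtain ⟨q, hq, e, hpos⟩ := hadj huv
      exact ⟨q, hq, v, e, hall q hpos, by rw [← e, hrank]⟩
    · rintro ⟨q, hq, v, e, h1, rfl⟩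
      have h2 := (h.supp q h1).2
      rw [hw q hq, e] at h2
      refine ⟨v, (G.wt_pos_iff).2 ⟨?_, h2⟩, by rw [← e, hrank]⟩
      rw [← G.mem_edges, ← e]
      exact L.edge_mem hq

theorem RunDone.congr {R r : ℕ} {pr : Sym2 (Fin n) → ℕ} {a a' : ℕ → ℕ → ℕ} (h : RunDone G R r pr a)
    (ha : ∀ w : Fin n, entries n R r a' w = entries n R r a w) : RunDone G R r pr a' := by
  obtain ⟨rank, h1, h2, h3⟩ := h
  exact ⟨rank, h1, h2, fun u => by rw [ha]; exact h3 u⟩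

theorem sortRun_tr {L : EdgeList G} {B R D r : ℕ} {s : State} (h : SortRegs L R D s) (hr : r < R)
    (h26 : s.reg 26 = r) (hl : ∀ (u : Fin n) t, entries n R r s.arr u t = 0)
    (hc : ∀ u : Fin n, s.arr 4 (r * n + u) = 0) {pr : Sym2 (Fin n) → ℕ}
    (hp : ∀ q, ∀ hq : q < L.list.length, pr (L.edge q hq) = s.arr 14 (r * L.list.length + q))
    (hB : 2 * 2 ^ D < B) (hB2 : R * n < B) (hB3 : (L.list.length + 2) * (n + 1) < B) :
    Tr L.input B sortRun s (fun s' => RunDone G R r pr s'.arr ∧ s'.arr 8 0 = 1 ∧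
      (∀ q < R, q ≠ r → ∀ w : Fin n, entries n R q s'.arr w = entries n R q s.arr w ∧
        s'.arr 4 (q * n + w) = s.arr 4 (q * n + w)) ∧
      s'.time ≤ s.time + (4 * 2 ^ D + L.list.length * (12 * D + 30) + 4)) := by
  rw [sortRun, Tr_seq]
  refine (treeProg_tr h h26 hl hc hB).mono ?_
  rintro s1 hF1 ⟨hS, h80, h8, t1⟩
  have h1 : SortRegs L R D s1 := h.keep (fun y hy => hF1.reg y (by revert y; decide))
    (h80.trans h.items.one.symm) (hF1.arr 13 rfl)
  have e26 : s1.reg 26 = r := (hF1.reg 26 rfl).trans h26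
  have a3 : s1.arr 3 = s.arr 3 := hF1.arr 3 rfl
  have a4 : s1.arr 4 = s.arr 4 := hF1.arr 4 rfl
  refine Tr.loop (c := 6 * D + 21) (fun p s' => (∃ rk, SortInv L R r D p rk s'.arr) ∧
      ∀ q < R, q ≠ r → ∀ w : Fin n, entries n R q s'.arr w = entries n R q s.arr w ∧
        s'.arr 4 (q * n + w) = s.arr 4 (q * n + w)) (by simp)
    ⟨⟨_, hS⟩, fun q _ _ w => ⟨by funext t; simp [entries, a3], by rw [a4]⟩⟩ ?_ ?_
  · rintro p hpl s2 ⟨⟨rk, hrk⟩, hoth⟩ hF2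
    simp [h1.size] at hpl
    have h2 : SortRegs L R D (s2.set 27 p) := h1.keep (fun y hy => by
        refine Eq.trans ?_ (hF2.reg y (by revert y; decide))
        have : y ≠ 27 := by rintro rfl; simp at hy
        simp [this])
      (by rw [State.set_arr, hF2.arr 8 rfl]) (by rw [State.set_arr, hF2.arr 13 rfl])
    have e26' : (s2.set 27 p).reg 26 = r := by rw [← e26, ← hF2.reg 26 rfl]; simp
    refine (popStep_tr hr h2.order h2.depth h2.cap h2.stride e26' h2.items (by simpa using hrk) hB2 hB ?_).mono ?_
    · refine lt_of_le_of_lt ?_ hB3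
      simp
      gcongr
    · rintro s3 - ⟨k1, k2, k3⟩
      simp at k1 k2 k3
      exact ⟨⟨k1, fun q hq hqr w => ⟨(k2 q hq hqr w).1.trans (hoth q hq hqr w).1,
        (k2 q hq hqr w).2.trans (hoth q hq hqr w).2⟩⟩, by omega⟩
  · rintro s2 ⟨⟨rk, hrk⟩, hoth⟩ hF2 t2
    simp [h1.size] at hrk t2
    have e8 : s2.arr 8 = s1.arr 8 := hF2.arr 8 rfl
    have e13 : s2.arr 13 = s1.arr 13 := hF2.arr 13 rfl
    refine ⟨hrk.runDone ⟨by rw [e8]; exact h80, by rw [e13]; exact h1.items.zero,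
      by rw [e13]; exact h1.items.item, h1.items.cap⟩ fun q hq => by rw [hp, e8, h8 q hq],
      by simp [e8, h80], hoth, ?_⟩
    simp
    have : L.list.length * (12 * D + 30) = L.list.length * (6 * D + 9) + L.list.length * (6 * D + 21) := by ring
    omega

theorem sortProg_tr {L : EdgeList G} {B R D : ℕ} {s : State} (h0 : s.reg 0 = n)
    (h1 : s.reg 1 = L.list.length) (h11 : s.reg 11 = R) (h12 : s.reg 12 = L.list.length)
    (h13 : s.reg 13 = D) (h14 : s.reg 14 = 2 ^ D) (hz : s.arr 13 0 = 0)
    (hi : ∀ q < L.list.length, s.arr 13 (q + 1) = L.input 2 q 0) (hm : L.list.length ≤ 2 ^ D)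
    (h3 : ∀ i, s.arr 3 i = 0) (h4 : ∀ i, s.arr 4 i = 0) {pr : ℕ → Sym2 (Fin n) → ℕ}
    (hp : ∀ r < R, ∀ q, ∀ hq : q < L.list.length, pr r (L.edge q hq) = s.arr 14 (r * L.list.length + q))
    (hB : 2 * 2 ^ D < B) (hB2 : R * n < B) (hB3 : (L.list.length + 2) * (n + 1) < B) :
    Tr L.input B sortProg s (fun s' => (∀ r < R, RunDone G R r (pr r) s'.arr) ∧
      s'.time ≤ s.time + R * (4 * 2 ^ D + L.list.length * (12 * D + 30) + 5) + 3) := by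
  rw [sortProg, Tr_seq, Tr_set]
  refine ⟨by simp [h0, h11, hB2], ?_⟩
  rw [Tr_seq, Tr_sto]
  refine ⟨by simp, ?_⟩
  refine Tr.loop (c := 4 * 2 ^ D + L.list.length * (12 * D + 30) + 5) (fun r s' => s'.arr 8 0 = 1 ∧
    (∀ r' < r, RunDone G R r' (pr r') s'.arr) ∧
    ∀ q < R, r ≤ q → ∀ w : Fin n, (∀ t, entries n R q s'.arr w t = 0) ∧ s'.arr 4 (q * n + w) = 0)
    (by simp) ⟨by simp, by simp, fun q _ _ w => ⟨by simp [entries, h3], by simp [h4]⟩⟩ ?_ ?_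
  · rintro r hr s1 ⟨q8, hd, hz'⟩ hF
    simp [h11] at hr
    have fr : ∀ y ∈ [0, 1, 11, 12, 13, 14], s1.reg y = s.reg y := fun y hy => by
      rw [hF.reg y (by revert y; decide)]
      simp_all; omega
    have f16 : s1.reg 16 = R * n := by rw [hF.reg 16 rfl]; simp [h0, h11]
    have a13 : s1.arr 13 = s.arr 13 := by rw [hF.arr 13 rfl]; simp
    have a14 : s1.arr 14 = s.arr 14 := by rw [hF.arr 14 rfl]; simp
    simp at fr
    obtain ⟨r0, r1, r11, r12, r13, r14⟩ := fr
    have hreg : SortRegs L R D (s1.set 26 r) := by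
      constructor <;> simp [r0, r1, r11, r12, r13, r14, f16, h0, h1, h11, h12, h13, h14]
      exact ⟨q8, by simp [a13, hz], by simpa [a13] using hi, hm⟩
    refine (sortRun_tr (pr := pr r) hreg hr (by simp) (fun u => (hz' r hr le_rfl u).1)
      (fun u => (hz' r hr le_rfl u).2) (by simpa [a14] using hp r hr) hB hB2 hB3).mono ?_
    rintro s2 - ⟨k1, k2, k3, k4⟩
    simp at k3 k4
    refine ⟨⟨k2, fun r' hr' => ?_, fun q hq hrq w => ?_⟩, by omega⟩
    · rcases Nat.lt_succ_iff_lt_or_eq.1 hr' with h | rfl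
      · exact (hd r' h).congr fun w => (k3 r' (by omega) (by omega) w).1
      · exact k1
    · have := k3 q hq (by omega) w
      have hq' := hz' q hq (by omega) w
      exact ⟨fun t => by rw [this.1]; exact hq'.1 t, by rw [this.2]; exact hq'.2⟩
  · rintro s1 ⟨-, hd, -⟩ hF t1
    simp [h11] at hd t1 ⊢
    exact ⟨hd, by omega⟩

/-! ### The query -/

/-- Look at the first remaining edge of vertex number `v 32` of the set: pass it by if its other end
is in the set; otherwise take it into account and go to the next vertex. -/
def scanQuery : Stmt := set 40 (ld 9 (v 32)) ;; set 41 (v 26 * v 0 + v 40) ;;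
  set 42 (ld 3 (ld 5 (v 41) * v 16 + v 41)) ;;
  ite (v 42 * .bin .eq (ld 10 (v 42 % v 0)) (v 28)) (sto 5 (v 41) (ld 5 (v 41) + 1))
    (ite (v 42 * (.bin .eq (v 33) 0 + .bin .lt (v 42) (v 33))) (set 33 (v 42)) .skip ;;
      set 43 (ld 0 (v 38 * v 0 + v 40)) ;; set 36 (v 36 + .bin .lt 0 (v 43)) ;;
      set 37 (v 37 + 2 * (v 43 - 1)) ;; set 32 (v 32 + 1))

/-- Add the end of the best edge to the set. -/
def growQuery : Stmt := set 38 (v 33 % v 0) ;; sto 10 (v 38) (v 28) ;; sto 9 (v 39) (v 38) ;; set 39 (v 39 + 1) ;;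
  set 34 (v 34 + ld 1 (v 38)) ;; set 35 (v 35 + ld 2 (v 38)) ;; set 32 0 ;; set 33 0

/-- After a scan: return the set, add a vertex, or give up. -/
def decideQuery : Stmt := ite (.bin .lt (v 34) (v 4 + v 36) * .bin .lt (v 35) (v 5 + v 37)) (set 30 1 ;; set 31 0)
    (ite (v 33 * .bin .lt (v 39 + 1) (v 2)) growQuery (set 31 0))

def stepQuery : Stmt := ite (v 31) (ite (.bin .lt (v 32) (v 39)) scanQuery decideQuery) .skip

open Classical in
/-- Whether the vertices are adjacent, as a number. -/
noncomputable def WeightedGraph.adj (G : WeightedGraph n) (u w : Fin n) : ℕ := if G.graph.Adj u w then 1 else 0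

theorem WeightedGraph.adj_le (u w : Fin n) : G.adj u w ≤ 1 := by unfold adj; split_ifs <;> omega

theorem WeightedGraph.adj_self (u : Fin n) : G.adj u u = 0 := by simp [adj]

/-- The degree of `z` counts its edges to `S` a second time; these corrections are collected while
`S` is scanned. -/
theorem WeightedGraph.vol_insert_add {S : Finset (Fin n)} {z : Fin n} (hz : z ∉ S) :
    G.vol (insert z S) + ∑ u ∈ S, G.adj z u = G.vol S + ∑ u, G.adj z u := by
  classical
  rw [G.vol_insert hz, add_assoc, ← sum_add_sum_compl S, Nat.add_comm (∑ u ∈ S, _)]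
  congr 2
  rw [outNbrs, card_filter, ← sum_filter_add_sum_filter_not _ (· ∈ S)]
  simp only [filter_not, filter_mem_eq_inter, univ_inter, ← compl_eq_univ_sdiff]
  rw [sum_congr rfl fun u hu => if_neg (fun h => h.2 hu), sum_const_zero, zero_add]
  exact sum_congr rfl fun u hu => by simp [adj, mem_compl.1 hu]

/-- An edge from `z` to `S` is subtracted twice: it leaves the old cut, and it was wrongly added
with the weighted degree of `z`. -/
theorem WeightedGraph.cutValue_insert_add {S : Finset (Fin n)} {z : Fin n} (hz : z ∉ S) :
    G.cutValue (insert z S) + 2 * ∑ u ∈ S, G.wt z u = G.cutValue S + ∑ u, G.wt z u := by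
  have h1 := G.cutValue_insert hz
  have h2 := sum_add_sum_compl (insert z S) (G.wt z)
  rw [sum_insert hz, G.wt_self] at h2
  omega

/-- The tables of weights, degrees and weighted degrees. -/
structure AdjTable (G : WeightedGraph n) (a : ℕ → ℕ → ℕ) : Prop where
  weight : ∀ u w : Fin n, a 0 (u * n + w) = G.wt u w + G.adj u w
  deg : ∀ u : Fin n, a 1 u = ∑ w, G.adj u w
  wdeg : ∀ u : Fin n, a 2 u = ∑ w, G.wt u w

theorem Tables.adjTable {L : EdgeList G} {a : ℕ → ℕ → ℕ} (h : Tables L G.numEdges a) : AdjTable G a := by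
  classical
  refine ⟨fun u w => ?_, fun u => ?_, fun u => ?_⟩
  · rw [h.weight]
    simp only [L.upTo_all, G.mem_edges, WeightedGraph.wt, WeightedGraph.adj]
    split_ifs <;> rfl
  · rw [h.deg, EdgeList.sumAt]
    simp only [L.upTo_all, G.mem_edges, WeightedGraph.adj]
  · rw [h.wdeg, EdgeList.sumAt]
    simp only [L.upTo_all, G.mem_edges, WeightedGraph.wt]

/-- The words of the edges at `u`. -/
abbrev codeSet (G : WeightedGraph n) (rank : Sym2 (Fin n) → ℕ) (u : Fin n) : Set ℕ :=
  {c | ∃ v : Fin n, 0 < G.wt u v ∧ c = rank s(u, v) * n + v}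

theorem ListInv.head {f : ℕ → ℕ} {cnt p : ℕ} {C : Set ℕ} (h : ListInv f cnt C) (hp : f p ≠ 0) :
    p < cnt ∧ f p ∈ C := by
  have : p < cnt := by
    by_contra hc
    exact hp (h.zero p (not_lt.1 hc))
  exact ⟨this, (h.mem _).2 ⟨p, this, rfl⟩⟩

/-- The entries of a list have distinct codes and belong to one vertex, so passed entries lead to
different members of `l`. This pays for all movements of the pointers. -/
theorem ListInv.passed_le {f : ℕ → ℕ} {cnt p : ℕ} {rank : Sym2 (Fin n) → ℕ} {u : Fin n}
    (h : ListInv f cnt (codeSet G rank u)) {l : List (Fin n)}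
    (hp : ∀ t < p, f t ≠ 0 ∧ ∃ w ∈ l, f t = rank s(u, w) * n + w) : p ≤ l.length := by
  classical
  rcases Nat.eq_zero_or_pos p with rfl | hpos
  · exact Nat.zero_le _
  have hw : ∀ t, ∃ w : Fin n, t < p → w ∈ l ∧ f t = rank s(u, w) * n + w := fun t => by grind
  choose w hw using hw
  have hinj : Set.InjOn w (range p : Finset ℕ) := by
    intro t ht t' ht' e
    have ht := mem_range.1 ht
    have ht' := mem_range.1 ht'
    have e1 := (hw t ht).2
    have e2 := (hw t' ht').2
    rw [e] at e1
    have l1 := (h.head (hp t ht).1).1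
    have l2 := (h.head (hp t' ht').1).1
    rcases lt_trichotomy t t' with h1 | h1 | h1
    · exact absurd (h.mono t t' h1 l2) (by omega)
    · exact h1
    · exact absurd (h.mono t' t h1 l1) (by omega)
  have := card_le_card_of_injOn (t := l.toFinset) w
    (fun t ht => List.mem_toFinset.2 (hw t (mem_range.1 ht)).1) hinj
  rw [card_range] at this
  exact this.trans (List.toFinset_card_le l)

/-- Passed entries lead into `l`, so an edge to a vertex outside `l` has not been passed; as the
list increases, its code is at least that of the head. -/
theorem ListInv.head_le {f : ℕ → ℕ} {cnt p : ℕ} {rank : Sym2 (Fin n) → ℕ} {u : Fin n}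
    (h : ListInv f cnt (codeSet G rank u)) {l : List (Fin n)}
    (hp : ∀ t < p, f t ≠ 0 ∧ ∃ w ∈ l, f t = rank s(u, w) * n + w) {w : Fin n} (hw : w ∉ l)
    (huw : 0 < G.wt u w) : f p ≠ 0 ∧ f p ≤ rank s(u, w) * n + w := by
  obtain ⟨t, ht, e⟩ := (h.mem _).1 ⟨w, huw, rfl⟩
  have hpt : p ≤ t := by
    by_contra hc
    obtain ⟨-, w', hw', e'⟩ := hp t (not_le.1 hc)
    rw [e, pair_inj w.2 w'.2, Fin.val_inj] at e'
    exact hw (e'.2 ▸ hw')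
  refine ⟨fun h0 => h.pos ?_, ?_⟩
  · rw [← h0, h.mem]
    exact ⟨p, by omega, rfl⟩
  · rw [← e]
    rcases hpt.eq_or_lt with rfl | h1
    · exact le_rfl
    · exact (h.mono p t h1 ht).le

/-- The constants of a query in the run `r`. -/
structure QueryRegs (x : Fin n) (ν σ k R r : ℕ) (s : State) : Prop where
  order : s.reg 0 = n
  size : s.reg 2 = σ
  x : s.reg 3 = x
  vol : s.reg 4 = ν
  cut : s.reg 5 = k
  stride : s.reg 16 = R * n
  run : s.reg 26 = r
  mark : s.reg 28 = r + 1

/-- The set `l` has been grown, with last vertex `z`, and its first `j` vertices have been scanned. -/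
structure Grow (G : WeightedGraph n) (x : Fin n) (σ R r : ℕ) (rank : Sym2 (Fin n) → ℕ)
    (good : Finset (Fin n) → Prop) (i : ℕ) (l : List (Fin n)) (z : Fin n) (j : ℕ) (s : State) : Prop where
  nodup : l.Nodup
  start : x ∈ l
  last : s.reg 38 = z
  size : s.reg 39 = l.length
  lt : l.length < σ
  list : ∀ t, ∀ ht : t < l.length, s.arr 9 t = l[t]
  pos : s.reg 32 = j
  le : j ≤ l.length
  marks : ∀ u : Fin n, s.arr 10 u = r + 1 ↔ u ∈ l
  ptr : ∀ u : Fin n, u ∉ l → s.arr 5 (r * n + u) = 0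
  passed : ∀ u : Fin n, ∀ t < s.arr 5 (r * n + u), entries n R r s.arr u t ≠ 0 ∧
    ∃ w ∈ l, entries n R r s.arr u t = rank s(u, w) * n + w
  head : ∀ t < j, ∀ ht : t < l.length, entries n R r s.arr l[t] (s.arr 5 (r * n + l[t])) = 0 ∨
    (s.reg 33 ≠ 0 ∧ s.reg 33 ≤ entries n R r s.arr l[t] (s.arr 5 (r * n + l[t])))
  best : s.reg 33 ≠ 0 → ∃ u ∈ l, ∃ w, w ∉ l ∧ 0 < G.wt u w ∧ s.reg 33 = rank s(u, w) * n + w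
  vol : s.reg 34 = G.vol l.toFinset + s.reg 36 + ((l.drop j).map (G.adj z)).sum
  cut : s.reg 35 = G.cutValue l.toFinset + s.reg 37 + 2 * ((l.drop j).map (G.wt z)).sum
  volA : s.reg 34 ≤ l.length * n
  cutA : s.reg 35 ≤ l.length * (n * G.maxWeight)
  budget : i + 1 ≤ ∑ u : Fin n, s.arr 5 (r * n + u) + j + l.length * (σ + 1)
  good : ∀ X, good X → l.toFinset ⊆ X

variable {x : Fin n} {ν σ k R r : ℕ} {rank : Sym2 (Fin n) → ℕ} {good : Finset (Fin n) → Prop} {i j B : ℕ}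
  {l : List (Fin n)} {z : Fin n} {s : State} {inp : Input}

/-- Every step moves either the pointer of a vertex or the position `j`, and both are counted in
`budget`. -/
theorem scanQuery_tr (hp : QueryRegs x ν σ k R r s) (hr : r < R) (hT : AdjTable G s.arr)
    (hL : ∀ u : Fin n, ∃ cnt, ListInv (entries n R r s.arr u) cnt (codeSet G rank u))
    (h : Grow G x σ R r rank good i l z j s) (hj : j < l.length) (hB : R * n < B)
    (hB2 : σ * (n * (G.maxWeight + 1) + 1) < B) :
    Tr inp B scanQuery s (fun s' => (∃ j', Grow G x σ R r rank good (i + 1) l z j' s') ∧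
      (∀ q, q ≠ r → ∀ u : Fin n, s'.arr 5 (q * n + u) = s.arr 5 (q * n + u)) ∧
      s'.time ≤ s.time + 10) := by
  have hu := l[j].2
  have hlt := wordIndex_lt hr hu
  have h9 := h.list j hj
  have hσB : σ < B := (Nat.le_mul_of_pos_right _ (Nat.succ_pos _)).trans_lt hB2
  have hlσ := h.lt
  obtain ⟨cnt, hC⟩ := hL l[j]
  have hdrop : l.drop j = l[j] :: l.drop (j + 1) := List.drop_eq_getElem_cons hj
  have hvol := h.vol
  have hcut := h.cut
  have hvB : s.reg 34 < B := by
    refine lt_of_le_of_lt (h.volA.trans (Nat.mul_le_mul hlσ.le ?_)) hB2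
    nlinarith
  have hcB : s.reg 35 < B := by
    refine lt_of_le_of_lt (h.cutA.trans (Nat.mul_le_mul hlσ.le ?_)) hB2
    nlinarith
  rw [hdrop, List.map_cons, List.sum_cons] at hvol hcut
  obtain ⟨p, hpdef⟩ : ∃ p, p = s.arr 5 (r * n + l[j]) := ⟨_, rfl⟩
  obtain ⟨f, hf⟩ : ∃ f, f = entries n R r s.arr l[j] := ⟨_, rfl⟩
  have hfp : s.arr 3 (p * (R * n) + (r * n + l[j])) = f p := by rw [hf]; rfl
  have hpass := h.passed l[j]
  rw [← hf] at hC hpass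
  rw [← hpdef] at hpass
  have hmod : ∀ c (w : Fin n), (c * n + w) % n = w := fun c w => by
    rw [mul_comm, Nat.mul_add_mod, Nat.mod_eq_of_lt w.2]
  rw [scanQuery, Tr_seq, Tr_set]
  refine ⟨by simp, ?_⟩
  rw [Tr_seq, Tr_set]
  refine ⟨by simp [hp.run, hp.order, h.pos, h9]; omega, ?_⟩
  rw [Tr_seq, Tr_set]
  refine ⟨by simp, ?_⟩
  rw [Tr_ite]
  constructor
  · intro hc
    simp [hp.run, hp.order, h.pos, h9, hp.stride, ← hpdef, hfp, hp.mark] at hc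
    obtain ⟨hm, hf0⟩ := hc
    obtain ⟨-, w, hw0, hw⟩ := hC.head hf0
    rw [hw, hmod, h.marks] at hm
    have hpass' : ∀ t < p + 1, f t ≠ 0 ∧ ∃ w ∈ l, f t = rank s(l[j], w) * n + w := fun t ht => by grind
    have hple := hC.passed_le hpass'
    have hne : ∀ u : Fin n, u ≠ l[j] → r * n + (u : ℕ) ≠ r * n + l[j] := fun u hu h => hu (Fin.ext (by omega))
    rw [Tr_sto]
    refine ⟨by simp [hp.run, hp.order, h.pos, h9, ← hpdef]; omega, ⟨j, ?_⟩, fun q hq u => ?_, by simp⟩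
    · have hsum : ∑ u : Fin n, update (s.arr 5) (r * n + l[j]) (p + 1) (r * n + u) =
          ∑ u : Fin n, s.arr 5 (r * n + u) + 1 := by
        rw [← add_sum_erase _ _ (mem_univ l[j]),
          ← add_sum_erase _ (fun u : Fin n => s.arr 5 (r * n + u)) (mem_univ l[j]),
          sum_congr rfl fun u hu => update_of_ne (hne u (ne_of_mem_erase hu)) _ _]
        simp [← hpdef]
        omega
      have hbud := h.budget
      have h' := h
      cases h'
      constructor <;> try simp only [State.put_reg, State.tick_reg, State.set_reg, State.put_arr, State.tick_arr,
        State.set_arr, Ex.eval_v, Ex.eval_add, Ex.eval_mul, Ex.eval_ld, hp.run, hp.order, h.pos, h9, entries,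
        Nat.reduceEqDiff, ↓reduceIte, ← hpdef]
      all_goals first | assumption | skip
      · intro u hu
        rw [update_of_ne (hne u (by rintro rfl; exact hu (List.getElem_mem hj)))]
        exact h.ptr u hu
      · intro u
        by_cases huj : u = l[j]
        · subst huj
          rw [update_self]
          intro t ht
          have := hpass' t ht
          rw [hf] at this
          exact this
        · rw [update_of_ne (hne u huj)]
          exact h.passed u
      · intro t ht ht'
        have : l[t] ≠ l[j] := fun e => by
          have := (List.Nodup.getElem_inj_iff h.nodup).1 e
          omega
        rw [update_of_ne (hne _ this)]
        exact h.head t ht ht'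
      · rw [Ex.eval_ofNat, hsum]; omega
    · simp [hp.run, hp.order, h.pos, h9]
      rw [update_of_ne]
      rw [Ne, pair_inj u.2 hu]
      tauto
  · intro hc
    simp [hp.run, hp.order, h.pos, h9, hp.stride, ← hpdef, hfp, hp.mark] at hc
    -- An entry that is not passed by leads out of the set, so it is a candidate for the best edge.
    have hout : f p ≠ 0 → ∃ w, w ∉ l ∧ 0 < G.wt l[j] w ∧ f p = rank s(l[j], w) * n + w := fun hf0 => by
      obtain ⟨-, w, hw0, hw⟩ := hC.head hf0
      refine ⟨w, fun hwl => ?_, hw0, hw⟩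
      refine hf0 (hc ?_)
      rw [hw, hmod]
      exact (h.marks w).2 hwl
    rw [Tr_seq]
    refine Tr.mono (Q := fun s' => (∀ y, y ≠ 33 → y ≠ 40 → y ≠ 41 → y ≠ 42 → s'.reg y = s.reg y) ∧
      s'.reg 40 = l[j] ∧ s'.arr = s.arr ∧ s'.time ≤ s.time + 6 ∧
      (s'.reg 33 = s.reg 33 ∧ (f p = 0 ∨ s.reg 33 ≠ 0 ∧ s.reg 33 ≤ f p) ∨
        s'.reg 33 = f p ∧ f p ≠ 0 ∧ (s.reg 33 = 0 ∨ f p ≤ s.reg 33))) ?_ ?_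
    · rw [Tr_ite]
      constructor
      · intro h1
        rw [Tr_set]
        simp [hp.run, hp.order, h.pos, h9, hp.stride, ← hpdef, hfp] at h1
        refine ⟨by simp, fun y a b c d => by simp [a, b, c, d], by simp [h.pos, h9], by simp, by simp, Or.inr ?_⟩
        simp [hp.run, hp.order, h.pos, h9, hp.stride, ← hpdef, hfp]
        refine ⟨h1.1, ?_⟩
        by_cases h2 : s.reg 33 = 0
        · exact Or.inl h2
        · exact Or.inr (h1.2 h2).le
      · intro h1
        rw [Tr_skip]
        simp [hp.run, hp.order, h.pos, h9, hp.stride, ← hpdef, hfp] at h1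
        refine ⟨fun y a b c d => by simp [b, c, d], by simp [h.pos, h9], by simp, by simp, Or.inl ?_⟩
        simp
        exact h1
    rintro s1 hF1 ⟨e, e40, ea, et, hbest⟩
    have hz : s.arr 0 (z * n + l[j]) = G.wt z l[j] + G.adj z l[j] := hT.weight z l[j]
    -- Decoding the table entry: positivity tells adjacency, and truncated subtraction of one gives
    -- the weight, also for missing edges.
    have had : (if 0 < G.wt z l[j] + G.adj z l[j] then 1 else 0) = G.adj z l[j] ∧
        G.wt z l[j] + G.adj z l[j] - 1 = G.wt z l[j] := by
      unfold WeightedGraph.adj WeightedGraph.wt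
      split_ifs <;> simp_all
    simp only [Tr_seq, Tr_set]
    have hbud := h.budget
    refine ⟨by simp, ?_, ?_, ?_, ⟨j + 1, ?_⟩, fun q hq u => by simp [ea], ?_⟩
    · right
      simp only [State.set_reg, Ex.eval_v, Ex.eval_add, Ex.eval_mul, Ex.eval_ld,
        Ex.eval_lt', Ex.eval_ofNat, e, ne_eq, not_false_eq_true, e40, hp.order, h.last, ea, Nat.reduceEqDiff, ↓reduceIte, hz, had.1]
      omega
    · simp [e, e40, hp.order, h.last, ea, hz, had.2]; omega
    · simp [e, h.pos]; omega
    · have h' := h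
      cases h'
      constructor <;> try simp only [State.set_reg, State.set_arr, Ex.eval_v, Ex.eval_add, Ex.eval_mul,
        Ex.eval_ld, Ex.eval_sub, Ex.eval_lt', Ex.eval_ofNat, e, ne_eq, not_false_eq_true, e40, hp.order,
        h.pos, h.last, ea, Nat.reduceEqDiff, ↓reduceIte, hz, had.1, had.2, entries]
      all_goals first | assumption | omega | skip
      · intro t ht ht'
        rcases Nat.lt_succ_iff_lt_or_eq.1 ht with h1 | rfl
        · have := h.head t h1 ht'
          rw [entries] at this
          rcases hbest with ⟨h2, -⟩ | ⟨h2, h3, h4⟩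
          · rw [h2]; exact this
          · rw [h2]
            refine this.imp_right fun h5 => ⟨h3, (h4.resolve_left h5.1).trans h5.2⟩
        · rw [← hpdef, hfp]
          rcases hbest with ⟨h2, h3⟩ | ⟨h2, h3, -⟩
          · rw [h2]; exact h3
          · rw [h2]; exact Or.inr ⟨h3, le_rfl⟩
      · intro hne
        rcases hbest with ⟨h2, -⟩ | ⟨h2, h3, -⟩
        · rw [h2] at hne ⊢; exact h.best hne
        · rw [h2]
          obtain ⟨w, hw⟩ := hout h3
          exact ⟨l[j], List.getElem_mem hj, w, hw⟩
    · simp; omega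

end

/-! ### Correctness and length of a query -/

section

variable {n : ℕ} {G : WeightedGraph n} {x : Fin n} {ν σ k R r : ℕ} {rank pr : Sym2 (Fin n) → ℕ}
  {good : Finset (Fin n) → Prop} {i j B : ℕ} {l : List (Fin n)} {z : Fin n} {s : State} {inp : Input}

/-- The edges are ranked by the ratio of priority and weight. -/
def RankOrder (G : WeightedGraph n) (rank pr : Sym2 (Fin n) → ℕ) : Prop :=
  ∀ e ∈ G.edges, ∀ e' ∈ G.edges, 0 < G.weight e → 0 < G.weight e' → rank e ≤ rank e' →
    pr e * G.weight e' ≤ pr e' * G.weight e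

/-- Analogue of `HeapInv.root_mem`. Some edge from `l` into the rest of `X` is below the threshold;
the best head has no larger rank, hence no larger ratio, and edges leaving `X` are above the
threshold. -/
theorem Grow.extend (h : Grow G x σ R r rank good i l z l.length s)
    (hL : ∀ u : Fin n, ∃ cnt, ListInv (entries n R r s.arr u) cnt (codeSet G rank u))
    (ho : RankOrder G rank pr) {X : Finset (Fin n)} (hX : l.toFinset ⊂ X) (hs : G.Separates pr X) :
    s.reg 33 ≠ 0 ∧ ∃ u ∈ l, ∃ w, w ∉ l ∧ w ∈ X ∧ s.reg 33 = rank s(u, w) * n + w := by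
  obtain ⟨t, h1, h2⟩ := hs
  obtain ⟨u, hu, w, hwX, hwl, huw, hp⟩ := h1 _ hX ⟨x, List.mem_toFinset.2 h.start⟩
  rw [List.mem_toFinset] at hu hwl
  obtain ⟨a, ha, rfl⟩ := List.mem_iff_getElem.1 hu
  obtain ⟨cnt, hC⟩ := hL l[a]
  obtain ⟨hne, hle⟩ := hC.head_le (h.passed l[a]) hwl huw
  obtain ⟨hb, hb'⟩ := (h.head a ha ha).resolve_left hne
  obtain ⟨u', hu', w', hw'l, huw', e⟩ := h.best hb
  refine ⟨hb, u', hu', w', hw'l, ?_, e⟩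
  by_contra hw'X
  -- Codes compare first by rank, because the vertex part is smaller than `n`.
  have hrank : rank s(u', w') ≤ rank s(l[a], w) := by
    by_contra hc
    have h3 := Nat.mul_le_mul_right n (Nat.succ_le_of_lt (not_le.1 hc))
    grind
  have q := (G.wt_pos_iff).1 huw
  have q' := (G.wt_pos_iff).1 huw'
  have h3 := ho _ ((G.mem_edges).2 q'.1) _ ((G.mem_edges).2 q.1) q'.2 q.2 hrank
  rw [← G.wt_of_adj q.1, ← G.wt_of_adj q'.1] at h3
  have h4 := h2 u' (hX.1 (List.mem_toFinset.2 hu')) w' hw'X huw'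
  have h5 : (0 : ℝ) < G.wt l[a] w := by exact_mod_cast huw
  have h6 : (0 : ℝ) < G.wt u' w' := by exact_mod_cast huw'
  have h7 : (pr s(u', w') : ℝ) * G.wt l[a] w ≤ pr s(l[a], w) * G.wt u' w' := by exact_mod_cast h3
  nlinarith [mul_lt_mul_of_pos_right h4 h5, mul_le_mul_of_nonneg_right hp h6.le]

/-- The invariant of a run of a query. -/
structure QueryInv (G : WeightedGraph n) (x : Fin n) (ν σ k R r : ℕ) (rank pr : Sym2 (Fin n) → ℕ)
    (i : ℕ) (s : State) : Prop where
  active : s.reg 31 ≠ 0 → s.reg 30 = 0 ∧ ∃ l z j,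
    Grow G x σ R r rank (fun X => G.IsLocalSet x ν σ k X ∧ G.Separates pr X) i l z j s
  found : s.reg 30 ≠ 0 → Found G x ν σ k s
  fail : s.reg 31 = 0 → s.reg 30 = 0 → ∀ X, G.IsLocalSet x ν σ k X → ¬ G.Separates pr X
  marks : ∀ u, s.arr 10 u ≤ r + 1

/-- After a complete scan all corrections are made, so the test uses the true volume and cut value.
If it fails, every separated local set strictly contains `l`, and the best edge stays inside it. -/
theorem decideQuery_tr (hp : QueryRegs x ν σ k R r s) (hT : AdjTable G s.arr)
    (hL : ∀ u : Fin n, ∃ cnt, ListInv (entries n R r s.arr u) cnt (codeSet G rank u))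
    (ho : RankOrder G rank pr)
    (h : Grow G x σ R r rank (fun X => G.IsLocalSet x ν σ k X ∧ G.Separates pr X) i l z l.length s)
    (hm : ∀ u, s.arr 10 u ≤ r + 1) (h30 : s.reg 30 = 0) (h31 : s.reg 31 ≠ 0)
    (hB2 : σ * (n * (G.maxWeight + 1) + 1) < B) :
    Tr inp B decideQuery s (fun s' => QueryInv G x ν σ k R r rank pr (i + 1) s' ∧ s'.arr 5 = s.arr 5 ∧
      s'.time ≤ s.time + 10) := by
  have hvol := h.vol
  have hcut := h.cut
  have hlσ := h.lt
  have hcard := List.toFinset_card_of_nodup h.nodup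
  simp [mul_zero] at hvol hcut
  rw [decideQuery, Tr_ite]
  constructor
  · intro hc
    simp [hp.vol, hp.cut] at hc
    simp only [Tr_seq, Tr_set]
    refine ⟨by simp, by simp, ⟨by simp, fun _ => ⟨l.toFinset, ⟨List.mem_toFinset.2 h.start, by omega,
      by omega, by omega⟩, by simp [h.size, hcard], ?_⟩, by simp, by simpa using hm⟩, by simp, by simp⟩
    rw [hcard]
    ext c
    simp
    constructor
    · rintro ⟨t, ht, rfl⟩
      exact ⟨l[t], List.getElem_mem ht, (h.list t ht).symm⟩
    · rintro ⟨u, hu, rfl⟩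
      obtain ⟨t, ht, rfl⟩ := List.mem_iff_getElem.1 hu
      exact ⟨t, ht, h.list t ht⟩
  · intro hc
    simp [hp.vol, hp.cut] at hc
    have hext : ∀ X, G.IsLocalSet x ν σ k X → G.Separates pr X → l.length + 1 < σ ∧ s.reg 33 ≠ 0 ∧
        ∃ u ∈ l, ∃ w, w ∉ l ∧ w ∈ X ∧ s.reg 33 = rank s(u, w) * n + w := by
      intro X hX hs
      have hss : l.toFinset ⊂ X := by
        refine (h.good X ⟨hX, hs⟩).ssubset_of_ne ?_
        rintro rfl
        obtain ⟨-, h1, -, h2⟩ := hX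
        omega
      have := card_lt_card hss
      exact ⟨by have := hX.2.2.1; omega, h.extend hL ho hss hs⟩
    rw [Tr_ite]
    constructor
    · intro hc'
      simp [hp.size, h.size] at hc'
      obtain ⟨u, hu, w, hwl, huw, hw⟩ := h.best hc'.2
      have hn : s.reg 33 % n = w := by rw [hw, mul_comm, Nat.mul_add_mod, Nat.mod_eq_of_lt w.2]
      have hwS : w ∉ l.toFinset := fun h => hwl (List.mem_toFinset.1 h)
      have hins : (l ++ [w]).toFinset = insert w l.toFinset := by ext; simp
      have hlen : (l ++ [w]).length = l.length + 1 := by simp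
      have hdeg : ∑ u, G.adj w u ≤ n := (sum_le_card_nsmul _ _ 1 fun u _ => G.adj_le w u).trans (by simp)
      have hwdeg : ∑ u, G.wt w u ≤ n * G.maxWeight :=
        (sum_le_card_nsmul _ _ _ fun u _ => G.wt_le_maxWeight w u).trans (by simp)
      have hA : s.reg 34 + ∑ u, G.adj w u ≤ (l.length + 1) * n := by
        have := h.volA; rw [Nat.succ_mul]; omega
      have hA' : s.reg 35 + ∑ u, G.wt w u ≤ (l.length + 1) * (n * G.maxWeight) := by
        have := h.cutA; rw [Nat.succ_mul]; omega
      have hbud := h.budget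
      have hB3 : s.reg 34 + ∑ u, G.adj w u < B := by
        refine lt_of_le_of_lt (hA.trans (Nat.mul_le_mul hlσ ?_)) hB2
        nlinarith
      have hB4 : s.reg 35 + ∑ u, G.wt w u < B := by
        refine lt_of_le_of_lt (hA'.trans (Nat.mul_le_mul hlσ ?_)) hB2
        nlinarith
      have hσB : σ < B := (Nat.le_mul_of_pos_right _ (Nat.succ_pos _)).trans_lt hB2
      simp only [growQuery, Tr_seq, Tr_set, Tr_sto]
      refine ⟨by simp, by simp, by simp, by simp [h.size]; omega,
        by simpa [hp.order, hn, hT.deg] using hB3, by simpa [hp.order, hn, hT.wdeg] using hB4,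
        by simp, by simp, ⟨fun _ => ⟨by simp [h30], l ++ [w], w, 0, ?_⟩, by simp [h30], ?_, fun u => ?_⟩,
        by simp, by simp⟩
      · have hv := G.vol_insert_add hwS
        have hcv := G.cutValue_insert_add hwS
        have e1 : ∑ u ∈ l.toFinset, G.adj w u = (l.map (G.adj w)).sum := List.sum_toFinset _ h.nodup
        have e2 : ∑ u ∈ l.toFinset, G.wt w u = (l.map (G.wt w)).sum := List.sum_toFinset _ h.nodup
        constructor <;> try simp only [State.tick_reg, State.set_reg, State.put_reg, State.put_arr, State.tick_arr,
          State.set_arr, Ex.eval_v, Ex.eval_add, Ex.eval_mod, Ex.eval_ld, Ex.eval_ofNat, hp.order, hn, hp.mark,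
          h.size, hlen, hT.deg, hT.wdeg, Nat.reduceEqDiff, ↓reduceIte, hins, List.drop_zero, List.map_append, List.map_cons,
          List.map_nil, List.sum_append, List.sum_cons, List.sum_nil, G.adj_self, G.wt_self, entries]
        · simp [List.nodup_append, h.nodup]
          rintro a ha rfl
          exact hwl ha
        · exact List.mem_append_left _ h.start
        · exact hc'.1
        · intro t ht
          rcases Nat.lt_succ_iff_lt_or_eq.1 ht with h1 | rfl
          · rw [update_of_ne (by omega), h.list t h1, List.getElem_append_left h1]
          · simp
        · omega
        · intro u'
          rw [List.mem_append, List.mem_singleton, update_apply]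
          split_ifs with h1
          · simp [Fin.ext h1]
          · rw [h.marks]
            have : u' ≠ w := fun e => h1 (by rw [e])
            simp [this]
        · intro u' hu'
          exact h.ptr u' fun h => hu' (List.mem_append_left _ h)
        · intro u' t ht
          obtain ⟨p1, w', p2, p3⟩ := h.passed u' t ht
          exact ⟨p1, w', List.mem_append_left _ p2, p3⟩
        · intro t ht; omega
        · simp
        · omega
        · omega
        · exact hA
        · exact hA'
        · rw [Nat.succ_mul]; omega
        · rintro X ⟨hX, hs⟩
          obtain ⟨-, -, u', -, w', -, hw', e⟩ := hext X hX hs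
          rw [hw, pair_inj w.2 w'.2, Fin.val_inj] at e
          exact insert_subset (e.2 ▸ hw') (h.good X ⟨hX, hs⟩)
      · intro h0
        exact absurd (by simpa using h0) h31
      · simp [update_apply, hp.mark]
        split_ifs
        · exact le_rfl
        · exact hm u
    · intro hc'
      simp [hp.size, h.size] at hc'
      rw [Tr_set]
      refine ⟨by simp, ⟨by simp, by simp [h30], fun _ _ X hX hs => ?_, by simpa using hm⟩, by simp, by simp⟩
      obtain ⟨h1, h2, -⟩ := hext X hX hs
      tauto

/-- Start a run with the set that consists of the vertex in variable `3`. -/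
def initQuery : Stmt :=
  set 28 (v 26 + 1) ;; sto 10 (v 3) (v 28) ;; sto 9 0 (v 3) ;; set 39 1 ;; set 32 0 ;; set 33 0 ;;
  set 34 (ld 1 (v 3)) ;; set 35 (ld 2 (v 3)) ;; set 36 0 ;; set 37 0 ;; set 38 (v 3) ;; set 31 1

def runQuery : Stmt := ite (v 30) .skip (initQuery ;; .loop 27 (4 * (v 2 * v 2)) stepQuery)

/-- All runs. -/
def mainQuery : Stmt := set 16 (v 11 * v 0) ;; .loop 26 (v 11) runQuery

/-- The query algorithm. -/
def queryProg (c : ℕ) : Stmt := ite (.bin .lt 1 (v 0) * .bin .lt 1 (v 2))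
    (lg 6 (v 0) ;; set 11 (.c (c) * (v 2 * v 2 * v 6)) ;; mainQuery) .skip ;;
  ite (v 30) (set 0 1 ;; set 1 (v 39)) (set 0 0 ;; set 1 0)

theorem QueryRegs.keep {s' : State} (h : QueryRegs x ν σ k R r s)
    (hr : ∀ y ∈ [0, 2, 3, 4, 5, 16, 26, 28], s'.reg y = s.reg y) : QueryRegs x ν σ k R r s' := by
  simp at hr
  obtain ⟨h0, h2, h3, h4, h5, h16, h26, h28⟩ := hr
  exact ⟨h0.trans h.order, h2.trans h.size, h3.trans h.x, h4.trans h.vol, h5.trans h.cut,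
    h16.trans h.stride, h26.trans h.run, h28.trans h.mark⟩

theorem AdjTable.congr {a a' : ℕ → ℕ → ℕ} (h : AdjTable G a) (h0 : a' 0 = a 0) (h1 : a' 1 = a 1)
    (h2 : a' 2 = a 2) : AdjTable G a' :=
  ⟨by rw [h0]; exact h.weight, by rw [h1]; exact h.deg, by rw [h2]; exact h.wdeg⟩

theorem initQuery_tr (h3 : s.reg 3 = x) (h26 : s.reg 26 = r) (hT : AdjTable G s.arr)
    (hm : ∀ u, s.arr 10 u ≤ r) (h5 : ∀ u : Fin n, s.arr 5 (r * n + u) = 0) (hσ : 2 ≤ σ) (h30 : s.reg 30 = 0)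
    (hB : r + 1 < B) (hx : ∀ X, good X → x ∈ X) :
    Tr inp B initQuery s (fun s' => Grow G x σ R r rank good 0 [x] x 0 s' ∧ s'.reg 30 = 0 ∧
      s'.reg 28 = r + 1 ∧ s'.reg 31 = 1 ∧ (∀ u, s'.arr 10 u ≤ r + 1) ∧ s'.time = s.time + 12) := by
  simp only [initQuery, Tr_seq, Tr_set, Tr_sto]
  have hv := G.vol_insert_add (notMem_empty x)
  have hc := G.cutValue_insert_add (notMem_empty x)
  have hdeg : ∑ u, G.adj x u ≤ n := (sum_le_card_nsmul _ _ 1 fun u _ => G.adj_le x u).trans (by simp)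
  have hwdeg : ∑ u, G.wt x u ≤ n * G.maxWeight :=
    (sum_le_card_nsmul _ _ _ fun u _ => G.wt_le_maxWeight x u).trans (by simp)
  simp [G.vol_empty, G.cutValue_empty] at hv hc
  refine ⟨by simp [h26, hB], by simp, by simp, by simp, by simp, by simp, by simp, by simp, by simp, by simp,
    by simp, by simp, ?_, by simp [h30], by simp [h26], by simp, fun u => ?_, by simp⟩
  · constructor <;> simp [h3, h26, hT.deg, hT.wdeg, h5, hv, hc, hdeg, hwdeg, G.adj_self, G.wt_self]
    · omega
    · intro u
      rw [update_apply]
      have := hm u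
      split_ifs with h
      · simp [Fin.ext h]
      · have : u ≠ x := fun e => h (by rw [e])
        simp [this]; omega
    · exact hx
  · simp [h3, h26, update_apply]
    split_ifs
    · exact le_rfl
    · exact (hm u).trans (Nat.le_succ r)

/-- Pointers of the at most `σ - 1` members contribute at most `|l| ^ 2`; the positions of the
earlier and the current scan contribute at most `|l| * (σ + 1) + |l|`. The sum is below `4 * σ ^ 2`,
so the fixed number of steps of a run suffices. -/
theorem Grow.budget_lt (h : Grow G x σ R r rank good i l z j s)
    (hL : ∀ u : Fin n, ∃ cnt, ListInv (entries n R r s.arr u) cnt (codeSet G rank u)) :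
    i < 4 * (σ * σ) := by
  have h1 : ∑ u : Fin n, s.arr 5 (r * n + u) ≤ l.length * l.length := by
    rw [← sum_subset (subset_univ l.toFinset) fun u _ hu =>
      h.ptr u fun hl => hu (List.mem_toFinset.2 hl)]
    refine (sum_le_card_nsmul _ _ l.length fun u _ => ?_).trans ?_
    · obtain ⟨cnt, hC⟩ := hL u
      exact hC.passed_le (h.passed u)
    · rw [List.toFinset_card_of_nodup h.nodup, smul_eq_mul]
  have h2 := h.budget
  have h3 := h.lt
  have h4 := h.le
  nlinarith

/-- A run uses the mark `r + 1` and the pointers of block `r` only. No array has to be reset between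
runs, which would depend on `n`. -/
theorem runQuery_tr (h0 : s.reg 0 = n) (h2 : s.reg 2 = σ) (h3 : s.reg 3 = x) (h4 : s.reg 4 = ν)
    (hk : s.reg 5 = k) (h16 : s.reg 16 = R * n) (h26 : s.reg 26 = r) (hr : r < R) (hT : AdjTable G s.arr)
    (hD : RunDone G R r pr s.arr) (hm : ∀ u, s.arr 10 u ≤ r)
    (h5 : ∀ q < R, r ≤ q → ∀ u : Fin n, s.arr 5 (q * n + u) = 0) (hσ : 2 ≤ σ)
    (hf : s.reg 30 ≠ 0 → Found G x ν σ k s) (hB : R * n < B) (hB1 : R + 1 < B)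
    (hB2 : σ * (n * (G.maxWeight + 1) + 1) < B) (hB3 : 4 * (σ * σ) < B) :
    Tr inp B runQuery s (fun s' => (s'.reg 30 ≠ 0 → Found G x ν σ k s') ∧
      (s'.reg 30 = 0 → s.reg 30 = 0 ∧ ∀ X, G.IsLocalSet x ν σ k X → ¬ G.Separates pr X) ∧
      (∀ u, s'.arr 10 u ≤ r + 1) ∧ (∀ q < R, r + 1 ≤ q → ∀ u : Fin n, s'.arr 5 (q * n + u) = 0) ∧
      s'.time ≤ s.time + (60 * (σ * σ) + 15)) := by
  obtain ⟨rank, -, ho, hL⟩ := hD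
  rw [runQuery, Tr_ite]
  refine ⟨fun h30 => ?_, fun h30 => ?_⟩
  · rw [Tr_skip]
    exact ⟨hf, fun h => absurd h h30, fun u => (hm u).trans (Nat.le_succ r),
      fun q hq hrq => h5 q hq (by omega), by simp⟩
  rw [Tr_seq]
  refine Tr.mono (initQuery_tr (s := s.tick 1) (good := fun X => G.IsLocalSet x ν σ k X ∧ G.Separates pr X) (rank := rank)
    (R := R) h3 h26 hT hm (h5 r hr le_rfl) hσ h30 (by omega) fun X hX => hX.1.1) ?_
  rintro s1 hF1 ⟨hg, q30, q28, q31, qm, qt⟩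
  simp at qt
  have hp1 : QueryRegs x ν σ k R r s1 := by
    have f : ∀ y ∈ [0, 2, 3, 4, 5, 16, 26], s1.reg y = s.reg y := fun y hy => hF1.reg y (by revert y; decide)
    simp at f
    obtain ⟨f0, f2, f3, f4, f5, f16, f26⟩ := f
    exact ⟨f0.trans h0, f2.trans h2, f3.trans h3, f4.trans h4, f5.trans hk, f16.trans h16, f26.trans h26, q28⟩
  have a : ∀ t ∈ [0, 1, 2, 3, 5], s1.arr t = s.arr t := fun t ht => hF1.arr t (by revert t; decide)
  simp at a
  obtain ⟨a0, a1, a2, a3, a5⟩ := a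
  have hL' : ∀ s' : State, s'.arr 3 = s1.arr 3 → ∀ u : Fin n,
      ∃ cnt, ListInv (entries n R r s'.arr u) cnt (codeSet G rank u) := fun s' hs u => by
    obtain ⟨cnt, hc⟩ := hL u
    refine ⟨cnt, ?_⟩
    convert hc using 1
    funext t
    simp [entries, hs, a3]
  refine Tr.loop (c := 14) (fun i s' => QueryInv G x ν σ k R r rank pr i s' ∧
    ∀ q < R, r + 1 ≤ q → ∀ u : Fin n, s'.arr 5 (q * n + u) = 0) (by simp [hp1.size, hB3])
    ⟨⟨fun _ => ⟨q30, _, _, _, hg⟩, fun h => absurd q30 h, fun h31 => ?_, qm⟩,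
      fun q hq hrq u => by rw [a5]; exact h5 q hq (by omega) u⟩ ?_ ?_
  · omega
  · rintro i hi s2 ⟨hinv, hfr⟩ hF2
    have hp2 : QueryRegs x ν σ k R r (s2.set 27 i) := hp1.keep fun y hy => by
      refine Eq.trans ?_ (hF2.reg y (by revert y; decide))
      have : y ≠ 27 := by rintro rfl; simp at hy
      simp [this]
    have hT2 : AdjTable G s2.arr := hT.congr ((hF2.arr 0 rfl).trans a0) ((hF2.arr 1 rfl).trans a1)
      ((hF2.arr 2 rfl).trans a2)
    have hL2 := hL' s2 (hF2.arr 3 rfl)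
    rw [stepQuery, Tr_ite]
    constructor
    · intro h31
      obtain ⟨q30, l, z, j, hG⟩ := hinv.active (by simpa using h31)
      have hG' : Grow G x σ R r rank (fun X => G.IsLocalSet x ν σ k X ∧ G.Separates pr X) i l z j
          ((((s2.set 27 i).tick 1)).tick 1) :=
        ⟨hG.1, hG.2, hG.3, hG.4, hG.5, hG.6, hG.7, hG.8, hG.9, hG.10, hG.11, hG.12, hG.13, hG.14, hG.15,
          hG.16, hG.17, hG.18, hG.19⟩
      have hp2' := hp2.keep (s' := ((s2.set 27 i).tick 1).tick 1) fun _ _ => rfl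
      rw [Tr_ite]
      constructor
      · intro hj
        simp [hG.pos, hG.size] at hj
        refine (scanQuery_tr hp2' hr hT2 hL2 hG' hj hB hB2).mono ?_
        rintro s3 hF3 ⟨⟨j', hj'⟩, k2, k3⟩
        simp at k2 k3
        have e30 : s3.reg 30 = 0 := (hF3.reg 30 rfl).trans q30
        have e31 : s3.reg 31 ≠ 0 := by rw [hF3.reg 31 rfl]; exact h31
        refine ⟨⟨⟨fun _ => ⟨e30, _, _, _, hj'⟩, fun h => absurd e30 h, fun h => absurd h e31, fun u => ?_⟩,
          fun q hq hrq u => ?_⟩, by omega⟩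
        · rw [hF3.arr 10 rfl]; exact hinv.marks u
        · rw [k2 q (by omega)]; exact hfr q hq hrq u
      · intro hj
        simp [hG.pos, hG.size] at hj
        obtain rfl : j = l.length := le_antisymm hG.le hj
        refine (decideQuery_tr hp2' hT2 hL2 ho hG' hinv.marks q30 h31 hB2).mono ?_
        rintro s3 - ⟨k1, k2, k3⟩
        simp at k3
        exact ⟨⟨k1, fun q hq hrq u => by rw [k2]; exact hfr q hq hrq u⟩, by omega⟩
    · intro h31
      rw [Tr_skip]
      exact ⟨⟨⟨fun h => absurd h31 h, hinv.found, hinv.fail, hinv.marks⟩, hfr⟩, by simp⟩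
  · rintro s2 ⟨hinv, hfr⟩ hF2 ht
    have h31 : s2.reg 31 = 0 := by
      by_contra h
      obtain ⟨-, l, z, j, hG⟩ := hinv.active h
      have := hG.budget_lt (hL' s2 (hF2.arr 3 rfl))
      simp [hp1.size] at this
    simp [hp1.size] at ht
    exact ⟨hinv.found, fun h => ⟨h30, hinv.fail h31 h⟩, hinv.marks, hfr, by simp; omega⟩

/-- The query is deterministic. Its only possible error is to answer `⊥`, and this implies that no
run has separated any local set. -/
theorem mainQuery_tr (h0 : s.reg 0 = n) (h2 : s.reg 2 = σ) (h3 : s.reg 3 = x) (h4 : s.reg 4 = ν)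
    (hk : s.reg 5 = k) (h11 : s.reg 11 = R) (hT : AdjTable G s.arr) {pr : ℕ → Sym2 (Fin n) → ℕ}
    (hD : ∀ r < R, RunDone G R r (pr r) s.arr) (hm : ∀ u, s.arr 10 u = 0) (h5 : ∀ u, s.arr 5 u = 0)
    (hσ : 2 ≤ σ) (h30 : s.reg 30 = 0) (hB : R * n < B) (hB1 : R + 1 < B)
    (hB2 : σ * (n * (G.maxWeight + 1) + 1) < B) (hB3 : 4 * (σ * σ) < B) :
    Tr inp B mainQuery s (fun s' => (s'.reg 30 ≠ 0 → Found G x ν σ k s') ∧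
      (s'.reg 30 = 0 → ∀ r < R, ∀ X, G.IsLocalSet x ν σ k X → ¬ G.Separates (pr r) X) ∧
      s'.time ≤ s.time + R * (60 * (σ * σ) + 16) + 2) := by
  rw [mainQuery, Tr_seq, Tr_set]
  refine ⟨by simp [h0, h11, hB], ?_⟩
  refine Tr.loop (c := 60 * (σ * σ) + 16) (fun r s' => (s'.reg 30 ≠ 0 → Found G x ν σ k s') ∧
    (s'.reg 30 = 0 → ∀ r' < r, ∀ X, G.IsLocalSet x ν σ k X → ¬ G.Separates (pr r') X) ∧
    (∀ u, s'.arr 10 u ≤ r) ∧ (∀ q < R, r ≤ q → ∀ u : Fin n, s'.arr 5 (q * n + u) = 0)) (by simp)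
    ⟨by simp [h30], by simp, by simp [hm], by simp [h5]⟩ ?_ ?_
  · rintro r hr s1 ⟨k1, k2, k3, k4⟩ hF
    simp [h11] at hr
    have f : ∀ y ∈ [0, 2, 3, 4, 5], s1.reg y = s.reg y := fun y hy => by
      rw [hF.reg y (by revert y; decide)]
      simp_all; omega
    have f16 : s1.reg 16 = R * n := by rw [hF.reg 16 rfl]; simp [h0, h11]
    simp at f
    obtain ⟨f0, f2, f3, f4, f5⟩ := f
    refine Tr.mono (runQuery_tr (s := s1.set 26 r) (pr := pr r) (by simp [f0, h0]) (by simp [f2, h2]) (by simp [f3, h3])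
      (by simp [f4, h4]) (by simp [f5, hk]) (by simp [f16]) (by simp) hr
      (hT.congr (hF.arr 0 rfl) (hF.arr 1 rfl) (hF.arr 2 rfl))
      ((hD r hr).congr fun w => by funext t; simp [entries, hF.arr 3 rfl]) k3 k4 hσ k1 hB hB1 hB2 hB3) ?_
    rintro s2 - ⟨m1, m2, m3, m4, m5⟩
    simp at m2 m5
    refine ⟨⟨m1, fun h r' hr' => ?_, m3, m4⟩, by omega⟩
    rcases Nat.lt_succ_iff_lt_or_eq.1 hr' with h1 | rfl
    · exact k2 (m2 h).1 r' h1
    · exact (m2 h).2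
  · rintro s1 ⟨k1, k2, -, -⟩ hF ht
    simp [h11] at k2 ht
    exact ⟨k1, k2, by simp; omega⟩

/-- The memory that the preprocessing leaves. -/
structure Ready (G : WeightedGraph n) (R : ℕ) (pr : ℕ → Sym2 (Fin n) → ℕ) (a : ℕ → ℕ → ℕ) : Prop where
  table : AdjTable G a
  done : ∀ r < R, RunDone G R r (pr r) a
  marks : ∀ u, a 10 u = 0
  ptrs : ∀ u, a 5 u = 0

theorem queryProg_tr {c m : ℕ} {a : ℕ → ℕ → ℕ} {pr : ℕ → Sym2 (Fin n) → ℕ}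
    (ha : 2 ≤ n → 2 ≤ σ → Ready G (c * (σ * σ * n.size)) pr a) (hB : c * (σ * σ * n.size) * n < B)
    (hB1 : c * (σ * σ * n.size) + 1 < B) (hB2 : σ * (n * (G.maxWeight + 1) + 1) < B) (hB3 : 4 * (σ * σ) < B) :
    Tr inp B (queryProg c) (startState [n, m, σ, x, ν, k] a) (fun s' => Answers G x ν σ k s' ∧
      (s'.reg 0 = 0 → 2 ≤ n → ∀ r < c * (σ * σ * n.size), ∀ X, G.IsLocalSet x ν σ k X → ¬ G.Separates (pr r) X) ∧
      (n < 2 ∨ σ < 2 → s'.time ≤ 10) ∧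
      s'.time ≤ c * (σ * σ * n.size) * (60 * (σ * σ) + 16) + n.size + 10) := by
  obtain ⟨s, hs⟩ : ∃ s, s = startState [n, m, σ, x, ν, k] a := ⟨_, rfl⟩
  have h0 : s.reg 0 = n := by rw [hs]; rfl
  have h2 : s.reg 2 = σ := by rw [hs]; rfl
  have h3 : s.reg 3 = x := by rw [hs]; rfl
  have h4 : s.reg 4 = ν := by rw [hs]; rfl
  have h5 : s.reg 5 = k := by rw [hs]; rfl
  have h30 : s.reg 30 = 0 := by rw [hs]; rfl
  have ht : s.time = 0 := by rw [hs]; rfl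
  have harr : s.arr = a := by rw [hs]; rfl
  rw [← hs, queryProg, Tr_seq, Tr_ite]
  constructor
  · intro hc
    simp [h0, h2] at hc
    have hR := ha (by omega) (by omega)
    simp only [Tr_seq, Tr_set, Tr_lg]
    refine ⟨by simp, by simp [h0, h2]; omega, ?_⟩
    refine Tr.mono (mainQuery_tr (x := x) (ν := ν) (σ := σ) (k := k) (R := c * (σ * σ * n.size)) (pr := pr) (G := G) ?_ ?_ ?_ ?_ ?_ ?_ ?_ ?_ ?_ ?_ ?_ ?_ hB hB1 hB2 hB3) ?_
    · simp [h0]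
    · simp [h2]
    · simp [h3]
    · simp [h4]
    · simp [h5]
    · simp [h0, h2]
    · simpa [harr] using hR.table
    · simpa [harr] using hR.done
    · simpa [harr] using hR.marks
    · simpa [harr] using hR.ptrs
    · omega
    · simp [h30]
    rintro s1 - ⟨k1, k2, k3⟩
    simp [h0, ht] at k3
    refine (answers_tr k1).mono ?_
    rintro s2 - ⟨q1, q2, q3⟩
    exact ⟨q1, fun h _ => k2 (q2.1 h), fun h => by omega, by omega⟩
  · intro hc
    simp [h0, h2] at hc
    rw [Tr_skip]
    refine Tr.mono (answers_tr (G := G) (x := x) (ν := ν) (σ := σ) (k := k) (s := (s.tick 1).tick 1)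
      fun h => absurd h30 h) ?_
    rintro s2 - ⟨q1, q2, q3⟩
    simp [ht] at q3
    refine ⟨q1, fun _ hn r _ X hX => ?_, fun _ => by omega, by omega⟩
    have h1 := card_pos.2 ⟨x, hX.1⟩
    have h2 := hX.2.2.1
    omega

end

section

variable {n : ℕ} {G : WeightedGraph n}

/-! ### The preprocessing -/

/-- Everything before the coin flips. -/
def prePrep (c : ℕ) : Stmt :=
  ite (.bin .lt 0 (v 1) * .bin .lt 1 (v 2)) (set 3 (v 2) ;; set 12 (v 1) ;; prepProg c) .skip

/-- Everything after the coin flips. -/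
def preMain : Stmt := ite (v 12) ((wordsProg ;; clearProg) ;; tableProg ;; sortProg) .skip

/-- The priorities of the edges. -/
noncomputable def edgePrio (L : EdgeList G) (l : ℕ) (b : Fin L.list.length → Fin (32 * l) → Bool)
    (e : Sym2 (Fin n)) : ℕ :=
  open Classical in
  if h : ∃ q : Fin L.list.length, L.edge q q.2 = e then wordPrio l (32 * l) (b h.choose) else 0

theorem edgePrio_edge (L : EdgeList G) {l : ℕ} (b : Fin L.list.length → Fin (32 * l) → Bool)
    (q : Fin L.list.length) : edgePrio L l b (L.edge q q.2) = wordPrio l (32 * l) (b q) := by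
  have hex : ∃ q' : Fin L.list.length, L.edge q' q'.2 = L.edge q q.2 := ⟨q, rfl⟩
  rw [edgePrio, dif_pos hex, Fin.ext (L.edge_inj hex.choose_spec)]

theorem WeightedGraph.Separates.congr {p p' : Sym2 (Fin n) → ℕ} {X : Finset (Fin n)}
    (h : G.Separates p X) (hp : ∀ e ∈ G.edges, p' e = p e) : G.Separates p' X := by
  have hadj : ∀ {u v}, 0 < G.wt u v → p' s(u, v) = p s(u, v) := fun {u v} h =>
    hp _ ((G.mem_edges).2 ((G.wt_pos_iff).1 h).1)
  obtain ⟨t, h1, h2⟩ := h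
  refine ⟨t, fun S hS hne => ?_, fun u hu v hv huv => ?_⟩
  · obtain ⟨u, hu, v, hv, hvS, huv, hle⟩ := h1 S hS hne
    exact ⟨u, hu, v, hv, hvS, huv, by rwa [hadj huv]⟩
  · rw [hadj huv]
    exact h2 u hu v hv huv

-- Here all edges are read in the order of the list, so `adaptive_bound` is applied to a constant
-- strategy; it merely discards the coordinates of pairs that are not edges.
open Classical in
theorem card_not_separates_le (L : EdgeList G) {l R σ : ℕ} (hl : 1 ≤ l) (hn : n ≤ 2 ^ l)
    {X : Finset (Fin n)} (hX : G.IsExtreme X) (hne : X.Nonempty) (hσ : X.card < σ) :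
    ((univ.filter fun ω : Fin R → Fin L.list.length → Fin (32 * l) → Bool =>
      ∀ r : Fin R, ¬ G.Separates (edgePrio L l (ω r)) X).card : ℝ) ≤
      (1 - 1 / (2 ^ 16 * (σ : ℝ) ^ 2)) ^ R * Fintype.card (Fin R → Fin L.list.length → Fin (32 * l) → Bool) := by
  have hXc : (1 : ℝ) ≤ X.card := by exact_mod_cast card_pos.2 hne
  have hXσ : (X.card : ℝ) ≤ σ := by exact_mod_cast hσ.le
  have key := repeated_bound (V := Fin L.list.length → Fin (32 * l) → Bool) (R := R)
    (fun r ω => ∀ q : Fin R, (q : ℕ) < r → ¬ G.Separates (edgePrio L l (ω q)) X)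
    (p := 1 / (2 ^ 16 * (σ : ℝ) ^ 2)) ?_ (fun r _ ω h q hq => h q (by omega)) (fun r ω v h q hq => ?_) ?_
  · refine le_trans (Nat.cast_le.2 (card_le_card fun ω hω => ?_)) key
    simp only [mem_filter, mem_univ, true_and] at hω ⊢
    exact fun q _ => hω q
  · rw [div_le_one (by nlinarith)]
    nlinarith
  · have := h q hq
    rwa [update_of_ne (by rintro rfl; exact lt_irrefl _ hq)] at this
  · intro r ω _
    have hab := adaptive_bound (W := Fin (32 * l) → Bool)
      (fun _ (i : Fin L.list.length) => some (L.edge i i.2)) (fun _ _ _ _ => rfl)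
      (fun _ i j hij e he h => hij.ne (Fin.ext (L.edge_inj (Option.some_injective _ (h.trans he.symm)))))
      (fun b => G.Separates (edgePrio L l b) X)
      (fun τ => G.Separates (fun e => wordPrio l (32 * l) (τ e)) X)
      (fun b τ hτ hs => hs.congr fun e he => by
        obtain ⟨q, hq, rfl⟩ := L.exists_edge he
        rw [edgePrio_edge L b ⟨q, hq⟩, hτ ⟨q, hq⟩ _ rfl])
      (p := 1 / (2 ^ 16 * (X.card : ℝ) ^ 2))
      (by
        have := hX.prob_wordPrio hne hl hn
        convert this)
    refine le_trans ?_ (hab.trans ?_)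
    · refine Nat.cast_le.2 (card_le_card fun w hw => ?_)
      simp only [mem_filter, mem_univ, true_and] at hw ⊢
      have := hw r (Nat.lt_succ_self r)
      rwa [update_self] at this
    · refine mul_le_mul_of_nonneg_right ?_ (by positivity)
      have : 1 / (2 ^ 16 * (σ : ℝ) ^ 2) ≤ 1 / (2 ^ 16 * (X.card : ℝ) ^ 2) := by gcongr
      linarith

/-- The state before the coin flips. -/
structure PrePrepared (L : EdgeList G) (c σ : ℕ) (st : State) : Prop
    extends Prepared c n σ L.list.length st where
  order : st.reg 0 = n
  size : st.reg 1 = L.list.length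
  arr : ∀ t i, st.arr t i = 0
  time : st.time ≤ 80 * n.size + 4 * L.list.length.size + 23

theorem prePrep_tr {B c σ : ℕ} (L : EdgeList G) (hm : 0 < L.list.length) (hσ : 2 ≤ σ)
    (hb : PrepBounds c n σ L.list.length B) :
    Tr L.input B (prePrep c) (startState [n, L.list.length, σ] fun _ _ => 0) (PrePrepared L c σ) := by
  obtain ⟨s, hs⟩ : ∃ s, s = startState [n, L.list.length, σ] fun _ _ => 0 := ⟨_, rfl⟩
  have r0 : s.reg 0 = n := by rw [hs]; rfl
  have r1 : s.reg 1 = L.list.length := by rw [hs]; rfl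
  have r2 : s.reg 2 = σ := by rw [hs]; rfl
  have rt : s.time = 0 := by rw [hs]; rfl
  have ra : ∀ t i, s.arr t i = 0 := fun t i => by rw [hs]; rfl
  have hb1 := hb.pow
  have hb2 := hb.cap
  have hb3 := hb.runs
  have hb5 := hb.bits
  rw [← hs, prePrep, Tr_ite]
  refine ⟨fun _ => ?_, fun h => ?_⟩
  · simp only [Tr_seq, Tr_set]
    refine ⟨by simp, by simp, (prepProg_tr ?_ ?_ ?_ ?_ ?_ ?_).mono ?_⟩
    · simpa [r0] using hb.prio
    · simp [r0]; omega
    · simp [r1]; omega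
    · simp [r0, r2]; omega
    · simpa [r0, r1, r2] using hb.words
    · simp [r0, r1, r2]; omega
    · rintro s2 hF ⟨hp, ht⟩
      have f0 := hF.reg 0 rfl
      have f1 := hF.reg 1 rfl
      simp [r0, r1, r2, rt] at f0 f1 hp ht
      refine ⟨hp, f0, f1, fun t i => ?_, by omega⟩
      rw [hF.arr t rfl]
      exact ra t i
  · simp [r1, r2, List.length_pos_iff.1 hm] at h
    omega

theorem preMain_tr {B c R N σ : ℕ} {L : EdgeList G} {st : State} (h : PrePrepared L c σ st)
    (hm : 0 < L.list.length) (hR : R = c * (σ * σ * n.size)) (hN : N = R * L.list.length * (32 * n.size))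
    (hb : PrepBounds c n σ L.list.length B) (hB1 : (n + 1) * (G.maxWeight + 1) < B) (hB2 : R * n < B)
    (hB3 : (L.list.length + 2) * (n + 1) < B) (ω : Fin N → Bool) :
    Tr L.input B preMain (st.withBits N ω) (fun s' =>
      Ready G R (fun r => if hr : r < R then edgePrio L n.size (bitsEquiv hN ω ⟨r, hr⟩) else 0) s'.arr ∧
      s'.time ≤ 80 * n.size + 4 * L.list.length.size + R * L.list.length * (194 * n.size + 13) +
        L.list.length * 11 + R * (4 * 2 ^ L.list.length.size +
          L.list.length * (12 * L.list.length.size + 30) + 5) + 36) := by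
  have hlen := L.length_eq
  have htime := h.time
  rw [preMain, Tr_ite]
  refine ⟨fun _ => ?_, fun h0 => ?_⟩
  · rw [Tr_seq]
    have hw := words_tr (inp := L.input) (st := st.tick 1)
      ⟨⟨h.pow, h.scale, h.ln⟩, h.len, h.bits, h.runs, h.run, h.depth, h.cap, h.words, h.flips⟩
      hR hN (fun j => h.arr _ _) hb.prio hb.pow ω
    refine Tr.mono hw ?_
    rintro s1 - ⟨hs, t1⟩
    have a1 : ∀ t, t ≠ 14 → t ≠ 15 → ∀ i, s1.arr t i = 0 := fun t h1 h2 i => by rw [hs.arr t h1 h2]; exact h.arr t i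
    have r1 : ∀ y, y ∉ [20, 21, 22, 23, 24, 27] → s1.reg y = st.reg y := fun y hy => by rw [hs.reg, if_neg hy]; rfl
    rw [Tr_seq]
    refine (tableProg_tr ((r1 0 (by decide)).trans h.order) ((r1 1 (by decide)).trans (h.size.trans hlen))
      (fun t ht i => a1 t (by rintro rfl; simp at ht) (by rintro rfl; simp at ht) i) hB1).mono ?_
    rintro s2 hF2 ⟨hT, t2⟩
    have r2 : ∀ y, y ∉ [20, 21, 22, 23, 24, 27, 40, 41, 42] → s2.reg y = st.reg y := fun y hy => by
      simp at hy
      rw [hF2.reg y (by simp [tableProg, tableStep, Stmt.writes]; omega)]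
      exact r1 y (by simp; omega)
    have a2 : ∀ t ∈ [3, 4, 5, 10], ∀ i, s2.arr t i = 0 := fun t ht i => by
      rw [hF2.arr t (by revert t; decide)]
      grind
    have e14 : s2.arr 14 = s1.arr 14 := hF2.arr 14 rfl
    have hcap := hb.cap
    refine (sortProg_tr (D := L.list.length.size) (R := R)
      (pr := fun r => if hr : r < R then edgePrio L n.size (bitsEquiv hN ω ⟨r, hr⟩) else 0)
      ((r2 0 (by decide)).trans h.order) ((r2 1 (by decide)).trans h.size)
      ((r2 11 (by decide)).trans (h.runs.trans hR.symm)) ((r2 12 (by decide)).trans h.run)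
      ((r2 13 (by decide)).trans h.depth) ((r2 14 (by decide)).trans h.cap) hT.zero
      (fun q hq => ?_) (Nat.lt_size_self _).le (a2 3 (by simp)) (a2 4 (by simp)) (fun r hr q hq => ?_)
      (by omega) hB2 hB3).mono ?_
    · rw [hT.item q hq (by omega), (L.input_lt_iff hq 0).2.2]
    · rw [dif_pos hr, edgePrio_edge L _ ⟨q, hq⟩, e14]
      exact (hs.word ⟨r, hr⟩ ⟨q, hq⟩).symm
    · rintro s3 hF3 ⟨hD, t3⟩
      refine ⟨⟨hT.adjTable.congr (hF3.arr 0 rfl) (hF3.arr 1 rfl) (hF3.arr 2 rfl), hD, fun u => ?_, fun u => ?_⟩, ?_⟩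
      · rw [hF3.arr 10 rfl]; exact a2 10 (by simp) u
      · rw [hF3.arr 5 rfl]; exact a2 5 (by simp) u
      · simp at t1
        omega
  · have : st.reg 12 = 0 := h0
    rw [h.run] at this
    omega

/-! ### Running times and assembly of preprocessing and query -/

theorem EdgeList.length_le (L : EdgeList G) : L.list.length ≤ n * n := by
  simpa using (List.Nodup.of_map _ L.nodup).length_le_card

theorem prePrep_wf (c : ℕ) : (prePrep c).wf 64 (c + 64) := by
  simp [prePrep, prepProg, powProg, riemProg, Stmt.wf, Ex.wf]

theorem preMain_wf (c : ℕ) : preMain.wf 64 (c + 64) := by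
  simp [preMain, wordsProg, wordBody, riemProg, clearProg, tableProg, tableStep, sortProg, sortRun, treeProg,
    popStep, appendProg, updProg, Stmt.wf, Ex.wf]

theorem queryProg_wf (c : ℕ) : (queryProg c).wf 64 (c + 64) := by
  simp [queryProg, mainQuery, runQuery, initQuery, stepQuery, scanQuery, decideQuery, growQuery, Stmt.wf, Ex.wf]

/-- Without edges the empty memory already is the correct data structure, so the preprocessing may
do nothing. -/
theorem ready_of_length_eq_zero (L : EdgeList G) (hm : L.list.length = 0) {R : ℕ}
    {pr : ℕ → Sym2 (Fin n) → ℕ} {a : ℕ → ℕ → ℕ} (ha : ∀ t i, a t i = 0) : Ready G R pr a := by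
  have hadj : ∀ u w, ¬ G.graph.Adj u w := fun u w h => by
    obtain ⟨i, hi, -⟩ := L.exists_edge ((G.mem_edges).2 h)
    omega
  have hwt : ∀ u w, G.wt u w = 0 := fun u w => if_neg (hadj u w)
  refine ⟨⟨fun u w => ?_, fun u => ?_, fun u => ?_⟩, fun r _ => ⟨fun _ => 0, fun u v h => ?_,
    fun e he => ?_, fun u => ⟨0, fun _ _ => ha _ _, fun _ _ _ h => by omega, fun c => ?_, ?_⟩⟩, ha 10, ha 5⟩
  · simp [ha, hwt, WeightedGraph.adj, hadj]
  · simp [ha, WeightedGraph.adj, hadj]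
  · simp [ha, hwt]
  · simp [hwt] at h
  · obtain ⟨i, hi, -⟩ := L.exists_edge he
    omega
  · simp [hwt]
  · simp [hwt]

/-- All cut values vanish, so an extreme set has no nonempty strict subsets and both conditions are
vacuous. -/
theorem WeightedGraph.IsExtreme.separates_of_length_eq_zero (L : EdgeList G) (hm : L.list.length = 0)
    {X : Finset (Fin n)} (hX : G.IsExtreme X) (p : Sym2 (Fin n) → ℕ) : G.Separates p X := by
  have hwt : ∀ u w, G.wt u w = 0 := fun u w => if_neg fun h => by
    obtain ⟨i, hi, -⟩ := L.exists_edge ((G.mem_edges).2 h)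
    omega
  refine ⟨0, fun S hS hne => ?_, fun u _ v _ h => by simp [hwt] at h⟩
  have := hX S hne hS
  simp [cutValue_eq, hwt] at this

theorem pre_time_le {n I σ c κ t r : ℕ} (hn : 2 ≤ n) (hI : 1 ≤ I) (hIn : I ≤ n * n) (hσ : 2 ≤ σ) {R : ℕ}
    (hR : R = c * (σ * σ * n.size))
    (ht : t ≤ 80 * n.size + 4 * I.size + R * I * (194 * n.size + 13) + I * 11 +
      R * (4 * 2 ^ I.size + I * (12 * I.size + 30) + 5) + 36)
    (hr : r = R * I * (32 * n.size)) :
    κ * t + 8 * r + 13 ≤ (κ * (286 * c + 140) + 256 * c + 13) * (I * (σ * σ) * (n.size * n.size)) := by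
  have hD := size_le_three_mul hn (show I ≤ 4 * (n * n) by omega)
  have h2D : 2 ^ I.size ≤ 3 * I := two_pow_size_le.trans (by omega)
  have hl2 : 2 ≤ n.size := Nat.lt_size.2 (by simpa using hn)
  set l := n.size
  set W := I * (σ * σ) * (l * l) with hW
  have hσσ : 1 ≤ σ * σ := Nat.mul_pos (by omega) (by omega)
  have hIσ : I ≤ I * (σ * σ) := Nat.le_mul_of_pos_right _ hσσ
  have hll : l ≤ l * l := Nat.le_mul_of_pos_left _ (by omega)
  have hlW : l ≤ W := by nlinarith
  have hIW : I ≤ W := by nlinarith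
  have a1 : R * I * (194 * l + 13) ≤ 207 * c * W := by
    calc R * I * (194 * l + 13) ≤ R * I * (207 * l) := Nat.mul_le_mul_left _ (by omega)
      _ = 207 * c * W := by rw [hR, hW]; ring
  have a2 : R * (4 * 2 ^ I.size + I * (12 * I.size + 30) + 5) ≤ 79 * c * W := by
    have b1 : I * (12 * I.size + 30) ≤ I * (66 * l) := Nat.mul_le_mul_left _ (by omega)
    have b2 : I * 2 ≤ I * l := Nat.mul_le_mul_left _ hl2
    calc _ ≤ R * (79 * (I * l)) := Nat.mul_le_mul_left _ (by nlinarith)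
      _ = 79 * c * W := by rw [hR, hW]; ring
  have a3 : 8 * r = 256 * c * W := by rw [hr, hR, hW]; ring
  have a4 : t ≤ (286 * c + 140) * W := by linarith
  have a5 := Nat.mul_le_mul_left κ a4
  have : (κ * (286 * c + 140) + 256 * c + 13) * W = κ * ((286 * c + 140) * W) + 256 * c * W + 13 * W := by ring
  omega

/-- The number of runs is of order `σ ^ 2 * l`, and a run takes `O(σ ^ 2)` steps; emitting at most
`σ` vertices is absorbed. -/
theorem query_time_le {n σ c κ t w C : ℕ} (hn : 2 ≤ n) (hσ : 2 ≤ σ) (hw : w ≤ σ)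
    (ht : t ≤ c * (σ * σ * n.size) * (60 * (σ * σ) + 16) + n.size + 10)
    (hC : κ * (64 * c + 6) + 25 ≤ C) :
    κ * t + 12 * w + 13 ≤ ⌊(9 * C : ℝ) * ((σ : ℝ) ^ 4 * Real.log n + 1)⌋₊ := by
  have hl2 : 2 ≤ n.size := Nat.lt_size.2 (by simpa using hn)
  have hlog := size_le_log hn
  have h4 : 2 * 2 ≤ σ * σ := Nat.mul_le_mul hσ hσ
  have hσσ : σ ≤ σ * σ := Nat.le_mul_of_pos_left _ (by omega)
  obtain ⟨W, hW⟩ : ∃ W, W = σ * σ * (σ * σ) * n.size := ⟨_, rfl⟩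
  have h1 : σ * σ ≤ W := by
    rw [hW, mul_assoc]
    exact Nat.le_mul_of_pos_right _ (Nat.mul_pos (by omega) (by omega))
  have h2 : n.size ≤ W := by
    rw [hW]
    exact Nat.le_mul_of_pos_left _ (Nat.mul_pos (by omega) (by omega))
  have h3 : c * (σ * σ * n.size) * (60 * (σ * σ) + 16) ≤ 64 * c * W := by
    calc _ ≤ c * (σ * σ * n.size) * (64 * (σ * σ)) := Nat.mul_le_mul_left _ (by omega)
      _ = 64 * c * W := by rw [hW]; ring
  have h5 : t ≤ (64 * c + 6) * W := by linarith
  have h6 : κ * t + 12 * w + 13 ≤ C * W := by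
    have e1 := Nat.mul_le_mul_left κ h5
    have e2 := Nat.mul_le_mul_right W hC
    linarith
  refine h6.trans (Nat.le_floor ?_)
  rw [hW]
  push_cast
  have h7 : (0 : ℝ) ≤ C * (σ : ℝ) ^ 4 := by positivity
  nlinarith [mul_le_mul_of_nonneg_left hlog h7, mul_nonneg h7 (show (0 : ℝ) ≤ Real.log n by
    linarith)]

open Classical in
/-- What the preprocessing achieves: with random bits `ω`, it leaves the arrays `a ω`, which are
ready for queries with the priorities `pr ω`. -/
structure Preprocessed (G : WeightedGraph n) (σ R B : ℕ) (D : PMF (Option Store)) {N : ℕ}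
    (g : (Fin N → Bool) → Store) (a : (Fin N → Bool) → ℕ → ℕ → ℕ)
    (pr : (Fin N → Bool) → ℕ → Sym2 (Fin n) → ℕ) : Prop where
  dist : D = (PMF.uniformOfFintype (Fin N → Bool)).map (fun ω => some (g ω))
  mem : ∀ ω, ∀ t < 16, ∀ i, (g ω).mem (16 * i + t) = a ω t i
  lt : ∀ ω t i, a ω t i < B
  ready : ∀ ω, 2 ≤ n → 2 ≤ σ → Ready G R (pr ω) (a ω)
  fail : ∀ X, G.IsExtreme X → X.Nonempty → X.card < σ →
    ((univ.filter fun ω => ∀ r < R, ¬ G.Separates (pr ω r) X).card : ℝ) ≤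
      (1 - 1 / (2 ^ 16 * (σ : ℝ) ^ 2)) ^ R * Fintype.card (Fin N → Bool)

theorem exists_preprocessed (L : EdgeList G) {σ c κ C N B M : ℕ} (hN : N = n + σ + G.maxWeight + 2)
    (hB : B = N ^ (200 + c)) (hM : B ^ κ ≤ M) (hκ : 20 * (prePrep (2 ^ 16 * c)).size ≤ κ)
    (hκ' : 20 * preMain.size ≤ κ) (hκ2 : 2 ≤ κ) (hC : κ * (286 * (2 ^ 16 * c) + 140) + 256 * (2 ^ 16 * c) + 13 ≤ C) :
    ∃ (N' : ℕ) (g : (Fin N' → Bool) → Store) (a : (Fin N' → Bool) → ℕ → ℕ → ℕ)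
      (pr : (Fin N' → Bool) → ℕ → Sym2 (Fin n) → ℕ),
      Preprocessed G σ (2 ^ 16 * c * (σ * σ * n.size)) B
        (exec M L.input (.seq ((prePrep (2 ^ 16 * c)).comp 64) (.seq flipProg (preMain.comp 64)))
          ⌊(9 * C : ℝ) * ((G.numEdges : ℝ) * (σ : ℝ) ^ 2 * Real.log n ^ 2 + 1)⌋₊
          ⟨paramRegs [n, G.numEdges, σ], fun _ => 0⟩) g a pr := by
  classical
  have hwb := wordBounds hN.ge c
  have hwP := prePrep_wf (2 ^ 16 * c)
  have hwQ := preMain_wf (2 ^ 16 * c)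
  have hmn := L.length_le
  have hml := L.length_eq
  rw [← hB] at hwb
  have w1 := hwb.self
  have w2 := hwb.flips
  have w3 := hwb.const
  have w4 := hwb.table
  have hBM : B ≤ M := (Nat.le_self_pow (by omega) B).trans hM
  obtain ⟨c', hc'⟩ : ∃ c', c' = 2 ^ 16 * c := ⟨_, rfl⟩
  obtain ⟨T, hT⟩ : ∃ T, T = ⌊(9 * C : ℝ) * ((G.numEdges : ℝ) * (σ : ℝ) ^ 2 * Real.log n ^ 2 + 1)⌋₊ := ⟨_, rfl⟩
  have hnn : n * n + 2 < B := lt_of_le_of_lt (Nat.le_mul_of_pos_right _ (Nat.succ_pos n)) hwb.codes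
  have hmB : G.numEdges < B := by omega
  have hCT : C ≤ T := by
    rw [hT]
    refine Nat.le_floor ?_
    have h1 : (0 : ℝ) ≤ G.numEdges * (σ : ℝ) ^ 2 * Real.log n ^ 2 := by positivity
    have h2 : (0 : ℝ) ≤ C := by positivity
    nlinarith [mul_nonneg h2 h1]
  have hsm : Small L.input B (startState [n, G.numEdges, σ] fun _ _ => 0) := by
    refine ⟨paramRegs_lt (by omega) _ fun a ha => ?_, fun _ _ => by simp [startState]; omega,
      fun q a b => (L.input_le q a b).trans_lt (by omega)⟩
    simp at ha
    omega
  rw [← hT]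
  rw [← hc'] at hwP hwQ hκ hC w3 ⊢
  by_cases hgood : 0 < L.list.length ∧ 2 ≤ σ
  · obtain ⟨hm, hσ⟩ := hgood
    have hn : 2 ≤ n := by
      by_contra h
      have h1 := L.src_ne_dst hm
      exact h1 (Fin.ext (by omega))
    have hN2 : 2 ≤ N := by omega
    have hbI : ∀ I, I ≤ n * n → PrepBounds c' n σ I B := fun I hI => by
      rw [hB, hc']
      refine prepBounds hN2 (by omega) (by omega) ?_ c
      calc I ≤ N ^ 1 * N ^ 1 * 1 := by nlinarith
        _ ≤ N ^ 1 * N ^ 1 * N ^ 2 := Nat.mul_le_mul_left _ (Nat.one_le_pow _ _ (by omega))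
        _ = N ^ 4 := by ring
    have hb := hbI _ hmn
    have hRn := (hbI n (Nat.le_mul_self n)).words
    obtain ⟨hsafe, hst⟩ := prePrep_tr L hm hσ hb
    rw [hml] at hsafe hst
    obtain ⟨st, hst'⟩ : ∃ st, st = (prePrep c').run L.input (startState [n, G.numEdges, σ] fun _ _ => 0) := ⟨_, rfl⟩
    rw [← hst'] at hst
    obtain ⟨R, hR⟩ : ∃ R, R = c' * (σ * σ * n.size) := ⟨_, rfl⟩
    rw [← hR] at hRn ⊢
    have h19 : st.reg 19 = R * L.list.length * (32 * n.size) := by rw [hR]; exact hst.flips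
    have hcodes : (L.list.length + 2) * (n + 1) < B := lt_of_le_of_lt (Nat.mul_le_mul_right _ (by omega)) hwb.codes
    have hmain := fun ω : Fin (st.reg 19) → Bool => preMain_tr hst hm hR h19 hb w4 hRn hcodes ω
    have h19B : 16 * st.reg 19 + 31 < B := by rw [h19, hR]; exact hb.bits
    obtain ⟨g, hg, hgs⟩ := exec_comp_flip_comp (T := T) w2 w3 hM hwP hκ hwQ hκ' hsm hsafe hst'.symm (by omega)
      (fun ω => (hmain ω).1) fun ω => by
        refine (pre_time_le (κ := κ) hn hm hmn hσ hR (hmain ω).2.2 h19).trans ?_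
        rw [hT]
        exact (Nat.mul_le_mul_right _ hC).trans (le_floor_local C σ hn hml.le)
    refine ⟨_, g, _, _, hg, fun ω => (hgs ω).1.mem, fun ω => (hgs ω).2.arr, fun ω _ _ => (hmain ω).2.1,
      fun X hX hne hXσ => ?_⟩
    have key := card_not_separates_le L (R := R) (Nat.size_pos.2 (by omega)) (Nat.lt_size_self n).le hX hne hXσ
    rw [← Fintype.card_congr (bitsEquiv h19)] at key
    refine le_of_eq_of_le ?_ key
    congr 1
    refine card_equiv (bitsEquiv h19) fun ω => ?_
    simp only [mem_filter, mem_univ, true_and]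
    exact ⟨fun h r => by simpa using h r r.2, fun h r hr => by simpa [hr] using h ⟨r, hr⟩⟩
  · obtain ⟨st, hst⟩ : ∃ st, st = ((startState [n, G.numEdges, σ] fun _ _ => 0).tick 1).tick 1 := ⟨_, rfl⟩
    have he0 : (.bin .lt 0 (v 1) * .bin .lt 1 (v 2) : Ex).eval L.input
        (startState [n, G.numEdges, σ] fun _ _ => 0) = 0 := by
      simp [startState, paramRegs]
      omega
    have hr : ∀ y, 3 ≤ y → st.reg y = 0 := fun y hy => by
      rw [hst]
      simp [startState, paramRegs, List.getElem?_eq_none (l := [n, G.numEdges, σ]) (i := y) (by simpa using hy)]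
    have hprep : (prePrep c').run L.input (startState [n, G.numEdges, σ] fun _ _ => 0) = st := by
      rw [hst, prePrep, Stmt.run, if_neg (by simp [he0])]
      rfl
    have hmain : ∀ ω : Fin (st.reg 19) → Bool, Tr L.input B preMain (st.withBits (st.reg 19) ω)
        (fun s' => (∀ t i, s'.arr t i = 0) ∧ s'.time = 4) := by
      intro ω
      rw [preMain, Tr_ite]
      refine ⟨fun h => absurd (hr 12 (by norm_num)) h, fun _ => ?_⟩
      rw [Tr_skip]
      refine ⟨fun t i => ?_, by simp [State.withBits, hst, startState]⟩
      by_cases ht : t = 15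
      · subst ht
        simp [State.withBits, hst, startState]
        exact fun h => absurd h (by simp [paramRegs])
      · simp [State.withBits, hst, startState, ht]
    have h19 := hr 19 (by norm_num)
    obtain ⟨g, hg, hgs⟩ := exec_comp_flip_comp (T := T) w2 w3 hM hwP hκ hwQ hκ' hsm
      ⟨fun h => absurd he0 h, fun _ => trivial⟩ hprep (by omega) (fun ω => (hmain ω).1) fun ω => by
        rw [(hmain ω).2.2, h19]
        grind
    refine ⟨_, g, _, fun _ _ _ => 0, hg, fun ω => (hgs ω).1.mem, fun ω => (hgs ω).2.arr, fun ω _ hσ =>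
      ready_of_length_eq_zero L (by omega) (hmain ω).2.1, fun X hX hne hXσ => ?_⟩
    have := card_pos.2 hne
    have hm : L.list.length = 0 := by omega
    have hsep := hX.separates_of_length_eq_zero L hm (fun _ => 0)
    rcases Nat.eq_zero_or_pos (c' * (σ * σ * n.size)) with h0 | h0
    · rw [h0, pow_zero, one_mul]
      exact_mod_cast card_le_univ _
    -- There is at least one run, and every priority function separates `X`, so no outcome is bad.
    · rw [filter_false_of_mem fun ω _ h => h 0 h0 hsep]
      have h2 : (2 : ℝ) ≤ σ := by exact_mod_cast (by omega : 2 ≤ σ)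
      have : 1 / (2 ^ 16 * (σ : ℝ) ^ 2) ≤ 1 := by rw [div_le_one (by positivity)]; nlinarith
      simp only [card_empty, Nat.cast_zero]
      exact mul_nonneg (pow_nonneg (by linarith) _) (by positivity)

/-- Preprocessing and queries with `2 ^ 16 * c` times `σ ^ 2 * log n` runs. -/
theorem exists_preprocessing_query (c : ℕ) :
    ∃ (pre query : Prog) (C : ℝ) (K : ℕ), ∀ (n : ℕ) (G : WeightedGraph n) (L : EdgeList G) (σ : ℕ),
      let Tpre : ℕ := ⌊C * ((G.numEdges : ℝ) * (σ : ℝ) ^ 2 * Real.log n ^ 2 + 1)⌋₊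
      let Mpre : ℕ := (n + σ + G.maxWeight + 2) ^ K
      let s₀ : Store := ⟨paramRegs [n, G.numEdges, σ], fun _ => 0⟩
      none ∉ (exec Mpre L.input pre Tpre s₀).support ∧
      ∀ (x : Fin n) (ν k : ℕ), let T : ℕ := ⌊C * ((σ : ℝ) ^ 4 * Real.log n + 1)⌋₊
        let M : ℕ := (n + ν + σ + k + G.maxWeight + 2) ^ K
        let D : PMF (Option Store) := execTwo L.input Mpre pre Tpre s₀ M query T [n, G.numEdges, σ, x, ν, k]
        none ∉ D.support ∧ D.toOuterMeasure {o | Fails G x ν σ k o} ≤ ((n : ENNReal) ^ c)⁻¹ := by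
  classical
  obtain ⟨c', hc'⟩ : ∃ c', c' = 2 ^ 16 * c := ⟨_, rfl⟩
  obtain ⟨κ, hκ⟩ : ∃ κ, κ = 20 * ((prePrep c').size + preMain.size + (queryProg c').size) + 2 := ⟨_, rfl⟩
  obtain ⟨C, hC⟩ : ∃ C, C = κ * (350 * c' + 140) + 256 * c' + 25 := ⟨_, rfl⟩
  have hC1 : κ * (286 * c' + 140) + 256 * c' + 13 ≤ C := by grind
  have hC2 : κ * (64 * c' + 6) + 25 ≤ C := by linarith
  have hC3 : κ * 10 + 25 ≤ C := by linarith
  refine ⟨.seq ((prePrep c').comp 64) (.seq flipProg (preMain.comp 64)), .seq ((queryProg c').comp 64) emitProg,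
    9 * C, (200 + c) * κ, ?_⟩
  intro n G L σ Tpre Mpre s₀
  obtain ⟨N, hN⟩ : ∃ N, N = n + σ + G.maxWeight + 2 := ⟨_, rfl⟩
  have hMpre : (N ^ (200 + c)) ^ κ ≤ Mpre := by rw [← pow_mul, hN]
  obtain ⟨N', g, a, pr, hpre⟩ := exists_preprocessed L (C := C) hN rfl hMpre (by rw [← hc']; omega)
    (by omega) (by omega) (by rw [← hc']; exact hC1)
  rw [← hc'] at hpre
  refine ⟨by rw [hpre.dist]; exact none_notMem_support_map _, ?_⟩
  intro x ν k T M
  have hx := x.2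
  obtain ⟨N₂, hN₂⟩ : ∃ N₂, N₂ = n + ν + σ + k + G.maxWeight + 2 := ⟨_, rfl⟩
  obtain ⟨B, hB⟩ : ∃ B, B = N₂ ^ (200 + c) := ⟨_, rfl⟩
  have hM : B ^ κ ≤ M := by rw [hB, ← pow_mul, hN₂]
  -- The words of the query are at least as long as those of the preprocessing, so the memory left
  -- behind fits.
  have hBB : N ^ (200 + c) ≤ B := by rw [hB]; exact Nat.pow_le_pow_left (by omega) _
  have hwb := wordBounds (n := n) (σ := σ) (W := G.maxWeight) (N := N₂) (by omega) c
  have hb := prepBounds (N := N₂) (n := n) (σ := σ) (I := n) (by omega) (by omega) (by omega)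
    ((show n ≤ N₂ by omega).trans (Nat.le_self_pow (by norm_num) _)) c
  rw [← hB, ← hc'] at hwb hb
  have w1 := hwb.self
  have w3 := hwb.codes
  have hm : G.numEdges ≤ n * n := L.length_eq ▸ L.length_le
  have hnn : n * n + 2 < B := lt_of_le_of_lt (Nat.le_mul_of_pos_right _ (Nat.succ_pos n)) w3
  obtain ⟨s, hs⟩ : ∃ s : _ → State, s = fun ω => startState [n, G.numEdges, σ, x, ν, k] (a ω) := ⟨_, rfl⟩
  have hsm : ∀ ω, Small L.input B (s ω) := fun ω => by
    rw [hs]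
    refine ⟨paramRegs_lt (by omega) _ fun b hb => ?_, fun t i => (hpre.lt ω t i).trans_le hBB,
      fun q b d => (L.input_le q b d).trans_lt (by omega)⟩
    simp at hb
    omega
  have hq : ∀ ω, Tr L.input B (queryProg c') (s ω) _ := fun ω => by
    rw [hs]
    exact queryProg_tr (x := x) (ν := ν) (k := k) (m := G.numEdges) (hpre.ready ω) hb.words hb.runs hwb.sums hwb.steps
  have hex : ∀ ω, ∃ s', exec M L.input (.seq ((queryProg c').comp 64) emitProg) T
      ⟨paramRegs [n, G.numEdges, σ, x, ν, k], (g ω).mem⟩ = PMF.pure (some s') ∧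
      Emitted ((queryProg c').run L.input (s ω)) s' := fun ω => by
    have hsm' := hsm ω
    obtain ⟨hsafe, hans, -, ht, ht'⟩ := hq ω
    simp only [hs] at hsm' hsafe hans ht ht' ⊢
    refine exec_comp_emit hwb.flips hwb.const hM (by omega) (queryProg_wf c') (by omega) hsm' hsafe (hpre.mem ω) ?_
    obtain ⟨hsz, hsz'⟩ := hans.size
    by_cases hns : n < 2 ∨ σ < 2
    · have h1 : κ * _ ≤ κ * 10 := Nat.mul_le_mul_left _ (ht hns)
      refine le_trans (b := C) (by omega) (Nat.le_floor ?_)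
      have : (0 : ℝ) ≤ (σ : ℝ) ^ 4 * Real.log n := by positivity
      nlinarith [mul_nonneg (show (0 : ℝ) ≤ C by positivity) this]
    · exact query_time_le (by omega) (by omega) hsz ht' hC2
  choose g' hg' he using hex
  -- The query flips no coins, so the outcome of both phases is a function of the bits of the
  -- preprocessing.
  have hD : execTwo L.input Mpre (.seq ((prePrep c').comp 64) (.seq flipProg (preMain.comp 64))) Tpre s₀ M
      (.seq ((queryProg c').comp 64) emitProg) T [n, G.numEdges, σ, x, ν, k] =
      (PMF.uniformOfFintype (Fin N' → Bool)).map (fun ω => some (g' ω)) := by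
    rw [execTwo, hpre.dist, PMF.bind_map, ← PMF.bind_pure_comp]
    congr 1
    funext ω
    exact hg' ω
  simp only
  rw [hD]
  refine ⟨none_notMem_support_map _, ?_⟩
  -- Only if an extreme set exists can `⊥` be wrong; in that case the bad event is that no run
  -- separates this set.
  by_cases hX : 2 ≤ n ∧ ∃ X, G.IsLocalExtremeSet x ν σ k X
  · obtain ⟨hn, X, hX, hXe⟩ := hX
    have h1 := card_pos.2 ⟨x, hX.1⟩
    have h2 := hX.2.2.1
    refine toOuterMeasure_map_uniform_le _ _ (fun ω => ∀ r < c' * (σ * σ * n.size), ¬ G.Separates (pr ω r) X)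
      (fun ω hω => ?_) (runs_fail_le (σ := σ) (by omega) (by omega) c) ?_
    · by_contra h0
      refine hω ⟨_, rfl, (hq ω).2.1.solves (he ω) fun h => absurd ?_ h0⟩
      exact fun r hr => (hq ω).2.2.1 h hn r hr X hX
    · rw [← hc']
      exact hpre.fail X hXe ⟨x, hX.1⟩ h2
  · rcases Nat.lt_or_ge n 2 with hn | hn
    · obtain rfl : n = 1 := by omega
      exact toOuterMeasure_map_uniform_le _ _ (fun ω => True) (fun _ _ => trivial) (q' := 1) (by simp) (by simp)
    · exact toOuterMeasure_fails_le (fun ω => (hq ω).2.1.solves (he ω) fun _ h => hX ⟨hn, h⟩) _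

end

end LocalKCut

theorem theorem1p4 (c : ℕ) :
    (∃ (P : LocalKCut.Prog) (C : ℝ) (K : ℕ),
      ∀ (n : ℕ) (G : LocalKCut.WeightedGraph n) (A : LocalKCut.AdjLists G)
        (x : Fin n) (ν σ k : ℕ),
        let T : ℕ := ⌊C * ((ν : ℝ) * (σ : ℝ) ^ 2 * Real.log n ^ 2 + 1)⌋₊
        let M : ℕ := (n + ν + σ + k + G.maxWeight + 2) ^ K
        let D : PMF (Option LocalKCut.Store) :=
          LocalKCut.exec M A.input P T ⟨LocalKCut.paramRegs [n, x, ν, σ, k], fun _ => 0⟩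
        none ∉ D.support ∧
        D.toOuterMeasure {o | LocalKCut.Fails G x ν σ k o} ≤ ((n : ENNReal) ^ c)⁻¹) ∧
    (∃ (pre query : LocalKCut.Prog) (C : ℝ) (K : ℕ),
      ∀ (n : ℕ) (G : LocalKCut.WeightedGraph n) (L : LocalKCut.EdgeList G) (σ : ℕ),
        let Tpre : ℕ := ⌊C * ((G.numEdges : ℝ) * (σ : ℝ) ^ 2 * Real.log n ^ 2 + 1)⌋₊
        let Mpre : ℕ := (n + σ + G.maxWeight + 2) ^ K
        let s₀ : LocalKCut.Store :=
          ⟨LocalKCut.paramRegs [n, G.numEdges, σ], fun _ => 0⟩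
        none ∉ (LocalKCut.exec Mpre L.input pre Tpre s₀).support ∧
        ∀ (x : Fin n) (ν k : ℕ),
          let T : ℕ := ⌊C * ((σ : ℝ) ^ 4 * Real.log n + 1)⌋₊
          let M : ℕ := (n + ν + σ + k + G.maxWeight + 2) ^ K
          let D : PMF (Option LocalKCut.Store) :=
            LocalKCut.execTwo L.input Mpre pre Tpre s₀ M query T
              [n, G.numEdges, σ, x, ν, k]
          none ∉ D.support ∧
          D.toOuterMeasure {o | LocalKCut.Fails G x ν σ k o} ≤ ((n : ENNReal) ^ c)⁻¹) := by
  exact ⟨LocalKCut.exists_local_algorithm c, LocalKCut.exists_preprocessing_query c⟩
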